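/- A point $x\in\mathbb{R}^2$ is \emph{enclosed} by a finite set $\mathcal{T}$ of compact sets if $x$ lies in a bounded connected component of $\mathbb{R}^2\setminus\bigcup_{O\in\mathcal{T}}O$. In \textsc{Enclosing-All-Points} one is given finitely many points $X\subset\mathbb{R}^2$ and finitely many obstacles $\mathcal{O}$, $n=|X|+|\mathcal{O}|$, and looks for a smallest subset of $\mathcal{O}$ that encloses every point of $X$. A \emph{polynomial-time $C$-approximation algorithm} is a uniform program for the real RAM (unit-cost arithmetic $+,-,\times,\div$ and comparison on reals, addition, subtraction and comparison on natural numbers, arrays with indirect addressing, rational and natural constants only, no rounding) which halts after at most $p(n)$ steps for some polynomial $p$, decides correctly whether some subset of $\mathcal{O}$ encloses $X$, and, if so, outputs a subset of $\mathcal{O}$ that encloses $X$ and has at most $C$ times the minimum size. For constants $r,R$ with $0<r\le R$, a finite family of obstacles consists of \emph{similarly-sized fat pseudo-disks} (with constants $r,R$) if every obstacle $O$ is compact and convex, there is a point $c$ with $D(c,r)\subseteq O\subseteq D(c,R)$, where $D(c,\rho)$ is the closed disk of radius $\rho$ around $c$, and the boundaries of any two obstacles intersect at most twice, i.e. their intersection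 has at most two connected components (in particular, it may consist of at most two points). \textbf{Theorem.} (1) For all constants $0<r\le R$ there are a constant $C$ and a polynomial-time $C$-approximation algorithm for \textsc{Enclosing-All-Points} with similarly-sized fat pseudo-disks with constants $r,R$. Here the input consists of the coordinates of the points and, for every obstacle $O$, of a center $c_O$ with $D(c_O,r)\subseteq O\subseteq D(c_O,R)$; moreover the algorithm can query in one step whether a given obstacle contains a given input point, whether two given obstacles intersect, and, if they do, the coordinates of some (arbitrary) common point of them. (2) There are a constant $C$ and a polynomial-time $C$-approximation algorithm for \textsc{Enclosing-All-Points} with closed unit disks, the input consisting only of the coordinates of the points and of the centers of the disks. (3) The same holds for closed axis-parallel unit squares. -/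

import Mathlib

open scoped Polynomial

noncomputable section

namespace EnclosingAllPoints

/-! ### Geometry -/

/-- The Euclidean plane. -/
abbrev Plane : Type := EuclideanSpace ℝ (Fin 2)

/-- `x` lies in a bounded connected component of the complement of `U`.  (In particular `x` does
not lie in `U`.) -/
def IsEnclosedBy (x : Plane) (U : Set Plane) : Prop :=
  x ∈ Uᶜ ∧ Bornology.IsBounded (connectedComponentIn Uᶜ x)

/-- The subset `T` of the obstacles encloses all the points. -/
def EnclosesAll {m k : ℕ} (pt : Fin m → Plane) (obs : Fin k → Set Plane)
    (T : Finset (Fin k)) : Prop :=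
  ∀ j, IsEnclosedBy (pt j) (⋃ i ∈ T, obs i)

/-- `O` lies between the two concentric disks of radii `r` and `R` around `c`. -/
def IsSandwiched (r R : ℝ) (O : Set Plane) (c : Plane) : Prop :=
  Metric.closedBall c r ⊆ O ∧ O ⊆ Metric.closedBall c R

/-- The boundaries of `A` and `B` intersect at most twice: their intersection has at most two
connected components, i.e. it is the union of two (possibly empty) connected sets.  This holds
whenever the boundaries have at most two common points; a common boundary arc, as occurs for
axis-parallel squares, counts once. -/
def BoundariesMeetAtMostTwice (A B : Set Plane) : Prop :=
  ∃ S T : Set Plane, IsPreconnected S ∧ IsPreconnected T ∧ frontier A ∩ frontier B = S ∪ T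

/-- Similarly-sized fat pseudo-disks with constants `r` and `R`. -/
structure AreFatPseudoDisks {k : ℕ} (r R : ℝ) (obs : Fin k → Set Plane) : Prop where
  compact : ∀ i, IsCompact (obs i)
  convex : ∀ i, Convex ℝ (obs i)
  sandwiched : ∀ i, ∃ c, IsSandwiched r R (obs i) c
  boundaries : ∀ i j, i ≠ j → BoundariesMeetAtMostTwice (obs i) (obs j)

/-- The closed disk of radius one with centre `c`. -/
def unitDisk (c : Plane) : Set Plane := Metric.closedBall c 1

/-- The closed axis-parallel square of side length one with centre `c`. -/
def unitSquare (c : Plane) : Set Plane := {p | ∀ a, |p a - c a| ≤ 1 / 2}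

/-! ### The machine model: a real RAM

The memory consists of arrays of natural numbers and arrays of real numbers.  An array is named by
a literal in the program and has two indices, which may be computed (indirect addressing).
On naturals there are addition, truncated subtraction and comparison (no multiplication); on reals
the four field operations and comparison.  The only literals are naturals and rationals, and there
is no rounding and no conversion between the two kinds of number. -/

/-- A memory content: `nat a i j` and `real a i j` are the entries with indices `i`, `j` of the
array with name `a`. -/
structure Mem where
  nat : ℕ → ℕ → ℕ → ℕ
  real : ℕ → ℕ → ℕ → ℝ

/-- Expressions for natural numbers. -/
inductive NExp : Type
  | const (n : ℕ)
  | read (a : ℕ) (i j : NExp)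
  | add (e f : NExp)
  | sub (e f : NExp)

/-- Expressions for real numbers. -/
inductive RExp : Type
  | const (q : ℚ)
  | read (a : ℕ) (i j : NExp)
  | add (e f : RExp)
  | sub (e f : RExp)
  | mul (e f : RExp)
  | div (e f : RExp)

/-- Tests. -/
inductive BExp : Type
  | natLt (e f : NExp)
  | realLt (e f : RExp)
  | not (b : BExp)
  | and (b c : BExp)

/-- Programs. -/
inductive Prog : Type
  | skip
  | setNat (a : ℕ) (i j e : NExp)
  | setReal (a : ℕ) (i j : NExp) (e : RExp)
  | seq (c d : Prog)
  | ite (b : BExp) (c d : Prog)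
  | while (b : BExp) (c : Prog)

/-- The value of an expression for natural numbers. -/
def NExp.eval (s : Mem) : NExp → ℕ
  | .const n => n
  | .read a i j => s.nat a (i.eval s) (j.eval s)
  | .add e f => e.eval s + f.eval s
  | .sub e f => e.eval s - f.eval s

/-- The value of an expression for real numbers. -/
def RExp.eval (s : Mem) : RExp → ℝ
  | .const q => (q : ℝ)
  | .read a i j => s.real a (i.eval s) (j.eval s)
  | .add e f => e.eval s + f.eval s
  | .sub e f => e.eval s - f.eval s
  | .mul e f => e.eval s * f.eval s
  | .div e f => e.eval s / f.eval s

/-- The truth value of a test. -/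
def BExp.eval (s : Mem) : BExp → Prop
  | .natLt e f => e.eval s < f.eval s
  | .realLt e f => e.eval s < f.eval s
  | .not b => ¬ b.eval s
  | .and b c => b.eval s ∧ c.eval s

/-- Write `v` into a cell of an array of naturals. -/
def Mem.setNat (s : Mem) (a i j v : ℕ) : Mem :=
  { s with nat := fun a' i' j' => if a' = a ∧ i' = i ∧ j' = j then v else s.nat a' i' j' }

/-- Write `v` into a cell of an array of reals. -/
def Mem.setReal (s : Mem) (a i j : ℕ) (v : ℝ) : Mem :=
  { s with real := fun a' i' j' => if a' = a ∧ i' = i ∧ j' = j then v else s.real a' i' j' }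

/-- `Exec c s s' t`: started in memory `s`, the program `c` halts in memory `s'` after `t` steps.
Every assignment and every test is a step (the expressions in a program have a size that does not
depend on the input). -/
inductive Exec : Prog → Mem → Mem → ℕ → Prop
  | skip (s : Mem) : Exec .skip s s 1
  | setNat (s : Mem) (a : ℕ) (i j e : NExp) :
      Exec (.setNat a i j e) s (s.setNat a (i.eval s) (j.eval s) (e.eval s)) 1
  | setReal (s : Mem) (a : ℕ) (i j : NExp) (e : RExp) :
      Exec (.setReal a i j e) s (s.setReal a (i.eval s) (j.eval s) (e.eval s)) 1
  | seq {c d : Prog} {s s' s'' : Mem} {t t' : ℕ} :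
      Exec c s s' t → Exec d s' s'' t' → Exec (.seq c d) s s'' (t + t')
  | iteTrue {b : BExp} {c d : Prog} {s s' : Mem} {t : ℕ} :
      b.eval s → Exec c s s' t → Exec (.ite b c d) s s' (t + 1)
  | iteFalse {b : BExp} {c d : Prog} {s s' : Mem} {t : ℕ} :
      ¬ b.eval s → Exec d s s' t → Exec (.ite b c d) s s' (t + 1)
  | whileTrue {b : BExp} {c : Prog} {s s' s'' : Mem} {t t' : ℕ} :
      b.eval s → Exec c s s' t → Exec (.while b c) s' s'' t' →
        Exec (.while b c) s s'' (t + t' + 1)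
  | whileFalse {b : BExp} {c : Prog} {s : Mem} :
      ¬ b.eval s → Exec (.while b c) s s 1

/-- The machine is deterministic. -/
theorem Exec.unique {c : Prog} {s s₁ s₂ : Mem} {t₁ t₂ : ℕ}
    (h₁ : Exec c s s₁ t₁) (h₂ : Exec c s s₂ t₂) : s₁ = s₂ ∧ t₁ = t₂ := by
  induction h₁ generalizing s₂ t₂ with
  | skip => cases h₂; exact ⟨rfl, rfl⟩
  | setNat => cases h₂; exact ⟨rfl, rfl⟩
  | setReal => cases h₂; exact ⟨rfl, rfl⟩
  | seq _ _ ih ih' =>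
    cases h₂ with
    | seq k k' =>
      obtain ⟨rfl, rfl⟩ := ih k
      obtain ⟨rfl, rfl⟩ := ih' k'
      exact ⟨rfl, rfl⟩
  | iteTrue hb _ ih =>
    cases h₂ with
    | iteTrue _ k => obtain ⟨rfl, rfl⟩ := ih k; exact ⟨rfl, rfl⟩
    | iteFalse hb' _ => exact absurd hb hb'
  | iteFalse hb _ ih =>
    cases h₂ with
    | iteTrue hb' _ => exact absurd hb' hb
    | iteFalse _ k => obtain ⟨rfl, rfl⟩ := ih k; exact ⟨rfl, rfl⟩
  | whileTrue hb _ _ ih ih' =>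
    cases h₂ with
    | whileTrue _ k k' =>
      obtain ⟨rfl, rfl⟩ := ih k
      obtain ⟨rfl, rfl⟩ := ih' k'
      exact ⟨rfl, rfl⟩
    | whileFalse hb' => exact absurd hb hb'
  | whileFalse hb =>
    cases h₂ with
    | whileTrue hb' _ _ => exact absurd hb' hb
    | whileFalse => exact ⟨rfl, rfl⟩

/-! ### Input and output -/

/-- The table with entries `f i j`, and `0` outside the range. -/
def table {α : Type} [Zero α] {k l : ℕ} (f : Fin k → Fin l → α) (i j : ℕ) : α :=
  if h : i < k ∧ j < l then f ⟨i, h.1⟩ ⟨j, h.2⟩ else 0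

/-- The natural number `1` if `p` holds and `0` otherwise. -/
def bit (p : Prop) : ℕ := open Classical in if p then 1 else 0

/-- The numbers of points and of obstacles, as entries `0` and `1` of the first row. -/
def sizes (m k : ℕ) : ℕ → ℕ → ℕ
  | 0, 0 => m
  | 0, 1 => k
  | _, _ => 0

/-- The input that lists only coordinates: the two numbers of points and of obstacles (naturals,
array `0`), the coordinates of the points (reals, array `0`) and of the centres of the obstacles
(reals, array `1`).  All other cells are `0`. -/
def coordinateInput {m k : ℕ} (pt : Fin m → Plane) (ctr : Fin k → Plane) : Mem where
  nat
    | 0 => sizes m k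
    | _ => fun _ _ => 0
  real
    | 0 => table fun j a => pt j a
    | 1 => table fun i a => ctr i a
    | _ => fun _ _ => 0

/-- The input for general obstacles.  In addition to the coordinates of the points and of the
centres it gives access to the obstacles through the following elementary queries: does obstacle
`i` contain point `j` (naturals, array `1`), do the obstacles `i` and `j` intersect (naturals,
array `2`), and the coordinates of a point `wit i j` (reals, arrays `2` and `3`), which is a common
point of the obstacles `i` and `j` if they intersect. -/
def obstacleInput {m k : ℕ} (pt : Fin m → Plane) (obs : Fin k → Set Plane) (ctr : Fin k → Plane)
    (wit : Fin k → Fin k → Plane) : Mem where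
  nat
    | 0 => sizes m k
    | 1 => table fun i j => bit (pt j ∈ obs i)
    | 2 => table fun i j => bit (obs i ∩ obs j).Nonempty
    | _ => fun _ _ => 0
  real
    | 0 => table fun j a => pt j a
    | 1 => table fun i a => ctr i a
    | 2 => table fun i j => wit i j 0
    | 3 => table fun i j => wit i j 1
    | _ => fun _ _ => 0

/-- The output set: the obstacles `i` whose entry `(i, 0)` of the array `3` of naturals is not
zero. -/
def output (k : ℕ) (s : Mem) : Finset (Fin k) :=
  Finset.univ.filter fun i => s.nat 3 i 0 ≠ 0

/-- The answer "a solution exists": entry `(0, 0)` of the array `4` of naturals is not zero. -/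
def saysFeasible (s : Mem) : Prop := s.nat 4 0 0 ≠ 0

/-- Started on the memory content `s`, which describes the instance `(pt, obs)`, the program halts
within `p (m + k)` steps, it decides correctly whether all the points can be enclosed, and if they
can, it outputs a set of obstacles that encloses them all and has at most `C` times the smallest
possible size. -/
def Approximates (C : ℕ) (p : ℕ[X]) (prog : Prog) {m k : ℕ} (pt : Fin m → Plane)
    (obs : Fin k → Set Plane) (s : Mem) : Prop :=
  ∃ (s' : Mem) (t : ℕ), Exec prog s s' t ∧ t ≤ p.eval (m + k) ∧
    (saysFeasible s' ↔ ∃ T, EnclosesAll pt obs T) ∧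
    ∀ T, EnclosesAll pt obs T →
      EnclosesAll pt obs (output k s') ∧ (output k s').card ≤ C * T.card

end EnclosingAllPoints

end

/-!
The algorithm is a minimum cut in a planar network whose size is polynomial in the number of points and obstacles.

*Reduction to few paths.*  Obstacles that contain a point are discarded.  Among the centres a greedy net of mesh size
`δ < r` is chosen, and each obstacle belongs to the cells of the nearby net points, which lie in its interior.  If two
obstacles of the cells of `a` and `b` intersect, they contain a path from `a` to `b` that consists of two segments and
passes through the common point of the obstacles.  For the question which points are enclosed, only the angle that
the path sweeps around a point matters, and this angle is one of two values, which are told apart by its sign. As the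
boundaries of the obstacles meet at most twice, parts of two obstacles cannot cross (`nonCrossing_of_boundaries`),
and so the sets of points around which the paths for fixed `a` and `b` sweep a positive angle form a chain
(`sweepsPos_chain`).  It is therefore enough to keep the paths with the smallest and with the largest set:
whenever obstacles enclose the points, so do the kept paths of their cells (`Inst.Valid.stars_enclose`).  The last
step uses that a point `x` off a compact set is not enclosed by the set exactly if `z - x` has a continuous logarithm on
the set; a logarithm on the kept paths can be transferred to the obstacles one by one, since these are convex and
each sweeps the same angle as the path that replaces it.

*The cut.*  The star of a net point is the union of the paths that start there.  The lines through all points in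
question cut the plane into faces, and barycentres of triples of vertices meet every face inside a large box
(`exists_sample`).  In the network, one can walk freely between incident faces, but has to pass through a
gate of capacity one whenever one touches a star.  A set of stars encloses the points if it is a cut between the points
and the outer faces (`Network.IsCut.encloses`). Conversely, if some stars enclose the points, then all the stars that
meet one of them form a cut (`Network.exists_isCut`), and as net points are separated, these are only a constant
factor more (`exists_packing_bound`).  A minimum cut, translated back into the obstacles that contain its paths, is
hence an enclosure whose size is optimal up to a constant factor (`Inst.Valid.exists_cut`, `Inst.Valid.out_encloses`,
`Inst.Valid.card_out_le`).

*The program.*  All the numbers above are computed by nested loops that fill tables, with rational operations only: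
angles, incidences and intersections of lines are decided by signs of polynomials.  The minimum cut is found by
augmenting paths, of which at most as many as there are obstacles are needed (`Flow.AfterRounds.result`).  Since the
machine cannot multiply naturals, lists of pairs are built by additions.  The running time is bounded by a polynomial
in the longest loop (`cost`), whose length is a polynomial in the size of the input (`Inst.size_le`).

For disks and squares, the queries are answered by comparing coordinates, and the midpoint of the two centres is a
common point of two obstacles that intersect.
-/

open scoped Polynomial

noncomputable section

namespace EnclosingAllPoints

/-! ### Continuous logarithms and enclosure -/

/-- The plane as the complex numbers. -/
def toC (p : Plane) : ℂ := ⟨p 0, p 1⟩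

/-- The complex numbers as the plane. -/
def ofC (z : ℂ) : Plane := !₂[z.re, z.im]

@[simp] theorem toC_ofC (z : ℂ) : toC (ofC z) = z := by simp [toC, ofC]

theorem toC_sub (p q : Plane) : toC p - toC q = toC (p - q) := by
  apply Complex.ext <;> simp [toC]

theorem norm_toC (p : Plane) : ‖toC p‖ = ‖p‖ := by
  rw [EuclideanSpace.norm_eq, Complex.norm_def, Complex.normSq_apply]
  simp [toC, Fin.sum_univ_two, sq]

theorem toC_inj {p q : Plane} : toC p = toC q ↔ p = q := by
  rw [← sub_eq_zero, toC_sub, ← norm_eq_zero, norm_toC, norm_eq_zero, sub_eq_zero]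

theorem isometry_toC : Isometry toC := by
  refine Isometry.of_dist_eq fun p q => ?_
  rw [dist_eq_norm, toC_sub, norm_toC, dist_eq_norm]

@[fun_prop] theorem continuous_toC : Continuous toC := isometry_toC.continuous

@[fun_prop] theorem continuous_ofC : Continuous ofC := by
  refine isometry_toC.comp_continuous_iff.1 ?_
  have : toC ∘ ofC = id := by ext1 z; simp
  rw [this]; exact continuous_id

/-- The function `f` has a continuous logarithm on `K`. -/
def HasLogOn {Y : Type*} [TopologicalSpace Y] (K : Set Y) (f : Y → ℂ) : Prop :=
  ∃ L : Y → ℂ, ContinuousOn L K ∧ ∀ z ∈ K, Complex.exp (L z) = f z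

/-- A function that is pointwise closer to `f` than the origin inherits a logarithm from `f`, as the
quotient takes its values in a disk around `1`. -/
theorem HasLogOn.of_near {Y : Type*} [TopologicalSpace Y] {K : Set Y} {f g : Y → ℂ}
    (h : HasLogOn K f) (hf : ContinuousOn f K) (hg : ContinuousOn g K)
    (hfg : ∀ z ∈ K, ‖g z - f z‖ < ‖f z‖) : HasLogOn K g := by
  obtain ⟨L, hL, hLf⟩ := h
  have h0 : ∀ z ∈ K, f z ≠ 0 := fun z hz => by
    rw [← hLf z hz]; exact Complex.exp_ne_zero _
  have hs : ∀ z ∈ K, g z / f z ∈ Complex.slitPlane := fun z hz => by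
    have h1 : g z / f z = 1 + (g z - f z) / f z := by
      have := h0 z hz
      field_simp; ring
    rw [h1]
    apply Complex.mem_slitPlane_of_norm_lt_one
    rw [norm_div, div_lt_one (norm_pos_iff.2 (h0 z hz))]
    exact hfg z hz
  refine ⟨fun z => L z + Complex.log (g z / f z), hL.add ((hg.div hf h0).clog hs), fun z hz => ?_⟩
  have h2 : g z / f z ≠ 0 := Complex.slitPlane_ne_zero (hs z hz)
  rw [Complex.exp_add, hLf z hz, Complex.exp_log h2]
  have := h0 z hz
  field_simp

/-- The existence of a logarithm is invariant under homotopies through nonvanishing functions. -/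
theorem HasLogOn.homotopy {Y β : Type*} [TopologicalSpace Y] [TopologicalSpace β] {K : Set Y}
    {S : Set β} (hS : IsPreconnected S) {F : β → Y → ℂ} (hF : ∀ b ∈ S, ContinuousOn (F b) K)
    (hnear : ∀ b ∈ S, ∀ᶠ b' in nhdsWithin b S, ∀ z ∈ K,
      ‖F b' z - F b z‖ < ‖F b z‖ ∧ ‖F b' z - F b z‖ < ‖F b' z‖)
    {b₀ b₁ : β} (h₀ : b₀ ∈ S) (h₁ : b₁ ∈ S) (h : HasLogOn K (F b₀)) : HasLogOn K (F b₁) := by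
  have := hS.induction₂ (fun b b' => HasLogOn K (F b) ↔ HasLogOn K (F b')) (fun b hb => ?_)
    (fun x y z _ _ _ => Iff.trans) (fun x y _ _ => Iff.symm) h₀ h₁
  · exact this.1 h
  · filter_upwards [hnear b hb, self_mem_nhdsWithin] with b' hb' hbS
    exact ⟨fun h => h.of_near (hF b hb) (hF b' hbS) fun z hz => (hb' z hz).1,
      fun h => h.of_near (hF b' hbS) (hF b hb) fun z hz => by
        rw [norm_sub_rev]; exact (hb' z hz).2⟩

/-- The function `z - x` has a continuous logarithm on `U`. -/
def HasBranch (U : Set Plane) (x : Plane) : Prop := HasLogOn U fun z => toC z - toC x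

/-- The component of `x` is unbounded, so it contains a point `y` far away, and `z - y` is close to the constant
`-y` on `U`.  Moving `y` to `x` inside the component keeps the logarithm. -/
theorem hasBranch_of_not_enclosed {U : Set Plane} (hU : IsCompact U) {x : Plane} (hx : x ∉ U)
    (h : ¬ IsEnclosedBy x U) : HasBranch U x := by
  set V := connectedComponentIn Uᶜ x with hV
  have hxV : x ∈ V := mem_connectedComponentIn hx
  have hVU : V ⊆ Uᶜ := connectedComponentIn_subset _ _
  have hunb : ¬ Bornology.IsBounded V := fun hb => h ⟨hx, hb⟩
  obtain ⟨ρ, hρ⟩ := hU.isBounded.subset_closedBall 0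
  obtain ⟨y, hyV, hy⟩ : ∃ y ∈ V, max ρ 0 < ‖y‖ := by
    by_contra! hcon
    exact hunb ((Metric.isBounded_closedBall (x := (0 : Plane)) (r := max ρ 0)).subset
      fun y hy => by simpa [Metric.mem_closedBall, dist_zero_right] using hcon y hy)
  have hfar : HasBranch U y := by
    -- far away, `z - y` stays close to the constant `-y`
    have hc : HasLogOn U fun _ : Plane => - toC y :=
      ⟨fun _ => Complex.log (- toC y), continuousOn_const, fun z _ => Complex.exp_log (by
        have : 0 < ‖y‖ := lt_of_le_of_lt (le_max_right _ _) hy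
        rw [← norm_pos_iff, norm_neg, norm_toC]; exact this)⟩
    refine hc.of_near continuousOn_const (by fun_prop) fun z hz => ?_
    have : ‖z‖ ≤ ρ := by simpa using hρ hz
    rw [norm_neg, norm_toC, sub_neg_eq_add, sub_add_cancel, norm_toC]
    exact this.trans_lt (lt_of_le_of_lt (le_max_left _ _) hy)
  refine HasLogOn.homotopy (F := fun y z => toC z - toC y) isPreconnected_connectedComponentIn
    (fun b _ => by fun_prop) (fun b hb => ?_) hyV hxV hfar
  obtain ⟨ε, hε, hball⟩ := Metric.isOpen_iff.1 hU.isClosed.isOpen_compl b (hVU hb)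
  have : ∀ᶠ b' in nhdsWithin b V, dist b' b < ε / 2 :=
    nhdsWithin_le_nhds (Metric.ball_mem_nhds b (half_pos hε))
  filter_upwards [this] with b' hb' z hz
  have h1 : ε ≤ ‖z - b‖ := by
    by_contra! hcon
    exact hball (by rwa [Metric.mem_ball, dist_eq_norm]) hz
  have h2 : ‖b - b'‖ < ε / 2 := by rwa [← dist_eq_norm, dist_comm]
  have h3 : ‖z - b‖ ≤ ‖z - b'‖ + ‖b - b'‖ := by
    calc ‖z - b‖ = ‖(z - b') - (b - b')‖ := by congr 1; abel
      _ ≤ _ := norm_sub_le _ _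
  rw [sub_sub_sub_cancel_left, toC_sub, toC_sub, toC_sub, norm_toC, norm_toC, norm_toC]
  constructor <;> linarith

/-- Two logarithms of the same function on a connected set differ by a constant. -/
theorem eq_of_exp_eq_one {Y : Type*} [TopologicalSpace Y] {S : Set Y} (hS : IsPreconnected S)
    {d : Y → ℂ} (hd : ContinuousOn d S) (h1 : ∀ z ∈ S, Complex.exp (d z) = 1) {a b : Y}
    (ha : a ∈ S) (hb : b ∈ S) : d a = d b := by
  have hint : ∀ t ∈ S, ∃ n : ℤ, d t = n * (2 * Real.pi * Complex.I) := fun t ht =>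
    Complex.exp_eq_one_iff.1 (h1 t ht)
  have hmaps : Set.MapsTo (fun t => (d t).im / (2 * Real.pi)) S (Set.range ((↑) : ℤ → ℝ)) := by
    intro t ht
    obtain ⟨n, hn⟩ := hint t ht
    refine ⟨n, ?_⟩
    simp [hn]
  have key := hS.constant_of_mapsTo Int.isClosedEmbedding_coe_real.isEmbedding.isDiscrete_range
    ((Complex.continuous_im.comp_continuousOn hd).div_const _) hmaps ha hb
  obtain ⟨n, hn⟩ := hint a ha
  obtain ⟨n', hn'⟩ := hint b hb
  have hpi := Real.pi_ne_zero
  apply Complex.ext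
  · simp [hn, hn']
  · field_simp at key
    exact key

/-- The identity of a circle has no continuous logarithm. -/
theorem not_hasLogOn_circle {ρ : ℝ} :
    ¬ HasLogOn (Set.univ : Set Circle) fun c => (ρ : ℂ) * (c : ℂ) := by
  rintro ⟨L, hL, hLe⟩
  rw [continuousOn_univ] at hL
  -- along the circle, the imaginary part of a logarithm would differ from the angle by a constant
  let d : ℝ → ℂ := fun t => L (Circle.exp t) - L (Circle.exp 0) - t * Complex.I
  have hd : Continuous d := by fun_prop
  have hρ : (ρ : ℂ) ≠ 0 := fun h => by
    have := hLe 1 trivial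
    simp [h, Complex.exp_ne_zero] at this
  have hexp : ∀ t, Complex.exp (d t) = 1 := fun t => by
    simp only [d]
    rw [Complex.exp_sub, Complex.exp_sub, hLe _ trivial, hLe _ trivial]
    simp only [Circle.coe_exp]
    have := Complex.exp_ne_zero (t * Complex.I)
    field_simp
    simp
  have hconst : d (2 * Real.pi) = d 0 := eq_of_exp_eq_one isPreconnected_univ hd.continuousOn
    (fun t _ => hexp t) trivial trivial
  have : d (2 * Real.pi) = - (2 * Real.pi * Complex.I) := by
    simp [d, Circle.exp_two_pi]
  rw [this] at hconst
  simp [d, Real.pi_ne_zero] at hconst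

theorem closure_component_inter_subset {U : Set Plane} {x : Plane} (hx : x ∉ U) :
    closure (connectedComponentIn Uᶜ x) ∩ Uᶜ ⊆ connectedComponentIn Uᶜ x := by
  have hsub : connectedComponentIn Uᶜ x ⊆ closure (connectedComponentIn Uᶜ x) ∩ Uᶜ :=
    Set.subset_inter subset_closure (connectedComponentIn_subset _ _)
  exact (isPreconnected_connectedComponentIn.subset_closure hsub
    Set.inter_subset_left).subset_connectedComponentIn (hsub (mem_connectedComponentIn hx))
    Set.inter_subset_right

/-- If the component `V` of `x` were bounded, a logarithm of `z - x` on `U`, extended to the whole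
plane, would yield a nonvanishing function equal to `z - x` outside `V`, whose restriction to a
large circle is homotopic to a constant. -/
theorem not_enclosed_of_hasBranch {U : Set Plane} (hU : IsCompact U) {x : Plane}
    (h : HasBranch U x) : ¬ IsEnclosedBy x U := by
  classical
  rintro ⟨hx, hb⟩
  set V := connectedComponentIn Uᶜ x with hV
  have hVo : IsOpen V := hU.isClosed.isOpen_compl.connectedComponentIn
  have hfr : frontier V ⊆ U := by
    intro z hz
    by_contra hzU
    rw [hVo.frontier_eq] at hz
    exact hz.2 (closure_component_inter_subset hx ⟨hz.1, hzU⟩)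
  obtain ⟨L, hL, hLe⟩ := h
  obtain ⟨Λ, hΛ⟩ := ContinuousMap.exists_restrict_eq hU.isClosed
    (⟨U.domRestrict L, continuousOn_iff_continuous_domRestrict.1 hL⟩ : C(U, ℂ))
  have hΛL : ∀ z ∈ U, Λ z = L z := fun z hz => by
    exact DFunLike.congr_fun hΛ ⟨z, hz⟩
  set g : Plane → ℂ := V.piecewise (fun z => Complex.exp (Λ z)) fun z => toC z - toC x with hg
  have hgc : Continuous g := by
    refine Continuous.piecewise (fun z hz => ?_) (by fun_prop) (by fun_prop)
    rw [hΛL z (hfr hz)]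
    exact hLe z (hfr hz)
  have hg0 : ∀ z, g z ≠ 0 := fun z => by
    by_cases hz : z ∈ V
    · rw [hg, Set.piecewise_eq_of_mem _ _ _ hz]; exact Complex.exp_ne_zero _
    · rw [hg, Set.piecewise_eq_of_notMem _ _ _ hz, sub_ne_zero, Ne, toC_inj]
      rintro rfl
      exact hz (mem_connectedComponentIn hx)
  obtain ⟨ρ, hρ0, hρ⟩ := hb.subset_ball_lt 0 x
  let F : ℝ → Circle → ℂ := fun r c => g (x + ofC (r * (c : ℂ)))
  have hFc : Continuous fun p : ℝ × Circle => F p.1 p.2 := by fun_prop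
  have h0 : HasLogOn (Set.univ : Set Circle) (F 0) :=
    ⟨fun c => Complex.log (F 0 c), by
      have : (fun c => Complex.log (F 0 c)) = fun _ => Complex.log (F 0 1) := by
        funext c; simp [F]
      rw [this]; exact continuousOn_const, fun c _ => Complex.exp_log (hg0 _)⟩
  have h1 : HasLogOn (Set.univ : Set Circle) (F ρ) := by
    refine HasLogOn.homotopy (isPreconnected_univ) (fun b _ => ?_) (fun b _ => ?_)
      (Set.mem_univ (0 : ℝ)) (Set.mem_univ ρ) h0
    · exact (hFc.comp (Continuous.prodMk_right b)).continuousOn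
    · rw [nhdsWithin_univ]
      refine isCompact_univ.eventually_forall_of_forall_eventually fun c _ => ?_
      have hcont : Continuous fun p : ℝ × Circle => ‖F p.1 p.2 - F b p.2‖ := by fun_prop
      have hpos : 0 < ‖F b c‖ := norm_pos_iff.2 (hg0 _)
      refine ((hcont.tendsto (b, c)).eventually_lt
        ((hFc.norm.comp (continuous_const.prodMk continuous_snd)).tendsto (b, c)) ?_).and
        ((hcont.tendsto (b, c)).eventually_lt (hFc.norm.tendsto (b, c)) ?_) <;>
      simpa using hpos
  have h2 : F ρ = fun c : Circle => (ρ : ℂ) * (c : ℂ) := by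
    funext c
    have hnot : x + ofC (ρ * (c : ℂ)) ∉ V := fun hmem => by
      have := hρ hmem
      rw [Metric.mem_ball, dist_eq_norm, add_sub_cancel_left, ← norm_toC, toC_ofC, norm_mul,
        Circle.norm_coe, mul_one, Complex.norm_real, Real.norm_of_nonneg hρ0.le] at this
      exact lt_irrefl _ this
    simp only [F]
    rw [hg, Set.piecewise_eq_of_notMem _ _ _ hnot, toC_sub, add_sub_cancel_left, toC_ofC]
  rw [h2] at h1
  exact not_hasLogOn_circle h1

/-! ### Swept angles and exchange of paths -/

theorem toC_add (p q : Plane) : toC (p + q) = toC p + toC q := by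
  apply Complex.ext <;> simp [toC]

theorem toC_smul (t : ℝ) (p : Plane) : toC (t • p) = t * toC p := by
  apply Complex.ext <;> simp [toC]

/-- The logarithm of the ratio of `v` and `u` as seen from `x`; its imaginary part is the angle
swept by the segment from `u` to `v`. -/
def sweep (x u v : Plane) : ℂ := Complex.log ((toC v - toC x) / (toC u - toC x))

theorem sub_ne_zero_of_notMem {A : Set Plane} {x u : Plane} (hu : u ∈ A) (hx : x ∉ A) :
    toC u - toC x ≠ 0 := by
  rw [sub_ne_zero, Ne, toC_inj]
  rintro rfl
  exact hx hu

theorem ratio_mem_slitPlane {A : Set Plane} (hA : Convex ℝ A) {x u v : Plane} (hu : u ∈ A)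
    (hv : v ∈ A) (hx : x ∉ A) : (toC v - toC x) / (toC u - toC x) ∈ Complex.slitPlane := by
  have hu0 := sub_ne_zero_of_notMem hu hx
  by_contra hcon
  rw [Complex.mem_slitPlane_iff_not_le_zero, not_not, Complex.le_def] at hcon
  set ζ := (toC v - toC x) / (toC u - toC x) with hζ
  obtain ⟨hre, him⟩ := hcon
  set t := -ζ.re with ht
  have ht0 : 0 ≤ t := by simpa [ht] using hre
  have h1 : toC v - toC x = -t * (toC u - toC x) := by
    have : ζ = -t := by apply Complex.ext <;> simp [ht, him]
    rw [← this, hζ]; field_simp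
  have h2 : x = (1 / (1 + t)) • v + (t / (1 + t)) • u := by
    rw [← toC_inj, toC_add, toC_smul, toC_smul]
    have h3 : (1 + t : ℂ) ≠ 0 := by
      have : (1 + t : ℝ) ≠ 0 := by positivity
      exact_mod_cast this
    push_cast
    field_simp
    linear_combination (-1 : ℂ) * h1
  apply hx
  rw [h2]
  refine hA hv hu (by positivity) (by positivity) ?_
  field_simp

theorem exp_sweep {A : Set Plane} {x u v : Plane} (hu : u ∈ A) (hv : v ∈ A) (hx : x ∉ A) :
    Complex.exp (sweep x u v) = (toC v - toC x) / (toC u - toC x) :=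
  Complex.exp_log (div_ne_zero (sub_ne_zero_of_notMem hv hx) (sub_ne_zero_of_notMem hu hx))

theorem continuousOn_sweep {A : Set Plane} (hA : Convex ℝ A) {x u : Plane} (hu : u ∈ A)
    (hx : x ∉ A) : ContinuousOn (sweep x u) A :=
  ContinuousOn.clog (by fun_prop) fun _ hv => ratio_mem_slitPlane hA hu hv hx

/-- Along a convex set, every branch of the logarithm changes by the principal value. -/
theorem branch_sub_eq_sweep {A : Set Plane} (hA : Convex ℝ A) {x u v : Plane} (hu : u ∈ A)
    (hv : v ∈ A) (hx : x ∉ A) {L : Plane → ℂ} (hL : ContinuousOn L A)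
    (hLe : ∀ z ∈ A, Complex.exp (L z) = toC z - toC x) : L v - L u = sweep x u v := by
  have h := eq_of_exp_eq_one hA.isPreconnected (d := fun z => L z - L u - sweep x u z)
    ((hL.sub continuousOn_const).sub (continuousOn_sweep hA hu hx)) (fun z hz => by
      rw [Complex.exp_sub, Complex.exp_sub, hLe z hz, hLe u hu, exp_sweep hu hz hx]
      have := sub_ne_zero_of_notMem hu hx
      have := sub_ne_zero_of_notMem hz hx
      field_simp) hv hu
  have h0 : sweep x u u = 0 := by
    rw [sweep, div_self (sub_ne_zero_of_notMem hu hx), Complex.log_one]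
  simp only [h0, sub_self] at h
  exact sub_eq_zero.1 h

/-- Twice the signed area of the triangle `p q x`. -/
def orient (p q x : Plane) : ℝ := (p 0 - x 0) * (q 1 - x 1) - (p 1 - x 1) * (q 0 - x 0)

/-- The path along the segments `p w` and `w q` sweeps a positive angle as seen from `x`, expressed
by orientations (for `x` not on the path). -/
def SweepsPos (x p w q : Plane) : Prop :=
  (0 ≤ orient p w x ∧ 0 ≤ orient w q x ∧ (0 < orient p w x ∨ 0 < orient w q x)) ∨
  ((0 < orient p w x ∧ orient w q x < 0 ∨ orient p w x < 0 ∧ 0 < orient w q x) ∧ 0 < orient p q x)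

theorem im_ratio (x u v : Plane) :
    ((toC v - toC x) / (toC u - toC x)).im = orient u v x / Complex.normSq (toC u - toC x) := by
  rw [Complex.div_im]
  simp only [toC, orient, Complex.sub_re, Complex.sub_im]
  ring

theorem im_ratio_pos {x u v : Plane} (hu : toC u - toC x ≠ 0) :
    0 < ((toC v - toC x) / (toC u - toC x)).im ↔ 0 < orient u v x := by
  rw [im_ratio]
  have := Complex.normSq_pos.2 hu
  exact div_pos_iff_of_pos_right this

theorem im_ratio_neg {x u v : Plane} (hu : toC u - toC x ≠ 0) :
    ((toC v - toC x) / (toC u - toC x)).im < 0 ↔ orient u v x < 0 := by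
  rw [im_ratio]
  have := Complex.normSq_pos.2 hu
  rw [div_lt_iff₀ this, zero_mul]

theorem arg_pos_iff {z : ℂ} (hz : z ∈ Complex.slitPlane) : 0 < Complex.arg z ↔ 0 < z.im := by
  have h1 : Complex.arg z ≠ Real.pi := Complex.slitPlane_arg_ne_pi hz
  constructor
  · intro h
    rcases lt_trichotomy z.im 0 with h2 | h2 | h2
    · exact absurd (Complex.arg_neg_iff.2 h2) (by linarith)
    · rw [Complex.mem_slitPlane_iff] at hz
      rcases hz with h3 | h3
      · exact absurd (Complex.arg_eq_zero_iff.2 ⟨h3.le, h2⟩) h.ne'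
      · exact absurd h2 h3
    · exact h2
  · intro h
    refine lt_of_le_of_ne (Complex.arg_nonneg_iff.2 h.le) fun h0 => ?_
    exact h.ne' (Complex.arg_eq_zero_iff.1 h0.symm).2

/-- The argument of a product compared with the sum of the arguments. -/
theorem arg_add_arg_pos_iff {a b : ℂ} (ha : a ∈ Complex.slitPlane) (hb : b ∈ Complex.slitPlane) :
    0 < Complex.arg a + Complex.arg b ↔
      (0 ≤ a.im ∧ 0 ≤ b.im ∧ (0 < a.im ∨ 0 < b.im)) ∨
      ((0 < a.im ∧ b.im < 0 ∨ a.im < 0 ∧ 0 < b.im) ∧ 0 < (a * b).im) := by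
  have pa := arg_pos_iff ha
  have pb := arg_pos_iff hb
  have na := Complex.arg_neg_iff (z := a)
  have nb := Complex.arg_neg_iff (z := b)
  have la := Complex.arg_lt_pi_iff (z := a)
  have a1 := Complex.neg_pi_lt_arg a
  have b1 := Complex.neg_pi_lt_arg b
  have a2 := lt_of_le_of_ne (Complex.arg_le_pi a) (Complex.slitPlane_arg_ne_pi ha)
  have b2 := lt_of_le_of_ne (Complex.arg_le_pi b) (Complex.slitPlane_arg_ne_pi hb)
  by_cases hopp : (0 < a.im ∧ b.im < 0 ∨ a.im < 0 ∧ 0 < b.im)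
  · have hlt : -Real.pi < Complex.arg a + Complex.arg b ∧
        Complex.arg a + Complex.arg b < Real.pi := by
      rcases hopp with ⟨h1, h2⟩ | ⟨h1, h2⟩
      · have := pa.2 h1; have := nb.2 h2
        constructor <;> linarith
      · have := na.2 h1; have := pb.2 h2
        constructor <;> linarith
    have hab : Complex.arg (a * b) = Complex.arg a + Complex.arg b :=
      (Complex.arg_mul_eq_add_arg_iff (Complex.slitPlane_ne_zero ha)
        (Complex.slitPlane_ne_zero hb)).2 ⟨hlt.1, hlt.2.le⟩
    have hs : a * b ∈ Complex.slitPlane := by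
      rw [Complex.mem_slitPlane_iff_arg, hab]
      exact ⟨hlt.2.ne, mul_ne_zero (Complex.slitPlane_ne_zero ha) (Complex.slitPlane_ne_zero hb)⟩
    rw [← hab, arg_pos_iff hs]
    have : ¬ (0 ≤ a.im ∧ 0 ≤ b.im ∧ (0 < a.im ∨ 0 < b.im)) := by
      rintro ⟨h1, h2, -⟩
      rcases hopp with h | h
      · linarith [h.2]
      · linarith [h.1]
    tauto
  · have h2 : ¬ ((0 < a.im ∧ b.im < 0 ∨ a.im < 0 ∧ 0 < b.im) ∧ 0 < (a * b).im) :=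
      fun h => hopp h.1
    rw [or_iff_left h2]
    constructor
    · intro h
      have h3 : 0 < a.im ∨ 0 < b.im := by
        by_contra! hcon
        have := not_lt.1 (fun h => absurd (pa.1 h) (by linarith [hcon.1]))
        have := not_lt.1 (fun h => absurd (pb.1 h) (by linarith [hcon.2]))
        linarith
      refine ⟨?_, ?_, h3⟩ <;> by_contra! hcon <;> apply hopp
      · right; exact ⟨hcon, h3.resolve_left (by linarith)⟩
      · left; exact ⟨h3.resolve_right (by linarith), hcon⟩
    · rintro ⟨h1, h2, h3⟩
      have := Complex.arg_nonneg_iff.2 h1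
      have := Complex.arg_nonneg_iff.2 h2
      rcases h3 with h3 | h3
      · have := pa.2 h3; linarith
      · have := pb.2 h3; linarith

theorem sweepsPos_iff {x p w q : Plane} (h1 : x ∉ segment ℝ p w) (h2 : x ∉ segment ℝ w q) :
    SweepsPos x p w q ↔ 0 < (sweep x p w + sweep x w q).im := by
  have hp := sub_ne_zero_of_notMem (left_mem_segment ℝ p w) h1
  have hw := sub_ne_zero_of_notMem (right_mem_segment ℝ p w) h1
  have hq := sub_ne_zero_of_notMem (right_mem_segment ℝ w q) h2
  have ha := ratio_mem_slitPlane (convex_segment p w) (left_mem_segment ℝ p w)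
    (right_mem_segment ℝ p w) h1
  have hb := ratio_mem_slitPlane (convex_segment w q) (left_mem_segment ℝ w q)
    (right_mem_segment ℝ w q) h2
  have hab : (toC w - toC x) / (toC p - toC x) * ((toC q - toC x) / (toC w - toC x)) =
      (toC q - toC x) / (toC p - toC x) := by field_simp
  rw [sweep, sweep, Complex.add_im, Complex.log_im, Complex.log_im, arg_add_arg_pos_iff ha hb, hab,
    im_ratio_pos hp, im_ratio_pos hp, im_ratio_pos hw, im_ratio_neg hp, im_ratio_neg hw,
    ← not_lt, ← not_lt, im_ratio_neg hp, im_ratio_neg hw, not_lt, not_lt, SweepsPos]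

/-- The angles swept by two paths with the same ends differ by a multiple of `2π`, and both are
less than `2π` in absolute value, so they agree if they have the same sign. -/
theorem sweep_add_eq {x p q w w' : Plane} (h1 : x ∉ segment ℝ p w) (h2 : x ∉ segment ℝ w q)
    (h1' : x ∉ segment ℝ p w') (h2' : x ∉ segment ℝ w' q)
    (h : SweepsPos x p w q ↔ SweepsPos x p w' q) :
    sweep x p w + sweep x w q = sweep x p w' + sweep x w' q := by
  have key : ∀ w, x ∉ segment ℝ p w → x ∉ segment ℝ w q →
      Complex.exp (sweep x p w + sweep x w q) = (toC q - toC x) / (toC p - toC x) ∧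
      |(sweep x p w + sweep x w q).im| < 2 * Real.pi := by
    intro w h1 h2
    have hp := sub_ne_zero_of_notMem (left_mem_segment ℝ p w) h1
    have hw := sub_ne_zero_of_notMem (right_mem_segment ℝ p w) h1
    constructor
    · rw [Complex.exp_add, exp_sweep (left_mem_segment ℝ p w) (right_mem_segment ℝ p w) h1,
        exp_sweep (left_mem_segment ℝ w q) (right_mem_segment ℝ w q) h2]
      field_simp
    · have ha := ratio_mem_slitPlane (convex_segment p w) (left_mem_segment ℝ p w)
        (right_mem_segment ℝ p w) h1
      have hb := ratio_mem_slitPlane (convex_segment w q) (left_mem_segment ℝ w q)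
        (right_mem_segment ℝ w q) h2
      have a1 := Complex.neg_pi_lt_arg ((toC w - toC x) / (toC p - toC x))
      have b1 := Complex.neg_pi_lt_arg ((toC q - toC x) / (toC w - toC x))
      have a2 := lt_of_le_of_ne (Complex.arg_le_pi _) (Complex.slitPlane_arg_ne_pi ha)
      have b2 := lt_of_le_of_ne (Complex.arg_le_pi _) (Complex.slitPlane_arg_ne_pi hb)
      rw [sweep, sweep, Complex.add_im, Complex.log_im, Complex.log_im, abs_lt]
      constructor <;> linarith
  obtain ⟨e1, b1⟩ := key w h1 h2
  obtain ⟨e2, b2⟩ := key w' h1' h2'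
  rw [sweepsPos_iff h1 h2, sweepsPos_iff h1' h2'] at h
  obtain ⟨n, hn⟩ := Complex.exp_eq_exp_iff_exists_int.1 (e1.trans e2.symm)
  have him : (sweep x p w + sweep x w q).im = (sweep x p w' + sweep x w' q).im + n * (2 * Real.pi) := by
    rw [hn]; simp
  have hpi := Real.pi_pos
  rw [abs_lt] at b1 b2
  have hn0 : n = 0 := by
    have : |(n : ℝ)| < 1 := by
      rw [abs_lt]
      constructor <;> by_contra! hcon
      · have : n * (2 * Real.pi) ≤ -1 * (2 * Real.pi) := by gcongr
        by_cases hp : 0 < (sweep x p w + sweep x w q).im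
        · linarith
        · linarith [not_lt.1 (mt h.2 hp)]
      · have : 1 * (2 * Real.pi) ≤ n * (2 * Real.pi) := by gcongr
        by_cases hp : 0 < (sweep x p w' + sweep x w' q).im
        · linarith
        · linarith [not_lt.1 (mt h.1 hp)]
    have : |n| < 1 := by exact_mod_cast this
    rwa [Int.abs_lt_one_iff] at this
  rw [hn, hn0]; simp

/-- If a family of convex obstacles encloses `x`, then so does every set `P` in which each two-link
path through two intersecting obstacles can be replaced by a two-link path with the same ends that
sweeps the same angle around `x`: a logarithm on `P` can be transported to the obstacles. -/
theorem enclosed_of_exchange {k : ℕ} {obs : Fin k → Set Plane} (T : Finset (Fin k))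
    (hc : ∀ i, IsCompact (obs i)) (hconv : ∀ i, Convex ℝ (obs i)) {π : Fin k → Plane}
    (hπ : ∀ i ∈ T, π i ∈ obs i) {x : Plane} (hx : ∀ i ∈ T, x ∉ obs i) {P : Set Plane}
    (hP : IsCompact P) (hxP : x ∉ P)
    (h : ∀ i ∈ T, ∀ j ∈ T, (obs i ∩ obs j).Nonempty → ∃ w ∈ obs i ∩ obs j, ∃ w',
      segment ℝ (π i) w' ⊆ P ∧ segment ℝ w' (π j) ⊆ P ∧
      (SweepsPos x (π i) w (π j) ↔ SweepsPos x (π i) w' (π j)))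
    (henc : IsEnclosedBy x (⋃ i ∈ T, obs i)) : IsEnclosedBy x P := by
  classical
  by_contra hcon
  obtain ⟨L, hL, hLe⟩ := hasBranch_of_not_enclosed hP hxP hcon
  refine not_enclosed_of_hasBranch (T.isCompact_biUnion fun i _ => hc i) ?_ henc
  let M : Fin k → Plane → ℂ := fun i z => L (π i) + sweep x (π i) z
  have hMc : ∀ i ∈ T, ContinuousOn (M i) (obs i) := fun i hi =>
    continuousOn_const.add (continuousOn_sweep (hconv i) (hπ i hi) (hx i hi))
  have hπP : ∀ i ∈ T, π i ∈ P := fun i hi => by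
    obtain ⟨w, -, w', h1, -, -⟩ := h i hi i hi ⟨π i, hπ i hi, hπ i hi⟩
    exact h1 (left_mem_segment ℝ _ _)
  have hMe : ∀ i ∈ T, ∀ z ∈ obs i, Complex.exp (M i z) = toC z - toC x := fun i hi z hz => by
    simp only [M]
    rw [Complex.exp_add, hLe _ (hπP i hi), exp_sweep (hπ i hi) hz (hx i hi)]
    have := sub_ne_zero_of_notMem (hπ i hi) (hx i hi)
    field_simp
  have hMM : ∀ i ∈ T, ∀ j ∈ T, ∀ z ∈ obs i ∩ obs j, M i z = M j z := by
    intro i hi j hj z hz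
    obtain ⟨w, hw, w', h1, h2, h3⟩ := h i hi j hj ⟨z, hz⟩
    have hwz : M i z - M i w = M j z - M j w := by
      rw [branch_sub_eq_sweep (hconv i) hw.1 hz.1 (hx i hi) (hMc i hi) (hMe i hi),
        branch_sub_eq_sweep (hconv j) hw.2 hz.2 (hx j hj) (hMc j hj) (hMe j hj)]
    have hs1 : segment ℝ (π i) w ⊆ obs i := (hconv i).segment_subset (hπ i hi) hw.1
    have hs2 : segment ℝ w (π j) ⊆ obs j := (hconv j).segment_subset hw.2 (hπ j hj)
    have hsum := sweep_add_eq (fun hh => hx i hi (hs1 hh)) (fun hh => hx j hj (hs2 hh))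
      (fun hh => hxP (h1 hh)) (fun hh => hxP (h2 hh)) h3
    have e1 := branch_sub_eq_sweep (convex_segment _ _) (left_mem_segment ℝ (π i) w')
      (right_mem_segment ℝ _ _) (fun hh => hxP (h1 hh)) (hL.mono h1) fun z hz => hLe z (h1 hz)
    have e2 := branch_sub_eq_sweep (convex_segment _ _) (left_mem_segment ℝ w' (π j))
      (right_mem_segment ℝ _ _) (fun hh => hxP (h2 hh)) (hL.mono h2) fun z hz => hLe z (h2 hz)
    have e3 := branch_sub_eq_sweep (hconv j) hw.2 (hπ j hj) (hx j hj) (hMc j hj) (hMe j hj)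
    have e4 : M j (π j) = L (π j) := by
      simp only [M, sweep]
      rw [div_self (sub_ne_zero_of_notMem (hπ j hj) (hx j hj)), Complex.log_one, add_zero]
    have e5 : M i w = L (π i) + sweep x (π i) w := rfl
    linear_combination hwz + e5 + hsum - e1 - e2 + e3 - e4
  let F : Plane → ℂ := fun z => if hz : ∃ i ∈ T, z ∈ obs i then M hz.choose z else 0
  have hF : ∀ i ∈ T, ∀ z ∈ obs i, F z = M i z := fun i hi z hz => by
    have hex : ∃ i ∈ T, z ∈ obs i := ⟨i, hi, hz⟩
    simp only [F, dif_pos hex]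
    exact hMM _ hex.choose_spec.1 _ hi z ⟨hex.choose_spec.2, hz⟩
  refine ⟨F, ?_, fun z hz => ?_⟩
  · have : (⋃ i ∈ T, obs i) = ⋃ i : T, obs i := by ext; simp
    rw [this]
    refine LocallyFinite.continuousOn_iUnion (locallyFinite_of_finite _)
      (fun i => (hc i).isClosed) fun i => (hMc i i.2).congr fun z hz => hF i i.2 z hz
  · simp only [Set.mem_iUnion] at hz
    obtain ⟨i, hi, hz⟩ := hz
    simp only [hF i hi z hz, hMe i hi z hz]

/-! ### Orientations and triangles -/

theorem orient_swap (p q x : Plane) : orient q p x = -orient p q x := by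
  simp only [orient]; ring

theorem orient_sum (a b c x : Plane) :
    orient a b x + orient b c x + orient c a x = orient a b c := by
  simp only [orient]; ring

/-- Orientations are affine in the third argument, written in barycentric coordinates. -/
theorem orient_barycentric (a b c u v x : Plane) : orient a b c * orient u v x =
    orient b c x * orient u v a + orient c a x * orient u v b + orient a b x * orient u v c := by
  simp only [orient]; ring

theorem plane_ext {p q : Plane} (h0 : p 0 = q 0) (h1 : p 1 = q 1) : p = q := by
  ext i; fin_cases i <;> assumption

/-- A point on the inner side of all edges of a triangle lies in the triangle. -/
theorem mem_of_orient {S : Set Plane} (hS : Convex ℝ S) {a b c x : Plane} (ha : a ∈ S) (hb : b ∈ S)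
    (hc : c ∈ S) (hD : 0 < orient a b c) (h1 : 0 ≤ orient a b x) (h2 : 0 ≤ orient b c x)
    (h3 : 0 ≤ orient c a x) : x ∈ S := by
  set D := orient a b c with hDd
  have hx : x = (orient b c x / D) • a + (orient c a x / D) • b + (orient a b x / D) • c := by
    apply plane_ext <;> simp only [PiLp.add_apply, PiLp.smul_apply, smul_eq_mul] <;> field_simp <;>
      simp only [hDd, orient] <;> ring
  have := hS.sum_mem (t := Finset.univ) (w := ![orient b c x / D, orient c a x / D, orient a b x / D])
    (z := ![a, b, c]) (by
      intro i _
      fin_cases i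
      exacts [div_nonneg h2 hD.le, div_nonneg h3 hD.le, div_nonneg h1 hD.le]) (by
      have := orient_sum a b c x
      simp only [Fin.sum_univ_three, Matrix.cons_val]
      field_simp
      linarith) (by
      intro i _
      fin_cases i
      exacts [ha, hb, hc])
  simpa only [Fin.sum_univ_three, Matrix.cons_val, ← hx] using this

theorem mem_segment_of_lineMap {p w : Plane} {t : ℝ} (h0 : 0 ≤ t) (h1 : t ≤ 1) :
    p + t • (w - p) ∈ segment ℝ p w := by
  rw [segment_eq_image']
  exact ⟨t, ⟨h0, h1⟩, rfl⟩

/-- No segment from the interior of `A` that leaves `B` at both ends crosses, inside `A`, a segment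
of the same kind inside `B`.  Two convex sets that cross like this would have boundaries
with common points in all four sectors between the segments. -/
def NonCrossing (A B : Set Plane) : Prop :=
  ∀ p ∈ interior A, ∀ q ∈ interior B, ∀ w ∈ A, ∀ v ∈ B, p ∉ B → w ∉ B → q ∉ A → v ∉ A →
    Disjoint (segment ℝ p w) (segment ℝ q v)

theorem NonCrossing.symm {A B : Set Plane} (h : NonCrossing A B) : NonCrossing B A :=
  fun p hp q hq w hw v hv h1 h2 h3 h4 => (h q hq p hp v hv w hw h3 h4 h1 h2).symm

/-- If the triangles `p q w₁` and `p q w₂` are such that `p w₁` and `q w₂` cross, the two parts in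
which they differ are triangles with vertices `p`, `w₂` and `w₁`, `q` and the crossing point.  As one
of them avoids `A` and one of them avoids `B`, the segments leave the other set at both ends. -/
theorem ears_contradiction {A B : Set Plane} (hA : Convex ℝ A) (hB : Convex ℝ B)
    (hAB : NonCrossing A B) {p q w₁ w₂ x₁ x₂ : Plane} (hp : p ∈ interior A) (hq : q ∈ interior B)
    (hw₁ : w₁ ∈ A) (hw₂ : w₂ ∈ B) (hx₁A : x₁ ∉ A) (hx₁B : x₁ ∉ B) (hx₂A : x₂ ∉ A) (hx₂B : x₂ ∉ B)
    (o₁ : 0 < orient p q w₁) (o₂ : 0 < orient p q w₂)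
    (hα : 0 < orient p w₁ w₂) (hβ : orient w₁ q w₂ < 0)
    (h1 : orient p w₂ x₁ ≤ 0) (h2 : orient w₂ q x₁ ≤ 0) (h3 : 0 ≤ orient p q x₁)
    (h4 : 0 < orient p w₁ x₁ ∨ 0 < orient w₁ q x₁)
    (h5 : orient p w₁ x₂ ≤ 0) (h6 : orient w₁ q x₂ ≤ 0) (h7 : 0 ≤ orient p q x₂)
    (h8 : 0 < orient p w₂ x₂ ∨ 0 < orient w₂ q x₂) : False := by
  have hpA := interior_subset hp
  have hqB := interior_subset hq
  have hs1 : 0 < orient p w₁ x₁ := by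
    refine h4.resolve_right fun hcon => ?_
    have e := orient_barycentric p q w₂ w₁ q x₁
    have e1 : orient w₁ q p = -orient p q w₁ := by simp only [orient]; ring
    have e2 : orient w₁ q q = 0 := by simp only [orient]; ring
    have e3 := orient_swap w₂ q x₁
    rw [e1, e2] at e
    nlinarith [mul_pos o₂ hcon]
  have hs2 : 0 < orient w₂ q x₂ := by
    refine h8.resolve_left fun hcon => ?_
    have e := orient_barycentric p q w₁ p w₂ x₂
    have e1 : orient p w₂ q = -orient p q w₂ := by simp only [orient]; ring
    have e2 : orient p w₂ p = 0 := by simp only [orient]; ring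
    have e3 : orient p w₂ w₁ = -orient p w₁ w₂ := by simp only [orient]; ring
    have e4 := orient_swap p w₁ x₂
    rw [e1, e2, e3] at e
    nlinarith [mul_pos o₁ hcon]
  have hsum : orient p w₁ w₂ + orient w₁ q w₂ = orient p q w₂ - orient p q w₁ := by
    simp only [orient]; ring
  set α := orient p w₁ w₂ with hαd
  set a := orient p q w₁ with had
  set b := orient p q w₂ with hbd
  have hden : 0 < α + a := by linarith
  set τ := b / (α + a) with hτ
  set σ := a / (α + a) with hσ
  have hτ0 : 0 < τ := by positivity
  have hτ1 : τ < 1 := by rw [hτ, div_lt_one hden]; linarith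
  have hσ0 : 0 < σ := by positivity
  have hσ1 : σ < 1 := by rw [hσ, div_lt_one hden]; linarith
  set z := p + τ • (w₁ - p) with hz
  have hz' : z = q + σ • (w₂ - q) := by
    apply plane_ext <;>
      simp only [hz, PiLp.add_apply, PiLp.smul_apply, PiLp.sub_apply, smul_eq_mul, hτ, hσ] <;>
      field_simp <;> simp only [hαd, had, hbd, orient] <;> ring
  have hz1 : z ∈ segment ℝ p w₁ := mem_segment_of_lineMap hτ0.le hτ1.le
  have hz2 : z ∈ segment ℝ q w₂ := by rw [hz']; exact mem_segment_of_lineMap hσ0.le hσ1.le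
  have hzA : z ∈ A := hA.segment_subset hpA hw₁ hz1
  have hzB : z ∈ B := hB.segment_subset hqB hw₂ hz2
  have f1 : ∀ x, orient p z x = τ * orient p w₁ x := fun x => by
    simp only [hz, orient, PiLp.add_apply, PiLp.smul_apply, PiLp.sub_apply, smul_eq_mul]; ring
  have f2 : ∀ x, orient z w₂ x = - (1 - σ) * orient w₂ q x := fun x => by
    simp only [hz', orient, PiLp.add_apply, PiLp.smul_apply, PiLp.sub_apply, smul_eq_mul]; ring
  have f3 : ∀ x, orient z w₁ x = (1 - τ) * orient p w₁ x := fun x => by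
    simp only [hz, orient, PiLp.add_apply, PiLp.smul_apply, PiLp.sub_apply, smul_eq_mul]; ring
  have f4 : ∀ x, orient q z x = - σ * orient w₂ q x := fun x => by
    simp only [hz', orient, PiLp.add_apply, PiLp.smul_apply, PiLp.sub_apply, smul_eq_mul]; ring
  have ear₁ : ∀ S : Set Plane, Convex ℝ S → p ∈ S → z ∈ S → w₂ ∈ S → x₁ ∈ S := by
    intro S hS h h' h''
    refine mem_of_orient hS h h' h'' ?_ ?_ ?_ ?_
    · rw [f1]; positivity
    · rw [f1]; positivity
    · rw [f2]; nlinarith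
    · rw [orient_swap]; linarith
  have ear₂ : ∀ S : Set Plane, Convex ℝ S → z ∈ S → w₁ ∈ S → q ∈ S → x₂ ∈ S := by
    intro S hS h h' h''
    -- the triangle `z w₁ q` is traversed clockwise
    refine mem_of_orient hS h' h h'' ?_ ?_ ?_ ?_
    · rw [orient_swap, f3]
      have : orient p w₁ q = - a := by simp only [had, orient]; ring
      rw [this]; nlinarith
    · rw [orient_swap, f3]; nlinarith
    · rw [orient_swap, f4]; nlinarith
    · rw [orient_swap]; linarith
  refine Set.disjoint_left.1 (hAB p hp q hq w₁ hw₁ w₂ hw₂ ?_ ?_ ?_ ?_) hz1 hz2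
  · exact fun h => hx₁B (ear₁ B hB h hzB hw₂)
  · exact fun h => hx₂B (ear₂ B hB hzB h hqB)
  · exact fun h => hx₂A (ear₂ A hA hzA hw₁ h)
  · exact fun h => hx₁A (ear₁ A hA hpA hzA h)

/-- If the paths from `p` over `w₁` and over `w₂` to `q` both turn to the left of the segment from `p` to `q`,
then it is impossible that the region swept by each path contains a point outside of the other region, unless
one of these points lies in one of the sets. -/
theorem triangles_nested {A₁ B₁ A₂ B₂ : Set Plane} (hA₁ : Convex ℝ A₁) (hB₁ : Convex ℝ B₁)
    (hA₂ : Convex ℝ A₂) (hB₂ : Convex ℝ B₂) (h₁₂ : NonCrossing A₁ B₂) (h₂₁ : NonCrossing A₂ B₁)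
    {p q w₁ w₂ x₁ x₂ : Plane} (hp₁ : p ∈ interior A₁) (hp₂ : p ∈ interior A₂)
    (hq₁ : q ∈ interior B₁) (hq₂ : q ∈ interior B₂)
    (hw₁ : w₁ ∈ A₁ ∩ B₁) (hw₂ : w₂ ∈ A₂ ∩ B₂)
    (hx₁ : x₁ ∉ A₁ ∪ B₁ ∪ (A₂ ∪ B₂)) (hx₂ : x₂ ∉ A₁ ∪ B₁ ∪ (A₂ ∪ B₂))
    (o₁ : 0 < orient p q w₁) (o₂ : 0 < orient p q w₂)
    (h1 : orient p w₂ x₁ ≤ 0) (h2 : orient w₂ q x₁ ≤ 0) (h3 : 0 ≤ orient p q x₁)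
    (h4 : 0 < orient p w₁ x₁ ∨ 0 < orient w₁ q x₁)
    (h5 : orient p w₁ x₂ ≤ 0) (h6 : orient w₁ q x₂ ≤ 0) (h7 : 0 ≤ orient p q x₂)
    (h8 : 0 < orient p w₂ x₂ ∨ 0 < orient w₂ q x₂) : False := by
  simp only [Set.mem_union, not_or] at hx₁ hx₂
  -- neither of `w₁`, `w₂` lies in the triangle of the other one
  have key : ∀ {w₁ w₂ x₁ : Plane}, 0 < orient p q w₁ → 0 < orient p q w₂ →
      orient p w₂ x₁ ≤ 0 → orient w₂ q x₁ ≤ 0 → 0 ≤ orient p q x₁ →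
      0 < orient p w₁ x₁ ∨ 0 < orient w₁ q x₁ → 0 < orient p w₁ w₂ ∨ 0 < orient w₁ q w₂ := by
    intro w₁ w₂ x₁ o₁ o₂ h1 h2 h3 h4
    by_contra! hcon
    have e := orient_barycentric p q w₂ w₁ q x₁
    have e' := orient_barycentric p q w₂ p w₁ x₁
    have e1 : orient w₁ q p = -orient p q w₁ := by simp only [orient]; ring
    have e2 : orient w₁ q q = 0 := by simp only [orient]; ring
    have e3 := orient_swap w₂ q x₁
    have e4 := orient_swap p w₂ x₁
    have e5 : orient p w₁ q = -orient p q w₁ := by simp only [orient]; ring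
    have e6 : orient p w₁ p = 0 := by simp only [orient]; ring
    rw [e1, e2, e3] at e
    rw [e5, e6, e4] at e'
    rcases h4 with h4 | h4
    · nlinarith [mul_pos o₂ h4, mul_nonneg h3 (sub_nonneg.2 hcon.1),
        mul_nonneg (neg_nonneg.2 h1) o₁.le]
    · nlinarith [mul_pos o₂ h4, mul_nonneg h3 (sub_nonneg.2 hcon.2),
        mul_nonneg (neg_nonneg.2 h2) o₁.le]
  have k1 := key o₁ o₂ h1 h2 h3 h4
  have k2 := key o₂ o₁ h5 h6 h7 h8
  have s1 : orient p w₂ w₁ = -orient p w₁ w₂ := by simp only [orient]; ring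
  have s2 : orient w₂ q w₁ = -orient w₁ q w₂ := by simp only [orient]; ring
  rw [s1, s2] at k2
  rcases k1 with k1 | k1
  · have k3 : orient w₁ q w₂ < 0 := by rcases k2 with h | h <;> linarith
    exact ears_contradiction hA₁ hB₂ h₁₂ hp₁ hq₂ hw₁.1 hw₂.2 hx₁.1.1 hx₁.2.2 hx₂.1.1 hx₂.2.2 o₁ o₂
      k1 k3 h1 h2 h3 h4 h5 h6 h7 h8
  · have k3 : orient p w₁ w₂ < 0 := by rcases k2 with h | h <;> linarith
    exact ears_contradiction hA₂ hB₁ h₂₁ hp₂ hq₁ hw₂.1 hw₁.2 hx₂.2.1 hx₂.1.2 hx₁.2.1 hx₁.1.2 o₂ o₁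
      (by linarith) (by linarith) h5 h6 h7 h8 h1 h2 h3 h4

/-- For paths from `p` to `q` through pairs of mutually noncrossing convex sets, the sets of
points around which the paths sweep a positive angle are nested. -/
theorem sweepsPos_chain {A₁ B₁ A₂ B₂ : Set Plane} (hA₁ : Convex ℝ A₁) (hB₁ : Convex ℝ B₁)
    (hA₂ : Convex ℝ A₂) (hB₂ : Convex ℝ B₂) (h₁₂ : NonCrossing A₁ B₂) (h₂₁ : NonCrossing A₂ B₁)
    {p q w₁ w₂ x₁ x₂ : Plane} (hp₁ : p ∈ interior A₁) (hp₂ : p ∈ interior A₂)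
    (hq₁ : q ∈ interior B₁) (hq₂ : q ∈ interior B₂)
    (hw₁ : w₁ ∈ A₁ ∩ B₁) (hw₂ : w₂ ∈ A₂ ∩ B₂)
    (hx₁ : x₁ ∉ A₁ ∪ B₁ ∪ (A₂ ∪ B₂)) (hx₂ : x₂ ∉ A₁ ∪ B₁ ∪ (A₂ ∪ B₂))
    (h1 : SweepsPos x₁ p w₁ q) (h2 : ¬ SweepsPos x₁ p w₂ q) (h3 : SweepsPos x₂ p w₂ q) :
    SweepsPos x₂ p w₁ q := by
  by_contra h4
  have hsum : ∀ w x, orient p w x + orient w q x = orient p q x - orient p q w := fun w x => by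
    simp only [orient]; ring
  -- a path on the left of `p q` sweeps positive angles only around points on the left
  have left : ∀ w x, 0 ≤ orient p q w → SweepsPos x p w q → 0 < orient p q x := by
    rintro w x h0 (⟨ha, hb, h⟩ | h)
    · have := hsum w x
      rcases h with h | h <;> linarith
    · exact h.2
  have right : ∀ w x, orient p q w ≤ 0 → 0 < orient p q x → SweepsPos x p w q := by
    intro w x h0 h
    have := hsum w x
    by_cases h5 : 0 ≤ orient p w x ∧ 0 ≤ orient w q x
    · left
      refine ⟨h5.1, h5.2, ?_⟩
      by_contra! hcon
      linarith
    · right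
      refine ⟨?_, h⟩
      rw [not_and_or, not_le, not_le] at h5
      rcases h5 with h5 | h5
      · right; exact ⟨h5, by linarith⟩
      · left; exact ⟨by linarith, h5⟩
  rcases lt_or_ge 0 (orient p q w₁) with o₁ | o₁
  · have d1 := left w₁ x₁ o₁.le h1
    have o₂ : 0 < orient p q w₂ := by
      by_contra! hcon
      exact h2 (right w₂ x₁ hcon d1)
    have d2 := left w₂ x₂ o₂.le h3
    have inside : ∀ w x, 0 < orient p q w → 0 < orient p q x → ¬ SweepsPos x p w q →
        orient p w x ≤ 0 ∧ orient w q x ≤ 0 := by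
      intro w x o d h
      simp only [SweepsPos, not_or, not_and, not_lt] at h
      obtain ⟨ha, hb⟩ := h
      constructor <;> by_contra! hcon
      · rcases lt_or_ge (orient w q x) 0 with h5 | h5
        · exact absurd (hb (Or.inl ⟨hcon, h5⟩)) (by linarith)
        · exact absurd (ha hcon.le h5) (by simp [hcon])
      · rcases lt_or_ge (orient p w x) 0 with h5 | h5
        · exact absurd (hb (Or.inr ⟨h5, hcon⟩)) (by linarith)
        · exact absurd (ha h5 hcon.le) (by simp [hcon])
    have outside : ∀ w x, SweepsPos x p w q → 0 < orient p w x ∨ 0 < orient w q x := by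
      rintro w x (⟨-, -, h⟩ | ⟨h | h, -⟩)
      exacts [h, Or.inl h.1, Or.inr h.2]
    obtain ⟨i1, i2⟩ := inside w₂ x₁ o₂ d1 h2
    obtain ⟨i3, i4⟩ := inside w₁ x₂ o₁ d2 h4
    exact triangles_nested hA₁ hB₁ hA₂ hB₂ h₁₂ h₂₁ hp₁ hp₂ hq₁ hq₂ hw₁ hw₂ hx₁ hx₂ o₁ o₂ i1 i2 d1.le
      (outside _ _ h1) i3 i4 d2.le (outside _ _ h3)
  · have d2 : orient p q x₂ ≤ 0 := by
      by_contra! hcon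
      exact h4 (right w₁ x₂ o₁ hcon)
    have o₂ : orient p q w₂ < 0 := by
      by_contra! hcon
      exact absurd (left w₂ x₂ hcon h3) (by linarith)
    have d1 : orient p q x₁ ≤ 0 := by
      by_contra! hcon
      exact h2 (right w₂ x₁ o₂.le hcon)
    have o₁' : orient p q w₁ < 0 := by
      refine lt_of_le_of_ne o₁ fun h0 => ?_
      exact absurd (left w₁ x₁ h0.ge h1) (by linarith)
    have inside : ∀ w x, orient p q x ≤ 0 → SweepsPos x p w q →
        0 ≤ orient p w x ∧ 0 ≤ orient w q x := by
      rintro w x d (h | h)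
      · exact ⟨h.1, h.2.1⟩
      · linarith [h.2]
    have outside : ∀ w x, orient p q w < 0 → orient p q x ≤ 0 → x ≠ w → ¬ SweepsPos x p w q →
        orient p w x < 0 ∨ orient w q x < 0 := by
      intro w x o d hne h
      by_contra! hcon
      simp only [SweepsPos, not_or, not_and, not_lt] at h
      have h5 := h.1 hcon.1 hcon.2
      -- otherwise `x` lies on the lines `p w` and `w q`, which meet in `w` only
      have e1 : orient p w x = 0 := le_antisymm h5.1 hcon.1
      have e2 : orient w q x = 0 := le_antisymm h5.2 hcon.2
      have o' := o.ne
      have e3 : orient p q x = orient p q w := by have := hsum w x; linarith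
      apply hne
      apply plane_ext
      · have : orient p q w * (x 0 - w 0) =
            (q 0 - w 0) * (- orient p w x) - (p 0 - w 0) * orient w q x := by
          simp only [orient]; ring
        rw [e1, e2] at this
        have := (mul_eq_zero.1 (this.trans (by ring))).resolve_left o'
        linarith
      · have : orient p q w * (x 1 - w 1) =
            (q 1 - w 1) * (- orient p w x) - (p 1 - w 1) * orient w q x := by
          simp only [orient]; ring
        rw [e1, e2] at this
        have := (mul_eq_zero.1 (this.trans (by ring))).resolve_left o'
        linarith
    have hx₁w : x₁ ≠ w₂ := by
      rintro rfl
      exact hx₁ (Or.inr (Or.inl hw₂.1))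
    have hx₂w : x₂ ≠ w₁ := by
      rintro rfl
      exact hx₂ (Or.inl (Or.inl hw₁.1))
    obtain ⟨i1, i2⟩ := inside w₁ x₁ d1 h1
    obtain ⟨i3, i4⟩ := inside w₂ x₂ d2 h3
    have u1 := outside w₂ x₁ o₂ d1 hx₁w h2
    have u2 := outside w₁ x₂ o₁' d2 hx₂w h4
    have sw := fun a b c : Plane => orient_swap a b c
    -- reverse all paths, which exchanges the roles of the ends and of the two indices
    refine triangles_nested (p := q) (q := p) (w₁ := w₁) (w₂ := w₂) (x₁ := x₂) (x₂ := x₁)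
      hB₁ hA₁ hB₂ hA₂ h₂₁.symm h₁₂.symm hq₁ hq₂ hp₁ hp₂ hw₁.symm hw₂.symm
      (fun h => hx₂ ?_) (fun h => hx₁ ?_) ?_ ?_ ?_ ?_ ?_ ?_ ?_ ?_ ?_ ?_
    · simp only [Set.mem_union] at h ⊢; tauto
    · simp only [Set.mem_union] at h ⊢; tauto
    · rw [sw]; linarith
    · rw [sw]; linarith
    · rw [sw]; linarith
    · rw [sw]; linarith
    · rw [sw]; linarith
    · rcases u2 with h | h
      · right; rw [sw]; linarith
      · left; rw [sw]; linarith
    · rw [sw]; linarith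
    · rw [sw]; linarith
    · rw [sw]; linarith
    · rcases u1 with h | h
      · right; rw [sw]; linarith
      · left; rw [sw]; linarith

/-! ### Pseudo-disks, disks and squares do not cross -/

/-- Between the rays from `z` through `p` and through `q` there is a ray that leaves `A` and `B` at the same point,
because the difference of the gauges of the two sets around `z` changes its sign. -/
theorem exists_mem_frontier_both {A B : Set Plane} (hA : Convex ℝ A) (hB : Convex ℝ B)
    (hcA : IsCompact A) (hcB : IsCompact B) {z p q : Plane} (hzA : z ∈ interior A)
    (hzB : z ∈ interior B) (hp : p ∈ A) (hpB : p ∉ B) (hq : q ∈ B) (hqA : q ∉ A)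
    (hne : ∀ t : ℝ, (1 - t) • (p - z) + t • (q - z) ≠ 0) :
    ∃ t c : ℝ, 0 < t ∧ t < 1 ∧ 0 < c ∧
      z + c • ((1 - t) • (p - z) + t • (q - z)) ∈ frontier A ∩ frontier B := by
  let e : Plane ≃ₜ Plane := Homeomorph.addLeft z
  have key : ∀ S : Set Plane, Convex ℝ S → IsCompact S → z ∈ interior S →
      Convex ℝ (e ⁻¹' S) ∧ e ⁻¹' S ∈ nhds (0 : Plane) ∧ IsClosed (e ⁻¹' S) ∧
      Bornology.IsVonNBounded ℝ (e ⁻¹' S) := by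
    intro S hS hc hz
    refine ⟨hS.translate_preimage_right z, ?_, hc.isClosed.preimage e.continuous, ?_⟩
    · apply e.continuous.continuousAt.preimage_mem_nhds
      simpa [e] using mem_interior_iff_mem_nhds.1 hz
    · rw [NormedSpace.isVonNBounded_iff]
      exact (e.isCompact_preimage.2 hc).isBounded
  obtain ⟨vA, nA, clA, bA⟩ := key A hA hcA hzA
  obtain ⟨vB, nB, clB, bB⟩ := key B hB hcB hzB
  let u : ℝ → Plane := fun t => (1 - t) • (p - z) + t • (q - z)
  have hu : Continuous u := by fun_prop
  have le_iff : ∀ S : Set Plane, Convex ℝ (e ⁻¹' S) → e ⁻¹' S ∈ nhds (0 : Plane) →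
      IsClosed (e ⁻¹' S) → ∀ y, gauge (e ⁻¹' S) (y - z) ≤ 1 ↔ y ∈ S := by
    intro S h1 h2 h3 y
    rw [gauge_le_one_iff_mem_closure h1 h2, h3.closure_eq]
    simp [e]
  have g : Continuous fun t => gauge (e ⁻¹' A) (u t) - gauge (e ⁻¹' B) (u t) :=
    ((continuous_gauge vA nA).comp hu).sub ((continuous_gauge vB nB).comp hu)
  have u0 : u 0 = p - z := by simp [u]
  have u1 : u 1 = q - z := by simp [u]
  have a1 := (le_iff A vA nA clA p).2 hp
  have a2 := mt (le_iff B vB nB clB p).1 hpB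
  have b1 := (le_iff B vB nB clB q).2 hq
  have b2 := mt (le_iff A vA nA clA q).1 hqA
  have hiv := intermediate_value_Ioo zero_le_one g.continuousOn
  obtain ⟨t, ⟨ht0, ht1⟩, ht⟩ := hiv (show (0 : ℝ) ∈ _ by
    constructor
    · rw [u0]; linarith
    · rw [u1]; linarith)
  have hgt : gauge (e ⁻¹' A) (u t) = gauge (e ⁻¹' B) (u t) := sub_eq_zero.1 ht
  have hpos : 0 < gauge (e ⁻¹' A) (u t) :=
    (gauge_pos (absorbent_nhds_zero nA) bA).2 (hne t)
  refine ⟨t, (gauge (e ⁻¹' A) (u t))⁻¹, ht0, ht1, inv_pos.2 hpos, ?_⟩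
  have hfr : ∀ S : Set Plane, Convex ℝ (e ⁻¹' S) → e ⁻¹' S ∈ nhds (0 : Plane) →
      gauge (e ⁻¹' S) (u t) = gauge (e ⁻¹' A) (u t) →
      z + (gauge (e ⁻¹' A) (u t))⁻¹ • u t ∈ frontier S := by
    intro S h1 h2 h3
    have : (gauge (e ⁻¹' A) (u t))⁻¹ • u t ∈ frontier (e ⁻¹' S) := by
      rw [← gauge_eq_one_iff_mem_frontier h1 h2, gauge_smul_of_nonneg (inv_nonneg.2 hpos.le), h3,
        smul_eq_mul, inv_mul_cancel₀ hpos.ne']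
    rw [← e.preimage_frontier] at this
    exact this
  exact ⟨hfr A vA nA rfl, hfr B vB nB hgt.symm⟩

/-- The determinant of two vectors. -/
def det2 (a b : Plane) : ℝ := a 0 * b 1 - a 1 * b 0

theorem exists_smul_of_det2_eq_zero {a b : Plane} (ha : a ≠ 0) (h : det2 a b = 0) :
    ∃ c : ℝ, b = c • a := by
  have h0 : 0 < a 0 ^ 2 + a 1 ^ 2 := by
    by_contra! hcon
    apply ha
    apply plane_ext <;> simp <;> nlinarith [sq_nonneg (a 0), sq_nonneg (a 1)]
  unfold det2 at h
  refine ⟨(a 0 * b 0 + a 1 * b 1) / (a 0 ^ 2 + a 1 ^ 2), ?_⟩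
  apply plane_ext <;> simp only [PiLp.smul_apply, smul_eq_mul] <;> field_simp
  · linear_combination (-a 1) * h
  · linear_combination (a 0) * h

theorem same_sign_of_isPreconnected {S : Set Plane} (hS : IsPreconnected S) {f : Plane → ℝ}
    (hf : Continuous f) (h0 : ∀ y ∈ S, f y ≠ 0) {y y' : Plane} (hy : y ∈ S) (hy' : y' ∈ S)
    (h : 0 < f y) : 0 < f y' := by
  by_contra! hcon
  obtain ⟨x, hx, hx0⟩ := hS.intermediate_value hy' hy hf.continuousOn ⟨hcon, h.le⟩
  exact h0 x hx hx0

/-- A point beyond which `B` contains a further point of a ray lies in `B`. -/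
theorem mem_of_ray {B : Set Plane} (hB : Convex ℝ B) {z a : Plane} {c d : ℝ} (hz : z ∈ B)
    (h : z + c • a ∈ B) (hd : 0 ≤ d) (hdc : d ≤ c) : z + d • a ∈ B := by
  rcases hd.eq_or_lt with rfl | hd
  · simpa using hz
  have hc : 0 < c := hd.trans_le hdc
  have := hB.add_smul_sub_mem hz h (t := d / c) ⟨by positivity, (div_le_one hc).2 hdc⟩
  rwa [add_sub_cancel_left, smul_smul, div_mul_cancel₀ _ hc.ne'] at this

/-- Two crossing convex sets have common boundary points in all four sectors between the two
segments and none on the segments, so two connected sets cannot cover these points. -/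
theorem nonCrossing_of_boundaries {A B : Set Plane} (hA : Convex ℝ A) (hB : Convex ℝ B)
    (hcA : IsCompact A) (hcB : IsCompact B) (h : BoundariesMeetAtMostTwice A B) :
    NonCrossing A B := by
  intro p hp q hq w hw v hv hpB hwB hqA hvA
  rw [Set.disjoint_left]
  intro z hz hz'
  have hpA := interior_subset hp
  have hqB := interior_subset hq
  have hzA : z ∈ A := hA.segment_subset hpA hw hz
  have hzB : z ∈ B := hB.segment_subset hqB hv hz'
  have hz1 : z ∈ openSegment ℝ p w := by
    rcases mem_openSegment_of_ne_left_right (x := p) (y := w) (z := z)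
      (by rintro rfl; exact hpB hzB) (by rintro rfl; exact hwB hzB) hz with h
    exact h
  have hz2 : z ∈ openSegment ℝ q v :=
    mem_openSegment_of_ne_left_right
      (by rintro rfl; exact hqA hzA) (by rintro rfl; exact hvA hzA) hz'
  have oA := hA.openSegment_interior_self_subset_interior hp hw
  have oB := hB.openSegment_interior_self_subset_interior hq hv
  have hziA := oA hz1
  have hziB := oB hz2
  set a := p - z with ha
  set b := q - z with hb
  have hray : ∀ {p w : Plane}, z ∈ openSegment ℝ p w →
      ∃ s : ℝ, 0 < s ∧ w = z + (-s) • (p - z) ∧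
        ∀ c, -s < c → c < 1 → z + c • (p - z) ∈ openSegment ℝ p w := by
    rintro p w ⟨α, β, hα, hβ, hαβ, rfl⟩
    refine ⟨α / β, by positivity, ?_, fun c h1 h2 => ?_⟩
    · have hα' : α = 1 - β := by linarith
      subst hα'
      apply plane_ext <;> simp <;> field_simp <;> ring
    · have h3 : -α < c * β := by
        have e := mul_lt_mul_of_pos_right h1 hβ
        rwa [neg_mul, div_mul_cancel₀ _ hβ.ne'] at e
      refine ⟨α + c * β, β * (1 - c), by linarith, mul_pos hβ (by linarith), by linarith, ?_⟩
      have hα' : α = 1 - β := by linarith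
      subst hα'
      apply plane_ext <;> simp <;> ring
  obtain ⟨s, hs, hws, hs'⟩ := hray hz1
  obtain ⟨t, ht, hvt, ht'⟩ := hray hz2
  rw [← ha] at hws hs'
  rw [← hb] at hvt ht'
  have hpa : p = z + (1 : ℝ) • a := by simp [ha]
  have hqb : q = z + (1 : ℝ) • b := by simp [hb]
  have rayneg : ∀ {S : Set Plane} {a : Plane} {c d : ℝ}, Convex ℝ S → z ∈ S → z + c • a ∈ S →
      c ≤ d → d ≤ 0 → z + d • a ∈ S := by
    intro S a c d hS h1 h2 h3 h4
    have := mem_of_ray hS (a := -a) (c := -c) (d := -d) h1 (by simpa using h2) (by linarith)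
      (by linarith)
    simpa using this
  have ha0 : a ≠ 0 := by
    intro h0
    rw [h0, smul_zero, add_zero] at hpa
    exact hpB (hpa ▸ hzB)
  have hb0 : b ≠ 0 := by
    intro h0
    rw [h0, smul_zero, add_zero] at hqb
    exact hqA (hqb ▸ hzA)
  have hD : det2 a b ≠ 0 := by
    intro h0
    obtain ⟨c, hc⟩ := exists_smul_of_det2_eq_zero ha0 h0
    have hqc : q = z + c • a := by rw [← hc]; simp [hb]
    rcases le_or_gt 0 c with h1 | h1
    · rcases le_or_gt 1 c with h2 | h2
      · exact hpB (hpa ▸ mem_of_ray hB hzB (hqc ▸ hqB) zero_le_one h2)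
      · exact hqA (hqc ▸ mem_of_ray hA hzA (hpa ▸ hpA) h1 h2.le)
    · rcases le_or_gt c (-s) with h2 | h2
      · exact hwB (hws ▸ rayneg hB hzB (hqc ▸ hqB) h2 (by linarith))
      · exact hqA (hqc ▸ rayneg hA hzA (hws ▸ hw) h2.le h1.le)
  set D := det2 a b with hDd
  -- no common boundary point lies on one of the two lines
  have line1 : ∀ y ∈ frontier A ∩ frontier B, det2 a (y - z) ≠ 0 := by
    rintro y ⟨hyA, hyB⟩ h0
    obtain ⟨c, hc⟩ := exists_smul_of_det2_eq_zero ha0 h0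
    have hy : y = z + c • a := by rw [← hc]; simp
    have hyB' : y ∈ B := hcB.isClosed.frontier_subset hyB
    refine hyA.2 (hy ▸ oA (hs' c ?_ ?_))
    · by_contra! hcon
      exact hwB (hws ▸ rayneg hB hzB (hy ▸ hyB') hcon (by linarith))
    · by_contra! hcon
      exact hpB (hpa ▸ mem_of_ray hB hzB (hy ▸ hyB') zero_le_one hcon)
  have line2 : ∀ y ∈ frontier A ∩ frontier B, det2 b (y - z) ≠ 0 := by
    rintro y ⟨hyA, hyB⟩ h0
    obtain ⟨c, hc⟩ := exists_smul_of_det2_eq_zero hb0 h0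
    have hy : y = z + c • b := by rw [← hc]; simp
    have hyA' : y ∈ A := hcA.isClosed.frontier_subset hyA
    refine hyB.2 (hy ▸ oB (ht' c ?_ ?_))
    · by_contra! hcon
      exact hvA (hvt ▸ rayneg hA hzA (hy ▸ hyA') hcon (by linarith))
    · by_contra! hcon
      exact hqA (hqb ▸ mem_of_ray hA hzA (hy ▸ hyA') zero_le_one hcon)
  have sector : ∀ p' ∈ A, p' ∉ B → ∀ q' ∈ B, q' ∉ A → ∀ α β : ℝ, p' - z = α • a →
      q' - z = β • b → α ≠ 0 → β ≠ 0 → ∃ y ∈ frontier A ∩ frontier B,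
        0 < det2 a (y - z) * D * β ∧ 0 < - (det2 b (y - z) * D * α) := by
    intro p' h1 h2 q' h3 h4 α β h5 h6 h7 h8
    obtain ⟨t, c, t0, t1, c0, hy⟩ := exists_mem_frontier_both hA hB hcA hcB hziA hziB h1 h2 h3 h4
      (fun t h0 => by
        rw [h5, h6] at h0
        have e1 : (1 - t) * α * D = 0 := by
          have : det2 ((1 - t) • α • a + t • β • b) b = (1 - t) * α * D := by
            simp [det2, hDd]; ring
          rw [← this, h0]; simp [det2]
        have e2 : t * β * D = 0 := by
          have : det2 a ((1 - t) • α • a + t • β • b) = t * β * D := by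
            simp [det2, hDd]; ring
          rw [← this, h0]; simp [det2]
        have e3 := (mul_eq_zero.1 ((mul_eq_zero.1 e1).resolve_right hD)).resolve_right h7
        have e4 := (mul_eq_zero.1 ((mul_eq_zero.1 e2).resolve_right hD)).resolve_right h8
        linarith)
    refine ⟨_, hy, ?_, ?_⟩
    · rw [add_sub_cancel_left, h5, h6]
      have : det2 a (c • ((1 - t) • α • a + t • β • b)) * D * β = c * t * (D ^ 2 * β ^ 2) := by
        simp [det2, hDd]; ring
      rw [this]; positivity
    · rw [add_sub_cancel_left, h5, h6]
      have : -(det2 b (c • ((1 - t) • α • a + t • β • b)) * D * α) =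
          c * (1 - t) * (D ^ 2 * α ^ 2) := by
        simp [det2, hDd]; ring
      rw [this]
      have : 0 < 1 - t := by linarith
      positivity
  have wza : w - z = (-s) • a := by rw [hws]; simp
  have vzb : v - z = (-t) • b := by rw [hvt]; simp
  have paz : p - z = (1 : ℝ) • a := by simp [ha]
  have qbz : q - z = (1 : ℝ) • b := by simp [hb]
  obtain ⟨y₁, m₁, c₁, d₁⟩ := sector p hpA hpB q hqB hqA 1 1 paz qbz one_ne_zero one_ne_zero
  obtain ⟨y₂, m₂, c₂, d₂⟩ := sector w hw hwB q hqB hqA (-s) 1 wza qbz (by linarith) one_ne_zero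
  obtain ⟨y₃, m₃, c₃, d₃⟩ := sector w hw hwB v hv hvA (-s) (-t) wza vzb (by linarith) (by linarith)
  obtain ⟨y₄, m₄, c₄, d₄⟩ := sector p hpA hpB v hv hvA 1 (-t) paz vzb one_ne_zero (by linarith)
  obtain ⟨S, T, hS, hT, hST⟩ := h
  let f₁ : Plane → ℝ := fun y => det2 a (y - z) * D
  let f₂ : Plane → ℝ := fun y => det2 b (y - z) * D
  have hf₁ : Continuous f₁ := by simp only [f₁, det2]; fun_prop
  have hf₂ : Continuous f₂ := by simp only [f₂, det2]; fun_prop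
  have c₁' : 0 < f₁ y₁ := by simpa [f₁] using c₁
  have c₂' : 0 < f₁ y₂ := by simpa [f₁] using c₂
  have c₃' : ¬ 0 < f₁ y₃ := fun h => by
    have := mul_pos h ht
    simp only [f₁] at this
    linarith
  have c₄' : ¬ 0 < f₁ y₄ := fun h => by
    have := mul_pos h ht
    simp only [f₁] at this
    linarith
  have d₁' : ¬ 0 < f₂ y₁ := fun h => by simp only [f₂] at h; linarith
  have d₂' : 0 < f₂ y₂ := by
    by_contra! hcon
    have := mul_nonneg (neg_nonneg.2 hcon) hs.le
    simp only [f₂] at this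
    linarith
  have d₃' : 0 < f₂ y₃ := by
    by_contra! hcon
    have := mul_nonneg (neg_nonneg.2 hcon) hs.le
    simp only [f₂] at this
    linarith
  have d₄' : ¬ 0 < f₂ y₄ := fun h => by simp only [f₂] at h; linarith
  have same : ∀ S' : Set Plane, IsPreconnected S' → S' ⊆ frontier A ∩ frontier B →
      ∀ y ∈ S', ∀ y' ∈ S', (0 < f₁ y ↔ 0 < f₁ y') ∧ (0 < f₂ y ↔ 0 < f₂ y') := by
    intro S' hS' hsub y hy y' hy'
    have n₁ : ∀ y ∈ S', f₁ y ≠ 0 := fun y hy => mul_ne_zero (line1 y (hsub hy)) hD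
    have n₂ : ∀ y ∈ S', f₂ y ≠ 0 := fun y hy => mul_ne_zero (line2 y (hsub hy)) hD
    exact ⟨⟨same_sign_of_isPreconnected hS' hf₁ n₁ hy hy',
      same_sign_of_isPreconnected hS' hf₁ n₁ hy' hy⟩,
      ⟨same_sign_of_isPreconnected hS' hf₂ n₂ hy hy',
      same_sign_of_isPreconnected hS' hf₂ n₂ hy' hy⟩⟩
  have sS := same S hS (hST ▸ Set.subset_union_left)
  have sT := same T hT (hST ▸ Set.subset_union_right)
  rw [hST] at m₁ m₂ m₃ m₄
  rcases m₁ with m₁ | m₁ <;> rcases m₂ with m₂ | m₂ <;> rcases m₃ with m₃ | m₃ <;>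
    first
    | exact d₁' ((sS _ m₁ _ m₂).2.2 d₂')
    | exact d₁' ((sT _ m₁ _ m₂).2.2 d₂')
    | exact c₃' ((sS _ m₂ _ m₃).1.1 c₂')
    | exact c₃' ((sT _ m₂ _ m₃).1.1 c₂')
    | exact c₃' ((sS _ m₁ _ m₃).1.1 c₁')
    | exact c₃' ((sT _ m₁ _ m₃).1.1 c₁')

theorem dist_le_iff {p c : Plane} {r : ℝ} (hr : 0 ≤ r) :
    dist p c ≤ r ↔ (p 0 - c 0) ^ 2 + (p 1 - c 1) ^ 2 ≤ r ^ 2 := by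
  rw [EuclideanSpace.dist_eq, Real.sqrt_le_left hr]
  simp [Fin.sum_univ_two, Real.dist_eq, sq_abs]

/-- The difference of the powers of a point with respect to the two circles is an affine function, which has
different signs on the part of each disk outside the other one. -/
theorem nonCrossing_unitDisk (c d : Plane) : NonCrossing (unitDisk c) (unitDisk d) := by
  intro p hp q hq w hw v hv hpB hwB hqA hvA
  rw [Set.disjoint_left]
  intro z hz hz'
  replace hp := interior_subset hp
  replace hq := interior_subset hq
  simp only [unitDisk, Metric.mem_closedBall, dist_le_iff zero_le_one, not_le] at *
  rw [segment_eq_image'] at hz hz'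
  obtain ⟨s, ⟨hs0, hs1⟩, rfl⟩ := hz
  obtain ⟨t, ⟨ht0, ht1⟩, hzt⟩ := hz'
  -- the difference of the powers with respect to the two circles is an affine function
  let F : Plane → ℝ := fun y => (y 0 - c 0) ^ 2 + (y 1 - c 1) ^ 2 -
    ((y 0 - d 0) ^ 2 + (y 1 - d 1) ^ 2)
  have hF : ∀ (y y' : Plane) (t : ℝ), F (y + t • (y' - y)) = (1 - t) * F y + t * F y' := by
    intro y y' t
    simp only [F, PiLp.add_apply, PiLp.smul_apply, PiLp.sub_apply, smul_eq_mul]; ring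
  have h1 : F p < 0 := by simp only [F]; linarith
  have h2 : F w < 0 := by simp only [F]; linarith
  have h3 : 0 < F q := by simp only [F]; linarith
  have h4 : 0 < F v := by simp only [F]; linarith
  have e : (1 - s) * F p + s * F w = (1 - t) * F q + t * F v := by
    rw [← hF, ← hF]; exact congrArg F hzt.symm
  have e1 : (1 - s) * F p + s * F w < 0 := by
    rcases hs0.eq_or_lt with rfl | hs0
    · simpa using h1
    · nlinarith
  have e2 : 0 ≤ (1 - t) * F q + t * F v :=
    add_nonneg (mul_nonneg (by linarith) h3.le) (mul_nonneg ht0 h4.le)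
  linarith

theorem interior_unitSquare_lt {c p : Plane} (hp : p ∈ interior (unitSquare c)) (a : Fin 2) :
    |p a - c a| < 1 / 2 := by
  obtain ⟨ε, hε, hball⟩ := Metric.isOpen_iff.1 isOpen_interior p hp
  have key : ∀ s : ℝ, |s| < ε → |p a + s - c a| ≤ 1 / 2 := by
    intro s hs
    have : p + EuclideanSpace.single a s ∈ unitSquare c := interior_subset (hball (by
      rw [Metric.mem_ball, dist_eq_norm, add_sub_cancel_left]
      simpa using hs))
    simpa using this a
  have k1 := abs_le.1 (key (ε / 2) (by rw [abs_of_pos (by linarith)]; linarith))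
  have k2 := abs_le.1 (key (-(ε / 2)) (by rw [abs_neg, abs_of_pos (by linarith)]; linarith))
  rw [abs_lt]
  constructor <;> linarith [k1.1, k1.2, k2.1, k2.2]

/-- The unit squares centred at the origin and at a point `(s, t)` with `s, t ≥ 0`: their differences
are separated by the line through the two corners of the intersection. -/
theorem squares_no_cross {s t p₀ p₁ w₀ w₁ q₀ q₁ v₀ v₁ σ τ : ℝ} (hs : 0 ≤ s) (ht : 0 ≤ t)
    (p0 : |p₀| < 1 / 2) (p1 : |p₁| < 1 / 2) (w0 : |w₀| ≤ 1 / 2) (w1 : |w₁| ≤ 1 / 2)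
    (q0 : |q₀ - s| < 1 / 2) (q1 : |q₁ - t| < 1 / 2) (v0 : |v₀ - s| ≤ 1 / 2) (v1 : |v₁ - t| ≤ 1 / 2)
    (hp : 1 / 2 < |p₀ - s| ∨ 1 / 2 < |p₁ - t|) (hw : 1 / 2 < |w₀ - s| ∨ 1 / 2 < |w₁ - t|)
    (hq : 1 / 2 < |q₀| ∨ 1 / 2 < |q₁|) (hv : 1 / 2 < |v₀| ∨ 1 / 2 < |v₁|)
    (σ0 : 0 ≤ σ) (σ1 : σ < 1) (τ0 : 0 ≤ τ) (τ1 : τ < 1)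
    (e0 : p₀ + σ * (w₀ - p₀) = q₀ + τ * (v₀ - q₀))
    (e1 : p₁ + σ * (w₁ - p₁) = q₁ + τ * (v₁ - q₁)) : False := by
  rw [abs_lt] at p0 p1 q0 q1
  rw [abs_le] at w0 w1 v0 v1
  have s1 : s < 1 := by nlinarith
  have t1 : t < 1 := by nlinarith
  have hp' : p₀ < s - 1 / 2 ∨ p₁ < t - 1 / 2 := by
    simp only [lt_abs] at hp
    rcases hp with (h | h) | (h | h)
    · linarith
    · left; linarith
    · linarith
    · right; linarith
  have hw' : w₀ < s - 1 / 2 ∨ w₁ < t - 1 / 2 := by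
    simp only [lt_abs] at hw
    rcases hw with (h | h) | (h | h)
    · linarith
    · left; linarith
    · linarith
    · right; linarith
  have hq' : 1 / 2 < q₀ ∨ 1 / 2 < q₁ := by
    simp only [lt_abs] at hq
    rcases hq with (h | h) | (h | h)
    · left; linarith
    · linarith
    · right; linarith
    · linarith
  have hv' : 1 / 2 < v₀ ∨ 1 / 2 < v₁ := by
    simp only [lt_abs] at hv
    rcases hv with (h | h) | (h | h)
    · left; linarith
    · linarith
    · right; linarith
    · linarith
  have below : ∀ a b : ℝ, a ≤ 1 / 2 → b ≤ 1 / 2 → a < s - 1 / 2 ∨ b < t - 1 / 2 →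
      (a - s + 1 / 2) * (1 - t) + (b - t + 1 / 2) * (1 - s) < (1 - s) * (1 - t) := by
    rintro a b h1 h2 (h | h)
    · nlinarith [mul_pos (sub_pos.2 h) (sub_pos.2 t1), mul_nonneg (sub_nonneg.2 h2) (sub_pos.2 s1).le]
    · nlinarith [mul_pos (sub_pos.2 h) (sub_pos.2 s1), mul_nonneg (sub_nonneg.2 h1) (sub_pos.2 t1).le]
  have above : ∀ a b : ℝ, s - 1 / 2 ≤ a → t - 1 / 2 ≤ b → 1 / 2 < a ∨ 1 / 2 < b →
      (1 - s) * (1 - t) < (a - s + 1 / 2) * (1 - t) + (b - t + 1 / 2) * (1 - s) := by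
    rintro a b h1 h2 (h | h)
    · nlinarith [mul_pos (sub_pos.2 h) (sub_pos.2 t1), mul_nonneg (sub_nonneg.2 h2) (sub_pos.2 s1).le]
    · nlinarith [mul_pos (sub_pos.2 h) (sub_pos.2 s1), mul_nonneg (sub_nonneg.2 h1) (sub_pos.2 t1).le]
  have bp := below p₀ p₁ (by linarith) (by linarith) hp'
  have bw := below w₀ w₁ (by linarith) (by linarith) hw'
  have aq := above q₀ q₁ (by linarith) (by linarith) hq'
  have av := above v₀ v₁ (by linarith) (by linarith) hv'
  have m1 := mul_lt_mul_of_pos_left bp (sub_pos.2 σ1)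
  have m2 := mul_le_mul_of_nonneg_left bw.le σ0
  have m3 := mul_lt_mul_of_pos_left aq (sub_pos.2 τ1)
  have m4 := mul_le_mul_of_nonneg_left av.le τ0
  have e : (1 - σ) * ((p₀ - s + 1 / 2) * (1 - t) + (p₁ - t + 1 / 2) * (1 - s)) +
      σ * ((w₀ - s + 1 / 2) * (1 - t) + (w₁ - t + 1 / 2) * (1 - s)) =
      (1 - τ) * ((q₀ - s + 1 / 2) * (1 - t) + (q₁ - t + 1 / 2) * (1 - s)) +
      τ * ((v₀ - s + 1 / 2) * (1 - t) + (v₁ - t + 1 / 2) * (1 - s)) := by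
    linear_combination (1 - t) * e0 + (1 - s) * e1
  linarith

theorem convex_unitSquare (c : Plane) : Convex ℝ (unitSquare c) := by
  intro x hx y hy s t hs ht hst a
  have h1 := abs_le.1 (hx a)
  have h2 := abs_le.1 (hy a)
  simp only [PiLp.smul_apply, PiLp.add_apply, smul_eq_mul]
  obtain rfl : s = 1 - t := by linarith
  exact abs_le.2 ⟨by nlinarith, by nlinarith⟩

theorem nonCrossing_unitSquare (c d : Plane) : NonCrossing (unitSquare c) (unitSquare d) := by
  intro p hp q hq w hw v hv hpB hwB hqA hvA
  rw [Set.disjoint_left]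
  intro z hz hz'
  have hzB := (convex_unitSquare d).segment_subset (interior_subset hq) hv hz'
  have hzA := (convex_unitSquare c).segment_subset (interior_subset hp) hw hz
  rw [segment_eq_image'] at hz hz'
  obtain ⟨σ, ⟨hs0, hs1⟩, rfl⟩ := hz
  obtain ⟨τ, ⟨ht0, ht1⟩, hzt⟩ := hz'
  have hs1' : σ < 1 := lt_of_le_of_ne hs1 (by
    rintro rfl
    simp only [one_smul, add_sub_cancel] at hzB
    exact hwB hzB)
  have ht1' : τ < 1 := lt_of_le_of_ne ht1 (by
    rintro rfl
    simp only [one_smul, add_sub_cancel] at hzt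
    exact hvA (hzt ▸ hzA))
  have sgn : ∀ a : ℝ, ∃ ε : ℝ, |ε| = 1 ∧ 0 ≤ ε * a := fun a => by
    rcases le_total 0 a with h | h
    · exact ⟨1, by simp, by linarith⟩
    · exact ⟨-1, by simp, by linarith⟩
  -- reflect so that the second square lies to the upper right of the first one
  obtain ⟨ε, hε, hε0⟩ := sgn (d 0 - c 0)
  obtain ⟨η, hη, hη0⟩ := sgn (d 1 - c 1)
  have a1 : ∀ y : Plane, |ε * (y 0 - c 0)| = |y 0 - c 0| := fun y => by rw [abs_mul, hε, one_mul]
  have a2 : ∀ y : Plane, |η * (y 1 - c 1)| = |y 1 - c 1| := fun y => by rw [abs_mul, hη, one_mul]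
  have a3 : ∀ y : Plane, |ε * (y 0 - c 0) - ε * (d 0 - c 0)| = |y 0 - d 0| := fun y => by
    rw [← mul_sub, abs_mul, hε, one_mul]; congr 1; ring
  have a4 : ∀ y : Plane, |η * (y 1 - c 1) - η * (d 1 - c 1)| = |y 1 - d 1| := fun y => by
    rw [← mul_sub, abs_mul, hη, one_mul]; congr 1; ring
  have nm : ∀ {c y : Plane}, y ∉ unitSquare c → 1 / 2 < |y 0 - c 0| ∨ 1 / 2 < |y 1 - c 1| := by
    intro c y h
    by_contra! hcon
    apply h
    intro i
    fin_cases i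
    exacts [hcon.1, hcon.2]
  have z0 := congrArg (fun y : Plane => y 0) hzt
  have z1 := congrArg (fun y : Plane => y 1) hzt
  simp only [PiLp.add_apply, PiLp.smul_apply, PiLp.sub_apply, smul_eq_mul] at z0 z1
  refine squares_no_cross (s := ε * (d 0 - c 0)) (t := η * (d 1 - c 1))
    (p₀ := ε * (p 0 - c 0)) (p₁ := η * (p 1 - c 1)) (w₀ := ε * (w 0 - c 0))
    (w₁ := η * (w 1 - c 1)) (q₀ := ε * (q 0 - c 0)) (q₁ := η * (q 1 - c 1))
    (v₀ := ε * (v 0 - c 0)) (v₁ := η * (v 1 - c 1)) hε0 hη0 ?_ ?_ ?_ ?_ ?_ ?_ ?_ ?_ ?_ ?_ ?_ ?_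
    hs0 hs1' ht0 ht1' ?_ ?_ <;> simp only [a1, a2, a3, a4]
  · exact interior_unitSquare_lt hp 0
  · exact interior_unitSquare_lt hp 1
  · exact hw 0
  · exact hw 1
  · exact interior_unitSquare_lt hq 0
  · exact interior_unitSquare_lt hq 1
  · exact hv 0
  · exact hv 1
  · exact nm hpB
  · exact nm hwB
  · exact nm hqA
  · exact nm hvA
  · linear_combination (-ε) * z0
  · linear_combination (-η) * z1

/-- Points with mutual distances above `δ` in a disk of radius `ρ`: their number is bounded uniformly in the centre. -/
theorem exists_packing_bound (ρ δ : ℝ) (hδ : 0 < δ) : ∃ N : ℕ, ∀ (c : Plane) {ι : Type} (f : ι → Plane)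
    (S : Finset ι), (∀ i ∈ S, dist (f i) c ≤ ρ) →
      (∀ i ∈ S, ∀ j ∈ S, i ≠ j → δ < dist (f i) (f j)) → S.card ≤ N := by
  obtain ⟨t, -, htf, ht⟩ := (isCompact_closedBall (0 : Plane) ρ).finite_cover_balls (half_pos hδ)
  refine ⟨htf.toFinset.card, fun c ι f S h1 h2 => ?_⟩
  have h3 : ∀ i ∈ S, ∃ y ∈ t, dist (f i - c) y < δ / 2 := by
    intro i hi
    have : f i - c ∈ ⋃ y ∈ t, Metric.ball y (δ / 2) := ht (by
      rw [Metric.mem_closedBall, dist_zero_right, ← dist_eq_norm]; exact h1 i hi)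
    simpa using this
  choose! g hg hgd using h3
  refine Finset.card_le_card_of_injOn g (fun i hi => by simpa using hg i hi) fun i hi j hj hij => ?_
  by_contra hne
  have := h2 i hi j hj hne
  have e1 := hgd i hi
  have e2 := hgd j hj
  rw [← hij] at e2
  have e3 := dist_triangle_right (f i - c) (f j - c) (g i)
  rw [dist_sub_right] at e3
  linarith

/-! ### Sample points in the faces of a line arrangement -/

/-- The triple `(a, b, c)` stands for the line `a x + b y + c = 0` (or for a constant, if `a = b = 0`). -/
abbrev Line : Type := ℝ × ℝ × ℝ

/-- The value of the affine function at a point; its sign tells the side of the line. -/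
def Line.ev (l : Line) (z : Plane) : ℝ := l.1 * z 0 + l.2.1 * z 1 + l.2.2

/-- The common point of two lines by Cramer's rule (an arbitrary point for parallel lines). -/
def Line.meet (l l' : Line) : Plane :=
  !₂[(l.2.1 * l'.2.2 - l'.2.1 * l.2.2) / (l.1 * l'.2.1 - l'.1 * l.2.1),
    (l.2.2 * l'.1 - l'.2.2 * l.1) / (l.1 * l'.2.1 - l'.1 * l.2.1)]

theorem Line.continuous_ev (l : Line) : Continuous l.ev := by
  unfold Line.ev; fun_prop

theorem Line.ev_add_smul (l : Line) (z d : Plane) (t : ℝ) :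
    l.ev (z + t • d) = l.ev z + t * (l.1 * d 0 + l.2.1 * d 1) := by
  simp only [Line.ev, PiLp.add_apply, PiLp.smul_apply, smul_eq_mul]; ring

theorem Line.ev_combo (l : Line) {y z : Plane} {a b : ℝ} (h : a + b = 1) :
    l.ev (a • y + b • z) = a * l.ev y + b * l.ev z := by
  simp only [Line.ev, PiLp.add_apply, PiLp.smul_apply, smul_eq_mul]
  linear_combination (-l.2.2) * h

theorem Line.ev_sum (l : Line) {ι : Type*} [Fintype ι] {w : ι → ℝ} (z : ι → Plane)
    (h : ∑ i, w i = 1) : l.ev (∑ i, w i • z i) = ∑ i, w i * l.ev (z i) := by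
  have h0 : ∀ a : Fin 2, (∑ i, w i • z i) a = ∑ i, w i * z i a := fun a => by
    simp [WithLp.ofLp_sum, Finset.sum_apply]
  simp only [Line.ev, h0, mul_add, Finset.sum_add_distrib, ← Finset.sum_mul, h, one_mul]
  congr 1
  congr 1 <;> rw [Finset.mul_sum] <;> exact Finset.sum_congr rfl fun i _ => by ring

/-- `y` lies in the closure of the face of `z` in the arrangement of the lines `S`. -/
def InClosedFace (S : Set Line) (z y : Plane) : Prop :=
  ∀ l ∈ S, (l.ev z ≤ 0 → l.ev y ≤ 0) ∧ (0 ≤ l.ev z → 0 ≤ l.ev y)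

/-- The four sides of the square with centre at the origin and side length `2 K`. -/
def boxLines (K : ℝ) : Set Line := {(1, 0, -K), (1, 0, K), (0, 1, -K), (0, 1, K)}

theorem convex_closedFace (S : Set Line) (z : Plane) : Convex ℝ {y | InClosedFace S z y} := by
  intro y hy y' hy' a b ha hb hab l hl
  rw [l.ev_combo hab]
  refine ⟨fun h => ?_, fun h => ?_⟩
  · have h1 := (hy l hl).1 h
    have h2 := (hy' l hl).1 h
    nlinarith
  · have h1 := (hy l hl).2 h
    have h2 := (hy' l hl).2 h
    nlinarith

theorem isCompact_closedFace {S : Set Line} {K : ℝ} (hK : boxLines K ⊆ S) {z : Plane}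
    (hz : ∀ a, |z a| ≤ K) : IsCompact {y | InClosedFace S z y} := by
  refine Metric.isCompact_of_isClosed_isBounded ?_ ?_
  · have : {y | InClosedFace S z y} = ⋂ l ∈ S, ({y | l.ev z ≤ 0 → l.ev y ≤ 0} ∩
        {y | 0 ≤ l.ev z → 0 ≤ l.ev y}) := by
      ext y; simp [InClosedFace]
    rw [this]
    refine isClosed_biInter fun l _ => IsClosed.inter ?_ ?_
    · by_cases h : l.ev z ≤ 0
      · simpa [h] using isClosed_le l.continuous_ev continuous_const
      · simp [h]
    · by_cases h : 0 ≤ l.ev z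
      · simpa [h] using isClosed_le continuous_const l.continuous_ev
      · simp [h]
  · refine (Metric.isBounded_closedBall (x := (0 : Plane)) (r := 2 * K)).subset fun y hy => ?_
    have h0 := abs_le.1 (hz 0)
    have h1 := abs_le.1 (hz 1)
    have b1 := (hy (1, 0, -K) (hK (by simp [boxLines]))).1 (by simp [Line.ev]; linarith)
    have b2 := (hy (1, 0, K) (hK (by simp [boxLines]))).2 (by simp [Line.ev]; linarith)
    have b3 := (hy (0, 1, -K) (hK (by simp [boxLines]))).1 (by simp [Line.ev]; linarith)
    have b4 := (hy (0, 1, K) (hK (by simp [boxLines]))).2 (by simp [Line.ev]; linarith)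
    simp only [Line.ev] at b1 b2 b3 b4
    rw [Metric.mem_closedBall, dist_le_iff (by linarith)]
    simp only [PiLp.zero_apply, sub_zero]
    nlinarith

/-- An extreme point of a face lies on two nonparallel lines, as otherwise it could be moved in both
directions along the only line through it. -/
theorem extremePoints_closedFace {S : Set Line} (hS : S.Finite) (z : Plane) :
    {y | InClosedFace S z y}.extremePoints ℝ ⊆ {v | ∃ l ∈ S, ∃ l' ∈ S, v = l.meet l'} := by
  intro v hv
  rw [mem_extremePoints] at hv
  obtain ⟨hvF, hext⟩ := hv
  by_cases hpar : ∃ l ∈ S, ∃ l' ∈ S, l.ev v = 0 ∧ l'.ev v = 0 ∧ l.1 * l'.2.1 - l'.1 * l.2.1 ≠ 0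
  · obtain ⟨l, hl, l', hl', h1, h2, h3⟩ := hpar
    refine ⟨l, hl, l', hl', ?_⟩
    simp only [Line.ev] at h1 h2
    apply plane_ext
    · simp only [Line.meet, PiLp.toLp_apply, Matrix.cons_val_zero]
      rw [eq_div_iff h3]
      linear_combination l'.2.1 * h1 - l.2.1 * h2
    · simp only [Line.meet, PiLp.toLp_apply, Matrix.cons_val_one, Matrix.cons_val_fin_one]
      rw [eq_div_iff h3]
      linear_combination l.1 * h2 - l'.1 * h1
  · exfalso
    push Not at hpar
    obtain ⟨d, hd0, hd⟩ : ∃ d : Plane, d ≠ 0 ∧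
        ∀ l ∈ S, l.ev v = 0 → l.1 * d 0 + l.2.1 * d 1 = 0 := by
      by_cases h : ∃ l ∈ S, l.ev v = 0 ∧ (l.1 ≠ 0 ∨ l.2.1 ≠ 0)
      · obtain ⟨l, hl, hlv, hl0⟩ := h
        refine ⟨!₂[-l.2.1, l.1], fun h0 => ?_, fun l' hl' hlv' => ?_⟩
        · have e0 := congrArg (fun y : Plane => y 0) h0
          have e1 := congrArg (fun y : Plane => y 1) h0
          simp at e0 e1
          tauto
        · have := hpar l hl l' hl' hlv hlv'
          simp only [Matrix.cons_val_zero, Matrix.cons_val_one]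
          linear_combination this
      · push Not at h
        refine ⟨!₂[1, 0], fun h0 => ?_, fun l hl hlv => ?_⟩
        · have e0 := congrArg (fun y : Plane => y 0) h0
          simp at e0
        · have := h l hl hlv
          simp [this.1]
    have hnear : ∀ᶠ t : ℝ in nhds 0, InClosedFace S z (v + t • d) := by
      refine (hS.eventually_all (p := fun l t => (l.ev z ≤ 0 → l.ev (v + t • d) ≤ 0) ∧
        (0 ≤ l.ev z → 0 ≤ l.ev (v + t • d)))).2 fun l hl => ?_
      have hc : Continuous fun t : ℝ => l.ev (v + t • d) := l.continuous_ev.comp (by fun_prop)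
      have hc0 : Filter.Tendsto (fun t : ℝ => l.ev (v + t • d)) (nhds 0) (nhds (l.ev v)) := by
        simpa using hc.tendsto 0
      rcases lt_trichotomy (l.ev v) 0 with h | h | h
      · filter_upwards [hc0.eventually_lt_const h] with t ht
        exact ⟨fun _ => ht.le, fun h0 => absurd ((hvF l hl).2 h0) (by linarith)⟩
      · filter_upwards with t
        rw [l.ev_add_smul, hd l hl h, mul_zero, add_zero]
        exact hvF l hl
      · filter_upwards [hc0.eventually_const_lt h] with t ht
        exact ⟨fun h0 => absurd ((hvF l hl).1 h0) (by linarith), fun _ => ht.le⟩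
    obtain ⟨ε, hε, hball⟩ := Metric.eventually_nhds_iff.1 hnear
    have h1 : InClosedFace S z (v + (ε / 2) • d) := hball (by
      rw [Real.dist_eq, sub_zero, abs_of_pos (by linarith)]; linarith)
    have h2 : InClosedFace S z (v + (-(ε / 2)) • d) := hball (by
      rw [Real.dist_eq, sub_zero, abs_neg, abs_of_pos (by linarith)]; linarith)
    have := (hext _ h1 _ h2 ⟨1 / 2, 1 / 2, by norm_num, by norm_num, by norm_num, by
      apply plane_ext <;> simp <;> ring⟩).1
    rw [add_eq_left, smul_eq_zero] at this
    rcases this with h | h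
    · linarith
    · exact hd0 h

/-- Every face inside the box contains the centroid of three vertices: by the theorems of
Krein–Milman and Carathéodory each of its points is a convex combination with positive coefficients of
at most three vertices of the face, and on each line or side only the positivity of the coefficients matters. -/
theorem exists_sample {S : Set Line} (hS : S.Finite) {K : ℝ} (hK : boxLines K ⊆ S) {z : Plane}
    (hz : ∀ a, |z a| ≤ K) :
    ∃ v : Fin 3 → Plane, (∀ i, ∃ l ∈ S, ∃ l' ∈ S, v i = l.meet l') ∧
      ∀ l ∈ S, SignType.sign (l.ev ((1 / 3 : ℝ) • (v 0 + v 1 + v 2))) = SignType.sign (l.ev z) := by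
  set F := {y | InClosedFace S z y} with hF
  have hext := extremePoints_closedFace hS z
  have hfin : (F.extremePoints ℝ).Finite := by
    refine Set.Finite.subset ?_ hext
    refine ((hS.prod hS).image fun p : Line × Line => p.1.meet p.2).subset ?_
    rintro v ⟨l, hl, l', hl', rfl⟩
    exact ⟨(l, l'), ⟨hl, hl'⟩, rfl⟩
  have hzF : z ∈ convexHull ℝ (F.extremePoints ℝ) := by
    rw [← (hfin.isClosed_convexHull ℝ).closure_eq,
      closure_convexHull_extremePoints (isCompact_closedFace hK hz) (convex_closedFace S z)]
    exact fun l _ => ⟨id, id⟩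
  obtain ⟨ι, hι, v, w, hv, haff, hw, hw1, hwz⟩ := eq_pos_convex_span_of_mem_convexHull (𝕜 := ℝ) hzF
  have hcard : Fintype.card ι ≤ 3 := by
    refine haff.card_le_finrank_succ.trans ?_
    have := (vectorSpan ℝ (Set.range v)).finrank_le
    rw [finrank_euclideanSpace_fin] at this
    omega
  have hne : Nonempty ι := by
    by_contra hcon
    rw [not_nonempty_iff] at hcon
    simp at hw1
  obtain ⟨g⟩ := Function.Embedding.nonempty_of_card_le (α := ι) (β := Fin 3) (by simpa using hcard)
  set f := Function.invFun g with hf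
  have hfs : Function.Surjective f := Function.invFun_surjective g.injective
  have hvF : ∀ i, v i ∈ F := fun i => extremePoints_subset (hv ⟨i, rfl⟩)
  refine ⟨fun j => v (f j), fun j => hext (hv ⟨f j, rfl⟩), fun l hl => ?_⟩
  have hsum : l.ev ((1 / 3 : ℝ) • (v (f 0) + v (f 1) + v (f 2))) =
      ∑ j, (1 / 3 : ℝ) * l.ev (v (f j)) := by
    simp only [Fin.sum_univ_three, Line.ev, PiLp.add_apply, PiLp.smul_apply, smul_eq_mul]; ring
  have hz' : l.ev z = ∑ i, w i * l.ev (v i) := by rw [← hwz, l.ev_sum v hw1]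
  rw [hsum]
  rcases lt_trichotomy (l.ev z) 0 with h | h | h
  · have h1 : ∀ i, l.ev (v i) ≤ 0 := fun i => ((hvF i) l hl).1 h.le
    obtain ⟨i, hi⟩ : ∃ i, l.ev (v i) < 0 := by
      by_contra! hcon
      rw [hz'] at h
      exact absurd (Finset.sum_nonneg fun i _ => mul_nonneg (hw i).le (hcon i)) (by linarith)
    obtain ⟨j, rfl⟩ := hfs i
    rw [sign_neg h, sign_neg]
    exact Finset.sum_neg' (fun j _ => by linarith [h1 (f j)]) ⟨j, Finset.mem_univ _, by linarith⟩
  · have h1 : ∀ i, l.ev (v i) = 0 := fun i =>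
      le_antisymm (((hvF i) l hl).1 h.le) (((hvF i) l hl).2 h.ge)
    simp [h1, h]
  · have h1 : ∀ i, 0 ≤ l.ev (v i) := fun i => ((hvF i) l hl).2 h.le
    obtain ⟨i, hi⟩ : ∃ i, 0 < l.ev (v i) := by
      by_contra! hcon
      rw [hz'] at h
      exact absurd (Finset.sum_nonpos fun i _ => mul_nonpos_of_nonneg_of_nonpos (hw i).le (hcon i))
        (by linarith)
    obtain ⟨j, rfl⟩ := hfs i
    rw [sign_pos h, sign_pos]
    exact Finset.sum_pos' (fun j _ => by linarith [h1 (f j)]) ⟨j, Finset.mem_univ _, by linarith⟩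

/-! ### Enclosures as cuts in a finite network -/

/-- The line through two points. -/
def lineThrough (u v : Plane) : Line := (u 1 - v 1, v 0 - u 0, u 0 * v 1 - u 1 * v 0)

theorem ev_lineThrough (u v z : Plane) : (lineThrough u v).ev z = orient u v z := by
  simp only [lineThrough, Line.ev, orient]; ring

/-- The line through two points, and the lines through these points parallel to the axes. -/
def segmentLines (u v : Plane) : Set Line :=
  {lineThrough u v, (1, 0, -u 0), (1, 0, -v 0), (0, 1, -u 1), (0, 1, -v 1)}

theorem mem_segment_iff {u v z : Plane} : z ∈ segment ℝ u v ↔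
    orient u v z = 0 ∧ (z 0 - u 0) * (z 0 - v 0) ≤ 0 ∧ (z 1 - u 1) * (z 1 - v 1) ≤ 0 := by
  constructor
  · rintro ⟨a, b, ha, hb, hab, rfl⟩
    obtain rfl : a = 1 - b := by linarith
    simp only [orient, PiLp.add_apply, PiLp.smul_apply, smul_eq_mul]
    refine ⟨by ring, ?_, ?_⟩
    · have : ((1 - b) * u 0 + b * v 0 - u 0) * ((1 - b) * u 0 + b * v 0 - v 0) =
        -(b * (1 - b) * (u 0 - v 0) ^ 2) := by ring
      rw [this, neg_nonpos]; positivity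
    · have : ((1 - b) * u 1 + b * v 1 - u 1) * ((1 - b) * u 1 + b * v 1 - v 1) =
        -(b * (1 - b) * (u 1 - v 1) ^ 2) := by ring
      rw [this, neg_nonpos]; positivity
  · rintro ⟨h, h0, h1⟩
    have bd : ∀ {x a b : ℝ}, (x - a) * (x - b) ≤ 0 → a ≤ x ∧ x ≤ b ∨ b ≤ x ∧ x ≤ a := by
      intro x a b h
      rcases mul_nonpos_iff.1 h with h | h
      · left; constructor <;> linarith [h.1, h.2]
      · right; constructor <;> linarith [h.1, h.2]
    by_cases hne : u 0 = v 0
    · by_cases hne' : u 1 = v 1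
      · have : z = u := by
          apply plane_ext
          · rcases bd h0 with h | h <;> linarith [h.1, h.2]
          · rcases bd h1 with h | h <;> linarith [h.1, h.2]
        rw [this]; exact left_mem_segment ℝ u v
      · have hd : v 1 - u 1 ≠ 0 := fun h => hne' (by linarith)
        have hz : z = u + ((z 1 - u 1) / (v 1 - u 1)) • (v - u) := by
          apply plane_ext <;> simp only [PiLp.add_apply, PiLp.smul_apply, PiLp.sub_apply, smul_eq_mul]
          · rcases bd h0 with h | h <;> rw [← hne] at h <;> rw [← hne] <;> linarith [h.1, h.2]
          · field_simp; ring
        rw [hz]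
        apply mem_segment_of_lineMap
        · rcases bd h1 with h | h
          · exact div_nonneg (by linarith) (by linarith)
          · exact div_nonneg_of_nonpos (by linarith) (by linarith)
        · rcases bd h1 with h | h
          · rw [div_le_one (lt_of_le_of_ne (by linarith) hd.symm)]; linarith
          · rw [div_le_one_of_neg (lt_of_le_of_ne (by linarith) hd)]; linarith
    · have hd : v 0 - u 0 ≠ 0 := fun h => hne (by linarith)
      have hz : z = u + ((z 0 - u 0) / (v 0 - u 0)) • (v - u) := by
        apply plane_ext <;> simp only [PiLp.add_apply, PiLp.smul_apply, PiLp.sub_apply, smul_eq_mul] <;>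
          field_simp
        · ring
        · simp only [orient] at h; linear_combination h
      rw [hz]
      apply mem_segment_of_lineMap
      · rcases bd h0 with h | h
        · exact div_nonneg (by linarith) (by linarith)
        · exact div_nonneg_of_nonpos (by linarith) (by linarith)
      · rcases bd h0 with h | h
        · rw [div_le_one (lt_of_le_of_ne (by linarith) hd.symm)]; linarith
        · rw [div_le_one_of_neg (lt_of_le_of_ne (by linarith) hd)]; linarith

/-- A segment is a union of closed faces of every arrangement that contains its lines. -/
theorem segment_closed_under_faces {S : Set Line} {u v z y : Plane} (hS : segmentLines u v ⊆ S)
    (hz : z ∈ segment ℝ u v) (hy : InClosedFace S z y) : y ∈ segment ℝ u v := by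
  rw [mem_segment_iff] at hz ⊢
  have e := hy _ (hS (show lineThrough u v ∈ _ by simp [segmentLines]))
  have e1 := hy _ (hS (show (1, 0, -u 0) ∈ _ by simp [segmentLines]))
  have e2 := hy _ (hS (show (1, 0, -v 0) ∈ _ by simp [segmentLines]))
  have e3 := hy _ (hS (show (0, 1, -u 1) ∈ _ by simp [segmentLines]))
  have e4 := hy _ (hS (show (0, 1, -v 1) ∈ _ by simp [segmentLines]))
  rw [ev_lineThrough, ev_lineThrough] at e
  simp only [Line.ev, one_mul, zero_mul, add_zero, zero_add, ← sub_eq_add_neg] at e1 e2 e3 e4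
  obtain ⟨h, h0, h1⟩ := hz
  refine ⟨le_antisymm (e.1 h.le) (e.2 h.ge), ?_, ?_⟩
  · rcases mul_nonpos_iff.1 h0 with h | h
    · exact mul_nonpos_of_nonneg_of_nonpos (e1.2 h.1) (e2.1 h.2)
    · exact mul_nonpos_of_nonpos_of_nonneg (e1.1 h.1) (e2.2 h.2)
  · rcases mul_nonpos_iff.1 h1 with h | h
    · exact mul_nonpos_of_nonneg_of_nonpos (e3.2 h.1) (e4.1 h.2)
    · exact mul_nonpos_of_nonpos_of_nonneg (e3.1 h.1) (e4.2 h.2)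

/-- The face of `y` contains the face of `z` in its closure: `y` lies strictly on the same side as `z` of
each line that does not contain `z`. -/
def Refines (S : Set Line) (z y : Plane) : Prop :=
  ∀ l ∈ S, l.ev z = 0 ∨ SignType.sign (l.ev z) = SignType.sign (l.ev y)

/-- The two points lie in the same face. -/
def SameFace (S : Set Line) (z y : Plane) : Prop :=
  ∀ l ∈ S, SignType.sign (l.ev z) = SignType.sign (l.ev y)

theorem SameFace.symm {S : Set Line} {z y : Plane} (h : SameFace S z y) : SameFace S y z :=
  fun l hl => (h l hl).symm

theorem Refines.congr {S : Set Line} {z y z' y' : Plane} (h : Refines S z y) (hz : SameFace S z z')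
    (hy : SameFace S y y') : Refines S z' y' := by
  intro l hl
  rw [← sign_eq_zero_iff, ← hz l hl, ← hy l hl, sign_eq_zero_iff]
  exact h l hl

theorem inClosedFace_of_sign {S : Set Line} {z y : Plane} (h : SameFace S z y) :
    InClosedFace S z y := by
  intro l hl
  have := h l hl
  constructor <;> intro h0
  · rcases h0.lt_or_eq with h1 | h1
    · rw [sign_neg h1] at this; exact (sign_eq_neg_one_iff.1 this.symm).le
    · rw [h1, sign_zero] at this; exact (sign_eq_zero_iff.1 this.symm).le
  · rcases h0.lt_or_eq with h1 | h1
    · rw [sign_pos h1] at this; exact (sign_eq_one_iff.1 this.symm).le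
    · rw [← h1, sign_zero] at this; exact (sign_eq_zero_iff.1 this.symm).ge

theorem Refines.inClosedFace {S : Set Line} {z y t : Plane} (h : Refines S z y)
    (ht : t ∈ segment ℝ z y) : InClosedFace S t z := by
  obtain ⟨a, b, ha, hb, hab, rfl⟩ := ht
  intro l hl
  rw [l.ev_combo hab]
  rcases h l hl with h0 | h0
  · simp [h0]
  · rcases lt_trichotomy (l.ev z) 0 with h1 | h1 | h1
    · rw [sign_neg h1] at h0
      have h2 := sign_eq_neg_one_iff.1 h0.symm
      refine ⟨fun _ => h1.le, fun h3 => ?_⟩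
      exfalso
      rcases ha.eq_or_lt with rfl | ha
      · nlinarith
      · nlinarith
    · simp [h1]
    · rw [sign_pos h1] at h0
      have h2 := sign_eq_one_iff.1 h0.symm
      refine ⟨fun h3 => ?_, fun _ => h1.le⟩
      exfalso
      rcases ha.eq_or_lt with rfl | ha
      · nlinarith
      · nlinarith

theorem eventually_refines {S : Set Line} (hS : S.Finite) (y : Plane) :
    ∀ᶠ z in nhds y, Refines S y z := by
  refine (hS.eventually_all (p := fun l z => l.ev y = 0 ∨
    SignType.sign (l.ev y) = SignType.sign (l.ev z))).2 fun l hl => ?_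
  rcases lt_trichotomy (l.ev y) 0 with h | h | h
  · filter_upwards [(l.continuous_ev.tendsto y).eventually_lt_const h] with z hz
    right; rw [sign_neg h, sign_neg hz]
  · filter_upwards with z
    left; exact h
  · filter_upwards [(l.continuous_ev.tendsto y).eventually_const_lt h] with z hz
    right; rw [sign_pos h, sign_pos hz]

/-- The geometric data of the network: the lines `S`, finitely many points `pos q` (`q < n`), the first `m` of
which are to be enclosed, and connected unions `P a` (`a < k`) of closed faces inside
the square `[-M, M]²`. Every face in a larger square contains one of the points. -/
structure Network where
  m : ℕ
  k : ℕ
  n : ℕ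
  pos : ℕ → Plane
  S : Set Line
  P : ℕ → Set Plane
  M : ℝ
  K : ℝ
  hmn : m ≤ n
  finite : S.Finite
  connected : ∀ a < k, IsPreconnected (P a)
  faces : ∀ a < k, ∀ z ∈ P a, ∀ y, InClosedFace S z y → y ∈ P a
  hMK : M < K
  boxM : boxLines M ⊆ S
  inBox : ∀ a < k, ∀ z ∈ P a, ∀ i, |z i| ≤ M
  sample : ∀ z, (∀ i, |z i| ≤ K) → ∃ q < n, SameFace S (pos q) z
  avoid : ∀ j < m, ∀ a < k, pos j ∉ P a

namespace Network

variable (N : Network)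

/-- The face of the point `q` has the set `P a` in its closure. -/
def Touches (q a : ℕ) : Prop := ∃ q₀ < N.n, Refines N.S (N.pos q₀) (N.pos q) ∧ N.pos q₀ ∈ N.P a

/-- The point `q` lies in none of the sets `P a`. -/
def Free (q : ℕ) : Prop := ∀ a < N.k, N.pos q ∉ N.P a

/-- The point `q` lies outside of the square `[-M, M]²`. -/
def Outer (q : ℕ) : Prop := ∃ i, N.M < |N.pos q i|

/-- One of the faces of the two points lies in the closure of the other one and in none of the sets
`P a`. -/
def Linked (q q' : ℕ) : Prop :=
  (Refines N.S (N.pos q) (N.pos q') ∧ N.Free q) ∨ (Refines N.S (N.pos q') (N.pos q) ∧ N.Free q')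

/-- A side of a cut of the network, given by the entries `I a` and the exits `O a` of the sets `P a` and by the
points `ρ q` on this side.  Only the arcs from `I a` to `O a` may leave it. -/
structure IsCut (I O ρ : ℕ → Prop) : Prop where
  source : ∀ j < N.m, ρ j
  outer : ∀ q < N.n, N.Outer q → ¬ ρ q
  enter : ∀ q < N.n, ∀ a < N.k, N.Touches q a → ρ q → I a
  leave : ∀ q < N.n, ∀ a < N.k, N.Touches q a → O a → ρ q
  link : ∀ q < N.n, ∀ q' < N.n, N.Linked q q' → ρ q → ρ q'

variable {N}

theorem refines_refl (S : Set Line) (z : Plane) : Refines S z z := fun _ _ => Or.inr rfl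

theorem IsCut.step {I O ρ : ℕ → Prop} (h : N.IsCut I O ρ) {q g : ℕ} (hq : q < N.n) (hg : g < N.n)
    (hqC : ∀ a < N.k, I a → ¬ O a → N.pos q ∉ N.P a) (hr : Refines N.S (N.pos q) (N.pos g)) :
    ρ q ↔ ρ g := by
  by_cases hf : N.Free q
  · exact ⟨h.link q hq g hg (Or.inl ⟨hr, hf⟩), h.link g hg q hq (Or.inr ⟨hr, hf⟩)⟩
  · simp only [Free, not_forall, not_not] at hf
    obtain ⟨a, ha, hqa⟩ := hf
    have hgate : I a → O a := fun hI => by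
      by_contra hO
      exact hqC a ha hI hO hqa
    have tq : N.Touches q a := ⟨q, hq, refines_refl _ _, hqa⟩
    have tg : N.Touches g a := ⟨q, hq, hr, hqa⟩
    exact ⟨fun hρ => h.leave g hg a ha tg (hgate (h.enter q hq a ha tq hρ)),
      fun hρ => h.leave q hq a ha tq (hgate (h.enter g hg a ha tg hρ))⟩

/-- The sets that a cut separates from themselves enclose the points: off their union, whether the face of a point
is on the source side of the cut is locally constant. -/
theorem IsCut.encloses {I O ρ : ℕ → Prop} (h : N.IsCut I O ρ) {j : ℕ} (hj : j < N.m) :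
    IsEnclosedBy (N.pos j) (⋃ a ∈ {a | a < N.k ∧ I a ∧ ¬ O a}, N.P a) := by
  set U := ⋃ a ∈ {a | a < N.k ∧ I a ∧ ¬ O a}, N.P a with hU
  have memU : ∀ z, z ∈ U ↔ ∃ a < N.k, I a ∧ ¬ O a ∧ z ∈ N.P a := by
    intro z
    simp only [hU, Set.mem_iUnion, exists_prop]
    constructor
    · rintro ⟨a, ⟨h1, h2, h3⟩, h4⟩; exact ⟨a, h1, h2, h3, h4⟩
    · rintro ⟨a, h1, h2, h3, h4⟩; exact ⟨a, ⟨h1, h2, h3⟩, h4⟩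
  have hxU : N.pos j ∈ Uᶜ := fun hx => by
    obtain ⟨a, ha, -, -, hxa⟩ := (memU _).1 hx
    exact N.avoid j hj a ha hxa
  refine ⟨hxU, ?_⟩
  let R : Plane → Prop := fun z => ∃ q < N.n, SameFace N.S (N.pos q) z ∧ ρ q
  have face_U : ∀ {z y}, z ∉ U → SameFace N.S y z → ∀ a < N.k, I a → ¬ O a → y ∉ N.P a := by
    intro z y hz hyz a ha hI hO hy
    exact hz ((memU z).2 ⟨a, ha, hI, hO, N.faces a ha y hy z (inClosedFace_of_sign hyz)⟩)
  have hRbox : ∀ z, R z → ∀ i, |z i| ≤ N.M := by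
    rintro z ⟨q, hq, hqz, hρ⟩ i
    have hnot : ∀ i, |N.pos q i| ≤ N.M := by
      by_contra! hcon
      exact h.outer q hq hcon hρ
    have hcl := inClosedFace_of_sign hqz
    have b1 := (hcl (1, 0, -N.M) (N.boxM (by simp [boxLines]))).1
    have b2 := (hcl (1, 0, N.M) (N.boxM (by simp [boxLines]))).2
    have b3 := (hcl (0, 1, -N.M) (N.boxM (by simp [boxLines]))).1
    have b4 := (hcl (0, 1, N.M) (N.boxM (by simp [boxLines]))).2
    simp only [Line.ev, one_mul, zero_mul, add_zero, zero_add] at b1 b2 b3 b4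
    have n0 := abs_le.1 (hnot 0)
    have n1 := abs_le.1 (hnot 1)
    have c0 : |z 0| ≤ N.M := abs_le.2 ⟨by linarith [b2 (by linarith)], by linarith [b1 (by linarith)]⟩
    have c1 : |z 1| ≤ N.M := abs_le.2 ⟨by linarith [b4 (by linarith)], by linarith [b3 (by linarith)]⟩
    fin_cases i <;> assumption
  have hR : ∀ z, z ∉ U → ∀ q < N.n, SameFace N.S (N.pos q) z → (R z ↔ ρ q) := by
    intro z hz q hq hqz
    constructor
    · rintro ⟨q', hq', hq'z, hρ⟩
      have hr : Refines N.S (N.pos q') (N.pos q) :=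
        (refines_refl N.S z).congr hq'z.symm hqz.symm
      exact (h.step hq' hq (face_U hz hq'z) hr).1 hρ
    · exact fun hρ => ⟨q, hq, hqz, hρ⟩
  have hloc : ∀ y ∈ connectedComponentIn Uᶜ (N.pos j),
      ∀ᶠ z in nhdsWithin y (connectedComponentIn Uᶜ (N.pos j)), (R y ↔ R z) := by
    intro y hy
    have hyU : y ∉ U := connectedComponentIn_subset _ _ hy
    by_cases hyK : ∀ i, |y i| < N.K
    · have hK : ∀ᶠ z : Plane in nhds y, ∀ i, |z i| < N.K := by
        rw [Filter.eventually_all]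
        intro i
        have hc : Continuous fun z : Plane => |z i| := by fun_prop
        exact (hc.tendsto y).eventually_lt_const (hyK i)
      filter_upwards [self_mem_nhdsWithin, nhdsWithin_le_nhds hK,
        nhdsWithin_le_nhds (eventually_refines N.finite y)] with z hz hzK hyz
      have hzU : z ∉ U := connectedComponentIn_subset _ _ hz
      obtain ⟨q, hq, hqy⟩ := N.sample y fun i => (hyK i).le
      obtain ⟨g, hg, hgz⟩ := N.sample z fun i => (hzK i).le
      rw [hR y hyU q hq hqy, hR z hzU g hg hgz]
      exact h.step hq hg (face_U hyU hqy) (hyz.congr hqy.symm hgz.symm)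
    · push Not at hyK
      obtain ⟨i, hi⟩ := hyK
      have hc : Continuous fun z : Plane => |z i| := by fun_prop
      have hM : ∀ᶠ z : Plane in nhds y, N.M < |z i| :=
        (hc.tendsto y).eventually_const_lt (N.hMK.trans_le hi)
      filter_upwards [nhdsWithin_le_nhds hM] with z hz
      refine iff_of_false (fun hRy => ?_) fun hRz => ?_
      · exact absurd (hRbox y hRy i) (not_le.2 (N.hMK.trans_le hi))
      · exact absurd (hRbox z hRz i) (not_le.2 hz)
  have hall : ∀ z ∈ connectedComponentIn Uᶜ (N.pos j), R z := by
    intro z hz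
    have := isPreconnected_connectedComponentIn.induction₂ (fun y z => R y ↔ R z) hloc
      (fun x y z _ _ _ => Iff.trans) (fun x y _ _ => Iff.symm) (mem_connectedComponentIn hxU) hz
    exact this.1 ⟨j, hj.trans_le N.hmn, fun _ _ => rfl, h.source j hj⟩
  refine (Metric.isBounded_closedBall (x := (0 : Plane)) (r := 2 * |N.M|)).subset fun z hz => ?_
  have h0 := hRbox z (hall z hz) 0
  have h1 := hRbox z (hall z hz) 1
  have hM0 : 0 ≤ N.M := (abs_nonneg _).trans h0
  rw [abs_of_nonneg hM0, Metric.mem_closedBall, dist_le_iff (by linarith)]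
  simp only [PiLp.zero_apply, sub_zero]
  have := sq_le_sq' (by linarith [(abs_le.1 h0).1]) (abs_le.1 h0).2
  have := sq_le_sq' (by linarith [(abs_le.1 h1).1]) (abs_le.1 h1).2
  nlinarith

/-- A point outside the square can escape from all sets inside the square. -/
theorem not_enclosed_of_outer {U : Set Plane} {M : ℝ} (hU : ∀ z ∈ U, ∀ i, |z i| ≤ M) {y : Plane} {i : Fin 2}
    (hy : M < |y i|) : ¬ Bornology.IsBounded (connectedComponentIn Uᶜ y) := by
  intro hb
  set e : Plane := EuclideanSpace.single i (y i) with he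
  let T : Set Plane := (fun t : ℝ => y + t • e) '' Set.Ici 0
  have hT : IsPreconnected T := isPreconnected_Ici.image _ (by fun_prop)
  have hTi : ∀ t : ℝ, (y + t • e) i = (1 + t) * y i := fun t => by simp [he]; ring
  have hTU : T ⊆ Uᶜ := by
    rintro z ⟨t, ht, rfl⟩ hz
    have h1 := hU _ hz i
    rw [hTi, abs_mul, abs_of_pos (by linarith [Set.mem_Ici.1 ht])] at h1
    have := Set.mem_Ici.1 ht
    nlinarith [abs_nonneg (y i)]
  have hyT : y ∈ T := ⟨0, Set.mem_Ici.2 le_rfl, by simp⟩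
  have hTb := hb.subset (hT.subset_connectedComponentIn hyT hTU)
  obtain ⟨ρ, hρ⟩ := hTb.subset_closedBall y
  have hyi : 0 < |y i| := by
    rcases (abs_nonneg (y i)).eq_or_lt with h0 | h0
    · have hM : M < 0 := by rw [← h0] at hy; exact hy
      -- if `y i = 0`, then `M < 0` and `U` is empty
      have hUe : U = ∅ := Set.eq_empty_of_forall_notMem fun z hz =>
        absurd ((abs_nonneg _).trans (hU z hz i)) (by linarith)
      rw [hUe, Set.compl_empty, connectedComponentIn_univ, PreconnectedSpace.connectedComponent_eq_univ] at hb
      exact absurd hb (NormedSpace.unbounded_univ ℝ Plane)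
    · exact h0
  have hmem : y + ((|ρ| + 1) / |y i|) • e ∈ T := ⟨_, Set.mem_Ici.2 (by positivity), rfl⟩
  have := hρ hmem
  rw [Metric.mem_closedBall, dist_eq_norm, add_sub_cancel_left, norm_smul, he,
    PiLp.norm_single, Real.norm_eq_abs, Real.norm_eq_abs, abs_of_pos (by positivity),
    div_mul_cancel₀ _ hyi.ne'] at this
  linarith [le_abs_self ρ]

/-- If some of the sets enclose the points, then those sets that meet one of them can be cut: on the
source side are the points in the components of the given points. -/
theorem exists_isCut {C : Set ℕ} (hC : ∀ a ∈ C, a < N.k)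
    (henc : ∀ j < N.m, IsEnclosedBy (N.pos j) (⋃ a ∈ C, N.P a)) :
    ∃ I O ρ : ℕ → Prop, N.IsCut I O ρ ∧
      ∀ a < N.k, I a → ¬ O a → ∃ a' ∈ C, (N.P a ∩ N.P a').Nonempty := by
  set U := ⋃ a ∈ C, N.P a with hU
  have memU : ∀ z, z ∈ U ↔ ∃ a ∈ C, z ∈ N.P a := by simp [hU]
  let Vis : Plane → Prop := fun z => ∃ j < N.m, z ∈ connectedComponentIn Uᶜ (N.pos j)
  have vis_of : ∀ T : Set Plane, IsPreconnected T → T ⊆ Uᶜ → ∀ z ∈ T, ∀ z' ∈ T, Vis z → Vis z' := by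
    rintro T hT hTU z hz z' hz' ⟨j, hj, hzj⟩
    refine ⟨j, hj, ?_⟩
    rw [connectedComponentIn_eq hzj]
    exact hT.subset_connectedComponentIn hz hTU hz'
  let Near : ℕ → Prop := fun a => ∃ a' ∈ C, (N.P a ∩ N.P a').Nonempty
  have seg : ∀ q₀ q, Refines N.S (N.pos q₀) (N.pos q) → N.pos q₀ ∉ U →
      segment ℝ (N.pos q₀) (N.pos q) ⊆ Uᶜ := by
    intro q₀ q hr hq z hz hzU
    obtain ⟨a, ha, hza⟩ := (memU z).1 hzU
    exact hq ((memU _).2 ⟨a, ha, N.faces a (hC a ha) z hza _ (hr.inClosedFace hz)⟩)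
  have touch : ∀ q a, ¬ Near a → N.Touches q a → ∃ q₀, N.pos q₀ ∈ N.P a ∧
      segment ℝ (N.pos q₀) (N.pos q) ⊆ Uᶜ := by
    rintro q a ha ⟨q₀, -, hr, hq₀⟩
    refine ⟨q₀, hq₀, seg q₀ q hr fun hU' => ?_⟩
    obtain ⟨a', ha', hqa'⟩ := (memU _).1 hU'
    exact ha ⟨a', ha', _, hq₀, hqa'⟩
  have free_U : ∀ q, N.Free q → N.pos q ∉ U := by
    intro q hq hqU
    obtain ⟨a, ha, hqa⟩ := (memU _).1 hqU
    exact hq a (hC a ha) hqa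
  refine ⟨fun a => Near a ∨ ∃ z ∈ N.P a, Vis z, fun a => ¬ Near a ∧ ∃ z ∈ N.P a, Vis z,
    fun q => Vis (N.pos q), ⟨?_, ?_, ?_, ?_, ?_⟩, ?_⟩
  · exact fun j hj => ⟨j, hj, mem_connectedComponentIn (henc j hj).1⟩
  · rintro q hq ⟨i, hi⟩ ⟨j, hj, hqj⟩
    refine not_enclosed_of_outer (U := U) (M := N.M) (fun z hz => ?_) hi ?_
    · obtain ⟨a, ha, hza⟩ := (memU z).1 hz
      exact N.inBox a (hC a ha) z hza
    · rw [← connectedComponentIn_eq hqj]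
      exact (henc j hj).2
  · intro q hq a ha ht hv
    by_cases hn : Near a
    · exact Or.inl hn
    · right
      obtain ⟨q₀, hq₀, hs⟩ := touch q a hn ht
      exact ⟨_, hq₀, vis_of _ (convex_segment _ _).isPreconnected hs _ (right_mem_segment ℝ _ _) _
        (left_mem_segment ℝ _ _) hv⟩
  · rintro q hq a ha ht ⟨hn, z, hza, hv⟩
    obtain ⟨q₀, hq₀, hs⟩ := touch q a hn ht
    have hPU : N.P a ⊆ Uᶜ := fun y hy hyU => by
      obtain ⟨a', ha', hya'⟩ := (memU y).1 hyU
      exact hn ⟨a', ha', y, hy, hya'⟩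
    have hv₀ := vis_of _ (N.connected a ha) hPU z hza _ hq₀ hv
    exact vis_of _ (convex_segment _ _).isPreconnected hs _ (left_mem_segment ℝ _ _) _
        (right_mem_segment ℝ _ _) hv₀
  · rintro q hq q' hq' (⟨hr, hf⟩ | ⟨hr, hf⟩) hv
    · exact vis_of _ (convex_segment _ _).isPreconnected (seg q q' hr (free_U q hf)) _
        (left_mem_segment ℝ _ _) _ (right_mem_segment ℝ _ _) hv
    · exact vis_of _ (convex_segment _ _).isPreconnected (seg q' q hr (free_U q' hf)) _
        (right_mem_segment ℝ _ _) _ (left_mem_segment ℝ _ _) hv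
  · intro a ha hI hO
    by_contra hn
    exact hO ⟨hn, hI.resolve_left hn⟩

end Network

/-! ### Representative paths -/

theorem pair_index {i j n₁ n₂ : ℕ} (hi : i < n₁) (hj : j < n₂) :
    i * n₂ + j < n₁ * n₂ ∧ (i * n₂ + j) / n₂ = i ∧ (i * n₂ + j) % n₂ = j := by
  refine ⟨?_, ?_, ?_⟩
  · calc i * n₂ + j < i * n₂ + n₂ := by omega
      _ = (i + 1) * n₂ := by ring
      _ ≤ n₁ * n₂ := Nat.mul_le_mul_right _ hi
  · rw [add_comm, Nat.add_mul_div_right _ _ (by omega), Nat.div_eq_of_lt hj, zero_add]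
  · rw [add_comm, Nat.add_mul_mod_self_right, Nat.mod_eq_of_lt hj]

theorem div_lt_and_mod_lt {d n₁ n₂ : ℕ} (h : d < n₁ * n₂) : d / n₂ < n₁ ∧ d % n₂ < n₂ :=
  ⟨Nat.div_lt_of_lt_mul (by rwa [mul_comm]), Nat.mod_lt _ (Nat.pos_of_ne_zero (by
    rintro rfl; simp at h))⟩

/-- The value of an accumulator after `n` steps of a loop. -/
def fold (F : ℕ → ℕ → ℕ) (c : ℕ) : ℕ → ℕ
  | 0 => c
  | n + 1 => F n (fold F c n)

/-- The number `a` if `p` holds and `b` otherwise. -/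
def ifElse (p : Prop) (a b : ℕ) : ℕ := open Classical in if p then a else b

theorem ifElse_pos {p : Prop} {a b : ℕ} (h : p) : ifElse p a b = a := if_pos h

theorem ifElse_neg {p : Prop} {a b : ℕ} (h : ¬ p) : ifElse p a b = b := if_neg h

/-- One plus the first index `e < n` with the property `p` at which `f` is smallest, or `0` if there is none. -/
def argMin (p : ℕ → Prop) (f : ℕ → ℤ) : ℕ → ℕ :=
  fold (fun e acc => ifElse (p e ∧ (acc = 0 ∨ f e < f (acc - 1))) (e + 1) acc) 0

theorem argMin_spec (p : ℕ → Prop) (f : ℕ → ℤ) (n : ℕ) :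
    (argMin p f n = 0 → ∀ e < n, ¬ p e) ∧ (argMin p f n ≠ 0 → argMin p f n - 1 < n ∧
      p (argMin p f n - 1) ∧ ∀ e < n, p e → f (argMin p f n - 1) ≤ f e) := by
  induction n with
  | zero => simp [argMin, fold]
  | succ n ih =>
    have hs : argMin p f (n + 1) = ifElse (p n ∧ (argMin p f n = 0 ∨ f n < f (argMin p f n - 1)))
      (n + 1) (argMin p f n) := rfl
    rw [hs]
    by_cases h : p n ∧ (argMin p f n = 0 ∨ f n < f (argMin p f n - 1))
    · rw [ifElse_pos h]
      refine ⟨by simp, fun _ => ⟨by simp, by simpa using h.1, fun e he hpe => ?_⟩⟩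
      rcases Nat.lt_succ_iff_lt_or_eq.1 he with he | rfl
      · rcases h.2 with h2 | h2
        · exact absurd hpe (ih.1 h2 e he)
        · by_cases h0 : argMin p f n = 0
          · exact absurd hpe (ih.1 h0 e he)
          · simpa using h2.le.trans ((ih.2 h0).2.2 e he hpe)
      · simp
    · rw [ifElse_neg h]
      refine ⟨fun h0 e he hpe => ?_, fun h0 => ⟨by have := (ih.2 h0).1; omega, (ih.2 h0).2.1,
        fun e he hpe => ?_⟩⟩
      · rcases Nat.lt_succ_iff_lt_or_eq.1 he with he | rfl
        · exact ih.1 h0 e he hpe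
        · exact h ⟨hpe, Or.inl h0⟩
      · rcases Nat.lt_succ_iff_lt_or_eq.1 he with he | rfl
        · exact (ih.2 h0).2.2 e he hpe
        · by_contra hlt
          exact h ⟨hpe, Or.inr (not_le.1 hlt)⟩

/-- The data of an instance that are accessible to the algorithm. Points and obstacles are
numbered from `0`; `con i j` says that obstacle `i` contains point `j`, and `int i j` that the obstacles
`i` and `j` intersect.  The parameter `δ` is the mesh size of the net of centres. -/
structure Inst where
  m : ℕ
  k : ℕ
  pt : ℕ → Plane
  ctr : ℕ → Plane
  wit : ℕ → ℕ → Plane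
  con : ℕ → ℕ → Prop
  int : ℕ → ℕ → Prop
  δ : ℝ

namespace Inst

variable (D : Inst)

/-- Obstacles that contain one of the points are useless. -/
def Bad (i : ℕ) : Prop := ∃ j < D.m, D.con i j

/-- The centres of the two obstacles have distance at most `δ`. -/
def Near (i j : ℕ) : Prop :=
  (D.ctr i 0 - D.ctr j 0) ^ 2 + (D.ctr i 1 - D.ctr j 1) ^ 2 ≤ D.δ ^ 2

/-- The centre is close to one of the net points chosen before it.  The net is chosen greedily, and consists of the
centres that are not covered in this sense. -/
def Cov (i : ℕ) : Prop := ∃ j, ∃ _ : j < i, ¬ Cov j ∧ D.Near i j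
termination_by i

/-- The pair of obstacles with index `e` can be used for a path between the two net points with
index `d`.  The index of a pair `(i, j)` is `i * k + j`. -/
def Rel (d e : ℕ) : Prop :=
  (¬ D.Cov (d / D.k) ∧ ¬ D.Cov (d % D.k)) ∧ (D.Near (e / D.k) (d / D.k) ∧
    D.Near (e % D.k) (d % D.k)) ∧ (¬ D.Bad (e / D.k) ∧ ¬ D.Bad (e % D.k)) ∧ D.int (e / D.k) (e % D.k)

/-- The path between the pair `d` of net points through the common point of the pair `e` of obstacles
sweeps a positive angle around the point `j`. -/
def Sw (d e j : ℕ) : Prop :=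
  SweepsPos (D.pt j) (D.ctr (d / D.k)) (D.wit (e / D.k) (e % D.k)) (D.ctr (d % D.k))

/-- The number of points around which the path sweeps a positive angle. -/
def cnt (d e : ℕ) : ℕ := ∑ j ∈ Finset.range D.m, bit (D.Sw d e j)

/-- One plus the index of a pair of obstacles that gives the smallest count, or `0`. -/
def lo (d : ℕ) : ℕ := argMin (D.Rel d) (fun e => (D.cnt d e : ℤ)) (D.k * D.k)

/-- One plus the index of a pair of obstacles that gives the largest count, or `0`. -/
def hi (d : ℕ) : ℕ := argMin (D.Rel d) (fun e => -(D.cnt d e : ℤ)) (D.k * D.k)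

/-- The two segments that connect the pair `d` of net points through the common point of the pair `e`
of obstacles. -/
def path (d e : ℕ) : Set Plane :=
  segment ℝ (D.ctr (d / D.k)) (D.wit (e / D.k) (e % D.k)) ∪
    segment ℝ (D.wit (e / D.k) (e % D.k)) (D.ctr (d % D.k))

/-- The chosen paths that start at the net point `a`. -/
def star (a : ℕ) : Set Plane :=
  ⋃ d ∈ {d | d < D.k * D.k ∧ d / D.k = a ∧ D.lo d ≠ 0}, D.path d (D.lo d - 1) ∪ D.path d (D.hi d - 1)

variable {D}

theorem mem_star {a : ℕ} {z : Plane} : z ∈ D.star a ↔ ∃ d < D.k * D.k, d / D.k = a ∧ D.lo d ≠ 0 ∧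
    (z ∈ D.path d (D.lo d - 1) ∨ z ∈ D.path d (D.hi d - 1)) := by
  simp only [star, Set.mem_iUnion, Set.mem_ofPred_eq, Set.mem_union, exists_prop, and_assoc]

theorem near_iff (hδ : 0 < D.δ) {i j : ℕ} : D.Near i j ↔ dist (D.ctr i) (D.ctr j) ≤ D.δ := by
  rw [dist_le_iff hδ.le]; rfl

theorem exists_near (D : Inst) (i : ℕ) : ∃ a ≤ i, ¬ D.Cov a ∧ D.Near i a := by
  by_cases h : D.Cov i
  · have h' := h
    rw [Cov] at h'
    obtain ⟨j, hj, h1, h2⟩ := h'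
    exact ⟨j, hj.le, h1, h2⟩
  · exact ⟨i, le_rfl, h, by simp only [Near, sub_self]; nlinarith [sq_nonneg D.δ]⟩

theorem separated (hδ : 0 < D.δ) {a b : ℕ} (ha : ¬ D.Cov a) (hb : ¬ D.Cov b) (hab : a ≠ b) :
    D.δ < dist (D.ctr a) (D.ctr b) := by
  by_contra hcon
  rw [not_lt] at hcon
  rcases lt_or_gt_of_ne hab with h | h
  · apply hb; rw [Cov]
    exact ⟨a, h, ha, (near_iff hδ).2 (by rwa [dist_comm])⟩
  · apply ha; rw [Cov]
    exact ⟨b, h, hb, (near_iff hδ).2 hcon⟩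

theorem hi_ne_zero {d : ℕ} (h : D.lo d ≠ 0) : D.hi d ≠ 0 := fun h0 =>
  ((argMin_spec _ _ _).1 h0) _ ((argMin_spec _ _ _).2 h).1 ((argMin_spec _ _ _).2 h).2.1

theorem lo_ne_zero {d e : ℕ} (he : e < D.k * D.k) (h : D.Rel d e) : D.lo d ≠ 0 := fun h0 =>
  ((argMin_spec _ _ _).1 h0) e he h

/-- Both chosen pairs of obstacles can be used. -/
theorem rel_of_chosen {d e : ℕ} (h : D.lo d ≠ 0) (he : e = D.lo d - 1 ∨ e = D.hi d - 1) :
    e < D.k * D.k ∧ D.Rel d e := by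
  rcases he with rfl | rfl
  · exact ⟨((argMin_spec _ _ _).2 h).1, ((argMin_spec _ _ _).2 h).2.1⟩
  · exact ⟨((argMin_spec _ _ _).2 (hi_ne_zero h)).1, ((argMin_spec _ _ _).2 (hi_ne_zero h)).2.1⟩

variable (D) in
/-- The obstacles `obs i` (`i < k`) of the instance have all the properties that the algorithm relies on. -/
structure Valid (obs : ℕ → Set Plane) (r R : ℝ) : Prop where
  δ_pos : 0 < D.δ
  δ_lt : D.δ < r
  compact : ∀ i < D.k, IsCompact (obs i)
  convex : ∀ i < D.k, Convex ℝ (obs i)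
  sandwiched : ∀ i < D.k, IsSandwiched r R (obs i) (D.ctr i)
  nonCrossing : ∀ i < D.k, ∀ j < D.k, NonCrossing (obs i) (obs j)
  con_iff : ∀ i < D.k, ∀ j < D.m, D.con i j ↔ D.pt j ∈ obs i
  int_iff : ∀ i < D.k, ∀ j < D.k, D.int i j ↔ (obs i ∩ obs j).Nonempty
  wit_mem : ∀ i < D.k, ∀ j < D.k, D.int i j → D.wit i j ∈ obs i ∩ obs j

variable {obs : ℕ → Set Plane} {r R : ℝ}

theorem Valid.mem_interior (V : D.Valid obs r R) {i a : ℕ} (hi : i < D.k) (h : D.Near i a) :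
    D.ctr a ∈ interior (obs i) := by
  refine interior_mono (V.sandwiched i hi).1 ?_
  refine Metric.ball_subset_interior_closedBall ?_
  rw [Metric.mem_ball, dist_comm]
  exact ((near_iff V.δ_pos).1 h).trans_lt V.δ_lt

theorem Valid.not_mem (V : D.Valid obs r R) {i j : ℕ} (hi : i < D.k) (hj : j < D.m) (h : ¬ D.Bad i) :
    D.pt j ∉ obs i := fun hm => h ⟨j, hj, (V.con_iff i hi j hj).2 hm⟩

/-- The sets of points around which the paths sweep positive angles form a chain, and are hence ordered by their
sizes. -/
theorem Valid.cnt_lt (V : D.Valid obs r R) {d e e' j : ℕ} (he : e < D.k * D.k)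
    (he' : e' < D.k * D.k) (h : D.Rel d e) (h' : D.Rel d e') (hj : j < D.m) (h1 : D.Sw d e j)
    (h2 : ¬ D.Sw d e' j) : D.cnt d e' < D.cnt d e := by
  obtain ⟨hA, hB⟩ := div_lt_and_mod_lt he
  obtain ⟨hA', hB'⟩ := div_lt_and_mod_lt he'
  have hx : ∀ j < D.m, D.pt j ∉ obs (e / D.k) ∪ obs (e % D.k) ∪ (obs (e' / D.k) ∪ obs (e' % D.k)) := by
    rintro j hj ((hm | hm) | (hm | hm))
    · exact V.not_mem hA hj h.2.2.1.1 hm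
    · exact V.not_mem hB hj h.2.2.1.2 hm
    · exact V.not_mem hA' hj h'.2.2.1.1 hm
    · exact V.not_mem hB' hj h'.2.2.1.2 hm
  have key : ∀ j' < D.m, D.Sw d e' j' → D.Sw d e j' := fun j' hj' h3 =>
    sweepsPos_chain (V.convex _ hA) (V.convex _ hB) (V.convex _ hA') (V.convex _ hB')
      (V.nonCrossing _ hA _ hB') (V.nonCrossing _ hA' _ hB) (V.mem_interior hA h.2.1.1)
      (V.mem_interior hA' h'.2.1.1) (V.mem_interior hB h.2.1.2) (V.mem_interior hB' h'.2.1.2)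
      (V.wit_mem _ hA _ hB h.2.2.2) (V.wit_mem _ hA' _ hB' h'.2.2.2) (hx j hj) (hx j' hj') h1 h2 h3
  refine Finset.sum_lt_sum (fun i hi => ?_) ⟨j, Finset.mem_range.2 hj, ?_⟩
  · unfold bit
    split_ifs with h4 h5
    · exact le_rfl
    · exact absurd (key i (Finset.mem_range.1 hi) h4) h5
    · exact zero_le_one
    · exact le_rfl
  · rw [bit, bit, if_neg h2, if_pos h1]; exact zero_lt_one

/-- Around each of the points one of the two chosen paths sweeps in the same direction as a given one. -/
theorem Valid.exists_chosen (V : D.Valid obs r R) {d e j : ℕ} (he : e < D.k * D.k)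
    (h : D.Rel d e) (hj : j < D.m) :
    ∃ e', (e' = D.lo d - 1 ∨ e' = D.hi d - 1) ∧ (D.Sw d e j ↔ D.Sw d e' j) := by
  have h0 := lo_ne_zero he h
  by_cases hs : D.Sw d e j
  · refine ⟨_, Or.inr rfl, iff_of_true hs ?_⟩
    by_contra hn
    obtain ⟨a, b⟩ := rel_of_chosen h0 (Or.inr rfl)
    have h1 := V.cnt_lt he a h b hj hs hn
    have h2 := ((argMin_spec (D.Rel d) (fun e => -(D.cnt d e : ℤ)) (D.k * D.k)).2
      (hi_ne_zero h0)).2.2 e he h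
    simp only [neg_le_neg_iff, Nat.cast_le] at h2
    exact absurd h2 (not_le.2 h1)
  · refine ⟨_, Or.inl rfl, iff_of_false hs fun hn => ?_⟩
    obtain ⟨a, b⟩ := rel_of_chosen h0 (Or.inl rfl)
    have h1 := V.cnt_lt a he b h hj hn hs
    have h2 := ((argMin_spec (D.Rel d) (fun e => (D.cnt d e : ℤ)) (D.k * D.k)).2 h0).2.2 e he h
    simp only [Nat.cast_le] at h2
    exact absurd h2 (not_le.2 h1)

theorem Valid.path_subset (V : D.Valid obs r R) {d e : ℕ} (he : e < D.k * D.k) (h : D.Rel d e) :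
    D.path d e ⊆ obs (e / D.k) ∪ obs (e % D.k) := by
  obtain ⟨hA, hB⟩ := div_lt_and_mod_lt he
  have hw := V.wit_mem _ hA _ hB h.2.2.2
  exact Set.union_subset_union
    ((V.convex _ hA).segment_subset (interior_subset (V.mem_interior hA h.2.1.1)) hw.1)
    ((V.convex _ hB).segment_subset hw.2 (interior_subset (V.mem_interior hB h.2.1.2)))

theorem mem_star_cases {a : ℕ} {z : Plane} (hz : z ∈ D.star a) : ∃ d < D.k * D.k, d / D.k = a ∧
    D.lo d ≠ 0 ∧ ∃ e, (e = D.lo d - 1 ∨ e = D.hi d - 1) ∧ e < D.k * D.k ∧ D.Rel d e ∧ z ∈ D.path d e := by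
  obtain ⟨d, hd, hda, h0, h⟩ := mem_star.1 hz
  rcases h with h | h
  · exact ⟨d, hd, hda, h0, _, Or.inl rfl, (rel_of_chosen h0 (Or.inl rfl)).1,
      (rel_of_chosen h0 (Or.inl rfl)).2, h⟩
  · exact ⟨d, hd, hda, h0, _, Or.inr rfl, (rel_of_chosen h0 (Or.inr rfl)).1,
      (rel_of_chosen h0 (Or.inr rfl)).2, h⟩

theorem mem_star_of {a d e : ℕ} {z : Plane} (hd : d < D.k * D.k) (hda : d / D.k = a) (h0 : D.lo d ≠ 0)
    (he : e = D.lo d - 1 ∨ e = D.hi d - 1) (hz : z ∈ D.path d e) : z ∈ D.star a :=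
  mem_star.2 ⟨d, hd, hda, h0, by rcases he with rfl | rfl; exacts [Or.inl hz, Or.inr hz]⟩

theorem Valid.pt_not_mem_star (V : D.Valid obs r R) {a j : ℕ} (hj : j < D.m) : D.pt j ∉ D.star a := by
  intro h
  obtain ⟨d, -, -, -, e, -, he, hr, hz⟩ := mem_star_cases h
  obtain ⟨hA, hB⟩ := div_lt_and_mod_lt he
  rcases V.path_subset he hr hz with h | h
  · exact V.not_mem hA hj hr.2.2.1.1 h
  · exact V.not_mem hB hj hr.2.2.1.2 h

theorem isCompact_path (d e : ℕ) : IsCompact (D.path d e) :=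
  (isCompact_segment _ _).union (isCompact_segment _ _)
where
  isCompact_segment (x y : Plane) : IsCompact (segment ℝ x y) := by
    rw [segment_eq_image_lineMap]
    exact isCompact_Icc.image (by fun_prop)

theorem isCompact_star (a : ℕ) : IsCompact (D.star a) := by
  refine Set.Finite.isCompact_biUnion ?_ fun d _ => (isCompact_path _ _).union (isCompact_path _ _)
  exact (Set.finite_Iio (D.k * D.k)).subset fun d hd => hd.1

theorem isPreconnected_path (d e : ℕ) : IsPreconnected (D.path d e) :=
  (convex_segment _ _).isPreconnected.union _ (right_mem_segment ℝ _ _) (left_mem_segment ℝ _ _)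
    (convex_segment _ _).isPreconnected

theorem isPreconnected_star (a : ℕ) : IsPreconnected (D.star a) := by
  have h : ∀ d e, D.ctr (d / D.k) ∈ D.path d e := fun d e => Or.inl (left_mem_segment ℝ _ _)
  rw [star, Set.biUnion_eq_iUnion]
  refine isPreconnected_iUnion (s := fun d : {d | d < D.k * D.k ∧ d / D.k = a ∧ D.lo d ≠ 0} =>
    D.path d (D.lo d - 1) ∪ D.path d (D.hi d - 1)) ⟨D.ctr a, ?_⟩ fun d => ?_
  · rw [Set.mem_iInter]
    rintro ⟨d, -, rfl, -⟩
    exact Or.inl (h d _)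
  · exact (isPreconnected_path _ _).union _ (h d _) (h d _) (isPreconnected_path _ _)

theorem Valid.dist_path (V : D.Valid obs r R) {d e : ℕ} (he : e < D.k * D.k) (h : D.Rel d e) {z : Plane}
    (hz : z ∈ D.path d e) : dist z (D.ctr (d / D.k)) ≤ 4 * R := by
  obtain ⟨hA, hB⟩ := div_lt_and_mod_lt he
  have hw := V.wit_mem _ hA _ hB h.2.2.2
  have hd : ∀ i < D.k, ∀ x ∈ obs i, ∀ y ∈ obs i, dist x y ≤ 2 * R := fun i hi x hx y hy => by
    have h1 := Metric.mem_closedBall.1 ((V.sandwiched i hi).2 hx)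
    have h2 := Metric.mem_closedBall.1 ((V.sandwiched i hi).2 hy)
    linarith [dist_triangle_right x y (D.ctr i)]
  have ha := interior_subset (V.mem_interior hA h.2.1.1)
  rcases V.path_subset he h hz with h1 | h1
  · have := hd _ hA _ h1 _ ha
    linarith [dist_nonneg (x := z) (y := D.ctr (d / D.k))]
  · have h2 := hd _ hB _ h1 _ hw.2
    have h3 := hd _ hA _ hw.1 _ ha
    linarith [dist_triangle z (D.wit (e / D.k) (e % D.k)) (D.ctr (d / D.k))]

/-- The paths of a star stay within distance `4 * R` of its net point. -/
theorem Valid.dist_of_meet (V : D.Valid obs r R) {a b : ℕ} (h : (D.star a ∩ D.star b).Nonempty) :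
    ¬ D.Cov a ∧ dist (D.ctr a) (D.ctr b) ≤ 8 * R := by
  obtain ⟨z, hza, hzb⟩ := h
  obtain ⟨d, hd, rfl, -, e, -, he, hr, hz⟩ := mem_star_cases hza
  obtain ⟨d', hd', rfl, -, e', -, he', hr', hz'⟩ := mem_star_cases hzb
  refine ⟨hr.1.1, ?_⟩
  have h1 := V.dist_path he hr hz
  have h2 := V.dist_path he' hr' hz'
  linarith [dist_triangle_left (D.ctr (d / D.k)) (D.ctr (d' / D.k)) z]

/-- If a set of obstacles encloses the points, then so do the stars of the net points close to them. -/
theorem Valid.stars_enclose (V : D.Valid obs r R) {T : Finset (Fin D.k)} {cell : ℕ → ℕ}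
    (hcell : ∀ i, cell i ≤ i ∧ ¬ D.Cov (cell i) ∧ D.Near i (cell i))
    (hT : EnclosesAll (fun j : Fin D.m => D.pt j) (fun i : Fin D.k => obs i) T) {j : ℕ} (hj : j < D.m) :
    IsEnclosedBy (D.pt j) (⋃ a ∈ (fun i : Fin D.k => cell i) '' T, D.star a) := by
  have hgood : ∀ i ∈ T, ¬ D.Bad i := by
    rintro i hi ⟨j, hj, hc⟩
    exact (hT ⟨j, hj⟩).1 (Set.mem_biUnion hi ((V.con_iff i i.2 j hj).1 hc))
  have hsub : ∀ i ∈ T, D.star (cell i) ⊆ ⋃ a ∈ (fun i : Fin D.k => cell i) '' T, D.star a := fun i hi =>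
    Set.subset_biUnion_of_mem (u := D.star) (Set.mem_image_of_mem _ hi)
  refine enclosed_of_exchange (obs := fun i : Fin D.k => obs i) T (fun i => V.compact i i.2)
    (fun i => V.convex i i.2) (π := fun i => D.ctr (cell i))
    (fun i _ => interior_subset (V.mem_interior i.2 (hcell i).2.2))
    (fun i hi => V.not_mem i.2 hj (hgood i hi)) ?_ ?_ ?_ (hT ⟨j, hj⟩)
  · exact (T.finite_toSet.image _).isCompact_biUnion fun a _ => isCompact_star a
  · simp only [Set.mem_iUnion, not_exists]
    exact fun a _ => V.pt_not_mem_star hj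
  · intro i hi i' hi' hne
    obtain ⟨hd, hd1, hd2⟩ := pair_index ((hcell i).1.trans_lt i.2) ((hcell i').1.trans_lt i'.2)
    obtain ⟨he, he1, he2⟩ := pair_index i.2 i'.2
    set d := cell i * D.k + cell i'
    set e := (i : ℕ) * D.k + i'
    have hint := (V.int_iff i i.2 i' i'.2).2 hne
    have hr : D.Rel d e := by
      rw [Rel, hd1, hd2, he1, he2]
      exact ⟨⟨(hcell i).2.1, (hcell i').2.1⟩, ⟨(hcell i).2.2, (hcell i').2.2⟩,
        ⟨hgood i hi, hgood i' hi'⟩, hint⟩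
    obtain ⟨e', he', hs⟩ := V.exists_chosen he hr hj
    have h0 := lo_ne_zero he hr
    have hp : D.path d e' ⊆ D.star (cell i) := fun z hz => mem_star_of hd hd1 h0 he' hz
    rw [path, hd1, hd2, Set.union_subset_iff] at hp
    rw [Sw, Sw, hd1, hd2, he1, he2] at hs
    exact ⟨D.wit i i', V.wit_mem i i.2 i' i'.2 hint, D.wit (e' / D.k) (e' % D.k),
      hp.1.trans (hsub i hi), hp.2.trans (hsub i hi), hs⟩

end Inst

/-! ### The network of an instance -/

theorem IsEnclosedBy.mono {x : Plane} {U W : Set Plane} (h : IsEnclosedBy x U) (hUW : U ⊆ W) (hx : x ∉ W) :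
    IsEnclosedBy x W :=
  ⟨hx, h.2.subset (connectedComponentIn_mono x (Set.compl_subset_compl.2 hUW))⟩

namespace Inst

variable (D : Inst)

/-- The number of given points, centres and common points of pairs of obstacles. -/
def nB : ℕ := D.m + D.k + D.k * D.k

/-- The list of the given points, the centres and the common points of pairs of obstacles. -/
def base (i : ℕ) : Plane :=
  if i < D.m then D.pt i else if i < D.m + D.k then D.ctr (i - D.m) else
    D.wit ((i - D.m - D.k) / D.k) ((i - D.m - D.k) % D.k)

/-- A bound for the coordinates of the first points of the list. -/
def boxSum : ℕ → ℝ
  | 0 => 1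
  | i + 1 => boxSum i + (D.base i 0 * D.base i 0 + D.base i 1 * D.base i 1)

/-- A bound for the coordinates of all points of the list. -/
def box : ℝ := D.boxSum D.nB

/-- The list, extended by corners of two boxes. -/
def corner (i : ℕ) : Plane :=
  if i < D.nB then D.base i else if i < D.nB + 1 then !₂[D.box, D.box] else
    if i < D.nB + 2 then !₂[-D.box, -D.box] else if i < D.nB + 3 then !₂[2 * D.box, 2 * D.box] else
      !₂[-(2 * D.box), -(2 * D.box)]

/-- The list, extended by translates of all its points in the directions of both axes.  This makes the
horizontal and vertical lines through the points lines through pairs of points. -/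
def site (i : ℕ) : Plane :=
  if i < D.nB + 4 then D.corner i else
    if i < D.nB + 4 + (D.nB + 4) then D.corner (i - (D.nB + 4)) + !₂[1, 0] else
      D.corner (i - (D.nB + 4) - (D.nB + 4)) + !₂[0, 1]

/-- The number of sites. -/
def nZ : ℕ := D.nB + 4 + (D.nB + 4) + (D.nB + 4)

/-- The number of lines. -/
def nL : ℕ := D.nZ * D.nZ

/-- The number of vertices. -/
def nV : ℕ := D.nL * D.nL

/-- The number of points of the network. -/
def nP : ℕ := D.m + D.nV * D.nV * D.nV

/-- The lines of the arrangement. -/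
def line (l : ℕ) : Line := lineThrough (D.site (l / D.nZ)) (D.site (l % D.nZ))

/-- The vertices of the arrangement. -/
def vertex (v : ℕ) : Plane := (D.line (v / D.nL)).meet (D.line (v % D.nL))

/-- Sums of two vertices. -/
def vertexSum (v : ℕ) : Plane := D.vertex (v / D.nV) + D.vertex (v % D.nV)

/-- The points of the network: the given points, and the barycentres of triples of vertices. -/
def pos (q : ℕ) : Plane :=
  if q < D.m then D.pt q else
    (1 / 3 : ℝ) • (D.vertexSum ((q - D.m) / D.nV) + D.vertex ((q - D.m) % D.nV))

/-- The arrangement. -/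
def lines : Set Line := D.line '' {l | l < D.nL}

variable {D}

theorem exists_base_ctr {a : ℕ} (ha : a < D.k) : ∃ i < D.nB, D.base i = D.ctr a :=
  ⟨D.m + a, by unfold nB; omega, by
    rw [base, if_neg (by omega), if_pos (by omega), Nat.add_sub_cancel_left]⟩

theorem exists_base_wit {e : ℕ} (he : e < D.k * D.k) :
    ∃ i < D.nB, D.base i = D.wit (e / D.k) (e % D.k) :=
  ⟨D.m + D.k + e, by unfold nB; omega, by
    rw [base, if_neg (by omega), if_neg (by omega), Nat.sub_sub, Nat.add_sub_cancel_left]⟩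

theorem boxSum_mono : Monotone D.boxSum :=
  monotone_nat_of_le_succ fun i => by
    exact le_add_of_nonneg_right (add_nonneg (mul_self_nonneg _) (mul_self_nonneg _))

theorem abs_base_le {i : ℕ} (hi : i < D.nB) (a : Fin 2) : |D.base i a| ≤ D.box := by
  have h1 : D.boxSum (i + 1) ≤ D.box := boxSum_mono hi
  have h2 : D.boxSum 0 ≤ D.boxSum i := boxSum_mono (Nat.zero_le i)
  rw [boxSum] at h1
  change 1 ≤ _ at h2
  have h3 : |D.base i a| ≤ 1 + D.base i a * D.base i a :=
    abs_le.2 ⟨by nlinarith [sq_nonneg (D.base i a + 1)], by nlinarith [sq_nonneg (D.base i a - 1)]⟩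
  have h4 : D.base i a * D.base i a ≤ D.base i 0 * D.base i 0 + D.base i 1 * D.base i 1 := by
    fin_cases a
    · exact le_add_of_nonneg_right (mul_self_nonneg _)
    · exact le_add_of_nonneg_left (mul_self_nonneg _)
  linarith

theorem one_le_box : 1 ≤ D.box := boxSum_mono (Nat.zero_le D.nB)

theorem site_corner {i : ℕ} (hi : i < D.nB + 4) : (∃ j < D.nZ, D.site j = D.corner i) ∧
    (∃ j < D.nZ, D.site j = D.corner i + !₂[1, 0]) ∧ ∃ j < D.nZ, D.site j = D.corner i + !₂[0, 1] := by
  refine ⟨⟨i, by unfold nZ; omega, by rw [site, if_pos hi]⟩,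
    ⟨D.nB + 4 + i, by unfold nZ; omega, ?_⟩, ⟨D.nB + 4 + (D.nB + 4) + i, by unfold nZ; omega, ?_⟩⟩
  · rw [site, if_neg (by omega), if_pos (by omega), Nat.add_sub_cancel_left]
  · rw [site, if_neg (by omega), if_neg (by omega), Nat.sub_sub, Nat.add_sub_cancel_left]

theorem line_mem {u v : Plane} (hu : ∃ j < D.nZ, D.site j = u) (hv : ∃ j < D.nZ, D.site j = v) :
    lineThrough u v ∈ D.lines := by
  obtain ⟨i, hi, rfl⟩ := hu
  obtain ⟨j, hj, rfl⟩ := hv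
  obtain ⟨h1, h2, h3⟩ := pair_index hi hj
  exact ⟨_, h1, by rw [line, h2, h3]⟩

theorem axis_line_mem {i : ℕ} (hi : i < D.nB + 4) :
    ((1, 0, -D.corner i 0) : Line) ∈ D.lines ∧ ((0, 1, -D.corner i 1) : Line) ∈ D.lines := by
  obtain ⟨h0, h1, h2⟩ := site_corner hi
  constructor
  · convert line_mem h2 h0 using 1
    simp only [lineThrough, PiLp.add_apply, Prod.mk.injEq]
    simp; ring
  · convert line_mem h0 h1 using 1
    simp only [lineThrough, PiLp.add_apply, Prod.mk.injEq]
    simp; ring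

theorem segmentLines_subset {u v : Plane} (hu : ∃ i < D.nB, D.base i = u) (hv : ∃ i < D.nB, D.base i = v) :
    segmentLines u v ⊆ D.lines := by
  obtain ⟨i, hi, rfl⟩ := hu
  obtain ⟨j, hj, rfl⟩ := hv
  have ci : D.corner i = D.base i := if_pos hi
  have cj : D.corner j = D.base j := if_pos hj
  have ai := axis_line_mem (D := D) (i := i) (by omega)
  have aj := axis_line_mem (D := D) (i := j) (by omega)
  have li := line_mem (site_corner (D := D) (i := i) (by omega)).1 (site_corner (i := j) (by omega)).1
  rw [ci] at ai li
  rw [cj] at aj li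
  rintro l (rfl | rfl | rfl | rfl | rfl)
  exacts [li, ai.1, aj.1, ai.2, aj.2]

theorem boxLines_subset : boxLines D.box ⊆ D.lines ∧ boxLines (2 * D.box) ⊆ D.lines := by
  have h0 := axis_line_mem (D := D) (i := D.nB) (by omega)
  have h1 := axis_line_mem (D := D) (i := D.nB + 1) (by omega)
  have h2 := axis_line_mem (D := D) (i := D.nB + 2) (by omega)
  have h3 := axis_line_mem (D := D) (i := D.nB + 3) (by omega)
  rw [corner, if_neg (by omega), if_pos (by omega)] at h0
  rw [corner, if_neg (by omega), if_neg (by omega), if_pos (by omega)] at h1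
  rw [corner, if_neg (by omega), if_neg (by omega), if_neg (by omega), if_pos (by omega)] at h2
  rw [corner, if_neg (by omega), if_neg (by omega), if_neg (by omega), if_neg (by omega)] at h3
  simp only [Matrix.cons_val_zero, Matrix.cons_val_one, neg_neg] at h0 h1 h2 h3
  constructor
  · rintro l (rfl | rfl | rfl | rfl)
    exacts [h0.1, h1.1, h0.2, h1.2]
  · rintro l (rfl | rfl | rfl | rfl)
    exacts [h2.1, h3.1, h2.2, h3.2]

theorem finite_lines : D.lines.Finite := (Set.finite_Iio D.nL).image _

theorem exists_pos {z : Plane} (hz : ∀ i, |z i| ≤ 2 * D.box) : ∃ q < D.nP, SameFace D.lines (D.pos q) z := by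
  obtain ⟨v, hv, hs⟩ := exists_sample finite_lines boxLines_subset.2 hz
  have hv' : ∀ i, ∃ w < D.nV, D.vertex w = v i := by
    intro i
    obtain ⟨_, ⟨l, hl, rfl⟩, _, ⟨l', hl', rfl⟩, h⟩ := hv i
    obtain ⟨h1, h2, h3⟩ := pair_index (show l < D.nL from hl) (show l' < D.nL from hl')
    exact ⟨_, h1, by rw [vertex, h2, h3, h]⟩
  choose w hw hwv using hv'
  obtain ⟨a1, a2, a3⟩ := pair_index (hw 0) (hw 1)
  obtain ⟨b1, b2, b3⟩ := pair_index a1 (hw 2)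
  refine ⟨D.m + ((w 0 * D.nV + w 1) * D.nV + w 2), by unfold nP; omega, fun l hl => ?_⟩
  rw [pos, if_neg (by omega), Nat.add_sub_cancel_left, b2, b3, vertexSum, a2, a3, hwv, hwv, hwv]
  exact hs l hl

theorem mem_star_base {a : ℕ} {z : Plane} (hz : z ∈ D.star a) : ∃ i < D.nB, ∃ j < D.nB,
    z ∈ segment ℝ (D.base i) (D.base j) ∧ segment ℝ (D.base i) (D.base j) ⊆ D.star a := by
  obtain ⟨d, hd, hda, h0, e, he, hek, -, hz⟩ := mem_star_cases hz
  have hp : D.path d e ⊆ D.star a := fun y hy => mem_star_of hd hda h0 he hy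
  rw [path, Set.union_subset_iff] at hp
  obtain ⟨h1, h2⟩ := div_lt_and_mod_lt hd
  obtain ⟨i, hi, hi'⟩ := exists_base_ctr h1
  obtain ⟨j, hj, hj'⟩ := exists_base_ctr h2
  obtain ⟨w, hw, hw'⟩ := exists_base_wit hek
  rcases hz with hz | hz
  · exact ⟨i, hi, w, hw, by rwa [hi', hw'], by rw [hi', hw']; exact hp.1⟩
  · exact ⟨w, hw, j, hj, by rwa [hj', hw'], by rw [hj', hw']; exact hp.2⟩

variable {obs : ℕ → Set Plane} {r R : ℝ}

/-- The network of an instance. -/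
def Valid.network (V : D.Valid obs r R) : Network where
  m := D.m
  k := D.k
  n := D.nP
  pos := D.pos
  S := D.lines
  P := D.star
  M := D.box
  K := 2 * D.box
  hmn := Nat.le_add_right _ _
  finite := finite_lines
  connected a _ := isPreconnected_star a
  faces a _ z hz y hy := by
    obtain ⟨i, hi, j, hj, hz, hs⟩ := mem_star_base hz
    exact hs (segment_closed_under_faces (segmentLines_subset ⟨i, hi, rfl⟩ ⟨j, hj, rfl⟩) hz hy)
  hMK := by linarith [one_le_box (D := D)]
  boxM := boxLines_subset.1
  inBox a _ z hz i := by
    obtain ⟨u, hu, v, hv, ⟨s, t, hs, ht, hst, rfl⟩, -⟩ := mem_star_base hz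
    simp only [PiLp.add_apply, PiLp.smul_apply, smul_eq_mul]
    have h1 := abs_le.1 (abs_base_le hu i)
    have h2 := abs_le.1 (abs_base_le hv i)
    obtain rfl : s = 1 - t := by linarith
    exact abs_le.2 ⟨by nlinarith, by nlinarith⟩
  sample z hz := exists_pos hz
  avoid j hj a _ := by
    rw [pos, if_pos hj]
    exact V.pt_not_mem_star hj

variable (D) in
/-- The obstacle `i` contains a part of one of the paths that start at net points in `C`. -/
def Out (C : ℕ → Prop) (i : ℕ) : Prop := ∃ d < D.k * D.k, D.lo d ≠ 0 ∧ C (d / D.k) ∧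
  (((D.lo d - 1) / D.k = i ∨ (D.lo d - 1) % D.k = i) ∨ ((D.hi d - 1) / D.k = i ∨ (D.hi d - 1) % D.k = i))

open Classical in
/-- Every set of obstacles that encloses the points gives a cut whose size is at most `B` times the size of the set,
where `B` bounds the number of stars that can meet a given star. -/
theorem Valid.exists_cut (V : D.Valid obs r R) {B : ℕ} (hB : ∀ (c : Plane) {ι : Type} (f : ι → Plane)
    (S : Finset ι), (∀ i ∈ S, dist (f i) c ≤ 8 * R) →
      (∀ i ∈ S, ∀ j ∈ S, i ≠ j → D.δ < dist (f i) (f j)) → S.card ≤ B) {T : Finset (Fin D.k)}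
    (hT : EnclosesAll (fun j : Fin D.m => D.pt j) (fun i : Fin D.k => obs i) T) :
    ∃ I O ρ : ℕ → Prop, V.network.IsCut I O ρ ∧
      ((Finset.range D.k).filter fun a => I a ∧ ¬ O a).card ≤ B * T.card := by
  choose cell hcell using D.exists_near
  set C : Finset ℕ := T.image fun i : Fin D.k => cell i with hC
  have hCset : (fun i : Fin D.k => cell i) '' (T : Set (Fin D.k)) = C := by simp [hC]
  obtain ⟨I, O, ρ, hcut, hn⟩ := V.network.exists_isCut (C := C) (by
    intro a ha
    obtain ⟨i, -, rfl⟩ := Finset.mem_image.1 (Finset.mem_coe.1 ha)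
    exact (hcell i).1.trans_lt i.2) (fun j hj => by
      have := V.stars_enclose hcell hT hj
      rw [hCset] at this
      change IsEnclosedBy (D.pos j) _
      rw [pos, if_pos (show j < D.m from hj)]
      exact this)
  refine ⟨I, O, ρ, hcut, ?_⟩
  have hsub : ((Finset.range D.k).filter fun a => I a ∧ ¬ O a) ⊆ C.biUnion fun a' =>
      (Finset.range D.k).filter fun a => ¬ D.Cov a ∧ dist (D.ctr a) (D.ctr a') ≤ 8 * R := by
    intro a ha
    obtain ⟨ha, hI, hO⟩ := Finset.mem_filter.1 ha
    obtain ⟨a', ha', hne⟩ := hn a (Finset.mem_range.1 ha) hI hO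
    exact Finset.mem_biUnion.2 ⟨a', ha', Finset.mem_filter.2 ⟨ha, V.dist_of_meet hne⟩⟩
  calc _ ≤ _ := Finset.card_le_card hsub
    _ ≤ C.card * B := Finset.card_biUnion_le_card_mul _ _ _ fun a' _ => by
        refine hB (D.ctr a') D.ctr _ (fun i hi => (Finset.mem_filter.1 hi).2.2) fun i hi j hj hij => ?_
        exact separated V.δ_pos (Finset.mem_filter.1 hi).2.1 (Finset.mem_filter.1 hj).2.1 hij
    _ ≤ T.card * B := Nat.mul_le_mul_right _ Finset.card_image_le
    _ = B * T.card := mul_comm _ _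

/-- The stars in a cut enclose the points, and they are covered by the obstacles along their paths, which do not
contain any of the points. -/
theorem Valid.out_encloses (V : D.Valid obs r R) {I O ρ : ℕ → Prop} (hcut : V.network.IsCut I O ρ)
    {T : Finset (Fin D.k)} (hT : ∀ i : Fin D.k, i ∈ T ↔ D.Out (fun a => I a ∧ ¬ O a) i) :
    EnclosesAll (fun j : Fin D.m => D.pt j) (fun i : Fin D.k => obs i) T := by
  rintro ⟨j, hj⟩
  have h := hcut.encloses hj
  change IsEnclosedBy (D.pos j) _ at h
  rw [pos, if_pos hj] at h
  refine h.mono (fun z hz => ?_) fun hx => ?_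
  · obtain ⟨a, ⟨-, hgate⟩, hza⟩ := Set.mem_iUnion₂.1 hz
    obtain ⟨d, hd, rfl, h0, e, he, hek, hr, hz⟩ := mem_star_cases hza
    obtain ⟨hA, hB⟩ := div_lt_and_mod_lt hek
    have hm : ∀ i (hi : i < D.k), (e / D.k = i ∨ e % D.k = i) → (⟨i, hi⟩ : Fin D.k) ∈ T := by
      intro i hi h
      refine (hT _).2 ⟨d, hd, h0, hgate, ?_⟩
      rcases he with rfl | rfl
      exacts [Or.inl h, Or.inr h]
    rcases V.path_subset hek hr hz with h | h
    · exact Set.mem_biUnion (hm _ hA (Or.inl rfl)) h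
    · exact Set.mem_biUnion (hm _ hB (Or.inr rfl)) h
  · obtain ⟨i, hi, hx⟩ := Set.mem_iUnion₂.1 hx
    obtain ⟨d, hd, h0, -, h | h⟩ := (hT i).1 hi
    · obtain ⟨hek, hr⟩ := rel_of_chosen h0 (Or.inl rfl)
      rcases h with h | h
      · exact V.not_mem i.2 hj (h ▸ hr.2.2.1.1) hx
      · exact V.not_mem i.2 hj (h ▸ hr.2.2.1.2) hx
    · obtain ⟨hek, hr⟩ := rel_of_chosen h0 (Or.inr rfl)
      rcases h with h | h
      · exact V.not_mem i.2 hj (h ▸ hr.2.2.1.1) hx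
      · exact V.not_mem i.2 hj (h ▸ hr.2.2.1.2) hx

theorem Valid.ctr_dist_le (V : D.Valid obs r R) {d e : ℕ} (he : e < D.k * D.k) (h : D.Rel d e) :
    dist (D.ctr (d % D.k)) (D.ctr (d / D.k)) ≤ 4 * R :=
  V.dist_path he h (Or.inr (right_mem_segment ℝ _ _))

open Classical in
/-- Each net point has paths to at most `B` others, because these lie within distance `8 * R`, and the two paths
of a pair use four obstacles. -/
theorem Valid.card_out_le (V : D.Valid obs r R) (hR : 0 ≤ R) {B : ℕ} (hB : ∀ (c : Plane) {ι : Type} (f : ι → Plane)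
    (S : Finset ι), (∀ i ∈ S, dist (f i) c ≤ 8 * R) →
      (∀ i ∈ S, ∀ j ∈ S, i ≠ j → D.δ < dist (f i) (f j)) → S.card ≤ B) {C : ℕ → Prop}
    {T : Finset (Fin D.k)} (hT : ∀ i : Fin D.k, i ∈ T ↔ D.Out C i) :
    T.card ≤ 4 * B * ((Finset.range D.k).filter C).card := by
  let near : ℕ → Finset ℕ := fun a =>
    (Finset.range D.k).filter fun b => ¬ D.Cov b ∧ dist (D.ctr b) (D.ctr a) ≤ 8 * R
  let four : ℕ → Finset ℕ := fun d =>
    {(D.lo d - 1) / D.k, (D.lo d - 1) % D.k, (D.hi d - 1) / D.k, (D.hi d - 1) % D.k}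
  have hsub : T.image (fun i : Fin D.k => (i : ℕ)) ⊆ ((Finset.range D.k).filter C).biUnion fun a =>
      (near a).biUnion fun b => four (a * D.k + b) := by
    intro i hi
    obtain ⟨i', hi', rfl⟩ := Finset.mem_image.1 hi
    obtain ⟨d, hd, h0, hC, h⟩ := (hT i').1 hi'
    obtain ⟨h1, h2⟩ := div_lt_and_mod_lt hd
    obtain ⟨hek, hr⟩ := rel_of_chosen h0 (Or.inl rfl)
    refine Finset.mem_biUnion.2 ⟨d / D.k, Finset.mem_filter.2 ⟨Finset.mem_range.2 h1, hC⟩,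
      Finset.mem_biUnion.2 ⟨d % D.k, Finset.mem_filter.2 ⟨Finset.mem_range.2 h2, hr.1.2, ?_⟩, ?_⟩⟩
    · linarith [V.ctr_dist_le hek hr]
    · rw [mul_comm, Nat.div_add_mod]
      simp only [four, Finset.mem_insert, Finset.mem_singleton]
      rcases h with (h | h) | (h | h) <;> simp [h]
  rw [← Finset.card_image_of_injective T Fin.val_injective]
  refine (Finset.card_le_card hsub).trans ?_
  rw [mul_comm]
  refine Finset.card_biUnion_le_card_mul _ _ _ fun a _ => ?_
  refine (Finset.card_biUnion_le_card_mul _ _ 4 fun b _ => Finset.card_le_four).trans ?_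
  rw [mul_comm]
  refine Nat.mul_le_mul_left _ ?_
  refine hB (D.ctr a) D.ctr _ (fun i hi => (Finset.mem_filter.1 hi).2.2) fun i hi j hj hij => ?_
  exact separated V.δ_pos (Finset.mem_filter.1 hi).2.1 (Finset.mem_filter.1 hj).2.1 hij

end Inst

/-! ### Running times -/

/-- A bound for the running time of a program whose loops make at most `X` iterations each time they are reached. -/
def cost : Prog → ℕ[X]
  | .skip => 1
  | .setNat _ _ _ _ => 1
  | .setReal _ _ _ _ => 1
  | .seq c d => cost c + cost d
  | .ite _ c d => cost c + cost d + 1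
  | .while _ c => Polynomial.X * (cost c + 1) + 1

/-- Started in memory `s`, the program halts within the time for loops with at most `N` iterations, in a memory with
property `Q`. -/
def Runs (N : ℕ) (c : Prog) (s : Mem) (Q : Mem → Prop) : Prop :=
  ∃ s' t, Exec c s s' t ∧ t ≤ (cost c).eval N ∧ Q s'

section
variable {N : ℕ} {c d : Prog} {s : Mem} {P Q : Mem → Prop}

theorem Runs.mono (h : Runs N c s P) (hPQ : ∀ s', P s' → Q s') : Runs N c s Q := by
  obtain ⟨s', t, h1, h2, h3⟩ := h
  exact ⟨s', t, h1, h2, hPQ s' h3⟩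

theorem Runs.seq (h : Runs N c s P) (h' : ∀ s', P s' → Runs N d s' Q) : Runs N (.seq c d) s Q := by
  obtain ⟨s', t, h1, h2, h3⟩ := h
  obtain ⟨s'', t', h4, h5, h6⟩ := h' s' h3
  exact ⟨s'', t + t', .seq h1 h4, by simpa [cost] using add_le_add h2 h5, h6⟩

theorem Runs.skip (h : Q s) : Runs N .skip s Q := ⟨s, 1, .skip s, by simp [cost], h⟩

theorem Runs.setNat {a : ℕ} {i j e : NExp} (h : Q (s.setNat a (i.eval s) (j.eval s) (e.eval s))) :
    Runs N (.setNat a i j e) s Q := ⟨_, 1, .setNat s a i j e, by simp [cost], h⟩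

theorem Runs.setReal {a : ℕ} {i j : NExp} {e : RExp}
    (h : Q (s.setReal a (i.eval s) (j.eval s) (e.eval s))) :
    Runs N (.setReal a i j e) s Q := ⟨_, 1, .setReal s a i j e, by simp [cost], h⟩

theorem Runs.ite {b : BExp} (h : b.eval s → Runs N c s Q) (h' : ¬ b.eval s → Runs N d s Q) :
    Runs N (.ite b c d) s Q := by
  by_cases hb : b.eval s
  · obtain ⟨s', t, h1, h2, h3⟩ := h hb
    exact ⟨s', t + 1, .iteTrue hb h1, by simp only [cost, Polynomial.eval_add, Polynomial.eval_one]; omega, h3⟩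
  · obtain ⟨s', t, h1, h2, h3⟩ := h' hb
    exact ⟨s', t + 1, .iteFalse hb h1, by simp only [cost, Polynomial.eval_add, Polynomial.eval_one]; omega, h3⟩

end

/-- The variable with name `v`: an array of which only one cell is used. -/
def vr (v : ℕ) : NExp := .read v (.const 0) (.const 0)

/-- The loop over all values below `n` of the variable `v`. -/
def forLt (v : ℕ) (n : NExp) (c : Prog) : Prog :=
  .seq (.setNat v (.const 0) (.const 0) (.const 0))
    (.while (.natLt (vr v) n) (.seq c (.setNat v (.const 0) (.const 0) (.add (vr v) (.const 1)))))

/-- A loop with the invariant `I`.  The body must leave the loop variable unchanged. -/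
theorem Runs.forLt {N B v : ℕ} {n : NExp} {c : Prog} {s : Mem} (I : ℕ → Mem → Prop) (hB : B ≤ N)
    (h0 : I 0 (s.setNat v 0 0 0)) (hv : ∀ i s, I i s → s.nat v 0 0 = i ∧ n.eval s = B)
    (hstep : ∀ i s, i < B → I i s →
      Runs N c s fun s' => s'.nat v 0 0 = i ∧ I (i + 1) (s'.setNat v 0 0 (i + 1))) :
    Runs N (forLt v n c) s (I B) := by
  have main : ∀ r i s, i + r = B → I i s → ∃ s' t,
      Exec (.while (.natLt (vr v) n) (.seq c (.setNat v (.const 0) (.const 0) (.add (vr v) (.const 1)))))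
        s s' t ∧ t ≤ r * ((cost c).eval N + 1 + 1) + 1 ∧ I B s' := by
    intro r
    induction r with
    | zero =>
      intro i s hi hI
      obtain ⟨h1, h2⟩ := hv i s hI
      refine ⟨s, 1, .whileFalse ?_, by omega, by rwa [← show i = B by omega]⟩
      simp only [BExp.eval, vr, NExp.eval, h1, h2]; omega
    | succ r ih =>
      intro i s hi hI
      obtain ⟨h1, h2⟩ := hv i s hI
      obtain ⟨s₁, t₁, e₁, ht₁, hv₁, hI₁⟩ := hstep i s (by omega) hI
      obtain ⟨s₂, t₂, e₂, ht₂, hI₂⟩ := ih (i + 1) _ (by omega) hI₁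
      refine ⟨s₂, t₁ + 1 + t₂ + 1, .whileTrue ?_ (.seq e₁ ?_) e₂, ?_, hI₂⟩
      · simp only [BExp.eval, vr, NExp.eval, h1, h2]; omega
      · have := Exec.setNat s₁ v (.const 0) (.const 0) (.add (vr v) (.const 1))
        simpa only [vr, NExp.eval, hv₁] using this
      · rw [Nat.succ_mul]; omega
  obtain ⟨s', t, e, ht, hI⟩ := main B 0 (s.setNat v 0 0 0) (by omega) h0
  refine ⟨s', 1 + t, .seq (.setNat s v (.const 0) (.const 0) (.const 0)) e, ?_, hI⟩
  have : B * ((cost c).eval N + 1 + 1) ≤ N * ((cost c).eval N + 1 + 1) := Nat.mul_le_mul_right _ hB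
  simp only [EnclosingAllPoints.forLt, cost, Polynomial.eval_add, Polynomial.eval_mul, Polynomial.eval_X,
    Polynomial.eval_one]
  omega

/-- Disjunction of tests. -/
def orB (b c : BExp) : BExp := .not (.and (.not b) (.not c))

/-- The test whether a natural number is not zero. -/
def posB (e : NExp) : BExp := .natLt (.const 0) e

/-- The test for equality of natural numbers. -/
def eqB (e f : NExp) : BExp := .and (.not (.natLt e f)) (.not (.natLt f e))

@[simp] theorem eval_orB {b c : BExp} {s : Mem} : (orB b c).eval s ↔ b.eval s ∨ c.eval s := by
  simp only [orB, BExp.eval]; tauto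

@[simp] theorem eval_posB {e : NExp} {s : Mem} : (posB e).eval s ↔ 0 < e.eval s := Iff.rfl

@[simp] theorem eval_eqB {e f : NExp} {s : Mem} : (eqB e f).eval s ↔ e.eval s = f.eval s := by
  simp only [eqB, BExp.eval]; omega

@[simp] theorem eval_vr {v : ℕ} {s : Mem} : (vr v).eval s = s.nat v 0 0 := rfl

theorem bit_pos {p : Prop} : 0 < bit p ↔ p := by
  unfold bit; split_ifs with h <;> simp [h]

theorem ifElse_step {p q : Prop} {x y v : ℕ} (h : p ↔ q) (hy : y = v) :
    (p → y = ifElse q v x) ∧ (¬ p → x = ifElse q v x) :=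
  ⟨fun hp => by rw [ifElse_pos (h.1 hp), hy], fun hp => by rw [ifElse_neg (mt h.2 hp)]⟩

/-! ### Tables in memory -/

/-- The statement that a part of an array holds the values of a function. -/
inductive Fact : Type
  | nat (a n₁ n₂ : ℕ) (f : ℕ → ℕ → ℕ)
  | real (a n₁ n₂ : ℕ) (f : ℕ → ℕ → ℝ)

/-- The statement is true for the memory `s`. -/
def Fact.Holds (s : Mem) : Fact → Prop
  | .nat a n₁ n₂ f => ∀ i < n₁, ∀ j < n₂, s.nat a i j = f i j
  | .real a n₁ n₂ f => ∀ i < n₁, ∀ j < n₂, s.real a i j = f i j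

/-- The statement does not concern any of the listed arrays of naturals and of reals. -/
def Fact.Off (W W' : List ℕ) : Fact → Prop
  | .nat a _ _ _ => a ∉ W
  | .real a _ _ _ => a ∉ W'

/-- All listed statements are true for the memory. -/
def Knows (s : Mem) (L : List Fact) : Prop := ∀ φ ∈ L, φ.Holds s

/-- No listed statement concerns any of the arrays in `W` and `W'`. -/
def Fresh (W W' : List ℕ) (L : List Fact) : Prop := ∀ φ ∈ L, φ.Off W W'

section
variable {s : Mem} {L L' : List Fact} {W W' : List ℕ}

theorem Knows.nat {a n₁ n₂ : ℕ} {f : ℕ → ℕ → ℕ} (h : Knows s L) (hm : Fact.nat a n₁ n₂ f ∈ L) {i j : ℕ}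
    (hi : i < n₁) (hj : j < n₂) : s.nat a i j = f i j := h _ hm i hi j hj

theorem Knows.real {a n₁ n₂ : ℕ} {f : ℕ → ℕ → ℝ} (h : Knows s L) (hm : Fact.real a n₁ n₂ f ∈ L) {i j : ℕ}
    (hi : i < n₁) (hj : j < n₂) : s.real a i j = f i j := h _ hm i hi j hj

theorem Knows.sub (h : Knows s L) (hL : L' ⊆ L) : Knows s L' := fun φ hφ => h φ (hL hφ)

theorem knows_cons {φ : Fact} : Knows s (φ :: L) ↔ φ.Holds s ∧ Knows s L := List.forall_mem_cons

theorem fresh_cons {φ : Fact} : Fresh W W' (φ :: L) ↔ φ.Off W W' ∧ Fresh W W' L := List.forall_mem_cons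

theorem Knows.setNat (h : Knows s L) (hW : Fresh W W' L) {a i j v : ℕ} (ha : a ∈ W) :
    Knows (s.setNat a i j v) L := by
  intro φ hφ
  have h1 := h φ hφ
  have h2 := hW φ hφ
  cases φ with
  | nat b n₁ n₂ f =>
    intro i' hi' j' hj'
    have hb : b ≠ a := by rintro rfl; exact h2 ha
    simpa [Mem.setNat, hb] using h1 i' hi' j' hj'
  | real b n₁ n₂ f => exact h1

theorem Knows.setReal (h : Knows s L) (hW : Fresh W W' L) {a i j : ℕ} {v : ℝ} (ha : a ∈ W') :
    Knows (s.setReal a i j v) L := by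
  intro φ hφ
  have h1 := h φ hφ
  have h2 := hW φ hφ
  cases φ with
  | real b n₁ n₂ f =>
    intro i' hi' j' hj'
    have hb : b ≠ a := by rintro rfl; exact h2 ha
    simpa [Mem.setReal, hb] using h1 i' hi' j' hj'
  | nat b n₁ n₂ f => exact h1

end

/-- Inside nested loops over `i`, `j` and `l`, in a memory with known tables. -/
structure Ctx (L : List Fact) (i j l : ℕ) (s : Mem) : Prop where
  knows : Knows s L
  hi : s.nat 50 0 0 = i
  hj : s.nat 51 0 0 = j
  hl : s.nat 52 0 0 = l

/-- Fills the table `a`: the entries start with the value of `c` and are updated in a loop, in each step of which they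
get the value of `e` if the test `b` succeeds. -/
def tab (a : ℕ) (n₁ n₂ n₃ c : NExp) (b : BExp) (e : NExp) : Prog :=
  forLt 50 n₁ (forLt 51 n₂ (.seq (.setNat a (vr 50) (vr 51) c)
    (forLt 52 n₃ (.ite b (.setNat a (vr 50) (vr 51) e) .skip))))

/-- If each entry starts as `C i j` and the step `l` of the innermost loop replaces it by `F i j l` of its old value,
then the table has the entries `G i j`.  The step may use the entries `G i' j'` of the rows `i' < i`, which are
complete at this time. -/
theorem runs_tab {N : ℕ} {L : List Fact} {a N₁ N₂ N₃ : ℕ} {n₁ n₂ n₃ c : NExp} {b : BExp} {e : NExp}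
    (C : ℕ → ℕ → ℕ) (F : ℕ → ℕ → ℕ → ℕ → ℕ) (G : ℕ → ℕ → ℕ)
    (ha : a < 50) (hL : Fresh [a, 50, 51, 52] [] L)
    (hn : ∀ s, Knows s L → n₁.eval s = N₁ ∧ n₂.eval s = N₂ ∧ n₃.eval s = N₃)
    (hN : N₁ ≤ N ∧ N₂ ≤ N ∧ N₃ ≤ N)
    (hC : ∀ s i j, Knows s L → s.nat 50 0 0 = i → s.nat 51 0 0 = j → i < N₁ → j < N₂ → c.eval s = C i j)
    (hF : ∀ s i j l, Ctx L i j l s → i < N₁ → j < N₂ → l < N₃ →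
      (∀ i' < i, ∀ j' < N₂, s.nat a i' j' = G i' j') → s.nat a i j = fold (F i j) (C i j) l →
      (b.eval s → e.eval s = F i j l (s.nat a i j)) ∧ (¬ b.eval s → s.nat a i j = F i j l (s.nat a i j)))
    (hG : ∀ i < N₁, ∀ j < N₂, fold (F i j) (C i j) N₃ = G i j) {s : Mem} (hs : Knows s L) :
    Runs N (tab a n₁ n₂ n₃ c b e) s fun s' => Knows s' (.nat a N₁ N₂ G :: L) := by
  have a0 : a ≠ 50 := by omega
  have a1 : a ≠ 51 := by omega
  have a2 : a ≠ 52 := by omega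
  have kn : ∀ {s : Mem} {x i j v : ℕ}, Knows s L → x ∈ [a, 50, 51, 52] → Knows (s.setNat x i j v) L :=
    fun h hx => h.setNat hL hx
  refine Runs.mono (Runs.forLt (B := N₁) (fun i s => Knows s L ∧ s.nat 50 0 0 = i ∧
    ∀ i' < i, ∀ j' < N₂, s.nat a i' j' = G i' j') hN.1 ?_ (fun i s h => ⟨h.2.1, (hn s h.1).1⟩) ?_) ?_
  · exact ⟨kn hs (by simp), by simp [Mem.setNat], by simp⟩
  · rintro i s hi ⟨h1, h2, h3⟩
    refine Runs.mono (Runs.forLt (B := N₂) (fun j s => Knows s L ∧ s.nat 50 0 0 = i ∧ s.nat 51 0 0 = j ∧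
      (∀ i' < i, ∀ j' < N₂, s.nat a i' j' = G i' j') ∧ ∀ j' < j, s.nat a i j' = G i j')
      hN.2.1 ?_ (fun i s h => ⟨h.2.2.1, (hn s h.1).2.1⟩) ?_) ?_
    · exact ⟨kn h1 (by simp), by simpa [Mem.setNat] using h2, by simp [Mem.setNat],
        by simpa [Mem.setNat, a1] using h3, by simp⟩
    · rintro j s hj ⟨h1, h2, h3, h4, h5⟩
      refine Runs.seq (Runs.setNat (Q := fun s => Knows s L ∧ s.nat 50 0 0 = i ∧ s.nat 51 0 0 = j ∧
        (∀ i' < i, ∀ j' < N₂, s.nat a i' j' = G i' j') ∧ (∀ j' < j, s.nat a i j' = G i j') ∧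
        s.nat a i j = C i j) ?_) ?_
      · simp only [vr, NExp.eval, h2, h3]
        refine ⟨kn h1 (by simp), by simpa [Mem.setNat, a0.symm] using h2,
          by simpa [Mem.setNat, a1.symm] using h3, fun i' hi' j' hj' => ?_, fun j' hj' => ?_, ?_⟩
        · simpa [Mem.setNat, hi'.ne] using h4 i' hi' j' hj'
        · simpa [Mem.setNat, hj'.ne] using h5 j' hj'
        · simpa [Mem.setNat] using hC s i j h1 h2 h3 hi hj
      · rintro s ⟨h1, h2, h3, h4, h5, h6⟩
        refine Runs.mono (Runs.forLt (B := N₃) (fun l s => Ctx L i j l s ∧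
          (∀ i' < i, ∀ j' < N₂, s.nat a i' j' = G i' j') ∧ (∀ j' < j, s.nat a i j' = G i j') ∧
          s.nat a i j = fold (F i j) (C i j) l) hN.2.2 ?_ (fun i s h => ⟨h.1.hl, (hn s h.1.knows).2.2⟩) ?_) ?_
        · exact ⟨⟨kn h1 (by simp), by simpa [Mem.setNat] using h2, by simpa [Mem.setNat] using h3,
            by simp [Mem.setNat]⟩, by simpa [Mem.setNat, a2] using h4, by simpa [Mem.setNat, a2] using h5,
            by simpa [Mem.setNat, a2, fold] using h6⟩
        · rintro l s hl ⟨h1, h4, h5, h6⟩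
          have h7 := hF s i j l h1 hi hj hl h4 h6
          refine Runs.ite (fun hb => Runs.setNat ?_) fun hb => Runs.skip ?_
          · have h8 := h7.1 hb
            simp only [vr, NExp.eval, h1.hi, h1.hj]
            refine ⟨by simpa [Mem.setNat, a2.symm] using h1.hl, ⟨kn (kn h1.knows (by simp)) (by simp),
              by simpa [Mem.setNat, a0.symm] using h1.hi, by simpa [Mem.setNat, a1.symm] using h1.hj,
              by simp [Mem.setNat]⟩, fun i' hi' j' hj' => ?_, fun j' hj' => ?_, ?_⟩
            · simpa [Mem.setNat, a2, hi'.ne] using h4 i' hi' j' hj'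
            · simpa [Mem.setNat, a2, hj'.ne] using h5 j' hj'
            · rw [h6] at h8
              simpa [Mem.setNat, a2, fold] using h8
          · have h8 := h7.2 hb
            refine ⟨h1.hl, ⟨kn h1.knows (by simp), by simpa [Mem.setNat] using h1.hi,
              by simpa [Mem.setNat] using h1.hj, by simp [Mem.setNat]⟩, fun i' hi' j' hj' => ?_,
              fun j' hj' => ?_, ?_⟩
            · simpa [Mem.setNat, a2] using h4 i' hi' j' hj'
            · simpa [Mem.setNat, a2] using h5 j' hj'
            · rw [h6] at h8
              simp only [Mem.setNat, a2, false_and, if_false, fold]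
              rw [← h8]; exact h6
        · rintro s ⟨h1, h4, h5, h6⟩
          refine ⟨h1.hj, kn h1.knows (by simp), by simpa [Mem.setNat] using h1.hi, by simp [Mem.setNat],
            by simpa [Mem.setNat, a1] using h4, fun j' hj' => ?_⟩
          rcases Nat.lt_succ_iff_lt_or_eq.1 hj' with hj' | rfl
          · simpa [Mem.setNat, a1] using h5 j' hj'
          · simpa [Mem.setNat, a1] using h6.trans (hG i hi _ hj)
    · rintro s ⟨h1, h2, -, h4, h5⟩
      refine ⟨h2, kn h1 (by simp), by simp [Mem.setNat], fun i' hi' j' hj' => ?_⟩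
      rcases Nat.lt_succ_iff_lt_or_eq.1 hi' with hi' | rfl
      · simpa [Mem.setNat, a0] using h4 i' hi' j' hj'
      · simpa [Mem.setNat, a0] using h5 j' hj'
  · rintro s ⟨h1, -, h3⟩
    exact knows_cons.2 ⟨h3, h1⟩

theorem fold_bit (p : ℕ → Prop) (n : ℕ) :
    fold (fun l acc => ifElse (p l) 1 acc) 0 n = bit (∃ l < n, p l) := by
  induction n with
  | zero => simp [fold, bit]
  | succ n ih =>
    rw [fold]
    by_cases h : p n
    · rw [ifElse_pos h, bit, if_pos ⟨n, n.lt_succ_self, h⟩]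
    · rw [ifElse_neg h, ih]
      congr 1
      exact propext ⟨fun ⟨l, hl, hp⟩ => ⟨l, hl.trans n.lt_succ_self, hp⟩, fun ⟨l, hl, hp⟩ =>
        ⟨l, (Nat.lt_succ_iff_lt_or_eq.1 hl).resolve_right (by rintro rfl; exact h hp), hp⟩⟩

theorem fold_add (f : ℕ → ℕ) (n : ℕ) : fold (fun l acc => acc + f l) 0 n = ∑ l ∈ Finset.range n, f l := by
  induction n with
  | zero => rfl
  | succ n ih => rw [fold, ih, Finset.sum_range_succ]

/-- Fills a table with the truth values of an existential statement. -/
def tabEx (a : ℕ) (n₁ n₂ n₃ : NExp) (b : BExp) : Prog := tab a n₁ n₂ n₃ (.const 0) b (.const 1)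

theorem runs_tabEx {N : ℕ} {L : List Fact} {a N₁ N₂ N₃ : ℕ} {n₁ n₂ n₃ : NExp} {b : BExp}
    (p : ℕ → ℕ → ℕ → Prop) (ha : a < 50) (hL : Fresh [a, 50, 51, 52] [] L)
    (hn : ∀ s, Knows s L → n₁.eval s = N₁ ∧ n₂.eval s = N₂ ∧ n₃.eval s = N₃)
    (hN : N₁ ≤ N ∧ N₂ ≤ N ∧ N₃ ≤ N)
    (hp : ∀ s i j l, Ctx L i j l s → i < N₁ → j < N₂ → l < N₃ → (b.eval s ↔ p i j l)) {s : Mem}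
    (hs : Knows s L) :
    Runs N (tabEx a n₁ n₂ n₃ b) s
      fun s' => Knows s' (.nat a N₁ N₂ (fun i j => bit (∃ l < N₃, p i j l)) :: L) := by
  refine runs_tab (fun _ _ => 0) (fun i j l acc => ifElse (p i j l) 1 acc) _ ha hL hn hN
    (fun _ _ _ _ _ _ _ _ => rfl) (fun s i j l hc hi hj hl _ _ => ?_) (fun i hi j hj => ?_) hs
  · exact ifElse_step (hp s i j l hc hi hj hl) rfl
  · exact fold_bit _ _

/-- Fills a table with the truth values of a test. -/
def tabBit (a : ℕ) (n₁ n₂ : NExp) (b : BExp) : Prog := tabEx a n₁ n₂ (.const 1) b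

theorem runs_tabBit {N : ℕ} {L : List Fact} {a N₁ N₂ : ℕ} {n₁ n₂ : NExp} {b : BExp}
    (p : ℕ → ℕ → Prop) (ha : a < 50) (hL : Fresh [a, 50, 51, 52] [] L)
    (hn : ∀ s, Knows s L → n₁.eval s = N₁ ∧ n₂.eval s = N₂)
    (hN : N₁ ≤ N ∧ N₂ ≤ N ∧ 1 ≤ N)
    (hp : ∀ s i j, Ctx L i j 0 s → i < N₁ → j < N₂ → (b.eval s ↔ p i j)) {s : Mem} (hs : Knows s L) :
    Runs N (tabBit a n₁ n₂ b) s
      fun s' => Knows s' (.nat a N₁ N₂ (fun i j => bit (p i j)) :: L) := by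
  refine (runs_tabEx (fun i j _ => p i j) ha hL (fun s h => ⟨(hn s h).1, (hn s h).2, rfl⟩) hN
    (fun s i j l hc hi hj hl => ?_) hs).mono fun s' h => ?_
  · obtain rfl : l = 0 := by omega
    exact hp s i j hc hi hj
  · simpa using h

/-- Fills a table with the numbers of `l` with a given property. -/
theorem runs_tab_count {N : ℕ} {L : List Fact} {a N₁ N₂ N₃ : ℕ} {n₁ n₂ n₃ : NExp} {b : BExp}
    (p : ℕ → ℕ → ℕ → Prop) (ha : a < 50) (hL : Fresh [a, 50, 51, 52] [] L)
    (hn : ∀ s, Knows s L → n₁.eval s = N₁ ∧ n₂.eval s = N₂ ∧ n₃.eval s = N₃)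
    (hN : N₁ ≤ N ∧ N₂ ≤ N ∧ N₃ ≤ N)
    (hp : ∀ s i j l, Ctx L i j l s → i < N₁ → j < N₂ → l < N₃ → (b.eval s ↔ p i j l)) {s : Mem}
    (hs : Knows s L) :
    Runs N (tab a n₁ n₂ n₃ (.const 0) b (.add (.read a (vr 50) (vr 51)) (.const 1))) s
      fun s' => Knows s' (.nat a N₁ N₂ (fun i j => ∑ l ∈ Finset.range N₃, bit (p i j l)) :: L) := by
  refine runs_tab (fun _ _ => 0) (fun i j l acc => acc + bit (p i j l)) _ ha hL hn hN
    (fun _ _ _ _ _ _ _ _ => rfl) (fun s i j l hc hi hj hl _ _ => ?_) (fun i hi j hj => ?_) hs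
  · rw [hp s i j l hc hi hj hl]
    exact ⟨fun h => by simp only [NExp.eval, vr, hc.hi, hc.hj, bit, if_pos h],
      fun h => by rw [bit, if_neg h, add_zero]⟩
  · exact fold_add _ _

/-- Fills a table with the values of an expression. -/
def tabVal (a : ℕ) (n₁ n₂ c : NExp) : Prog :=
  tab a n₁ n₂ (.const 0) c (.natLt (.const 0) (.const 0)) (.const 0)

theorem runs_tabVal {N : ℕ} {L : List Fact} {a N₁ N₂ : ℕ} {n₁ n₂ c : NExp} (G : ℕ → ℕ → ℕ) (ha : a < 50)
    (hL : Fresh [a, 50, 51, 52] [] L) (hn : ∀ s, Knows s L → n₁.eval s = N₁ ∧ n₂.eval s = N₂)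
    (hN : N₁ ≤ N ∧ N₂ ≤ N)
    (hG : ∀ s i j, Knows s L → s.nat 50 0 0 = i → s.nat 51 0 0 = j → i < N₁ → j < N₂ → c.eval s = G i j)
    {s : Mem} (hs : Knows s L) :
    Runs N (tabVal a n₁ n₂ c) s fun s' => Knows s' (.nat a N₁ N₂ G :: L) :=
  runs_tab G (fun _ _ _ acc => acc) G ha hL (fun s h => ⟨(hn s h).1, (hn s h).2, rfl⟩)
    ⟨hN.1, hN.2, Nat.zero_le _⟩ hG (fun _ _ _ _ _ _ _ hl => absurd hl (Nat.not_lt_zero _))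
    (fun _ _ _ _ => rfl) hs

theorem runs_set {N : ℕ} {L : List Fact} {a v : ℕ} {e : NExp} (hL : Fresh [a] [] L)
    (he : ∀ s, Knows s L → e.eval s = v) {s : Mem} (hs : Knows s L) :
    Runs N (.setNat a (.const 0) (.const 0) e) s
      fun s' => Knows s' (.nat a 1 1 (fun _ _ => v) :: L) := by
  refine Runs.setNat (knows_cons.2 ⟨fun i hi j hj => ?_, hs.setNat hL (by simp)⟩)
  obtain rfl : i = 0 := by omega
  obtain rfl : j = 0 := by omega
  simpa [Mem.setNat, NExp.eval] using he s hs

/-- Fills the table `f` with the quotients and the table `g` with the remainders on division of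
the numbers below the product of `n₁` and `n₂` by `n₂`, and the cell `c` with this product. -/
def pairs (f g c : ℕ) (n₁ n₂ : NExp) : Prog :=
  .seq (tab 9 (.add n₁ (.const 1)) (.const 1) (.const 1) (.const 0) (.natLt (.const 0) (vr 50))
      (.add (.read 9 (.sub (vr 50) (.const 1)) (.const 0)) n₂))
    (.seq (.setNat c (.const 0) (.const 0) (.read 9 n₁ (.const 0)))
      (.seq (tab f (vr c) (.const 1) n₁ (.const 0)
          (.not (.natLt (vr 50) (.read 9 (.add (vr 52) (.const 1)) (.const 0))))
          (.add (.read f (vr 50) (vr 51)) (.const 1)))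
        (tabVal g (vr c) (.const 1)
          (.sub (vr 50) (.read 9 (.read f (vr 50) (.const 0)) (.const 0))))))

theorem sum_bit_mul_le {n₁ n₂ d : ℕ} (hd : d < n₁ * n₂) :
    ∑ l ∈ Finset.range n₁, bit ((l + 1) * n₂ ≤ d) = d / n₂ := by
  have hn : 0 < n₂ := Nat.pos_of_ne_zero (by rintro rfl; simp at hd)
  have h : ∀ n, ∑ l ∈ Finset.range n, bit ((l + 1) * n₂ ≤ d) = min n (d / n₂) := by
    intro n
    induction n with
    | zero => simp
    | succ n ih =>
      rw [Finset.sum_range_succ, ih]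
      have : (n + 1) * n₂ ≤ d ↔ n + 1 ≤ d / n₂ := (Nat.le_div_iff_mul_le hn).symm
      unfold bit
      split_ifs with h
      · have := this.1 h; omega
      · have := mt this.2 h; omega
  rw [h]
  exact min_eq_right (div_lt_and_mod_lt hd).1.le

/-- The machine cannot divide natural numbers, so the quotients are found by counting the multiples of `N₂`. -/
theorem runs_pairs {N : ℕ} {L : List Fact} {f g c N₁ N₂ : ℕ} {n₁ n₂ : NExp} (hf : f < 50) (hg : g < 50)
    (hfg : f ≠ g) (hf9 : f ≠ 9) (hg9 : g ≠ 9) (hc : c ∉ [f, g, 9, 50, 51, 52])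
    (hL : Fresh [f, g, c, 9, 50, 51, 52] [] L)
    (hn : ∀ s, Knows s L → n₁.eval s = N₁ ∧ n₂.eval s = N₂) (hN : N₁ + 1 ≤ N ∧ N₁ * N₂ ≤ N) {s : Mem}
    (hs : Knows s L) :
    Runs N (pairs f g c n₁ n₂) s fun s' => Knows s' (.nat g (N₁ * N₂) 1 (fun d _ => d % N₂) ::
      .nat f (N₁ * N₂) 1 (fun d _ => d / N₂) :: .nat c 1 1 (fun _ _ => N₁ * N₂) :: L) := by
  have mono : ∀ {W W' : List ℕ}, W ⊆ W' → Fresh W' [] L → Fresh W [] L := by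
    intro W W' hW h φ hφ
    have := h φ hφ
    cases φ with
    | nat => exact fun h' => this (hW h')
    | real => exact this
  simp only [List.mem_cons, List.not_mem_nil, or_false, not_or] at hc
  obtain ⟨c1, c2, c3, c4, c5, c6⟩ := hc
  refine Runs.seq (runs_tab (L := L) (N₁ := N₁ + 1) (N₂ := 1) (N₃ := 1) (fun _ _ => 0)
    (fun i _ _ acc => if 0 < i then i * N₂ else acc) (fun i _ => i * N₂) (by norm_num)
    (mono (by simp) hL) (fun s h => ⟨by simp [NExp.eval, hn s h], rfl, rfl⟩) (by omega)
    (fun _ _ _ _ _ _ _ _ => rfl) (fun s i j l hc hi hj hl hrow _ => ?_) (fun i hi j hj => ?_) hs)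
    fun s hs => ?_
  · have hb : (BExp.natLt (.const 0) (vr 50)).eval s ↔ 0 < i := by simp [BExp.eval, NExp.eval, vr, hc.hi]
    rw [hb]
    refine ⟨fun h => ?_, fun h => by rw [if_neg h]⟩
    rw [if_pos h]
    simp only [NExp.eval, vr, hc.hi, (hn s hc.knows).2]
    rw [hrow (i - 1) (by omega) 0 one_pos]
    obtain ⟨i, rfl⟩ : ∃ i', i = i' + 1 := ⟨i - 1, by omega⟩
    rw [Nat.add_sub_cancel]; ring
  · simp only [fold]
    split_ifs with h
    · rfl
    · obtain rfl : i = 0 := by omega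
      simp
  refine Runs.seq (runs_set (v := N₁ * N₂) (L := .nat 9 (N₁ + 1) 1 (fun i _ => i * N₂) :: L)
    (fresh_cons.2 ⟨by simp [Fact.Off, Ne.symm c3], mono (by simp) hL⟩)
    (fun s h => ?_) hs) fun s hs => ?_
  · have h' := (knows_cons.1 h).2
    simp only [NExp.eval, (hn s h').1]
    exact (knows_cons.1 h).1 N₁ (by omega) 0 one_pos
  set L₁ : List Fact := .nat c 1 1 (fun _ _ => N₁ * N₂) :: .nat 9 (N₁ + 1) 1 (fun i _ => i * N₂) :: L
    with hL₁
  have k1 : ∀ {s}, Knows s L₁ → n₁.eval s = N₁ ∧ s.nat c 0 0 = N₁ * N₂ ∧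
      ∀ i < N₁ + 1, s.nat 9 i 0 = i * N₂ := fun h =>
    ⟨(hn _ (knows_cons.1 (knows_cons.1 h).2).2).1, (knows_cons.1 h).1 0 one_pos 0 one_pos,
      fun i hi => (knows_cons.1 (knows_cons.1 h).2).1 i hi 0 one_pos⟩
  refine Runs.seq (runs_tab_count (L := L₁) (N₁ := N₁ * N₂) (N₂ := 1) (N₃ := N₁)
    (fun i _ l => (l + 1) * N₂ ≤ i) hf ?_ (fun s h => ?_) (by omega) (fun s i j l hc hi hj hl => ?_) hs)
    fun s hs => ?_
  · refine fresh_cons.2 ⟨by simp [Fact.Off, c1, c4, c5, c6], fresh_cons.2 ⟨?_, mono (by simp) hL⟩⟩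
    simp [Fact.Off, Ne.symm hf9]
  · exact ⟨(k1 h).2.1, rfl, (k1 h).1⟩
  · simp only [BExp.eval, NExp.eval, vr, hc.hi, hc.hl, not_lt]
    rw [(k1 hc.knows).2.2 (l + 1) (by omega)]
  have k2 : ∀ {s}, Knows s (.nat f (N₁ * N₂) 1
      (fun i _ => ∑ l ∈ Finset.range N₁, bit ((l + 1) * N₂ ≤ i)) :: L₁) → ∀ d < N₁ * N₂,
      s.nat f d 0 = d / N₂ := fun h d hd => by
    exact ((knows_cons.1 h).1 d hd 0 one_pos).trans (sum_bit_mul_le hd)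
  refine (runs_tabVal (N₁ := N₁ * N₂) (N₂ := 1) (fun i _ => i % N₂) hg ?_ (fun s h => ?_) (by omega)
    (fun s i j h h1 h2 hi hj => ?_) hs).mono fun s hs => ?_
  · refine fresh_cons.2 ⟨by simp [Fact.Off, hfg]; omega, fresh_cons.2 ⟨by simp [Fact.Off, c2, c4, c5, c6],
      fresh_cons.2 ⟨by simp [Fact.Off, Ne.symm hg9], mono (by simp) hL⟩⟩⟩
  · exact ⟨(k1 (knows_cons.1 h).2).2.1, rfl⟩
  · simp only [NExp.eval, vr, h1]
    have := div_lt_and_mod_lt hi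
    rw [k2 h i hi, (k1 (knows_cons.1 h).2).2.2 _ (by omega)]
    have := Nat.div_add_mod' i N₂
    omega
  · have h1 := (knows_cons.1 hs).2
    have h2 := (knows_cons.1 h1).2
    refine knows_cons.2 ⟨(knows_cons.1 hs).1, knows_cons.2 ⟨fun d hd j hj => ?_,
      knows_cons.2 ⟨(knows_cons.1 h2).1, (knows_cons.1 (knows_cons.1 h2).2).2⟩⟩⟩
    obtain rfl : j = 0 := by omega
    exact k2 h1 d hd

/-- Writes the value of the first expression whose test succeeds, or of the last one. -/
def select (a : ℕ) (cases : List (BExp × RExp)) (d : RExp) : Prog :=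
  cases.foldr (fun p r => .ite p.1 (.setReal a (vr 50) (vr 51) p.2) r) (.setReal a (vr 50) (vr 51) d)

open Classical in
/-- The value of the first expression whose test succeeds, or of the last one. -/
def selectEval (s : Mem) (cases : List (BExp × RExp)) (d : RExp) : ℝ :=
  cases.foldr (fun p r => if p.1.eval s then p.2.eval s else r) (d.eval s)

theorem runs_select {N a : ℕ} (cases : List (BExp × RExp)) (d : RExp) {s : Mem} {Q : Mem → Prop}
    (h : Q (s.setReal a (s.nat 50 0 0) (s.nat 51 0 0) (selectEval s cases d))) :
    Runs N (select a cases d) s Q := by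
  induction cases with
  | nil => exact Runs.setReal h
  | cons p r ih =>
    refine Runs.ite (fun hb => Runs.setReal ?_) fun hb => ih ?_
    · simpa [selectEval, hb, vr, NExp.eval] using h
    · simpa [selectEval, hb] using h

/-- Fills a table of reals. -/
def tabReal (a : ℕ) (n₁ n₂ : NExp) (cases : List (BExp × RExp)) (d : RExp) : Prog :=
  forLt 50 n₁ (forLt 51 n₂ (select a cases d))

theorem runs_tabReal {N : ℕ} {L : List Fact} {a N₁ N₂ : ℕ} {n₁ n₂ : NExp} {cases : List (BExp × RExp)}
    {d : RExp} (G : ℕ → ℕ → ℝ) (hL : Fresh [50, 51] [a] L)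
    (hn : ∀ s, Knows s L → n₁.eval s = N₁ ∧ n₂.eval s = N₂) (hN : N₁ ≤ N ∧ N₂ ≤ N)
    (hG : ∀ s i j, Knows s L → s.nat 50 0 0 = i → s.nat 51 0 0 = j → i < N₁ → j < N₂ →
      (∀ i' < i, ∀ j' < N₂, s.real a i' j' = G i' j') → selectEval s cases d = G i j) {s : Mem}
    (hs : Knows s L) :
    Runs N (tabReal a n₁ n₂ cases d) s fun s' => Knows s' (.real a N₁ N₂ G :: L) := by
  have kn : ∀ {s : Mem} {x i j v : ℕ}, Knows s L → x ∈ [50, 51] → Knows (s.setNat x i j v) L :=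
    fun h hx => h.setNat hL hx
  refine Runs.mono (Runs.forLt (B := N₁) (fun i s => Knows s L ∧ s.nat 50 0 0 = i ∧
    ∀ i' < i, ∀ j' < N₂, s.real a i' j' = G i' j') hN.1 ?_ (fun i s h => ⟨h.2.1, (hn s h.1).1⟩) ?_) ?_
  · exact ⟨kn hs (by simp), by simp [Mem.setNat], by simp⟩
  · rintro i s hi ⟨h1, h2, h3⟩
    refine Runs.mono (Runs.forLt (B := N₂) (fun j s => Knows s L ∧ s.nat 50 0 0 = i ∧ s.nat 51 0 0 = j ∧
      (∀ i' < i, ∀ j' < N₂, s.real a i' j' = G i' j') ∧ ∀ j' < j, s.real a i j' = G i j')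
      hN.2 ?_ (fun i s h => ⟨h.2.2.1, (hn s h.1).2⟩) ?_) ?_
    · exact ⟨kn h1 (by simp), by simpa [Mem.setNat] using h2, by simp [Mem.setNat], h3, by simp⟩
    · rintro j s hj ⟨h1, h2, h3, h4, h5⟩
      refine runs_select cases d ?_
      rw [h2, h3, hG s i j h1 h2 h3 hi hj h4]
      refine ⟨h3, kn (h1.setReal hL (by simp)) (by simp), by simpa [Mem.setNat, Mem.setReal] using h2,
        by simp [Mem.setNat], fun i' hi' j' hj' => ?_, fun j' hj' => ?_⟩
      · simpa [Mem.setNat, Mem.setReal, hi'.ne] using h4 i' hi' j' hj'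
      · rcases Nat.lt_succ_iff_lt_or_eq.1 hj' with hj' | rfl
        · simpa [Mem.setNat, Mem.setReal, hj'.ne] using h5 j' hj'
        · simp [Mem.setNat, Mem.setReal]
    · rintro s ⟨h1, h2, -, h4, h5⟩
      refine ⟨h2, kn h1 (by simp), by simp [Mem.setNat], fun i' hi' j' hj' => ?_⟩
      rcases Nat.lt_succ_iff_lt_or_eq.1 hi' with hi' | rfl
      · exact h4 i' hi' j' hj'
      · exact h5 j' hj'
  · rintro s ⟨h1, -, h3⟩
    exact knows_cons.2 ⟨h3, h1⟩

/-! ### Maximum flows and minimum cuts -/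

namespace Flow

variable (n : ℕ)

/-- The node `u` can be reached from `0` in at most `r` steps along arcs with positive residual capacity. -/
def Lay (R : ℕ → ℕ → ℕ) : ℕ → ℕ → Prop
  | 0, u => u = 0
  | r + 1, u => ∃ l < n, Lay R r l ∧ (l = u ∨ 0 < R l u)

/-- The capacity of the arcs that leave the set of nodes. -/
def cutCap (f : ℕ → ℕ → ℕ) (S : ℕ → Prop) : ℕ := open Classical in
  ∑ u ∈ (Finset.range n).filter S, ∑ v ∈ (Finset.range n).filter fun v => ¬ S v, f u v

/-- The residual capacities `R` belong to a flow of value `val` from node `0` to node `1`. -/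
structure IsResidual (cap R : ℕ → ℕ → ℕ) (val : ℕ) : Prop where
  add_swap : ∀ u < n, ∀ v < n, R u v + R v u = cap u v + cap v u
  balance : ∀ u < n, ∑ v ∈ Finset.range n, R u v + val * bit (u = 0) =
    ∑ v ∈ Finset.range n, cap u v + val * bit (u = 1)

variable {n} {cap R : ℕ → ℕ → ℕ}

theorem Lay.mono {r r' u : ℕ} (hu : u < n) (hr : r ≤ r') (h : Lay n R r u) : Lay n R r' u := by
  induction r', hr using Nat.le_induction with
  | base => exact h
  | succ r' _ ih => exact ⟨u, hu, ih, Or.inl rfl⟩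

/-- After `n` steps the set of reachable nodes is closed. -/
theorem lay_closed (hn : 0 < n) {u v : ℕ} (hu : u < n) (hv : v < n) (h : Lay n R n u) (hR : 0 < R u v) :
    Lay n R n v := by
  classical
  let F : ℕ → Finset ℕ := fun r => (Finset.range n).filter (Lay n R r)
  have hF : ∀ r, F r ⊆ F (r + 1) := fun r x hx => by
    obtain ⟨h1, h2⟩ := Finset.mem_filter.1 hx
    exact Finset.mem_filter.2 ⟨h1, h2.mono (Finset.mem_range.1 h1) r.le_succ⟩
  have step : ∀ r, F (r + 1) = F r → F (r + 2) = F (r + 1) := by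
    intro r hr
    refine Finset.Subset.antisymm (fun x hx => ?_) (hF _)
    obtain ⟨h1, l, hl, h2, h3⟩ := Finset.mem_filter.1 hx
    have h4 : l ∈ F (r + 1) := Finset.mem_filter.2 ⟨Finset.mem_range.2 hl, h2⟩
    rw [hr] at h4
    exact Finset.mem_filter.2 ⟨h1, l, hl, (Finset.mem_filter.1 h4).2, h3⟩
  have key : F (n + 1) = F n := by
    by_contra hne
    have hlt : ∀ r ≤ n, r + 1 ≤ (F r).card ∧ F (r + 1) ≠ F r := by
      have hne' : ∀ r ≤ n, F (r + 1) ≠ F r := by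
        intro r hr
        induction hr using Nat.decreasingInduction with
        | self => exact hne
        | of_succ r _ ih => exact fun h => ih (step r h)
      intro r
      induction r with
      | zero =>
        exact fun h => ⟨Finset.card_pos.2 ⟨0, Finset.mem_filter.2 ⟨Finset.mem_range.2 hn, rfl⟩⟩, hne' 0 h⟩
      | succ r ih =>
        intro hr
        have h1 := ih (by omega)
        have h2 := Finset.card_lt_card ((hF r).ssubset_of_ne h1.2.symm)
        exact ⟨by omega, hne' _ hr⟩
    have h1 := (hlt n le_rfl).1
    have h2 : (F n).card ≤ n := (Finset.card_filter_le _ _).trans (Finset.card_range n).le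
    omega
  have hv' : v ∈ F (n + 1) := Finset.mem_filter.2 ⟨Finset.mem_range.2 hv, u, hu, h, Or.inr hR⟩
  rw [key] at hv'
  exact (Finset.mem_filter.1 hv').2

/-- A flow of value `val` uses up this much of the capacity of each cut. -/
theorem IsResidual.cutCap_eq {val : ℕ} (h : IsResidual n cap R val) (hn : 1 < n) {S : ℕ → Prop} (h0 : S 0)
    (h1 : ¬ S 1) : cutCap n R S + val = cutCap n cap S := by
  classical
  set A := (Finset.range n).filter S
  set B := (Finset.range n).filter fun v => ¬ S v
  have split : ∀ f : ℕ → ℕ → ℕ, ∑ u ∈ A, ∑ v ∈ Finset.range n, f u v =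
      ∑ u ∈ A, ∑ v ∈ A, f u v + cutCap n f S := by
    intro f
    have : cutCap n f S = ∑ u ∈ A, ∑ v ∈ B, f u v := by simp only [cutCap, A, B]
    rw [this, ← Finset.sum_add_distrib]
    exact Finset.sum_congr rfl fun u _ => (Finset.sum_filter_add_sum_filter_not _ _ _).symm
  have hin : ∑ u ∈ A, ∑ v ∈ A, R u v = ∑ u ∈ A, ∑ v ∈ A, cap u v := by
    have h2 : ∀ f : ℕ → ℕ → ℕ, 2 * ∑ u ∈ A, ∑ v ∈ A, f u v = ∑ u ∈ A, ∑ v ∈ A, (f u v + f v u) := by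
      intro f
      simp only [Finset.sum_add_distrib]
      rw [two_mul, Finset.sum_comm (f := fun u v => f v u)]
    have h3 := (h2 R).trans ((Finset.sum_congr rfl fun u hu => Finset.sum_congr rfl fun v hv =>
      h.add_swap u (Finset.mem_range.1 (Finset.mem_filter.1 hu).1) v
        (Finset.mem_range.1 (Finset.mem_filter.1 hv).1)).trans (h2 cap).symm)
    omega
  have hbal := Finset.sum_congr (rfl : A = A) fun u hu =>
    h.balance u (Finset.mem_range.1 (Finset.mem_filter.1 hu).1)
  rw [Finset.sum_add_distrib, Finset.sum_add_distrib, split, split, hin, ← Finset.mul_sum,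
    ← Finset.mul_sum] at hbal
  have e0 : ∑ u ∈ A, bit (u = 0) = 1 := by
    rw [Finset.sum_eq_single 0]
    · simp [bit]
    · intro b _ hb; simp [bit, hb]
    · intro h; exact absurd (Finset.mem_filter.2 ⟨Finset.mem_range.2 (by omega), h0⟩) h
  have e1 : ∑ u ∈ A, bit (u = 1) = 0 := by
    refine Finset.sum_eq_zero fun u hu => ?_
    rw [bit, if_neg]
    rintro rfl
    exact h1 (Finset.mem_filter.1 hu).2
  rw [e0, e1] at hbal
  omega

/-- The walk `w` goes from node `1` back to node `0`, passing through one layer in each step. -/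
structure IsWalk (n : ℕ) (R : ℕ → ℕ → ℕ) (w : ℕ → ℕ) : Prop where
  start : w 0 = 1
  lt : ∀ r ≤ n, w r < n
  lay : ∀ r ≤ n, Lay n R (n - r) (w r)
  step : ∀ r < n, w (r + 1) = w r ∨ (¬ Lay n R (n - (r + 1)) (w r) ∧ 0 < R (w (r + 1)) (w r))

/-- The walk uses the arc from `u` to `v`. -/
def Arc (n : ℕ) (w : ℕ → ℕ) (u v : ℕ) : Prop := ∃ r < n, w (r + 1) = u ∧ w r = v ∧ u ≠ v

section
variable {w : ℕ → ℕ} {u v : ℕ}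

theorem IsWalk.arc_at (h : IsWalk n R w) {r : ℕ} (hr : r < n) (h1 : w (r + 1) = u) (h2 : w r = v)
    (huv : u ≠ v) : Lay n R (n - (r + 1)) u ∧ ¬ Lay n R (n - (r + 1)) v ∧ Lay n R (n - r) v ∧ 0 < R u v := by
  subst h1 h2
  rcases h.step r hr with h3 | h3
  · exact absurd h3 huv
  · exact ⟨h.lay _ hr, h3.1, h.lay r hr.le, h3.2⟩

theorem IsWalk.arc_unique (h : IsWalk n R w) {r r' : ℕ} (hr : r < n) (hr' : r' < n) (h1 : w (r + 1) = u)
    (h2 : w r = v) (h1' : w (r' + 1) = u) (h2' : w r' = v) (huv : u ≠ v) : r = r' := by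
  have hv : v < n := h2 ▸ h.lt r hr.le
  obtain ⟨-, a, b, -⟩ := h.arc_at hr h1 h2 huv
  obtain ⟨-, a', b', -⟩ := h.arc_at hr' h1' h2' huv
  by_contra hne
  rcases lt_or_gt_of_ne hne with hlt | hlt
  · exact a (b'.mono hv (by omega))
  · exact a' (b.mono hv (by omega))

theorem IsWalk.bit_arc (h : IsWalk n R w) (u v : ℕ) :
    bit (Arc n w u v) = ∑ r ∈ Finset.range n, bit (w (r + 1) = u ∧ w r = v ∧ u ≠ v) := by
  by_cases ha : Arc n w u v
  · obtain ⟨r, hr, h1, h2, h3⟩ := ha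
    rw [Finset.sum_eq_single r]
    · rw [bit, bit, if_pos ⟨r, hr, h1, h2, h3⟩, if_pos ⟨h1, h2, h3⟩]
    · intro r' hr' hne
      rw [bit, if_neg]
      rintro ⟨h1', h2', -⟩
      exact hne (h.arc_unique (Finset.mem_range.1 hr') hr h1' h2' h1 h2 h3)
    · intro h'; exact absurd (Finset.mem_range.2 hr) h'
  · rw [bit, if_neg ha, eq_comm]
    refine Finset.sum_eq_zero fun r hr => ?_
    rw [bit, if_neg]
    exact fun h' => ha ⟨r, Finset.mem_range.1 hr, h'⟩

/-- Kirchhoff's law for the walk: it enters each node as often as it leaves it, except for its ends. -/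
theorem IsWalk.sum_arc (h : IsWalk n R w) (u : ℕ) :
    ∑ v ∈ Finset.range n, bit (Arc n w u v) + bit (u = 1) =
      ∑ v ∈ Finset.range n, bit (Arc n w v u) + bit (u = 0) := by
  have hout : ∑ v ∈ Finset.range n, bit (Arc n w u v) =
      ∑ r ∈ Finset.range n, bit (w (r + 1) = u ∧ w r ≠ u) := by
    simp only [h.bit_arc]
    rw [Finset.sum_comm]
    refine Finset.sum_congr rfl fun r hr => ?_
    rw [Finset.sum_eq_single (w r)]
    · congr 1; exact propext ⟨fun h => ⟨h.1, h.2.2.symm⟩, fun h => ⟨h.1, rfl, h.2.symm⟩⟩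
    · intro v _ hv; rw [bit, if_neg]; exact fun h => hv h.2.1.symm
    · intro h'; exact absurd (Finset.mem_range.2 (h.lt r (Finset.mem_range.1 hr).le)) h'
  have hin : ∑ v ∈ Finset.range n, bit (Arc n w v u) =
      ∑ r ∈ Finset.range n, bit (w r = u ∧ w (r + 1) ≠ u) := by
    simp only [h.bit_arc]
    rw [Finset.sum_comm]
    refine Finset.sum_congr rfl fun r hr => ?_
    rw [Finset.sum_eq_single (w (r + 1))]
    · congr 1; exact propext ⟨fun h => ⟨h.2.1, h.2.2⟩, fun h => ⟨rfl, h.1, h.2⟩⟩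
    · intro v _ hv; rw [bit, if_neg]; exact fun h => hv h.1.symm
    · intro h'; exact absurd (Finset.mem_range.2 (h.lt (r + 1) (Finset.mem_range.1 hr))) h'
  have hlast : w n = 0 := by simpa [Lay] using h.lay n le_rfl
  have tel : ∀ k, ∑ r ∈ Finset.range k, bit (w (r + 1) = u ∧ w r ≠ u) + bit (w 0 = u) =
      ∑ r ∈ Finset.range k, bit (w r = u ∧ w (r + 1) ≠ u) + bit (w k = u) := by
    intro k
    induction k with
    | zero => simp
    | succ k ih =>
      rw [Finset.sum_range_succ, Finset.sum_range_succ]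
      have : bit (w (k + 1) = u ∧ w k ≠ u) + bit (w k = u) =
          bit (w k = u ∧ w (k + 1) ≠ u) + bit (w (k + 1) = u) := by
        unfold bit; by_cases h1 : w k = u <;> by_cases h2 : w (k + 1) = u <;> simp [h1, h2]
      omega
  have := tel n
  rw [hlast, h.start] at this
  rw [hout, hin, eq_comm (a := u), eq_comm (a := u)]
  exact this

/-- The residual capacities after one unit has been sent along the walk. -/
theorem IsWalk.augment (h : IsWalk n R w) {val : ℕ} (hR : IsResidual n cap R val) :
    IsResidual n cap (fun u v => R u v + bit (Arc n w v u) - bit (Arc n w u v)) (val + 1) := by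
  have hpos : ∀ u v, bit (Arc n w u v) ≤ R u v := by
    intro u v
    unfold bit
    split_ifs with ha
    · obtain ⟨r, hr, h1, h2, h3⟩ := ha
      exact (h.arc_at hr h1 h2 h3).2.2.2
    · exact Nat.zero_le _
  refine ⟨fun u hu v hv => ?_, fun u hu => ?_⟩
  · have := hR.add_swap u hu v hv
    have := hpos u v
    have := hpos v u
    omega
  · have h1 : ∑ v ∈ Finset.range n, (R u v + bit (Arc n w v u) - bit (Arc n w u v)) +
        ∑ v ∈ Finset.range n, bit (Arc n w u v) =
        ∑ v ∈ Finset.range n, R u v + ∑ v ∈ Finset.range n, bit (Arc n w v u) := by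
      rw [← Finset.sum_add_distrib, ← Finset.sum_add_distrib]
      refine Finset.sum_congr rfl fun v _ => ?_
      have := hpos u v
      omega
    have h2 := hR.balance u hu
    have h3 := h.sum_arc u
    rw [add_mul, add_mul, one_mul, one_mul]
    omega

end

/-- The state after `it` rounds: there is a flow of value `it`, unless a smaller flow is already maximal. -/
def AfterRounds (n : ℕ) (cap R : ℕ → ℕ → ℕ) (it : ℕ) : Prop :=
  ∃ val ≤ it, IsResidual n cap R val ∧ (val = it ∨ ¬ Lay n R n 1)

theorem afterRounds_zero : AfterRounds n cap cap 0 :=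
  ⟨0, le_rfl, ⟨fun _ _ _ _ => rfl, fun _ _ => by simp⟩, Or.inl rfl⟩

/-- The final set of reachable nodes is a minimum cut, unless the sink can be reached and all cuts have capacity more
than the number of rounds. -/
theorem AfterRounds.result {it : ℕ} (h : AfterRounds n cap R it) (hn : 1 < n) :
    (¬ Lay n R n 1 → cutCap n cap (Lay n R n) ≤ it ∧
      ∀ S : ℕ → Prop, S 0 → ¬ S 1 → cutCap n cap (Lay n R n) ≤ cutCap n cap S) ∧
    (Lay n R n 1 → ∀ S : ℕ → Prop, S 0 → ¬ S 1 → it < cutCap n cap S) := by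
  classical
  obtain ⟨val, hval, hR, hv⟩ := h
  have h0 : Lay n R n 0 := Lay.mono (r := 0) (by omega) (Nat.zero_le _) rfl
  constructor
  · intro h1
    have hz : cutCap n R (Lay n R n) = 0 := by
      refine Finset.sum_eq_zero fun u hu => Finset.sum_eq_zero fun v hv => ?_
      obtain ⟨hu, hu'⟩ := Finset.mem_filter.1 hu
      obtain ⟨hv, hv'⟩ := Finset.mem_filter.1 hv
      by_contra hne
      exact hv' (lay_closed (by omega) (Finset.mem_range.1 hu) (Finset.mem_range.1 hv) hu'
        (Nat.pos_of_ne_zero hne))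
    have h2 := hR.cutCap_eq hn h0 h1
    refine ⟨by omega, fun S hS0 hS1 => ?_⟩
    have := hR.cutCap_eq hn hS0 hS1
    omega
  · intro h1 S hS0 hS1
    have hval' : val = it := hv.resolve_right (not_not.2 h1)
    have h2 := hR.cutCap_eq hn hS0 hS1
    have h3 : cutCap n R S ≠ 0 := by
      intro hz
      have hcl : ∀ r u, u < n → Lay n R r u → S u := by
        intro r
        induction r with
        | zero => rintro u - rfl; exact hS0
        | succ r ih =>
          rintro u hu ⟨l, hl, hlay, h3⟩
          have hSl := ih l hl hlay
          rcases h3 with rfl | h3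
          · exact hSl
          · by_contra hSu
            have h4 := Finset.sum_eq_zero_iff.1 hz l (Finset.mem_filter.2 ⟨Finset.mem_range.2 hl, hSl⟩)
            have h5 := Finset.sum_eq_zero_iff.1 h4 u (Finset.mem_filter.2 ⟨Finset.mem_range.2 hu, hSu⟩)
            omega
      exact hS1 (hcl n 1 hn h1)
    omega

end Flow

/-! ### A program for minimum cuts -/

namespace Flow

/-- The number of nodes. -/
def nE : NExp := vr 68

/-- Computes the layers of the residual network. -/
def layersProg : Prog :=
  tab 41 (.add nE (.const 1)) nE nE (.const 0)
    (orB (.and (eqB (vr 50) (.const 0)) (eqB (vr 51) (.const 0)))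
      (.and (posB (vr 50)) (.and (posB (.read 41 (.sub (vr 50) (.const 1)) (vr 52)))
        (orB (eqB (vr 52) (vr 51)) (posB (.read 40 (vr 52) (vr 51))))))) (.const 1)

/-- The node of the walk before the current one. -/
def prevE : NExp := .read 42 (.sub (vr 50) (.const 1)) (.const 0)

/-- Computes a walk from node `1` back to node `0`. -/
def walkProg : Prog :=
  tab 42 (.add nE (.const 1)) (.const 1) nE (.const 1)
    (.and (posB (vr 50)) (orB
      (.and (posB (.read 41 (.sub nE (vr 50)) prevE)) (eqB (vr 52) prevE))
      (.and (.not (posB (.read 41 (.sub nE (vr 50)) prevE)))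
        (.and (posB (.read 41 (.sub nE (vr 50)) (vr 52))) (posB (.read 40 (vr 52) prevE)))))) (vr 52)

/-- Computes the arcs of the walk, if there is one. -/
def arcProg : Prog :=
  tabEx 43 nE nE nE (.and (posB (.read 41 nE (.const 1)))
    (.and (eqB (.read 42 (.add (vr 52) (.const 1)) (.const 0)) (vr 50))
      (.and (eqB (.read 42 (vr 52) (.const 0)) (vr 51)) (.not (eqB (vr 50) (vr 51))))))

/-- Sends one unit along a walk from node `0` to node `1`, if there is one. -/
def roundProg : Prog :=
  .seq layersProg (.seq walkProg (.seq arcProg (.seq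
    (tabVal 44 nE nE (.sub (.add (.read 40 (vr 50) (vr 51)) (.read 43 (vr 51) (vr 50)))
      (.read 43 (vr 50) (vr 51))))
    (tabVal 40 nE nE (.read 44 (vr 50) (vr 51))))))

/-- Computes a set of nodes that is a minimum cut of the network with capacities in the array `35`, if there is a cut
of capacity at most the value of `k`. -/
def flowProg (k : NExp) : Prog :=
  .seq (tabVal 40 nE nE (.read 35 (vr 50) (vr 51))) (.seq (forLt 53 k roundProg) layersProg)

section
variable {N n : ℕ} {R : ℕ → ℕ → ℕ} {L : List Fact} {s : Mem}

theorem Fresh.mono {W W' : List ℕ} (hW : W ⊆ W') (h : Fresh W' [] L) : Fresh W [] L := by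
  intro φ hφ
  have := h φ hφ
  cases φ with
  | nat => exact fun h' => this (hW h')
  | real => exact this

theorem runs_layers (hn : 1 < n) (hN : n + 1 ≤ N) (hL : Fresh [41, 50, 51, 52] [] L)
    (hK : ∀ s, Knows s L → nE.eval s = n ∧ ∀ u < n, ∀ v < n, s.nat 40 u v = R u v) (hs : Knows s L) :
    Runs N layersProg s
      fun s' => Knows s' (.nat 41 (n + 1) n (fun r u => bit (Lay n R r u)) :: L) := by
  refine runs_tab (N₁ := n + 1) (N₂ := n) (N₃ := n) (fun _ _ => 0)
    (fun i j l acc => ifElse (i = 0 ∧ j = 0 ∨ 0 < i ∧ Lay n R (i - 1) l ∧ (l = j ∨ 0 < R l j)) 1 acc)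
    _ (by norm_num) hL (fun s h => ?_) (by omega) (fun _ _ _ _ _ _ _ _ => rfl)
    (fun s i j l hc hi hj hl hrow _ => ?_) (fun i hi j hj => ?_) hs
  · simp [NExp.eval, (hK s h).1]
  · refine ifElse_step ?_ rfl
    simp only [eval_orB, BExp.eval, eval_eqB, eval_posB, eval_vr, NExp.eval, hc.hi, hc.hj, hc.hl,
      (hK s hc.knows).2 l hl j hj]
    refine or_congr Iff.rfl (and_congr_right fun h => and_congr ?_ Iff.rfl)
    rw [hrow (i - 1) (by omega) l hl, bit_pos]
  · rw [fold_bit fun l => i = 0 ∧ j = 0 ∨ 0 < i ∧ Lay n R (i - 1) l ∧ (l = j ∨ 0 < R l j)]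
    congr 1
    cases i with
    | zero => simp only [Lay, lt_irrefl, false_and, or_false, true_and, eq_iff_iff]
              exact ⟨fun ⟨_, _, h⟩ => h, fun h => ⟨0, by omega, h⟩⟩
    | succ i => simp [Lay]

/-- The walk that the program computes. -/
def walk (n : ℕ) (R : ℕ → ℕ → ℕ) : ℕ → ℕ
  | 0 => 1
  | r + 1 => fold (fun l acc => ifElse (Lay n R (n - (r + 1)) (walk n R r) ∧ l = walk n R r ∨
      ¬ Lay n R (n - (r + 1)) (walk n R r) ∧ Lay n R (n - (r + 1)) l ∧ 0 < R l (walk n R r)) l acc) 1 n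

theorem fold_last (p : ℕ → Prop) (c n : ℕ) :
    (fold (fun l acc => ifElse (p l) l acc) c n = c ∨
      fold (fun l acc => ifElse (p l) l acc) c n < n) ∧
    ((∃ l < n, p l) → p (fold (fun l acc => ifElse (p l) l acc) c n)) := by
  induction n with
  | zero => simp [fold]
  | succ n ih =>
    rw [fold]
    by_cases h : p n
    · rw [ifElse_pos h]
      exact ⟨Or.inr n.lt_succ_self, fun _ => h⟩
    · rw [ifElse_neg h]
      refine ⟨ih.1.imp_right fun h => h.trans n.lt_succ_self, fun ⟨l, hl, hp⟩ => ih.2 ⟨l, ?_, hp⟩⟩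
      exact (Nat.lt_succ_iff_lt_or_eq.1 hl).resolve_right (by rintro rfl; exact h hp)

theorem walk_lt (hn : 1 < n) (r : ℕ) : walk n R r < n := by
  cases r with
  | zero => exact hn
  | succ r =>
    rw [walk]
    exact (fold_last _ 1 n).1.elim (fun h => h.trans_lt hn) id

theorem isWalk_walk (hn : 1 < n) (h : Lay n R n 1) : IsWalk n R (walk n R) := by
  have main : ∀ r < n, Lay n R (n - r) (walk n R r) → Lay n R (n - (r + 1)) (walk n R (r + 1)) ∧
      (walk n R (r + 1) = walk n R r ∨
        (¬ Lay n R (n - (r + 1)) (walk n R r) ∧ 0 < R (walk n R (r + 1)) (walk n R r))) := by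
    intro r hr hl
    have key := (fold_last (fun l => Lay n R (n - (r + 1)) (walk n R r) ∧ l = walk n R r ∨
      ¬ Lay n R (n - (r + 1)) (walk n R r) ∧ Lay n R (n - (r + 1)) l ∧ 0 < R l (walk n R r)) 1 n).2 (by
        by_cases h1 : Lay n R (n - (r + 1)) (walk n R r)
        · exact ⟨_, walk_lt hn r, Or.inl ⟨h1, rfl⟩⟩
        · rw [show n - r = n - (r + 1) + 1 by omega] at hl
          obtain ⟨l, hln, h2, h3⟩ := hl
          refine ⟨l, hln, Or.inr ⟨h1, h2, h3.resolve_left ?_⟩⟩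
          rintro rfl
          exact h1 h2)
    change Lay n R (n - (r + 1)) (walk n R r) ∧ walk n R (r + 1) = walk n R r ∨
      ¬ Lay n R (n - (r + 1)) (walk n R r) ∧ Lay n R (n - (r + 1)) (walk n R (r + 1)) ∧
        0 < R (walk n R (r + 1)) (walk n R r) at key
    rcases key with ⟨h1, h2⟩ | ⟨h1, h2, h3⟩
    · exact ⟨by rwa [h2], Or.inl h2⟩
    · exact ⟨h2, Or.inr ⟨h1, h3⟩⟩
  have hlay : ∀ r ≤ n, Lay n R (n - r) (walk n R r) := by
    intro r
    induction r with
    | zero => exact fun _ => h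
    | succ r ih => exact fun hr => (main r hr (ih (by omega))).1
  exact ⟨rfl, fun r _ => walk_lt hn r, hlay, fun r hr => (main r hr (hlay r hr.le)).2⟩

theorem runs_walk (hn : 1 < n) (hN : n + 1 ≤ N) (hL : Fresh [42, 50, 51, 52] [] L)
    (hK : ∀ s, Knows s L → nE.eval s = n ∧ (∀ u < n, ∀ v < n, s.nat 40 u v = R u v) ∧
      ∀ r < n + 1, ∀ u < n, s.nat 41 r u = bit (Lay n R r u)) (hs : Knows s L) :
    Runs N walkProg s fun s' => Knows s' (.nat 42 (n + 1) 1 (fun r _ => walk n R r) :: L) := by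
  refine runs_tab (N₁ := n + 1) (N₂ := 1) (N₃ := n) (fun _ _ => 1)
    (fun i j l acc => ifElse (0 < i ∧ (Lay n R (n - i) (walk n R (i - 1)) ∧ l = walk n R (i - 1) ∨
      ¬ Lay n R (n - i) (walk n R (i - 1)) ∧ Lay n R (n - i) l ∧ 0 < R l (walk n R (i - 1)))) l acc)
    _ (by norm_num) hL (fun s h => ?_) (by omega) (fun _ _ _ _ _ _ _ _ => rfl)
    (fun s i j l hc hi hj hl hrow _ => ?_) (fun i hi j hj => ?_) hs
  · simp [NExp.eval, (hK s h).1]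
  · refine ifElse_step ?_ hc.hl
    obtain ⟨k1, k2, k3⟩ := hK s hc.knows
    simp only [eval_orB, BExp.eval, eval_eqB, eval_posB, eval_vr, NExp.eval, prevE, hc.hi, hc.hl, k1]
    refine and_congr_right fun h => ?_
    rw [hrow (i - 1) (by omega) 0 one_pos, k3 _ (by omega) _ (walk_lt hn _), k3 _ (by omega) l hl,
      k2 l hl _ (walk_lt hn _), bit_pos, bit_pos]
  · cases i with
    | zero =>
      have : ∀ k, fold (fun l acc => ifElse (0 < 0 ∧ (Lay n R (n - 0) (walk n R (0 - 1)) ∧ l = walk n R (0 - 1) ∨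
        ¬ Lay n R (n - 0) (walk n R (0 - 1)) ∧ Lay n R (n - 0) l ∧ 0 < R l (walk n R (0 - 1)))) l
          acc) 1 k = 1 := by
        intro k
        induction k with
        | zero => rfl
        | succ k ih => rw [fold, ifElse_neg (by simp)]; exact ih
      exact this n
    | succ i =>
      rw [walk]
      congr 1
      funext l acc
      simp

theorem runs_arc (hn : 1 < n) (hN : n + 1 ≤ N) (hL : Fresh [43, 50, 51, 52] [] L)
    (hK : ∀ s, Knows s L → nE.eval s = n ∧ (∀ r < n + 1, ∀ u < n, s.nat 41 r u = bit (Lay n R r u)) ∧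
      ∀ r < n + 1, s.nat 42 r 0 = walk n R r) (hs : Knows s L) :
    Runs N arcProg s fun s' =>
      Knows s' (.nat 43 n n (fun u v => bit (Lay n R n 1 ∧ Arc n (walk n R) u v)) :: L) := by
  refine (runs_tabEx (N₁ := n) (N₂ := n) (N₃ := n) (fun u v r => Lay n R n 1 ∧ walk n R (r + 1) = u ∧
    walk n R r = v ∧ u ≠ v) (by norm_num) hL (fun s h => ?_) (by omega)
    (fun s i j l hc hi hj hl => ?_) hs).mono fun s' h => ?_
  · simp [(hK s h).1]
  · obtain ⟨k1, k2, k3⟩ := hK s hc.knows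
    simp only [BExp.eval, eval_eqB, eval_posB, eval_vr, NExp.eval, hc.hi, hc.hj, hc.hl, k1]
    rw [k2 n n.lt_succ_self 1 hn, k3 _ (by omega), k3 _ (by omega), bit_pos]
  · convert h using 6 with u v
    refine ⟨?_, ?_⟩
    · rintro ⟨h1, r, hr, h2⟩; exact ⟨r, hr, h1, h2⟩
    · rintro ⟨r, hr, h1, h2⟩; exact ⟨h1, r, hr, h2⟩

/-- The residual capacities after one round. -/
def nextResidual (n : ℕ) (R : ℕ → ℕ → ℕ) (u v : ℕ) : ℕ :=
  R u v + bit (Lay n R n 1 ∧ Arc n (walk n R) v u) - bit (Lay n R n 1 ∧ Arc n (walk n R) u v)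

/-- A round augments the flow along a shortest path, if there is one, and changes nothing otherwise. -/
theorem AfterRounds.next {cap : ℕ → ℕ → ℕ} {it : ℕ} (hn : 1 < n) (h : AfterRounds n cap R it) :
    AfterRounds n cap (nextResidual n R) (it + 1) := by
  obtain ⟨val, hval, hR, hv⟩ := h
  by_cases h1 : Lay n R n 1
  · have hv' := hv.resolve_right (not_not.2 h1)
    have := (isWalk_walk hn h1).augment hR
    refine ⟨val + 1, by omega, ?_, Or.inl (by omega)⟩
    convert this using 3 with u v
    simp [nextResidual, h1]
  · have : nextResidual n R = R := by
      funext u v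
      simp [nextResidual, h1, bit]
    rw [this]
    exact ⟨val, by omega, hR, Or.inr h1⟩

theorem runs_round (hn : 1 < n) (hN : n + 1 ≤ N) (hL : Fresh [40, 41, 42, 43, 44, 50, 51, 52] [] L)
    (hK : ∀ s, Knows s L → nE.eval s = n) (hs : Knows s (.nat 40 n n R :: L)) :
    Runs N roundProg s fun s' => Knows s' (.nat 40 n n (nextResidual n R) :: L) := by
  have f : ∀ {W : List ℕ}, W ⊆ [40, 41, 42, 43, 44, 50, 51, 52] → Fresh W [] L :=
    fun hW => Fresh.mono hW hL
  refine Runs.seq (runs_layers (R := R) (L := .nat 40 n n R :: L) hn hN (fresh_cons.2 ⟨by simp [Fact.Off], f (by simp)⟩)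
    (fun s h => ⟨hK s (knows_cons.1 h).2, fun u hu v hv => (knows_cons.1 h).1 u hu v hv⟩) hs) fun s hs => ?_
  refine Runs.seq (runs_walk (R := R) hn hN
    (fresh_cons.2 ⟨by simp [Fact.Off], fresh_cons.2 ⟨by simp [Fact.Off], f (by simp)⟩⟩)
    (fun s h => ?_) hs) fun s hs => ?_
  · simp only [knows_cons] at h
    exact ⟨hK s h.2.2, h.2.1, h.1⟩
  refine Runs.seq (runs_arc (R := R) hn hN (fresh_cons.2 ⟨by simp [Fact.Off],
    fresh_cons.2 ⟨by simp [Fact.Off], fresh_cons.2 ⟨by simp [Fact.Off], f (by simp)⟩⟩⟩)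
    (fun s h => ?_) hs) fun s hs => ?_
  · simp only [knows_cons] at h
    exact ⟨hK s h.2.2.2, h.2.1, fun r hr => h.1 r hr 0 one_pos⟩
  refine Runs.seq (runs_tabVal (N₁ := n) (N₂ := n) (nextResidual n R) (by norm_num)
    (fresh_cons.2 ⟨by simp [Fact.Off], fresh_cons.2 ⟨by simp [Fact.Off], fresh_cons.2 ⟨by simp [Fact.Off],
      fresh_cons.2 ⟨by simp [Fact.Off], f (by simp)⟩⟩⟩⟩) (fun s h => ?_) (by omega)
    (fun s i j h h1 h2 hi hj => ?_) hs) fun s hs => ?_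
  · simp only [knows_cons] at h
    exact ⟨hK s h.2.2.2.2, hK s h.2.2.2.2⟩
  · simp only [knows_cons] at h
    simp only [NExp.eval, eval_vr, h1, h2]
    rw [h.1 i hi j hj, h.1 j hj i hi, h.2.2.2.1 i hi j hj]
    rfl
  have hs' : Knows s (.nat 44 n n (nextResidual n R) :: L) := by
    simp only [knows_cons] at hs ⊢
    exact ⟨hs.1, hs.2.2.2.2.2⟩
  refine (runs_tabVal (N₁ := n) (N₂ := n) (nextResidual n R) (by norm_num)
    (fresh_cons.2 ⟨by simp [Fact.Off], f (by simp)⟩) (fun s h => ?_) (by omega)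
    (fun s i j h h1 h2 hi hj => ?_) hs').mono fun s hs => ?_
  · simp only [knows_cons] at h
    exact ⟨hK s h.2, hK s h.2⟩
  · simp only [knows_cons] at h
    simp only [NExp.eval, eval_vr, h1, h2]
    exact h.1 i hi j hj
  · simp only [knows_cons] at hs ⊢
    exact ⟨hs.1, hs.2.2⟩

/-- Array 41 receives the layers of the residual capacities after `k` augmentations. -/
theorem runs_flow {cap : ℕ → ℕ → ℕ} {k : ℕ} {kE : NExp} (hn : 1 < n) (hN : n + 1 ≤ N) (hk : k ≤ N)
    (hL : Fresh [40, 41, 42, 43, 44, 50, 51, 52, 53] [] L)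
    (hK : ∀ s, Knows s L → nE.eval s = n ∧ kE.eval s = k ∧ ∀ u < n, ∀ v < n, s.nat 35 u v = cap u v)
    (hs : Knows s L) :
    Runs N (flowProg kE) s fun s' => ∃ R, AfterRounds n cap R k ∧
      Knows s' (.nat 41 (n + 1) n (fun r u => bit (Lay n R r u)) :: L) := by
  have f : ∀ {W : List ℕ}, W ⊆ [40, 41, 42, 43, 44, 50, 51, 52, 53] → Fresh W [] L :=
    fun hW => Fresh.mono hW hL
  refine Runs.seq (runs_tabVal (N₁ := n) (N₂ := n) cap (by norm_num) (f (by simp))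
    (fun s h => ⟨(hK s h).1, (hK s h).1⟩) (by omega) (fun s i j h h1 h2 hi hj => ?_) hs) fun s hs => ?_
  · simp only [NExp.eval, eval_vr, h1, h2]
    exact (hK s h).2.2 i hi j hj
  have f' : ∀ R : ℕ → ℕ → ℕ, Fresh [53] [] (.nat 40 n n R :: L) := fun R =>
    fresh_cons.2 ⟨by simp [Fact.Off], f (by simp)⟩
  refine Runs.seq (Runs.forLt (B := k) (fun it s => ∃ R, AfterRounds n cap R it ∧
    Knows s (.nat 40 n n R :: .nat 53 1 1 (fun _ _ => it) :: L)) hk ?_ (fun it s => ?_)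
    (fun it s hit => ?_)) fun s => ?_
  · refine ⟨cap, afterRounds_zero, ?_⟩
    have := hs.setNat (f' cap) (a := 53) (i := 0) (j := 0) (v := 0) (by simp)
    simp only [knows_cons] at this ⊢
    refine ⟨this.1, fun i hi j hj => ?_, this.2⟩
    obtain rfl : i = 0 := by omega
    obtain rfl : j = 0 := by omega
    simp [Mem.setNat]
  · rintro ⟨R, -, h⟩
    simp only [knows_cons] at h
    exact ⟨h.2.1 0 one_pos 0 one_pos, (hK s h.2.2).2.1⟩
  · rintro ⟨R, hR, h⟩
    refine (runs_round (L := .nat 53 1 1 (fun _ _ => it) :: L) hn hN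
      (fresh_cons.2 ⟨by simp [Fact.Off], f (by simp)⟩) (fun s h => (hK s (knows_cons.1 h).2).1) h).mono
      fun s h => ?_
    simp only [knows_cons] at h
    refine ⟨h.2.1 0 one_pos 0 one_pos, nextResidual n R, hR.next hn, ?_⟩
    have := (knows_cons.2 ⟨h.1, h.2.2⟩ : Knows s (_ :: L)).setNat (f' _) (a := 53) (i := 0) (j := 0)
      (v := it + 1) (by simp)
    simp only [knows_cons] at this ⊢
    refine ⟨this.1, fun i hi j hj => ?_, this.2⟩
    obtain rfl : i = 0 := by omega
    obtain rfl : j = 0 := by omega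
    simp [Mem.setNat]
  · rintro ⟨R, hR, h⟩
    simp only [knows_cons] at h
    refine (runs_layers (R := R) (L := .nat 40 n n R :: L) hn hN
      (fresh_cons.2 ⟨by simp [Fact.Off], f (by simp)⟩)
      (fun s h => ⟨(hK s (knows_cons.1 h).2).1, (knows_cons.1 h).1⟩) (knows_cons.2 ⟨h.1, h.2.2⟩)).mono
      fun s h => ⟨R, hR, ?_⟩
    simp only [knows_cons] at h ⊢
    exact ⟨h.1, h.2.2⟩

end

end Flow

/-! ### Geometric tests -/

/-- A pair of expressions for the coordinates of a point. -/
abbrev PExp : Type := RExp × RExp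

/-- The expressions have the coordinates of `P` as values. -/
def PExp.Is (s : Mem) (e : PExp) (P : Plane) : Prop := e.1.eval s = P 0 ∧ e.2.eval s = P 1

/-- The point in row `i` of an array. -/
def rowE (a : ℕ) (i : NExp) : PExp := (.read a i (.const 0), .read a i (.const 1))

/-- The test whether a real number is positive. -/
def posR (e : RExp) : BExp := .realLt (.const 0) e

/-- The test whether a real number is negative. -/
def negR (e : RExp) : BExp := .realLt e (.const 0)

@[simp] theorem eval_posR {e : RExp} {s : Mem} : (posR e).eval s ↔ 0 < e.eval s := by
  simp [posR, BExp.eval, RExp.eval]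

@[simp] theorem eval_negR {e : RExp} {s : Mem} : (negR e).eval s ↔ e.eval s < 0 := by
  simp [negR, BExp.eval, RExp.eval]

/-- The orientation of a triangle. -/
def orientE (p q x : PExp) : RExp :=
  .sub (.mul (.sub p.1 x.1) (.sub q.2 x.2)) (.mul (.sub p.2 x.2) (.sub q.1 x.1))

/-- The test `SweepsPos`. -/
def sweepsB (x p w q : PExp) : BExp :=
  orB (.and (.and (.not (negR (orientE p w x))) (.not (negR (orientE w q x))))
      (orB (posR (orientE p w x)) (posR (orientE w q x))))
    (.and (orB (.and (posR (orientE p w x)) (negR (orientE w q x)))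
      (.and (negR (orientE p w x)) (posR (orientE w q x)))) (posR (orientE p q x)))

/-- The test whether a point lies on a segment. -/
def segB (u v z : PExp) : BExp :=
  .and (.and (.not (posR (orientE u v z))) (.not (negR (orientE u v z))))
    (.and (.not (posR (.mul (.sub z.1 u.1) (.sub z.1 v.1)))) (.not (posR (.mul (.sub z.2 u.2) (.sub z.2 v.2)))))

/-- The test whether the distance of two points is at most `q`. -/
def nearB (q : ℚ) (u v : PExp) : BExp :=
  .not (.realLt (.const (q * q)) (.add (.mul (.sub u.1 v.1) (.sub u.1 v.1)) (.mul (.sub u.2 v.2) (.sub u.2 v.2))))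

section
variable {s : Mem} {p q x w : PExp} {P Q X W : Plane}

theorem eval_orientE (hp : p.Is s P) (hq : q.Is s Q) (hx : x.Is s X) :
    (orientE p q x).eval s = orient P Q X := by
  simp only [orientE, RExp.eval, orient, hp.1, hp.2, hq.1, hq.2, hx.1, hx.2]

theorem eval_sweepsB (hx : x.Is s X) (hp : p.Is s P) (hw : w.Is s W) (hq : q.Is s Q) :
    (sweepsB x p w q).eval s ↔ SweepsPos X P W Q := by
  simp only [sweepsB, eval_orB, BExp.eval, eval_posR, eval_negR, eval_orientE hp hw hx,
    eval_orientE hw hq hx, eval_orientE hp hq hx, SweepsPos, not_lt, and_assoc]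

theorem eval_segB (hp : p.Is s P) (hq : q.Is s Q) (hx : x.Is s X) :
    (segB p q x).eval s ↔ X ∈ segment ℝ P Q := by
  rw [mem_segment_iff]
  simp only [segB, BExp.eval, eval_posR, eval_negR, RExp.eval, eval_orientE hp hq hx, not_lt, hp.1, hp.2,
    hq.1, hq.2, hx.1, hx.2, le_antisymm_iff]

theorem eval_nearB {δ : ℚ} (hp : p.Is s P) (hq : q.Is s Q) :
    (nearB δ p q).eval s ↔ (P 0 - Q 0) ^ 2 + (P 1 - Q 1) ^ 2 ≤ (δ : ℝ) ^ 2 := by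
  simp only [nearB, BExp.eval, RExp.eval, hp.1, hp.2, hq.1, hq.2, not_lt, sq, Rat.cast_mul]

end

section
variable {L : List Fact} {i j l : ℕ} {s : Mem}

theorem Ctx.ei (h : Ctx L i j l s) : (vr 50).eval s = i := h.hi

theorem Ctx.ej (h : Ctx L i j l s) : (vr 51).eval s = j := h.hj

theorem Ctx.el (h : Ctx L i j l s) : (vr 52).eval s = l := h.hl

end

/-- The coordinate with number `a`. -/
def co (P : Plane) (a : ℕ) : ℝ := if a = 0 then P 0 else P 1

theorem rowE_is {s : Mem} {a n : ℕ} {f : ℕ → Plane} {L : List Fact} (h : Knows s L)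
    (hm : Fact.real a n 2 (fun i j => co (f i) j) ∈ L) {e : NExp} {i : ℕ} (he : e.eval s = i) (hi : i < n) :
    (rowE a e).Is s (f i) := by
  constructor
  · simp only [rowE, RExp.eval, NExp.eval, he]
    exact (h.real hm hi two_pos).trans rfl
  · simp only [rowE, RExp.eval, NExp.eval, he]
    exact (h.real hm hi one_lt_two).trans rfl

/-! ### The program: choosing the paths -/

/-- The number of points. -/
def mE : NExp := .read 0 (.const 0) (.const 0)

/-- The number of obstacles. -/
def kE : NExp := .read 0 (.const 0) (.const 1)

/-- The first component of a pair of obstacles. -/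
def fstE (e : NExp) : NExp := .read 12 e (.const 0)

/-- The second component of a pair of obstacles. -/
def sndE (e : NExp) : NExp := .read 13 e (.const 0)

/-- The common point of a pair of obstacles. -/
def witE (e : NExp) : PExp := (.read 2 (fstE e) (sndE e), .read 3 (fstE e) (sndE e))

namespace Inst

variable (D : Inst)

/-- A bound for the sizes of all tables. -/
def size : ℕ := 10 + D.m + D.k + D.k * D.k + D.nB + D.nZ + D.nL + D.nV + D.nV * D.nV + D.nV * D.nV * D.nV +
  D.nP + (D.k + D.nP)

/-- The input. -/
abbrev inputFacts : List Fact :=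
  [.nat 0 1 2 (sizes D.m D.k), .nat 1 D.k D.m (fun i j => bit (D.con i j)),
    .nat 2 D.k D.k (fun i j => bit (D.int i j)), .real 0 D.m 2 (fun i j => co (D.pt i) j),
    .real 1 D.k 2 (fun i j => co (D.ctr i) j), .real 2 D.k D.k (fun i j => D.wit i j 0),
    .real 3 D.k D.k (fun i j => D.wit i j 1)]

/-- The obstacles that contain a point are in array 10. -/
abbrev badFact : Fact := .nat 10 D.k 1 (fun i _ => bit (D.Bad i))
/-- The covered obstacles, whose centres are not net points, are in array 11. -/
abbrev covFact : Fact := .nat 11 D.k 1 (fun i _ => bit (D.Cov i))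
/-- The first indices of the pairs of obstacles are in array 12. -/
abbrev fstFact : Fact := .nat 12 (D.k * D.k) 1 (fun d _ => d / D.k)
/-- The second indices of the pairs of obstacles are in array 13. -/
abbrev sndFact : Fact := .nat 13 (D.k * D.k) 1 (fun d _ => d % D.k)
/-- The number of pairs of obstacles is in variable 60. -/
abbrev kkFact : Fact := .nat 60 1 1 (fun _ _ => D.k * D.k)
/-- The pairs `e` of obstacles usable for the pairs `d` of net points are in array 14. -/
abbrev relFact : Fact := .nat 14 (D.k * D.k) (D.k * D.k) (fun d e => bit (D.Rel d e))
/-- The counts of the points around which the paths sweep a positive angle are in array 15. -/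
abbrev cntFact : Fact := .nat 15 (D.k * D.k) (D.k * D.k) (fun d e => D.cnt d e)
/-- The choices of paths with smallest counts are in array 16. -/
abbrev loFact : Fact := .nat 16 (D.k * D.k) 1 (fun d _ => D.lo d)
/-- The choices of paths with largest counts are in array 17. -/
abbrev hiFact : Fact := .nat 17 (D.k * D.k) 1 (fun d _ => D.hi d)

/-- The pairs of obstacles. -/
abbrev pairFacts : List Fact := D.sndFact :: D.fstFact :: D.kkFact :: D.covFact :: D.badFact :: D.inputFacts

/-- The chosen paths. -/
def pathFacts : List Fact := D.hiFact :: D.loFact :: D.cntFact :: D.relFact :: D.pairFacts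

variable {D} {L : List Fact} {s : Mem} {N : ℕ}

theorem eval_mE (h : Knows s L) (hm : D.inputFacts ⊆ L) : mE.eval s = D.m :=
  (h.nat (hm (by simp : Fact.nat 0 1 2 (sizes D.m D.k) ∈ D.inputFacts)) one_pos two_pos).trans rfl

theorem eval_kE (h : Knows s L) (hm : D.inputFacts ⊆ L) : kE.eval s = D.k :=
  (h.nat (hm (by simp : Fact.nat 0 1 2 (sizes D.m D.k) ∈ D.inputFacts)) one_pos one_lt_two).trans rfl

theorem is_pt (h : Knows s L) (hm : D.inputFacts ⊆ L) {e : NExp} {i : ℕ} (he : e.eval s = i) (hi : i < D.m) :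
    (rowE 0 e).Is s (D.pt i) := rowE_is h (hm (by simp)) he hi

theorem is_ctr (h : Knows s L) (hm : D.inputFacts ⊆ L) {e : NExp} {i : ℕ} (he : e.eval s = i) (hi : i < D.k) :
    (rowE 1 e).Is s (D.ctr i) := rowE_is h (hm (by simp)) he hi

theorem eval_kk (h : Knows s L) (hm : D.pairFacts ⊆ L) : (vr 60).eval s = D.k * D.k :=
  h.nat (hm (by simp) : D.kkFact ∈ L) one_pos one_pos

theorem eval_fstE (h : Knows s L) (hm : D.pairFacts ⊆ L) {e : NExp} {i : ℕ} (he : e.eval s = i)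
    (hi : i < D.k * D.k) : (fstE e).eval s = i / D.k := by
  simp only [fstE, NExp.eval, he]
  exact h.nat (hm (by simp) : D.fstFact ∈ L) hi one_pos

theorem eval_sndE (h : Knows s L) (hm : D.pairFacts ⊆ L) {e : NExp} {i : ℕ} (he : e.eval s = i)
    (hi : i < D.k * D.k) : (sndE e).eval s = i % D.k := by
  simp only [sndE, NExp.eval, he]
  exact h.nat (hm (by simp) : D.sndFact ∈ L) hi one_pos

theorem is_wit (h : Knows s L) (hm : D.pairFacts ⊆ L) {e : NExp} {i : ℕ} (he : e.eval s = i)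
    (hi : i < D.k * D.k) : (witE e).Is s (D.wit (i / D.k) (i % D.k)) := by
  have h1 := div_lt_and_mod_lt hi
  simp only [PExp.Is, witE, RExp.eval, eval_fstE h hm he hi, eval_sndE h hm he hi]
  exact ⟨(h.real (hm (by simp) : Fact.real 2 D.k D.k (fun i j => D.wit i j 0) ∈ L) h1.1 h1.2),
    (h.real (hm (by simp) : Fact.real 3 D.k D.k (fun i j => D.wit i j 1) ∈ L) h1.1 h1.2)⟩

end Inst

/-- Computes for each pair of net points two paths. -/
def pathProg (δ : ℚ) : Prog :=
  .seq (tabEx 10 kE (.const 1) mE (posB (.read 1 (vr 50) (vr 52))))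
  (.seq (tabEx 11 kE (.const 1) kE (.and (.natLt (vr 52) (vr 50))
    (.and (.not (posB (.read 11 (vr 52) (.const 0)))) (nearB δ (rowE 1 (vr 50)) (rowE 1 (vr 52))))))
  (.seq (pairs 12 13 60 kE kE)
  (.seq (tabBit 14 (vr 60) (vr 60)
    (.and (.and (.not (posB (.read 11 (fstE (vr 50)) (.const 0))))
        (.not (posB (.read 11 (sndE (vr 50)) (.const 0)))))
      (.and (.and (nearB δ (rowE 1 (fstE (vr 51))) (rowE 1 (fstE (vr 50))))
        (nearB δ (rowE 1 (sndE (vr 51))) (rowE 1 (sndE (vr 50)))))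
      (.and (.and (.not (posB (.read 10 (fstE (vr 51)) (.const 0))))
        (.not (posB (.read 10 (sndE (vr 51)) (.const 0)))))
      (posB (.read 2 (fstE (vr 51)) (sndE (vr 51))))))))
  (.seq (tab 15 (vr 60) (vr 60) mE (.const 0)
    (sweepsB (rowE 0 (vr 52)) (rowE 1 (fstE (vr 50))) (witE (vr 51)) (rowE 1 (sndE (vr 50))))
    (.add (.read 15 (vr 50) (vr 51)) (.const 1)))
  (.seq (tab 16 (vr 60) (.const 1) (vr 60) (.const 0)
    (.and (posB (.read 14 (vr 50) (vr 52))) (orB (eqB (.read 16 (vr 50) (vr 51)) (.const 0))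
      (.natLt (.read 15 (vr 50) (vr 52)) (.read 15 (vr 50) (.sub (.read 16 (vr 50) (vr 51)) (.const 1))))))
    (.add (vr 52) (.const 1)))
  (tab 17 (vr 60) (.const 1) (vr 60) (.const 0)
    (.and (posB (.read 14 (vr 50) (vr 52))) (orB (eqB (.read 17 (vr 50) (vr 51)) (.const 0))
      (.natLt (.read 15 (vr 50) (.sub (.read 17 (vr 50) (vr 51)) (.const 1))) (.read 15 (vr 50) (vr 52)))))
    (.add (vr 52) (.const 1))))))))

namespace Inst

variable {D : Inst} {s : Mem} {N : ℕ}

/-- The program chooses the net points and the two paths of each pair of net points. -/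
theorem runs_pathProg {δ : ℚ} (hδ : D.δ = δ) (hN : D.size ≤ N) (hs : Knows s D.inputFacts) :
    Runs N (pathProg δ) s fun s' => Knows s' D.pathFacts := by
  unfold size at hN
  refine Runs.seq (P := fun s => Knows s (D.badFact :: D.inputFacts)) (runs_tabEx (N₁ := D.k) (N₂ := 1)
    (N₃ := D.m) (fun i _ l => D.con i l) (by norm_num) (by simp [Fresh, Fact.Off]) (fun s h => ?_) (by omega)
    (fun s i j l hc hi hj hl => ?_) hs) fun s hs => ?_
  · exact ⟨eval_kE h (by simp), rfl, eval_mE h (by simp)⟩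
  · simp only [eval_posB, NExp.eval, eval_vr, hc.hi, hc.hl]
    rw [hc.knows.nat (f := fun i j => bit (D.con i j)) (by simp) hi hl, bit_pos]
  refine Runs.seq (P := fun s => Knows s (D.covFact :: D.badFact :: D.inputFacts)) (runs_tab (N₁ := D.k)
    (N₂ := 1) (N₃ := D.k) (fun _ _ => 0)
    (fun i _ l acc => ifElse (l < i ∧ ¬ D.Cov l ∧ D.Near i l) 1 acc) _ (by norm_num) (by simp [Fresh, Fact.Off])
    (fun s h => ?_) (by omega) (fun _ _ _ _ _ _ _ _ => rfl)
    (fun s i j l hc hi hj hl hrow _ => ifElse_step ?_ rfl) (fun i hi j hj => ?_) hs) fun s hs => ?_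
  · exact ⟨eval_kE h (by simp), rfl, eval_kE h (by simp)⟩
  · simp only [BExp.eval, eval_posB, NExp.eval, eval_vr, hc.hi, hc.hl]
    refine and_congr_right fun h => ?_
    rw [hrow l h 0 one_pos, bit_pos, eval_nearB (is_ctr hc.knows (by simp) hc.ei hi)
      (is_ctr hc.knows (by simp) hc.el hl), Near, hδ]
  · rw [fold_bit fun l => l < i ∧ ¬ D.Cov l ∧ D.Near i l]
    congr 1
    rw [Cov, eq_iff_iff]
    constructor
    · rintro ⟨l, -, h1, h2⟩; exact ⟨l, h1, h2⟩
    · rintro ⟨l, h1, h2⟩; exact ⟨l, h1.trans hi, h1, h2⟩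
  refine Runs.seq (P := fun s => Knows s D.pairFacts) (runs_pairs (by norm_num) (by norm_num) (by norm_num)
    (by norm_num) (by norm_num) (by simp) (by simp [Fresh, Fact.Off]) (fun s h => ?_) (by omega) hs)
    fun s hs => ?_
  · exact ⟨eval_kE h (by simp), eval_kE h (by simp)⟩
  refine Runs.seq (P := fun s => Knows s (D.relFact :: D.pairFacts)) (runs_tabBit (N₁ := D.k * D.k)
    (N₂ := D.k * D.k) (fun d e => D.Rel d e) (by norm_num) (by simp [Fresh, Fact.Off])
    (fun s h => ?_) (by omega) (fun s d e hc hd he => ?_) hs) fun s hs => ?_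
  · exact ⟨eval_kk h (by simp), eval_kk h (by simp)⟩
  · have h1 := div_lt_and_mod_lt hd
    have h2 := div_lt_and_mod_lt he
    have d1 := eval_fstE hc.knows (by simp) hc.ei hd
    have d2 := eval_sndE hc.knows (by simp) hc.ei hd
    have e1 := eval_fstE hc.knows (by simp) hc.ej he
    have e2 := eval_sndE hc.knows (by simp) hc.ej he
    have cov := fun i (hi : i < D.k) =>
      hc.knows.nat (f := fun i _ => bit (D.Cov i)) (n₂ := 1) (a := 11) (by simp) hi one_pos
    have bad := fun i (hi : i < D.k) =>
      hc.knows.nat (f := fun i _ => bit (D.Bad i)) (n₂ := 1) (a := 10) (by simp) hi one_pos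
    have int := hc.knows.nat (f := fun i j => bit (D.int i j)) (a := 2) (by simp) h2.1 h2.2
    simp only [BExp.eval, eval_posB, NExp.eval, eval_nearB (is_ctr hc.knows (by simp) e1 h2.1)
      (is_ctr hc.knows (by simp) d1 h1.1), eval_nearB (is_ctr hc.knows (by simp) e2 h2.2)
      (is_ctr hc.knows (by simp) d2 h1.2)]
    simp only [d1, d2, e1, e2, cov _ h1.1, cov _ h1.2, bad _ h2.1, bad _ h2.2, int, bit_pos]
    rw [Rel, Near, Near, hδ]
  refine Runs.seq (P := fun s => Knows s (D.cntFact :: D.relFact :: D.pairFacts)) (runs_tab_count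
    (N₁ := D.k * D.k) (N₂ := D.k * D.k) (N₃ := D.m) (fun d e j => D.Sw d e j) (by norm_num)
    (by simp [Fresh, Fact.Off]) (fun s h => ?_) (by omega) (fun s d e j hc hd he hj => ?_) hs) fun s hs => ?_
  · exact ⟨eval_kk h (by simp), eval_kk h (by simp), eval_mE h (by simp)⟩
  · have h1 := div_lt_and_mod_lt hd
    exact eval_sweepsB (is_pt hc.knows (by simp) hc.el hj)
      (is_ctr hc.knows (by simp) (eval_fstE hc.knows (by simp) hc.ei hd) h1.1)
      (is_wit hc.knows (by simp) hc.ej he)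
      (is_ctr hc.knows (by simp) (eval_sndE hc.knows (by simp) hc.ei hd) h1.2)
  refine Runs.seq (P := fun s => Knows s (D.loFact :: D.cntFact :: D.relFact :: D.pairFacts)) (runs_tab
    (N₁ := D.k * D.k) (N₂ := 1) (N₃ := D.k * D.k) (fun _ _ => 0)
    (fun d _ e acc => ifElse (D.Rel d e ∧ (acc = 0 ∨ (D.cnt d e : ℤ) < D.cnt d (acc - 1))) (e + 1) acc) _
    (by norm_num) (by simp [Fresh, Fact.Off]) (fun s h => ?_) (by omega) (fun _ _ _ _ _ _ _ _ => rfl)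
    (fun s d j e hc hd hj he _ hacc => ifElse_step ?_ ?_) (fun d hd j hj => rfl) hs) fun s hs => ?_
  · exact ⟨eval_kk h (by simp), rfl, eval_kk h (by simp)⟩
  · have hlt : s.nat 16 d j ≠ 0 → s.nat 16 d j - 1 < D.k * D.k := fun h0 => by
      rw [hacc] at h0 ⊢
      exact ((argMin_spec (D.Rel d) (fun e => (D.cnt d e : ℤ)) e).2 h0).1.trans he
    simp only [BExp.eval, eval_orB, eval_eqB, eval_posB, NExp.eval, eval_vr, hc.hi, hc.hj, hc.hl]
    rw [hc.knows.nat (f := fun d e => bit (D.Rel d e)) (by simp) hd he, bit_pos]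
    refine and_congr_right fun _ => or_congr_right' fun h0 => ?_
    rw [hc.knows.nat (f := fun d e => D.cnt d e) (by simp) hd he,
      hc.knows.nat (f := fun d e => D.cnt d e) (by simp) hd (hlt h0), Nat.cast_lt]
  · simp only [NExp.eval, eval_vr, hc.hl]
  refine runs_tab
    (N₁ := D.k * D.k) (N₂ := 1) (N₃ := D.k * D.k) (fun _ _ => 0)
    (fun d _ e acc => ifElse (D.Rel d e ∧ (acc = 0 ∨ -(D.cnt d e : ℤ) < -D.cnt d (acc - 1))) (e + 1) acc) _
    (by norm_num) (by simp [Fresh, Fact.Off]) (fun s h => ?_) (by omega) (fun _ _ _ _ _ _ _ _ => rfl)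
    (fun s d j e hc hd hj he _ hacc => ifElse_step ?_ ?_) (fun d hd j hj => rfl) hs
  · exact ⟨eval_kk h (by simp), rfl, eval_kk h (by simp)⟩
  · have hlt : s.nat 17 d j ≠ 0 → s.nat 17 d j - 1 < D.k * D.k := fun h0 => by
      rw [hacc] at h0 ⊢
      exact ((argMin_spec (D.Rel d) (fun e => -(D.cnt d e : ℤ)) e).2 h0).1.trans he
    simp only [BExp.eval, eval_orB, eval_eqB, eval_posB, NExp.eval, eval_vr, hc.hi, hc.hj, hc.hl]
    rw [hc.knows.nat (f := fun d e => bit (D.Rel d e)) (by simp) hd he, bit_pos]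
    refine and_congr_right fun _ => or_congr_right' fun h0 => ?_
    rw [hc.knows.nat (f := fun d e => D.cnt d e) (by simp) hd he,
      hc.knows.nat (f := fun d e => D.cnt d e) (by simp) hd (hlt h0), neg_lt_neg_iff, Nat.cast_lt]
  · simp only [NExp.eval, eval_vr, hc.hl]

theorem pair_sub_path : D.pairFacts ⊆ D.pathFacts := by
  intro φ h
  simp only [pathFacts, List.mem_cons]
  exact Or.inr (Or.inr (Or.inr (Or.inr (by simpa using h))))

theorem input_sub_pair : D.inputFacts ⊆ D.pairFacts := by
  intro φ h
  simp only [pairFacts, List.mem_cons]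
  exact Or.inr (Or.inr (Or.inr (Or.inr (Or.inr (by simpa using h)))))

theorem lo_mem_path : D.loFact ∈ D.pathFacts := by simp [pathFacts]

theorem hi_mem_path : D.hiFact ∈ D.pathFacts := by simp [pathFacts]

/-- The natural number arrays 0 to 2, 10 to 17 and 60 and the real arrays 0 to 3 are in use once the paths
are chosen; the bounds leave a margin. -/
theorem fresh_path {W W' : List ℕ} (h : ∀ a ∈ W, (2 < a ∧ a < 10 ∨ 18 ≤ a) ∧ a ≠ 60) (h' : ∀ a ∈ W', 4 ≤ a) :
    Fresh W W' D.pathFacts := by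
  have h1 : ∀ a, ¬ ((2 < a ∧ a < 10 ∨ 18 ≤ a) ∧ a ≠ 60) → a ∉ W := fun a ha hm => ha (h a hm)
  have h2 : ∀ a, ¬ 4 ≤ a → a ∉ W' := fun a ha hm => ha (h' a hm)
  simp only [pathFacts, Fresh, List.forall_mem_cons, Fact.Off, List.not_mem_nil, false_implies, implies_true,
    and_true]
  refine ⟨h1 _ ?_, h1 _ ?_, h1 _ ?_, h1 _ ?_, h1 _ ?_, h1 _ ?_, h1 _ ?_, h1 _ ?_, h1 _ ?_, h1 _ ?_, h1 _ ?_,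
    h1 _ ?_, h2 _ ?_, h2 _ ?_, h2 _ ?_, h2 _ ?_⟩ <;> omega

end Inst

/-! ### The program: the arrangement -/

/-- The number of points in the list `base`. -/
def nBE : NExp := vr 66

/-- The first component of a pair with index `e`, from the list of pairs in array `a`. -/
def pairE (a : ℕ) (e : NExp) : NExp := .read a e (.const 0)

/-- The test whether the second loop variable is `0`. -/
def firstB : BExp := .natLt (vr 51) (.const 1)

/-- Computes the list `base`. -/
def baseProg : Prog :=
  tabReal 4 nBE (.const 2)
    [(.natLt (vr 50) mE, .read 0 (vr 50) (vr 51)),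
      (.natLt (vr 50) (.add mE kE), .read 1 (.sub (vr 50) mE) (vr 51)),
      (firstB, (witE (.sub (.sub (vr 50) mE) kE)).1)] (witE (.sub (.sub (vr 50) mE) kE)).2

/-- Computes the size of the box. -/
def boxProg : Prog :=
  tabReal 5 (.add nBE (.const 1)) (.const 1)
    [(posB (vr 50), .add (.read 5 (.sub (vr 50) (.const 1)) (.const 0))
      (.add (.mul (.read 4 (.sub (vr 50) (.const 1)) (.const 0)) (.read 4 (.sub (vr 50) (.const 1)) (.const 0)))
        (.mul (.read 4 (.sub (vr 50) (.const 1)) (.const 1)) (.read 4 (.sub (vr 50) (.const 1)) (.const 1)))))]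
    (.const 1)

/-- The size of the box. -/
def boxE : RExp := .read 5 nBE (.const 0)

/-- Computes the list `corner`. -/
def cornerProg : Prog :=
  tabReal 6 (.add nBE (.const 4)) (.const 2)
    [(.natLt (vr 50) nBE, .read 4 (vr 50) (vr 51)), (.natLt (vr 50) (.add nBE (.const 1)), boxE),
      (.natLt (vr 50) (.add nBE (.const 2)), .sub (.const 0) boxE),
      (.natLt (vr 50) (.add nBE (.const 3)), .mul (.const 2) boxE)] (.sub (.const 0) (.mul (.const 2) boxE))

/-- The length of the list `corner`. -/
def nCE : NExp := .add nBE (.const 4)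

/-- Computes the list `site`. -/
def siteProg : Prog :=
  tabReal 7 (vr 61) (.const 2)
    [(.natLt (vr 50) nCE, .read 6 (vr 50) (vr 51)),
      (.and (.natLt (vr 50) (.add nCE nCE)) firstB, .add (.read 6 (.sub (vr 50) nCE) (.const 0)) (.const 1)),
      (.natLt (vr 50) (.add nCE nCE), .read 6 (.sub (vr 50) nCE) (.const 1)),
      (firstB, .read 6 (.sub (.sub (vr 50) nCE) nCE) (.const 0))]
    (.add (.read 6 (.sub (.sub (vr 50) nCE) nCE) (.const 1)) (.const 1))

/-- A coordinate of the first site on a line. -/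
def siteU (j : ℕ) : RExp := .read 7 (pairE 20 (vr 50)) (.const j)

/-- A coordinate of the second site on a line. -/
def siteV (j : ℕ) : RExp := .read 7 (pairE 21 (vr 50)) (.const j)

/-- Computes the lines. -/
def lineProg : Prog :=
  tabReal 8 (vr 62) (.const 3)
    [(firstB, .sub (siteU 1) (siteV 1)), (.natLt (vr 51) (.const 2), .sub (siteV 0) (siteU 0))]
    (.sub (.mul (siteU 0) (siteV 1)) (.mul (siteU 1) (siteV 0)))

/-- A coefficient of the first line through a vertex. -/
def lineU (j : ℕ) : RExp := .read 8 (pairE 22 (vr 50)) (.const j)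

/-- A coefficient of the second line through a vertex. -/
def lineV (j : ℕ) : RExp := .read 8 (pairE 23 (vr 50)) (.const j)

/-- Computes the vertices. -/
def vertexProg : Prog :=
  tabReal 9 (vr 63) (.const 2)
    [(firstB, .div (.sub (.mul (lineU 1) (lineV 2)) (.mul (lineV 1) (lineU 2)))
      (.sub (.mul (lineU 0) (lineV 1)) (.mul (lineV 0) (lineU 1))))]
    (.div (.sub (.mul (lineU 2) (lineV 0)) (.mul (lineV 2) (lineU 0)))
      (.sub (.mul (lineU 0) (lineV 1)) (.mul (lineV 0) (lineU 1))))

/-- Computes the sums of two vertices. -/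
def sumProg : Prog :=
  tabReal 10 (vr 64) (.const 2) []
    (.add (.read 9 (pairE 24 (vr 50)) (vr 51)) (.read 9 (pairE 25 (vr 50)) (vr 51)))

/-- Computes the points of the network. -/
def posProg : Prog :=
  tabReal 11 (vr 67) (.const 2) [(.natLt (vr 50) mE, .read 0 (vr 50) (vr 51))]
    (.mul (.const (1 / 3)) (.add (.read 10 (pairE 26 (.sub (vr 50) mE)) (vr 51))
      (.read 9 (pairE 27 (.sub (vr 50) mE)) (vr 51))))

/-- Sets a scalar variable. -/
def setVar (a : ℕ) (e : NExp) : Prog := .setNat a (.const 0) (.const 0) e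

/-- Computes the arrangement and the points of the network. -/
def arrangementProg : Prog :=
  .seq (.seq (setVar 66 (.add (.add mE kE) (vr 60))) (.seq baseProg (.seq boxProg cornerProg)))
  (.seq (.seq (setVar 61 (.add (.add nCE nCE) nCE)) (.seq siteProg (pairs 20 21 62 (vr 61) (vr 61))))
  (.seq (.seq lineProg (pairs 22 23 63 (vr 62) (vr 62)))
  (.seq (.seq vertexProg (pairs 24 25 64 (vr 63) (vr 63)))
  (.seq (.seq sumProg (pairs 26 27 65 (vr 64) (vr 63))) (.seq (setVar 67 (.add mE (vr 65))) posProg)))))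

/-- The coefficients of a line. -/
def lineCo (l : Line) (j : ℕ) : ℝ := if j = 0 then l.1 else if j = 1 then l.2.1 else l.2.2

section
variable {L L' : List Fact} {s : Mem}

theorem eval_scalar {a v : ℕ} (h : Knows s L) (hm : Fact.nat a 1 1 (fun _ _ => v) ∈ L) :
    (vr a).eval s = v := h.nat hm one_pos one_pos

theorem Fresh.append {W W' : List ℕ} (h : Fresh W W' L) (h' : Fresh W W' L') : Fresh W W' (L ++ L') :=
  fun φ hφ => (List.mem_append.1 hφ).elim (h φ) (h' φ)

theorem Knows.tail (h : Knows s (L ++ L')) : Knows s L' := h.sub (List.subset_append_right _ _)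

end

namespace Inst

variable (D : Inst)

/-- The number of points in the list `base` is in variable 66. -/
def nBFact : Fact := .nat 66 1 1 (fun _ _ => D.nB)
/-- The list `base` is in array 4. -/
def baseFact : Fact := .real 4 D.nB 2 (fun i j => co (D.base i) j)
/-- The partial sums that bound the coordinates are in array 5. -/
def boxFact : Fact := .real 5 (D.nB + 1) 1 (fun i _ => D.boxSum i)
/-- The list `corner` is in array 6. -/
def cornerFact : Fact := .real 6 (D.nB + 4) 2 (fun i j => co (D.corner i) j)
/-- The number of sites is in variable 61. -/
def nZFact : Fact := .nat 61 1 1 (fun _ _ => D.nZ)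
/-- The sites are in array 7. -/
def siteFact : Fact := .real 7 D.nZ 2 (fun i j => co (D.site i) j)
/-- The coefficients of the lines are in array 8. -/
def lineFact : Fact := .real 8 D.nL 3 (fun l j => lineCo (D.line l) j)
/-- The vertices are in array 9. -/
def vertexFact : Fact := .real 9 D.nV 2 (fun v j => co (D.vertex v) j)
/-- The sums of two vertices are in array 10. -/
def sumFact : Fact := .real 10 (D.nV * D.nV) 2 (fun v j => co (D.vertexSum v) j)
/-- The number of points of the network is in variable 67. -/
def nPFact : Fact := .nat 67 1 1 (fun _ _ => D.nP)
/-- The points of the network are in array 11. -/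
def posFact : Fact := .real 11 D.nP 2 (fun q j => co (D.pos q) j)

/-- The first components of the pairs of numbers below `n₁` and `n₂`. -/
def fstList (a n₁ n₂ : ℕ) : Fact := .nat a (n₁ * n₂) 1 (fun d _ => d / n₂)

/-- The second components of the pairs of numbers below `n₁` and `n₂`. -/
def sndList (b n₁ n₂ : ℕ) : Fact := .nat b (n₁ * n₂) 1 (fun d _ => d % n₂)

/-- The value of a scalar variable. -/
def scalar (c n : ℕ) : Fact := .nat c 1 1 (fun _ _ => n)

/-- The state of the memory once the list `corner` is known. -/
def cornerFacts : List Fact := [D.cornerFact, D.boxFact, D.baseFact, D.nBFact] ++ D.pathFacts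

/-- The state of the memory once the sites are known. -/
def siteFacts : List Fact :=
  [sndList 21 D.nZ D.nZ, fstList 20 D.nZ D.nZ, scalar 62 D.nL, D.siteFact, D.nZFact] ++ D.cornerFacts

/-- The state of the memory once the lines are known. -/
def lineFacts : List Fact :=
  [sndList 23 D.nL D.nL, fstList 22 D.nL D.nL, scalar 63 D.nV, D.lineFact] ++ D.siteFacts

/-- The state of the memory once the vertices are known. -/
def vertexFacts : List Fact :=
  [sndList 25 D.nV D.nV, fstList 24 D.nV D.nV, scalar 64 (D.nV * D.nV), D.vertexFact] ++ D.lineFacts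

/-- The state of the memory once the sums of two vertices are known. -/
def sumFacts : List Fact :=
  [sndList 27 (D.nV * D.nV) D.nV, fstList 26 (D.nV * D.nV) D.nV, scalar 65 (D.nV * D.nV * D.nV), D.sumFact] ++
    D.vertexFacts

/-- The points of the network. -/
def posFacts : List Fact := [D.posFact, D.nPFact] ++ D.sumFacts

variable {D} {L L' : List Fact} {s : Mem} {N : ℕ}

theorem input_sub_path : D.inputFacts ⊆ D.pathFacts := List.Subset.trans input_sub_pair pair_sub_path

theorem runs_corner (hN : D.size ≤ N) (hs : Knows s D.pathFacts) :
    Runs N (.seq (setVar 66 (.add (.add mE kE) (vr 60))) (.seq baseProg (.seq boxProg cornerProg))) s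
      fun s' => Knows s' D.cornerFacts := by
  unfold size at hN
  refine Runs.seq (P := fun s => Knows s ([D.nBFact] ++ D.pathFacts)) (runs_set
    (fresh_path (by simp) (by simp)) (fun s h => ?_) hs) fun s hs => ?_
  · simp only [NExp.eval, eval_mE h input_sub_path, eval_kE h input_sub_path, eval_kk h pair_sub_path, nB]
  refine Runs.seq (P := fun s => Knows s ([D.baseFact, D.nBFact] ++ D.pathFacts)) (runs_tabReal
    (N₁ := D.nB) (N₂ := 2) _ (Fresh.append (by simp [Fresh, Fact.Off, nBFact]) (fresh_path (by simp) (by simp)))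
    (fun s h => ⟨eval_scalar h (by simp : D.nBFact ∈ _), rfl⟩) (by omega)
    (fun s i j h h1 h2 hi hj _ => ?_) hs) fun s hs => ?_
  · have hp := h.tail
    have hm := eval_mE hp input_sub_path
    have hk := eval_kE hp input_sub_path
    simp only [selectEval, List.foldr, BExp.eval, NExp.eval, eval_vr, hm, hk, h1, firstB]
    rw [base]
    split_ifs with a1 a2 a3
    · simp only [RExp.eval, eval_vr, h1, h2]
      exact hp.real (f := fun i j => co (D.pt i) j) (input_sub_path (by simp)) a1 hj
    · simp only [RExp.eval, NExp.eval, eval_vr, h1, h2, hm]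
      exact hp.real (f := fun i j => co (D.ctr i) j) (n₁ := D.k) (input_sub_path (by simp)) (by omega) hj
    · have hw := is_wit hp pair_sub_path (e := .sub (.sub (vr 50) mE) kE) (i := i - D.m - D.k)
        (by simp only [NExp.eval, eval_vr, hm, hk, h1]) (by unfold nB at hi; omega)
      rw [hw.1, co, if_pos (by omega)]
    · have hw := is_wit hp pair_sub_path (e := .sub (.sub (vr 50) mE) kE) (i := i - D.m - D.k)
        (by simp only [NExp.eval, eval_vr, hm, hk, h1]) (by unfold nB at hi; omega)
      rw [hw.2, co, if_neg (by omega)]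
  refine Runs.seq (P := fun s => Knows s ([D.boxFact, D.baseFact, D.nBFact] ++ D.pathFacts)) (runs_tabReal
    (N₁ := D.nB + 1) (N₂ := 1) _
    (Fresh.append (by simp [Fresh, Fact.Off, nBFact, baseFact]) (fresh_path (by simp) (by simp)))
    (fun s h => ⟨?_, rfl⟩) (by omega) (fun s i j h h1 h2 hi hj hrow => ?_) hs) fun s hs => ?_
  · simp only [NExp.eval, nBE, eval_scalar h (by simp : D.nBFact ∈ _)]
  · simp only [selectEval, List.foldr, eval_posB, eval_vr, h1]
    cases i with
    | zero => rw [if_neg (lt_irrefl 0)]; simp [RExp.eval, boxSum]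
    | succ i =>
      have hb := fun j hj => h.real (by simp : D.baseFact ∈ _) (i := i) (j := j) (by omega) hj
      rw [if_pos i.succ_pos]
      simp only [RExp.eval, NExp.eval, eval_vr, h1, Nat.add_sub_cancel]
      rw [hrow i i.lt_succ_self 0 one_pos, hb 0 two_pos, hb 1 one_lt_two]
      rfl
  refine runs_tabReal (N₁ := D.nB + 4) (N₂ := 2) _
    (Fresh.append (by simp [Fresh, Fact.Off, nBFact, baseFact, boxFact]) (fresh_path (by simp) (by simp)))
    (fun s h => ⟨?_, rfl⟩) (by omega) (fun s i j h h1 h2 hi hj hrow => ?_) hs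
  · simp only [NExp.eval, nBE, eval_scalar h (by simp : D.nBFact ∈ _)]
  · have hn : s.nat 66 0 0 = D.nB := eval_scalar h (by simp : D.nBFact ∈ _)
    have hb : boxE.eval s = D.box := by
      simp only [boxE, RExp.eval, NExp.eval, nBE, eval_vr, hn]
      exact h.real (by simp : D.boxFact ∈ _) D.nB.lt_succ_self one_pos
    simp only [selectEval, List.foldr, BExp.eval, NExp.eval, eval_vr, nBE, hn, h1, h2, RExp.eval, hb]
    have hb := fun hi => h.real (by simp : D.baseFact ∈ _) (i := i) hi hj
    rw [corner]
    split_ifs with a1 a2 a3 a4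
    · exact hb a1
    all_goals
      obtain rfl | rfl : j = 0 ∨ j = 1 := by omega
      all_goals simp [co]

theorem path_sub_corner : D.pathFacts ⊆ D.cornerFacts := List.subset_append_right _ _

theorem corner_sub_site : D.cornerFacts ⊆ D.siteFacts := List.subset_append_right _ _

theorem site_sub_line : D.siteFacts ⊆ D.lineFacts := List.subset_append_right _ _

theorem line_sub_vertex : D.lineFacts ⊆ D.vertexFacts := List.subset_append_right _ _

theorem vertex_sub_sum : D.vertexFacts ⊆ D.sumFacts := List.subset_append_right _ _

theorem sum_sub_pos : D.sumFacts ⊆ D.posFacts := List.subset_append_right _ _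

theorem fresh_corner {W W' : List ℕ} (h : ∀ a ∈ W, (a = 9 ∨ 18 ≤ a) ∧ a ≠ 60 ∧ a ≠ 66) (h' : ∀ a ∈ W', 7 ≤ a) :
    Fresh W W' D.cornerFacts := by
  refine Fresh.append ?_ (fresh_path (fun a ha => by have := h a ha; omega) fun a ha => by linarith [h' a ha])
  simp only [Fresh, List.forall_mem_cons, List.not_mem_nil, false_implies, implies_true, and_true]
  exact ⟨fun hm => absurd (h' _ hm) (by norm_num), fun hm => absurd (h' _ hm) (by norm_num),
    fun hm => absurd (h' _ hm) (by norm_num), fun hm => (h _ hm).2.2 rfl⟩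

theorem runs_site (hN : D.size ≤ N) (hs : Knows s D.cornerFacts) :
    Runs N (.seq (setVar 61 (.add (.add nCE nCE) nCE)) (.seq siteProg (pairs 20 21 62 (vr 61) (vr 61)))) s
      fun s' => Knows s' D.siteFacts := by
  unfold size at hN
  have hL : D.nL = D.nZ * D.nZ := rfl
  have hnB : ∀ {s}, Knows s D.cornerFacts → s.nat 66 0 0 = D.nB := fun h =>
    eval_scalar h (by simp [cornerFacts] : D.nBFact ∈ _)
  refine Runs.seq (P := fun s => Knows s ([D.nZFact] ++ D.cornerFacts)) (runs_set
    (fresh_corner (by simp) (by simp)) (fun s h => ?_) hs) fun s hs => ?_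
  · simp only [nCE, NExp.eval, nBE, eval_vr, hnB h, nZ]
  refine Runs.seq (P := fun s => Knows s ([D.siteFact, D.nZFact] ++ D.cornerFacts)) (runs_tabReal
    (N₁ := D.nZ) (N₂ := 2) _
    (Fresh.append (by simp [Fresh, Fact.Off, nZFact]) (fresh_corner (by simp) (by simp)))
    (fun s h => ⟨eval_scalar h (by simp : D.nZFact ∈ _), rfl⟩) (by omega)
    (fun s i j h h1 h2 hi hj _ => ?_) hs) fun s hs => ?_
  · have hc := fun i j hi hj => h.tail.real (by simp [cornerFacts] : D.cornerFact ∈ _) (i := i) (j := j) hi hj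
    simp only [selectEval, List.foldr, BExp.eval, NExp.eval, eval_vr, nCE, nBE, hnB h.tail, h1, h2, RExp.eval,
      firstB, Nat.lt_one_iff, Rat.cast_one]
    unfold nZ at hi
    rw [site]
    by_cases a1 : i < D.nB + 4
    · rw [if_pos a1, if_pos a1]
      exact hc i j a1 hj
    rw [if_neg a1, if_neg a1]
    by_cases a2 : i < D.nB + 4 + (D.nB + 4)
    · rw [if_pos a2, hc _ 0 (by omega) two_pos, hc _ 1 (by omega) one_lt_two]
      obtain rfl | rfl : j = 0 ∨ j = 1 := by omega
      · simp [a2, co]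
      · simp [a2, co]
    · rw [if_neg a2, hc (i - (D.nB + 4) - (D.nB + 4)) 0 (by omega) two_pos,
        hc (i - (D.nB + 4) - (D.nB + 4)) 1 (by omega) one_lt_two]
      obtain rfl | rfl : j = 0 ∨ j = 1 := by omega
      · simp [a2, co]
      · simp [a2, co]
  refine runs_pairs (by norm_num) (by norm_num) (by norm_num) (by norm_num) (by norm_num) (by simp)
    (Fresh.append (by simp [Fresh, Fact.Off, nZFact, siteFact]) (fresh_corner (by simp) (by simp)))
    (fun s h => ?_) (by omega) hs
  exact ⟨eval_scalar h (by simp : D.nZFact ∈ _), eval_scalar h (by simp : D.nZFact ∈ _)⟩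

theorem fresh_site {W W' : List ℕ} (h : ∀ a ∈ W, (a = 9 ∨ 22 ≤ a) ∧ a ≠ 60 ∧ a ≠ 61 ∧ a ≠ 62 ∧ a ≠ 66)
    (h' : ∀ a ∈ W', 8 ≤ a) : Fresh W W' D.siteFacts := by
  refine Fresh.append ?_ (fresh_corner (fun a ha => ⟨by have := h a ha; omega, (h a ha).2.1, (h a ha).2.2.2.2⟩)
    fun a ha => by linarith [h' a ha])
  simp only [Fresh, List.forall_mem_cons, List.not_mem_nil, false_implies, implies_true, and_true]
  exact ⟨fun hm => absurd (h _ hm).1 (by norm_num), fun hm => absurd (h _ hm).1 (by norm_num),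
    fun hm => (h _ hm).2.2.2.1 rfl, fun hm => absurd (h' _ hm) (by norm_num), fun hm => (h _ hm).2.2.1 rfl⟩

theorem eval_pairE {a n₁ n₂ i : ℕ} {e : NExp} (h : Knows s L) (hm : fstList a n₁ n₂ ∈ L) (he : e.eval s = i)
    (hi : i < n₁ * n₂) : (pairE a e).eval s = i / n₂ := by
  simp only [pairE, NExp.eval, he]
  exact h.nat hm hi one_pos

theorem eval_pairE' {a n₁ n₂ i : ℕ} {e : NExp} (h : Knows s L) (hm : sndList a n₁ n₂ ∈ L) (he : e.eval s = i)
    (hi : i < n₁ * n₂) : (pairE a e).eval s = i % n₂ := by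
  simp only [pairE, NExp.eval, he]
  exact h.nat hm hi one_pos

theorem runs_line (hN : D.size ≤ N) (hs : Knows s D.siteFacts) :
    Runs N (.seq lineProg (pairs 22 23 63 (vr 62) (vr 62))) s fun s' => Knows s' D.lineFacts := by
  unfold size at hN
  have hV : D.nV = D.nL * D.nL := rfl
  have hn : ∀ {s}, Knows s D.siteFacts → (vr 62).eval s = D.nL := fun h =>
    eval_scalar h (by simp [siteFacts] : scalar 62 D.nL ∈ _)
  refine Runs.seq (P := fun s => Knows s ([D.lineFact] ++ D.siteFacts)) (runs_tabReal
    (N₁ := D.nL) (N₂ := 3) _ (fresh_site (by simp) (by simp))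
    (fun s h => ⟨hn h, rfl⟩) (by omega) (fun s i j h h1 h2 hi hj _ => ?_) hs) fun s hs => ?_
  · have hd := div_lt_and_mod_lt (show i < D.nZ * D.nZ from hi)
    have hc := fun i j hi hj => h.real (by simp [siteFacts] : D.siteFact ∈ _) (i := i) (j := j) hi hj
    have e1 := eval_pairE h (by simp [siteFacts] : fstList 20 D.nZ D.nZ ∈ _) (e := vr 50) h1 hi
    have e2 := eval_pairE' h (by simp [siteFacts] : sndList 21 D.nZ D.nZ ∈ _) (e := vr 50) h1 hi
    simp only [selectEval, List.foldr, BExp.eval, NExp.eval, eval_vr, h2, RExp.eval, siteU, siteV, e1, e2,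
      firstB, hc _ 0 hd.1 two_pos, hc _ 1 hd.1 one_lt_two, hc _ 0 hd.2 two_pos, hc _ 1 hd.2 one_lt_two]
    obtain rfl | rfl | rfl : j = 0 ∨ j = 1 ∨ j = 2 := by omega
    all_goals simp [lineCo, line, lineThrough, co]
  refine runs_pairs (by norm_num) (by norm_num) (by norm_num) (by norm_num) (by norm_num) (by simp)
    (Fresh.append (by simp [Fresh, Fact.Off, lineFact]) (fresh_site (by simp) (by simp)))
    (fun s h => ⟨hn h.tail, hn h.tail⟩) (by omega) hs

theorem fresh_line {W W' : List ℕ}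
    (h : ∀ a ∈ W, (a = 9 ∨ 24 ≤ a) ∧ a ≠ 60 ∧ a ≠ 61 ∧ a ≠ 62 ∧ a ≠ 66 ∧ a ≠ 63)
    (h' : ∀ a ∈ W', 9 ≤ a) : Fresh W W' D.lineFacts := by
  refine Fresh.append ?_ (fresh_site (fun a ha => ?_) fun a ha => by linarith [h' a ha])
  · simp only [Fresh, List.forall_mem_cons, List.not_mem_nil, false_implies, implies_true, and_true]
    exact ⟨fun hm => absurd (h _ hm).1 (by norm_num), fun hm => absurd (h _ hm).1 (by norm_num),
      fun hm => (h _ hm).2.2.2.2.2 rfl, fun hm => absurd (h' _ hm) (by norm_num)⟩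
  · have := h a ha; omega

theorem runs_vertex (hN : D.size ≤ N) (hs : Knows s D.lineFacts) :
    Runs N (.seq vertexProg (pairs 24 25 64 (vr 63) (vr 63))) s fun s' => Knows s' D.vertexFacts := by
  unfold size at hN
  have hn : ∀ {s}, Knows s D.lineFacts → (vr 63).eval s = D.nV := fun h =>
    eval_scalar h (by simp [lineFacts] : scalar 63 D.nV ∈ _)
  refine Runs.seq (P := fun s => Knows s ([D.vertexFact] ++ D.lineFacts)) (runs_tabReal
    (N₁ := D.nV) (N₂ := 2) _ (fresh_line (by simp) (by simp))
    (fun s h => ⟨hn h, rfl⟩) (by omega) (fun s i j h h1 h2 hi hj _ => ?_) hs) fun s hs => ?_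
  · have hd := div_lt_and_mod_lt (show i < D.nL * D.nL from hi)
    have hc := fun i j hi hj => h.real (by simp [lineFacts] : D.lineFact ∈ _) (i := i) (j := j) hi hj
    have e1 := eval_pairE h (by simp [lineFacts] : fstList 22 D.nL D.nL ∈ _) (e := vr 50) h1 hi
    have e2 := eval_pairE' h (by simp [lineFacts] : sndList 23 D.nL D.nL ∈ _) (e := vr 50) h1 hi
    simp only [selectEval, List.foldr, BExp.eval, NExp.eval, eval_vr, h2, RExp.eval, lineU, lineV, e1, e2,
      firstB, hc _ 0 hd.1 (by norm_num), hc _ 1 hd.1 (by norm_num), hc _ 2 hd.1 (by norm_num),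
      hc _ 0 hd.2 (by norm_num), hc _ 1 hd.2 (by norm_num), hc _ 2 hd.2 (by norm_num)]
    obtain rfl | rfl : j = 0 ∨ j = 1 := by omega
    all_goals simp [lineCo, vertex, Line.meet, co]
  refine runs_pairs (by norm_num) (by norm_num) (by norm_num) (by norm_num) (by norm_num) (by simp)
    (Fresh.append (by simp [Fresh, Fact.Off, vertexFact]) (fresh_line (by simp) (by simp)))
    (fun s h => ⟨hn h.tail, hn h.tail⟩) (by omega) hs

theorem fresh_vertex {W W' : List ℕ}
    (h : ∀ a ∈ W, (a = 9 ∨ 26 ≤ a) ∧ (a < 60 ∨ 64 < a) ∧ a ≠ 66)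
    (h' : ∀ a ∈ W', 10 ≤ a) : Fresh W W' D.vertexFacts := by
  refine Fresh.append ?_ (fresh_line (fun a ha => ?_) fun a ha => by linarith [h' a ha])
  · simp only [Fresh, List.forall_mem_cons, List.not_mem_nil, false_implies, implies_true, and_true]
    exact ⟨fun hm => absurd (h _ hm) (by norm_num), fun hm => absurd (h _ hm) (by norm_num),
      fun hm => absurd (h _ hm) (by norm_num), fun hm => absurd (h' _ hm) (by norm_num)⟩
  · have := h a ha; omega

theorem runs_sum (hN : D.size ≤ N) (hs : Knows s D.vertexFacts) :
    Runs N (.seq sumProg (pairs 26 27 65 (vr 64) (vr 63))) s fun s' => Knows s' D.sumFacts := by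
  unfold size at hN
  have hn : ∀ {s}, Knows s D.vertexFacts → (vr 64).eval s = D.nV * D.nV := fun h =>
    eval_scalar h (by simp [vertexFacts] : scalar 64 (D.nV * D.nV) ∈ _)
  have hn' : ∀ {s}, Knows s D.vertexFacts → (vr 63).eval s = D.nV := fun h =>
    eval_scalar (h.sub line_sub_vertex) (by simp [lineFacts] : scalar 63 D.nV ∈ _)
  refine Runs.seq (P := fun s => Knows s ([D.sumFact] ++ D.vertexFacts)) (runs_tabReal
    (N₁ := D.nV * D.nV) (N₂ := 2) _ (fresh_vertex (by simp) (by simp))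
    (fun s h => ⟨hn h, rfl⟩) (by omega) (fun s i j h h1 h2 hi hj _ => ?_) hs) fun s hs => ?_
  · have hd := div_lt_and_mod_lt hi
    have hc := fun i hi => h.real (by simp [vertexFacts] : D.vertexFact ∈ _) (i := i) hi hj
    have e1 := eval_pairE h (by simp [vertexFacts] : fstList 24 D.nV D.nV ∈ _) (e := vr 50) h1 hi
    have e2 := eval_pairE' h (by simp [vertexFacts] : sndList 25 D.nV D.nV ∈ _) (e := vr 50) h1 hi
    simp only [selectEval, List.foldr, eval_vr, h2, RExp.eval, e1, e2, hc _ hd.1, hc _ hd.2]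
    obtain rfl | rfl : j = 0 ∨ j = 1 := by omega
    all_goals simp [vertexSum, co]
  refine runs_pairs (by norm_num) (by norm_num) (by norm_num) (by norm_num) (by norm_num) (by simp)
    (Fresh.append (by simp [Fresh, Fact.Off, sumFact]) (fresh_vertex (by simp) (by simp)))
    (fun s h => ⟨hn h.tail, hn' h.tail⟩) (by omega) hs

theorem fresh_sum {W W' : List ℕ}
    (h : ∀ a ∈ W, (a = 9 ∨ 28 ≤ a) ∧ (a < 60 ∨ 66 < a))
    (h' : ∀ a ∈ W', 11 ≤ a) : Fresh W W' D.sumFacts := by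
  refine Fresh.append ?_ (fresh_vertex (fun a ha => ?_) fun a ha => by linarith [h' a ha])
  · simp only [Fresh, List.forall_mem_cons, List.not_mem_nil, false_implies, implies_true, and_true]
    exact ⟨fun hm => absurd (h _ hm) (by norm_num), fun hm => absurd (h _ hm) (by norm_num),
      fun hm => absurd (h _ hm) (by norm_num), fun hm => absurd (h' _ hm) (by norm_num)⟩
  · have := h a ha; omega

theorem input_sub_sum : D.inputFacts ⊆ D.sumFacts :=
  fun _ h => vertex_sub_sum (line_sub_vertex (site_sub_line (corner_sub_site (path_sub_corner
    (input_sub_path h)))))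

theorem runs_pos (hN : D.size ≤ N) (hs : Knows s D.sumFacts) :
    Runs N (.seq (setVar 67 (.add mE (vr 65))) posProg) s fun s' => Knows s' D.posFacts := by
  unfold size at hN
  refine Runs.seq (P := fun s => Knows s ([D.nPFact] ++ D.sumFacts)) (runs_set
    (fresh_sum (by simp) (by simp)) (fun s h => ?_) hs) fun s hs => ?_
  · simp only [NExp.eval, eval_mE h input_sub_sum,
      eval_scalar h (by simp [sumFacts] : scalar 65 (D.nV * D.nV * D.nV) ∈ _), nP]
  refine runs_tabReal (N₁ := D.nP) (N₂ := 2) _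
    (Fresh.append (by simp [Fresh, Fact.Off, nPFact]) (fresh_sum (by simp) (by simp)))
    (fun s h => ⟨eval_scalar h (by simp : D.nPFact ∈ _), rfl⟩) (by omega)
    (fun s i j h h1 h2 hi hj _ => ?_) hs
  have ht := h.tail
  have hm := eval_mE ht input_sub_sum
  simp only [selectEval, List.foldr, BExp.eval, eval_vr, hm, h1, h2, RExp.eval]
  rw [pos]
  split_ifs with a1
  · exact ht.real (f := fun i j => co (D.pt i) j) (input_sub_sum (by simp)) a1 hj
  · have hi' : i - D.m < D.nV * D.nV * D.nV := by unfold nP at hi; omega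
    have hd := div_lt_and_mod_lt hi'
    have he : (NExp.sub (vr 50) mE).eval s = i - D.m := by simp only [NExp.eval, eval_vr, hm, h1]
    have e1 := eval_pairE ht (by simp [sumFacts] : fstList 26 (D.nV * D.nV) D.nV ∈ _) he hi'
    have e2 := eval_pairE' ht (by simp [sumFacts] : sndList 27 (D.nV * D.nV) D.nV ∈ _) he hi'
    rw [e1, e2, ht.real (by simp [sumFacts] : D.sumFact ∈ _) hd.1 hj,
      (ht.sub vertex_sub_sum).real (by simp [vertexFacts] : D.vertexFact ∈ _) hd.2 hj]
    obtain rfl | rfl : j = 0 ∨ j = 1 := by omega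
    all_goals simp [co, mul_add]

/-- The program computes the points of the network. -/
theorem runs_arrangement (hN : D.size ≤ N) (hs : Knows s D.pathFacts) :
    Runs N arrangementProg s fun s' => Knows s' D.posFacts :=
  (runs_corner hN hs).seq fun _ h => (runs_site hN h).seq fun _ h => (runs_line hN h).seq fun _ h =>
    (runs_vertex hN h).seq fun _ h => (runs_sum hN h).seq fun _ h => runs_pos hN h

end Inst

/-! ### The network as a graph with capacities -/

namespace Network

variable (N : Network)

/-- The number of the first node that stands for a point.  The nodes are the source `0`, the sink `1`, for each of
the sets `P a` an entry `2 + a` and an exit `2 + k + a`, and the points. -/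
def off : ℕ := 2 + N.k + N.k

/-- The number of nodes. -/
def nodes : ℕ := N.off + N.n

/-- The arcs of infinite capacity. -/
def InfArc (u v : ℕ) : Prop :=
  (u = 0 ∧ N.off ≤ v ∧ v - N.off < N.m) ∨
  (v = 1 ∧ N.off ≤ u ∧ N.Outer (u - N.off)) ∨
  (N.off ≤ u ∧ (2 ≤ v ∧ v < 2 + N.k) ∧ N.Touches (u - N.off) (v - 2)) ∨
  ((2 + N.k ≤ u ∧ u < N.off) ∧ N.off ≤ v ∧ N.Touches (v - N.off) (u - (2 + N.k))) ∨
  (N.off ≤ u ∧ N.off ≤ v ∧ N.Linked (u - N.off) (v - N.off))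

/-- The arcs of capacity one, from the entries to the exits. -/
def UnitArc (u v : ℕ) : Prop := (2 ≤ u ∧ u < 2 + N.k) ∧ v = u + N.k

/-- The capacities; the number `k + 1` stands for infinity. -/
def cap (u v : ℕ) : ℕ := ∑ l ∈ Finset.range (N.k + 1), bit (N.InfArc u v ∨ (l = 0 ∧ N.UnitArc u v))

variable {N} {u v : ℕ}

theorem cap_of_inf (h : N.InfArc u v) : N.cap u v = N.k + 1 := by
  simp [cap, h, bit]

theorem one_le_cap_of_unit (h : N.UnitArc u v) : 1 ≤ N.cap u v := by
  refine le_trans ?_ (Finset.single_le_sum (f := fun l => bit (N.InfArc u v ∨ (l = 0 ∧ N.UnitArc u v)))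
    (fun _ _ => Nat.zero_le _) (Finset.mem_range.2 N.k.succ_pos))
  exact bit_pos.2 (Or.inr ⟨rfl, h⟩)

theorem cap_le (h : ¬ N.InfArc u v) : N.cap u v ≤ bit (N.UnitArc u v) := by
  rw [cap, Finset.sum_eq_single 0]
  · simp [h]
  · intro l _ hl; simp [h, hl, bit]
  · simp

/-- A cut of capacity at most `k` contains none of the arcs that stand for infinite capacity. -/
theorem isCut_of_cutCap_le {S : ℕ → Prop} (h0 : S 0) (h1 : ¬ S 1) (h : Flow.cutCap N.nodes N.cap S ≤ N.k) :
    N.IsCut (fun a => S (2 + a)) (fun a => S (2 + N.k + a)) (fun q => S (N.off + q)) := by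
  classical
  have key : ∀ u < N.nodes, ∀ v < N.nodes, N.InfArc u v → S u → S v := by
    intro u hu v hv huv hSu
    by_contra hSv
    have h2 : N.cap u v ≤ Flow.cutCap N.nodes N.cap S :=
      (Finset.single_le_sum (f := fun v => N.cap u v) (fun _ _ => Nat.zero_le _)
        (Finset.mem_filter.2 ⟨Finset.mem_range.2 hv, hSv⟩)).trans
      (Finset.single_le_sum (f := fun u => ∑ v ∈ (Finset.range N.nodes).filter fun v => ¬ S v, N.cap u v)
        (fun _ _ => Nat.zero_le _) (Finset.mem_filter.2 ⟨Finset.mem_range.2 hu, hSu⟩))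
    rw [cap_of_inf huv] at h2
    omega
  have hoff : N.off = 2 + N.k + N.k := rfl
  have hno : N.nodes = N.off + N.n := rfl
  have hmn := N.hmn
  constructor
  · intro j hj
    refine key 0 (by omega) _ (by omega) (Or.inl ⟨rfl, by omega, by rwa [Nat.add_sub_cancel_left]⟩) h0
  · intro q hq ho hS
    exact h1 (key _ (by omega) 1 (by omega)
      (Or.inr (Or.inl ⟨rfl, by omega, by rwa [Nat.add_sub_cancel_left]⟩)) hS)
  · intro q hq a ha ht hS
    refine key _ (by omega) (2 + a) (by omega) (Or.inr (Or.inr (Or.inl ⟨by omega, by omega, ?_⟩))) hS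
    rwa [Nat.add_sub_cancel_left, Nat.add_sub_cancel_left]
  · intro q hq a ha ht hS
    refine key _ (by omega) (N.off + q) (by omega)
      (Or.inr (Or.inr (Or.inr (Or.inl ⟨by omega, by omega, ?_⟩)))) hS
    rwa [Nat.add_sub_cancel_left, Nat.add_sub_cancel_left]
  · intro q hq q' hq' hl hS
    refine key _ (by omega) (N.off + q') (by omega)
      (Or.inr (Or.inr (Or.inr (Or.inr ⟨by omega, by omega, ?_⟩)))) hS
    rwa [Nat.add_sub_cancel_left, Nat.add_sub_cancel_left]

open Classical in
/-- The arc from the entry to the exit of each cut star contributes one. -/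
theorem card_le_cutCap (S : ℕ → Prop) :
    ((Finset.range N.k).filter fun a => S (2 + a) ∧ ¬ S (2 + N.k + a)).card ≤
      Flow.cutCap N.nodes N.cap S := by
  have hno : N.nodes = 2 + N.k + N.k + N.n := rfl
  set F := (Finset.range N.k).filter fun a => S (2 + a) ∧ ¬ S (2 + N.k + a)
  calc F.card = ∑ a ∈ F, 1 := by simp
    _ ≤ ∑ a ∈ F, ∑ v ∈ (Finset.range N.nodes).filter fun v => ¬ S v, N.cap (2 + a) v := by
        refine Finset.sum_le_sum fun a ha => ?_
        obtain ⟨ha, h1, h2⟩ := Finset.mem_filter.1 ha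
        have ha := Finset.mem_range.1 ha
        have hu : N.UnitArc (2 + a) (2 + N.k + a) := ⟨by omega, by omega⟩
        have hv : 2 + N.k + a ∈ (Finset.range N.nodes).filter fun v => ¬ S v :=
          Finset.mem_filter.2 ⟨Finset.mem_range.2 (by omega), h2⟩
        exact (one_le_cap_of_unit hu).trans
          (Finset.single_le_sum (f := fun v => N.cap (2 + a) v) (fun _ _ => Nat.zero_le _) hv)
    _ = ∑ u ∈ F.image (2 + ·), ∑ v ∈ (Finset.range N.nodes).filter fun v => ¬ S v, N.cap u v := by
        rw [Finset.sum_image]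
        exact fun a _ b _ h => Nat.add_left_cancel h
    _ ≤ Flow.cutCap N.nodes N.cap S := by
        refine Finset.sum_le_sum_of_subset fun u hu => ?_
        obtain ⟨a, ha, rfl⟩ := Finset.mem_image.1 hu
        obtain ⟨ha, h1, h2⟩ := Finset.mem_filter.1 ha
        have ha := Finset.mem_range.1 ha
        exact Finset.mem_filter.2 ⟨Finset.mem_range.2 (by omega), h1⟩

open Classical in
/-- Conversely, the nodes on one side of a cut of the network are left by unit arcs only. -/
theorem IsCut.exists_cutCap_le {I O ρ : ℕ → Prop} (h : N.IsCut I O ρ) : ∃ S : ℕ → Prop, S 0 ∧ ¬ S 1 ∧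
    Flow.cutCap N.nodes N.cap S ≤ ((Finset.range N.k).filter fun a => I a ∧ ¬ O a).card := by
  have hoff : N.off = 2 + N.k + N.k := rfl
  have hno : N.nodes = N.off + N.n := rfl
  have hmn := N.hmn
  let S : ℕ → Prop := fun u => u = 0 ∨ ((2 ≤ u ∧ u < 2 + N.k) ∧ I (u - 2)) ∨
    ((2 + N.k ≤ u ∧ u < N.off) ∧ O (u - (2 + N.k))) ∨ (N.off ≤ u ∧ ρ (u - N.off))
  have S_in : ∀ u, 2 ≤ u → u < 2 + N.k → (S u ↔ I (u - 2)) := fun u h1 h2 =>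
    ⟨by rintro (h | h | h | h); exacts [by omega, h.2, by omega, by omega], fun h => Or.inr (Or.inl ⟨⟨h1, h2⟩, h⟩)⟩
  have S_out : ∀ u, 2 + N.k ≤ u → u < N.off → (S u ↔ O (u - (2 + N.k))) := fun u h1 h2 =>
    ⟨by rintro (h | h | h | h); exacts [by omega, by omega, h.2, by omega],
      fun h => Or.inr (Or.inr (Or.inl ⟨⟨h1, h2⟩, h⟩))⟩
  have S_pt : ∀ u, N.off ≤ u → (S u ↔ ρ (u - N.off)) := fun u h1 =>
    ⟨by rintro (h | h | h | h); exacts [by omega, by omega, by omega, h.2],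
      fun h => Or.inr (Or.inr (Or.inr ⟨h1, h⟩))⟩
  have S_one : ¬ S 1 := by rintro (h | h | h | h) <;> omega
  have noInf : ∀ u < N.nodes, ∀ v < N.nodes, S u → ¬ S v → ¬ N.InfArc u v := by
    rintro u hu v hv hSu hSv (⟨rfl, h1, h2⟩ | ⟨rfl, h1, h2⟩ | ⟨h1, ⟨h2, h2'⟩, h3⟩ | ⟨⟨h1, h1'⟩, h2, h3⟩ | ⟨h1, h2, h3⟩)
    · exact hSv ((S_pt v h1).2 (h.source _ h2))
    · exact h.outer _ (by omega) h2 ((S_pt u h1).1 hSu)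
    · exact hSv ((S_in v h2 h2').2 (h.enter _ (by omega) _ (by omega) h3 ((S_pt u h1).1 hSu)))
    · exact hSv ((S_pt v h2).2 (h.leave _ (by omega) _ (by omega) h3 ((S_out u h1 h1').1 hSu)))
    · exact hSv ((S_pt v h2).2 (h.link _ (by omega) _ (by omega) h3 ((S_pt u h1).1 hSu)))
  refine ⟨S, Or.inl rfl, S_one, ?_⟩
  set F := (Finset.range N.k).filter fun a => I a ∧ ¬ O a with hF
  have hrow : ∀ u ∈ (Finset.range N.nodes).filter S,
      ∑ v ∈ (Finset.range N.nodes).filter (fun v => ¬ S v), N.cap u v ≤ if u ∈ F.image (2 + ·) then 1 else 0 := by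
    intro u hu
    obtain ⟨hu, hSu⟩ := Finset.mem_filter.1 hu
    have hu := Finset.mem_range.1 hu
    have hle : ∑ v ∈ (Finset.range N.nodes).filter (fun v => ¬ S v), N.cap u v ≤
        ∑ v ∈ (Finset.range N.nodes).filter (fun v => ¬ S v), bit (N.UnitArc u v) := by
      refine Finset.sum_le_sum fun v hv => ?_
      obtain ⟨hv, hSv⟩ := Finset.mem_filter.1 hv
      exact cap_le (noInf u hu v (Finset.mem_range.1 hv) hSu hSv)
    refine hle.trans ?_
    by_cases hmem : (2 ≤ u ∧ u < 2 + N.k) ∧ ¬ S (u + N.k)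
    · obtain ⟨⟨h1, h2⟩, h3⟩ := hmem
      rw [if_pos]
      · refine (Finset.sum_le_sum_of_ne_zero (t := {u + N.k}) fun v _ hv => ?_).trans ?_
        · by_contra hne
          refine hv ?_
          rw [bit, if_neg]
          exact fun hu => hne (Finset.mem_singleton.2 hu.2)
        · rw [Finset.sum_singleton, bit]
          split_ifs <;> simp
      · refine Finset.mem_image.2 ⟨u - 2, Finset.mem_filter.2 ⟨Finset.mem_range.2 (by omega),
          (S_in u h1 h2).1 hSu, fun hO => h3 ((S_out _ (by omega) (by omega)).2 ?_)⟩, by omega⟩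
        rwa [show u + N.k - (2 + N.k) = u - 2 by omega]
    · refine (Finset.sum_eq_zero fun v hv => ?_).trans_le (Nat.zero_le _)
      rw [bit, if_neg]
      rintro ⟨h1, rfl⟩
      exact hmem ⟨h1, (Finset.mem_filter.1 hv).2⟩
  calc Flow.cutCap N.nodes N.cap S
      ≤ ∑ u ∈ (Finset.range N.nodes).filter S, if u ∈ F.image (2 + ·) then 1 else 0 :=
        le_trans (le_of_eq (by unfold Flow.cutCap; congr!)) (Finset.sum_le_sum hrow)
    _ = (((Finset.range N.nodes).filter S).filter fun u => u ∈ F.image (2 + ·)).card := by simp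
    _ ≤ (F.image (2 + ·)).card := Finset.card_le_card fun u hu => (Finset.mem_filter.1 hu).2
    _ ≤ F.card := Finset.card_image_le

open Classical in
/-- The set of nodes that the flow computation finds is a smallest cut, if there is one. -/
theorem result_of_flow {R : ℕ → ℕ → ℕ} (h : Flow.AfterRounds N.nodes N.cap R N.k) :
    (Flow.Lay N.nodes R N.nodes 1 → ∀ I O ρ, ¬ N.IsCut I O ρ) ∧
    (¬ Flow.Lay N.nodes R N.nodes 1 → N.IsCut (fun a => Flow.Lay N.nodes R N.nodes (2 + a))
      (fun a => Flow.Lay N.nodes R N.nodes (2 + N.k + a)) (fun q => Flow.Lay N.nodes R N.nodes (N.off + q)) ∧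
      ∀ I O ρ, N.IsCut I O ρ →
        ((Finset.range N.k).filter fun a => Flow.Lay N.nodes R N.nodes (2 + a) ∧
          ¬ Flow.Lay N.nodes R N.nodes (2 + N.k + a)).card ≤
        ((Finset.range N.k).filter fun a => I a ∧ ¬ O a).card) := by
  have hn : 1 < N.nodes := by
    have h1 : N.off = 2 + N.k + N.k := rfl
    have h2 : N.nodes = N.off + N.n := rfl
    omega
  obtain ⟨h1, h2⟩ := h.result hn
  constructor
  · intro hl I O ρ hc
    obtain ⟨S, hS0, hS1, hS⟩ := hc.exists_cutCap_le
    have h3 := h2 hl S hS0 hS1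
    have h4 : ((Finset.range N.k).filter fun a => I a ∧ ¬ O a).card ≤ N.k :=
      (Finset.card_filter_le _ _).trans (Finset.card_range _).le
    omega
  · intro hl
    obtain ⟨h3, h4⟩ := h1 hl
    have h0 : Flow.Lay N.nodes R N.nodes 0 := Flow.Lay.mono (r := 0) (by omega) (Nat.zero_le _) rfl
    refine ⟨isCut_of_cutCap_le h0 hl h3, fun I O ρ hc => ?_⟩
    obtain ⟨S, hS0, hS1, hS⟩ := hc.exists_cutCap_le
    exact (card_le_cutCap _).trans ((h4 S hS0 hS1).trans hS)

end Network

/-! ### The program: the network and its minimum cut -/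

/-- The test whether a point lies on the path for the pair `d` of net points and the pair `e` of obstacles. -/
def pathB (d e : NExp) (z : PExp) : BExp :=
  orB (segB (rowE 1 (fstE d)) (witE e) z) (segB (witE e) (rowE 1 (sndE d)) z)

/-- The path that is chosen in array `a`, either `16` or `17`, for the pair `d` of net points. -/
def chosenE (a : ℕ) (d : NExp) : NExp := .sub (.read a d (.const 0)) (.const 1)

/-- Decides which points of the network lie on which stars. -/
def memProg : Prog :=
  tabEx 30 (vr 67) kE (vr 60) (.and (eqB (fstE (vr 52)) (vr 51)) (.and (posB (.read 16 (vr 52) (.const 0)))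
    (orB (pathB (vr 52) (chosenE 16 (vr 52)) (rowE 11 (vr 50)))
      (pathB (vr 52) (chosenE 17 (vr 52)) (rowE 11 (vr 50))))))

/-- The value of an affine function at a point. -/
def evE (l : NExp) (z : PExp) : RExp :=
  .add (.add (.mul (.read 8 l (.const 0)) z.1) (.mul (.read 8 l (.const 1)) z.2)) (.read 8 l (.const 2))

/-- Compares the faces of the points of the network. -/
def refinesProg : Prog :=
  tabEx 31 (vr 67) (vr 67) (vr 62) (orB
    (.and (posR (evE (vr 52) (rowE 11 (vr 50)))) (.not (posR (evE (vr 52) (rowE 11 (vr 51))))))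
    (.and (negR (evE (vr 52) (rowE 11 (vr 50)))) (.not (negR (evE (vr 52) (rowE 11 (vr 51)))))))

/-- Decides which stars touch which faces. -/
def touchProg : Prog :=
  tabEx 32 (vr 67) kE (vr 67)
    (.and (.not (posB (.read 31 (vr 52) (vr 50)))) (posB (.read 30 (vr 52) (vr 51))))

/-- Decides which points of the network lie on some star. -/
def coveredProg : Prog := tabEx 33 (vr 67) (.const 1) kE (posB (.read 30 (vr 50) (vr 52)))

/-- The number of the first node that stands for a point. -/
def offE : NExp := .add (.add (.const 2) kE) kE

/-- The first coordinate of a row is larger than the box, or the second one. -/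
def outerB (q : NExp) : BExp :=
  orB (orB (.realLt boxE (rowE 11 q).1) (.realLt (rowE 11 q).1 (.sub (.const 0) boxE)))
    (orB (.realLt boxE (rowE 11 q).2) (.realLt (rowE 11 q).2 (.sub (.const 0) boxE)))

/-- The comparison of natural numbers. -/
def leB (e f : NExp) : BExp := .not (.natLt f e)

/-- The test whether two faces are linked. -/
def linkedB (q q' : NExp) : BExp :=
  orB (.and (.not (posB (.read 31 q q'))) (.not (posB (.read 33 q (.const 0)))))
    (.and (.not (posB (.read 31 q' q))) (.not (posB (.read 33 q' (.const 0)))))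

/-- The test for an arc of infinite capacity. -/
def infB (u v : NExp) : BExp :=
  orB (.and (eqB u (.const 0)) (.and (leB offE v) (.natLt (.sub v offE) mE)))
  (orB (.and (eqB v (.const 1)) (.and (leB offE u) (outerB (.sub u offE))))
  (orB (.and (leB offE u) (.and (.and (leB (.const 2) v) (.natLt v (.add (.const 2) kE)))
    (posB (.read 32 (.sub u offE) (.sub v (.const 2))))))
  (orB (.and (.and (leB (.add (.const 2) kE) u) (.natLt u offE)) (.and (leB offE v)
    (posB (.read 32 (.sub v offE) (.sub u (.add (.const 2) kE))))))
  (.and (leB offE u) (.and (leB offE v) (linkedB (.sub u offE) (.sub v offE)))))))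

/-- Computes the capacities of the network. -/
def capProg : Prog :=
  .seq (setVar 68 (.add offE (vr 67)))
  (.seq (tabBit 34 Flow.nE Flow.nE (infB (vr 50) (vr 51)))
  (tab 35 Flow.nE Flow.nE (.add kE (.const 1)) (.const 0)
    (orB (posB (.read 34 (vr 50) (vr 51))) (.and (eqB (vr 52) (.const 0))
      (.and (.and (leB (.const 2) (vr 50)) (.natLt (vr 50) (.add (.const 2) kE)))
        (eqB (vr 51) (.add (vr 50) kE)))))
    (.add (.read 35 (vr 50) (vr 51)) (.const 1))))

/-- The test whether the minimum cut contains a star. -/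
def cutB (a : NExp) : BExp :=
  .and (posB (.read 41 Flow.nE (.add (.const 2) a)))
    (.not (posB (.read 41 Flow.nE (.add (.add (.const 2) kE) a))))

/-- The test whether the obstacle `i` is one of the pair `e`. -/
def isOneB (e i : NExp) : BExp := orB (eqB (fstE e) i) (eqB (sndE e) i)

/-- Writes the output. -/
def outProg : Prog :=
  .seq (tabEx 3 kE (.const 1) (vr 60) (.and (posB (.read 16 (vr 52) (.const 0))) (.and (cutB (fstE (vr 52)))
    (orB (isOneB (chosenE 16 (vr 52)) (vr 50)) (isOneB (chosenE 17 (vr 52)) (vr 50))))))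
  (setVar 4 (.sub (.const 1) (.read 41 Flow.nE (.const 1))))

/-- Solves an instance given by the coordinates and the answers to all queries. -/
def mainProg (δ : ℚ) : Prog :=
  .seq (pathProg δ) (.seq arrangementProg (.seq (.seq memProg (.seq refinesProg (.seq touchProg coveredProg)))
    (.seq capProg (.seq (Flow.flowProg kE) outProg))))

theorem not_sign_eq_iff {a b : ℝ} : ¬ (a = 0 ∨ SignType.sign a = SignType.sign b) ↔
    (0 < a ∧ ¬ 0 < b) ∨ (a < 0 ∧ ¬ b < 0) := by
  rcases lt_trichotomy a 0 with h | rfl | h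
  · simp only [sign_neg h, h.ne, h.not_gt, h, false_or, false_and, true_and, eq_comm (a := (-1 : SignType)),
      sign_eq_neg_one_iff]
  · simp
  · simp only [sign_pos h, h.ne', h.not_gt, h, false_or, false_and, or_false, true_and,
      eq_comm (a := (1 : SignType)), sign_eq_one_iff]

@[simp] theorem eval_leB {e f : NExp} {s : Mem} : (leB e f).eval s ↔ e.eval s ≤ f.eval s := not_lt

namespace Inst

variable {D : Inst} {L : List Fact} {s : Mem} {N : ℕ}

theorem pair_sub_sum : D.pairFacts ⊆ D.sumFacts :=
  fun _ h => vertex_sub_sum (line_sub_vertex (site_sub_line (corner_sub_site (path_sub_corner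
    (pair_sub_path h)))))

theorem path_sub_sum : D.pathFacts ⊆ D.sumFacts :=
  fun _ h => vertex_sub_sum (line_sub_vertex (site_sub_line (corner_sub_site (path_sub_corner h))))

theorem fresh_pos {W W' : List ℕ} (h : ∀ a ∈ W, (a = 9 ∨ 28 ≤ a) ∧ (a < 60 ∨ 67 < a))
    (h' : ∀ a ∈ W', 12 ≤ a) : Fresh W W' D.posFacts := by
  refine Fresh.append ?_ (fresh_sum (fun a ha => ?_) fun a ha => by linarith [h' a ha])
  · simp only [Fresh, List.forall_mem_cons, List.not_mem_nil, false_implies, implies_true, and_true]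
    exact ⟨fun hm => absurd (h' _ hm) (by norm_num), fun hm => absurd (h _ hm) (by norm_num)⟩
  · have := h a ha; omega

theorem eval_pathB {d e : NExp} {z : PExp} {i j : ℕ} {Z : Plane} (h : Knows s L) (hm : D.pairFacts ⊆ L)
    (hd : d.eval s = i) (hi : i < D.k * D.k) (he : e.eval s = j) (hj : j < D.k * D.k) (hz : z.Is s Z) :
    (pathB d e z).eval s ↔ Z ∈ D.path i j := by
  have h1 := div_lt_and_mod_lt hi
  have hw := is_wit h hm he hj
  rw [pathB, eval_orB, path, Set.mem_union,
    eval_segB (is_ctr h (fun _ hx => hm (input_sub_pair hx)) (eval_fstE h hm hd hi) h1.1) hw hz,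
    eval_segB hw (is_ctr h (fun _ hx => hm (input_sub_pair hx)) (eval_sndE h hm hd hi) h1.2) hz]

theorem eval_chosenE {d : NExp} {i : ℕ} (h : Knows s L) (hm : D.pathFacts ⊆ L) (hd : d.eval s = i)
    (hi : i < D.k * D.k) : NExp.eval s (.read 16 d (.const 0)) = D.lo i ∧
      (chosenE 16 d).eval s = D.lo i - 1 ∧ (chosenE 17 d).eval s = D.hi i - 1 := by
  have h1 : s.nat 16 i 0 = D.lo i := h.nat (hm lo_mem_path) hi one_pos
  have h2 : s.nat 17 i 0 = D.hi i := h.nat (hm hi_mem_path) hi one_pos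
  simp only [chosenE, NExp.eval, hd, h1, h2, and_self]

variable (D) in
/-- The incidences of the points of the network with the stars are in array 30. -/
def memFact : Fact := .nat 30 D.nP D.k (fun q a => bit (D.pos q ∈ D.star a))

variable (D) in
/-- The pairs of points of the network for which the face of the first is not in the closure of the
face of the second are marked in array 31. -/
def refinesFact : Fact := .nat 31 D.nP D.nP (fun q q' => bit (¬ Refines D.lines (D.pos q) (D.pos q')))

variable {obs : ℕ → Set Plane} {r R : ℝ} (V : D.Valid obs r R)

/-- Array 32 marks the pairs of a point and a star such that the star touches the face of the point. -/
def Valid.touchFact : Fact := .nat 32 D.nP D.k (fun q a => bit (V.network.Touches q a))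

/-- Array 33 marks the points that lie in a star. -/
def Valid.coveredFact : Fact := .nat 33 D.nP 1 (fun q _ => bit (¬ V.network.Free q))

/-- The incidences between faces and stars. -/
def Valid.netFacts : List Fact := [V.coveredFact, V.touchFact, D.refinesFact, D.memFact] ++ D.posFacts

/-- The capacities. -/
def Valid.capFacts : List Fact :=
  [.nat 35 V.network.nodes V.network.nodes V.network.cap,
    .nat 34 V.network.nodes V.network.nodes (fun u v => bit (V.network.InfArc u v)),
    scalar 68 V.network.nodes] ++ V.netFacts

variable {V}

/-- The program finds the incidences between faces and stars. -/
theorem Valid.runs_net (hN : D.size ≤ N) (hs : Knows s D.posFacts) :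
    Runs N (.seq memProg (.seq refinesProg (.seq touchProg coveredProg))) s
      fun s' => Knows s' V.netFacts := by
  unfold size at hN
  have nP : ∀ {s}, Knows s D.posFacts → (vr 67).eval s = D.nP := fun h =>
    eval_scalar h (by simp [posFacts] : D.nPFact ∈ _)
  have kk : ∀ {s}, Knows s D.posFacts → (vr 60).eval s = D.k * D.k := fun h =>
    eval_kk (h.sub sum_sub_pos) pair_sub_sum
  have k : ∀ {s}, Knows s D.posFacts → kE.eval s = D.k := fun h =>
    eval_kE (h.sub sum_sub_pos) input_sub_sum
  have ps : ∀ {s} {e : NExp} {q : ℕ}, Knows s D.posFacts → e.eval s = q → q < D.nP →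
      (rowE 11 e).Is s (D.pos q) := fun h he hq => rowE_is h (by simp [posFacts, posFact]) he hq
  refine Runs.seq (P := fun s => Knows s ([D.memFact] ++ D.posFacts)) ?_ fun s hs => ?_
  · refine (runs_tabEx (N₁ := D.nP) (N₂ := D.k) (N₃ := D.k * D.k) (fun q a d => d / D.k = a ∧ D.lo d ≠ 0 ∧
      (D.pos q ∈ D.path d (D.lo d - 1) ∨ D.pos q ∈ D.path d (D.hi d - 1))) (by norm_num)
      (fresh_pos (by simp) (by simp)) (fun s h => ⟨nP h, k h, kk h⟩) (by omega)
      (fun s q a d hc hq ha hd => ?_) hs).mono fun s h => ?_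
    · have h1 := hc.knows.sub sum_sub_pos
      obtain ⟨c1, c2, c3⟩ := eval_chosenE h1 path_sub_sum hc.el hd
      simp only [BExp.eval, eval_eqB, eval_fstE h1 pair_sub_sum hc.el hd, hc.ej, eval_posB, c1, eval_orB,
        ← Nat.pos_iff_ne_zero]
      refine and_congr_right fun _ => and_congr_right fun h0 => ?_
      rw [eval_pathB h1 pair_sub_sum hc.el hd c2 (rel_of_chosen h0.ne' (Or.inl rfl)).1 (ps hc.knows hc.ei hq),
        eval_pathB h1 pair_sub_sum hc.el hd c3 (rel_of_chosen h0.ne' (Or.inr rfl)).1 (ps hc.knows hc.ei hq)]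
    · simpa only [memFact, mem_star, List.cons_append, List.nil_append] using h
  refine Runs.seq (P := fun s => Knows s ([D.refinesFact, D.memFact] ++ D.posFacts)) ?_ fun s hs => ?_
  · refine (runs_tabEx (N₁ := D.nP) (N₂ := D.nP) (N₃ := D.nL) (fun q q' l =>
      ¬ ((D.line l).ev (D.pos q) = 0 ∨ SignType.sign ((D.line l).ev (D.pos q)) =
        SignType.sign ((D.line l).ev (D.pos q')))) (by norm_num)
      (Fresh.append (by simp [Fresh, Fact.Off, memFact]) (fresh_pos (by simp) (by simp)))
      (fun s h => ⟨nP h.tail, nP h.tail, ?_⟩) (by omega)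
      (fun s q q' l hc hq hq' hl => ?_) hs).mono fun s h => ?_
    · exact eval_scalar (h.tail.sub sum_sub_pos) (vertex_sub_sum (line_sub_vertex
        (site_sub_line (by simp [siteFacts] : scalar 62 D.nL ∈ _))))
    · have h1 : ∀ j < 3, s.real 8 l j = lineCo (D.line l) j := fun j hj =>
        (hc.knows.tail.sub sum_sub_pos).real (vertex_sub_sum (line_sub_vertex
          (by simp [lineFacts] : D.lineFact ∈ _))) hl hj
      have h2 : ∀ {e : PExp} {z : Plane}, e.Is s z → (evE (vr 52) e).eval s = (D.line l).ev z := fun he => by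
        simp only [evE, RExp.eval, NExp.eval, hc.el, h1 0 (by norm_num), h1 1 (by norm_num),
          h1 2 (by norm_num), he.1, he.2]
        simp [lineCo, Line.ev]
      simp only [eval_orB, BExp.eval, eval_posR, eval_negR, h2 (ps hc.knows.tail hc.ei hq),
        h2 (ps hc.knows.tail hc.ej hq'), not_sign_eq_iff]
    · have h3 : ∀ q q' : ℕ, (∃ l < D.nL, ¬ ((D.line l).ev (D.pos q) = 0 ∨
          SignType.sign ((D.line l).ev (D.pos q)) = SignType.sign ((D.line l).ev (D.pos q')))) ↔
          ¬ Refines D.lines (D.pos q) (D.pos q') := fun q q' => by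
        simp [Refines, lines]
      simpa only [h3, refinesFact, List.cons_append, List.nil_append] using h
  have mem : ∀ {s L}, Knows s L → D.memFact ∈ L → ∀ q < D.nP, ∀ a < D.k,
      s.nat 30 q a = bit (D.pos q ∈ D.star a) := fun h hm q hq a ha => h.nat hm hq ha
  refine Runs.seq (P := fun s => Knows s ([V.touchFact, D.refinesFact, D.memFact] ++ D.posFacts)) ?_
    fun s hs => ?_
  · refine runs_tabEx (N₁ := D.nP) (N₂ := D.k) (N₃ := D.nP)
      (fun q a q₀ => Refines D.lines (D.pos q₀) (D.pos q) ∧ D.pos q₀ ∈ D.star a) (by norm_num)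
      (Fresh.append (by simp [Fresh, Fact.Off, memFact, refinesFact]) (fresh_pos (by simp) (by simp)))
      (fun s h => ⟨nP h.tail, k h.tail, nP h.tail⟩) (by omega)
      (fun s q a q₀ hc hq ha hq₀ => ?_) hs
    simp only [BExp.eval, eval_posB, NExp.eval, hc.ei, hc.ej, hc.el]
    rw [mem hc.knows (by simp) q₀ hq₀ a ha, hc.knows.nat (by simp : D.refinesFact ∈ _) hq₀ hq, bit_pos, bit_pos,
      not_not]
  · refine (runs_tabEx (N₁ := D.nP) (N₂ := 1) (N₃ := D.k) (fun q _ a => D.pos q ∈ D.star a) (by norm_num)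
      (Fresh.append (by simp [Fresh, Fact.Off, memFact, refinesFact, touchFact]) (fresh_pos (by simp) (by simp)))
      (fun s h => ⟨nP h.tail, rfl, k h.tail⟩) (by omega)
      (fun s q j a hc hq hj ha => ?_) hs).mono fun s h => ?_
    · simp only [eval_posB, NExp.eval, hc.ei, hc.el]
      rw [mem hc.knows (by simp) q hq a ha, bit_pos]
    · have h3 : ∀ q, (∃ a < D.k, D.pos q ∈ D.star a) ↔ ¬ V.network.Free q := fun q => by
        simp only [Network.Free, not_forall, not_not, exists_prop]; rfl
      simpa only [h3, netFacts, coveredFact, List.cons_append, List.nil_append] using h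

theorem Valid.fresh_net {W W' : List ℕ} (h : ∀ a ∈ W, (a = 9 ∨ 34 ≤ a) ∧ (a < 60 ∨ 67 < a))
    (h' : ∀ a ∈ W', 12 ≤ a) : Fresh W W' V.netFacts := by
  refine Fresh.append ?_ (fresh_pos (fun a ha => ?_) h')
  · simp only [Fresh, List.forall_mem_cons, List.not_mem_nil, false_implies, implies_true, and_true]
    exact ⟨fun hm => absurd (h _ hm) (by norm_num), fun hm => absurd (h _ hm) (by norm_num),
      fun hm => absurd (h _ hm) (by norm_num), fun hm => absurd (h _ hm) (by norm_num)⟩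
  · have := h a ha; omega

theorem input_sub_pos : D.inputFacts ⊆ D.posFacts := fun _ h => sum_sub_pos (input_sub_sum h)

theorem corner_sub_pos : D.cornerFacts ⊆ D.posFacts := fun _ h =>
  sum_sub_pos (vertex_sub_sum (line_sub_vertex (site_sub_line (corner_sub_site h))))

theorem eval_boxE (h : Knows s L) (hm : D.cornerFacts ⊆ L) : boxE.eval s = D.box := by
  have hn : s.nat 66 0 0 = D.nB := eval_scalar (h.sub hm) (by simp [cornerFacts] : D.nBFact ∈ _)
  simp only [boxE, RExp.eval, NExp.eval, nBE, eval_vr, hn]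
  exact (h.sub hm).real (by simp [cornerFacts] : D.boxFact ∈ _) D.nB.lt_succ_self one_pos

theorem Valid.pos_sub_net : D.posFacts ⊆ V.netFacts := List.subset_append_right _ _

theorem eval_offE (h : Knows s L) (hm : D.inputFacts ⊆ L) : offE.eval s = V.network.off := by
  simp only [offE, NExp.eval, eval_kE h hm]; rfl

theorem Valid.eval_outerB {e : NExp} {q : ℕ} (h : Knows s D.posFacts) (he : e.eval s = q) (hq : q < D.nP) :
    (outerB e).eval s ↔ V.network.Outer q := by
  have hr : (rowE 11 e).Is s (D.pos q) := rowE_is h (by simp [posFacts, posFact]) he hq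
  simp only [outerB, eval_orB, BExp.eval, hr.1, hr.2, RExp.eval, eval_boxE h corner_sub_pos, Network.Outer,
    Fin.exists_fin_two, lt_abs, Rat.cast_zero, zero_sub]
  change _ ↔ (D.box < D.pos q 0 ∨ D.box < -D.pos q 0) ∨ (D.box < D.pos q 1 ∨ D.box < -D.pos q 1)
  rw [lt_neg (a := D.box), lt_neg (a := D.box)]

theorem Valid.eval_linkedB {e e' : NExp} {q q' : ℕ} (h : Knows s V.netFacts) (he : e.eval s = q)
    (he' : e'.eval s = q') (hq : q < D.nP) (hq' : q' < D.nP) :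
    (linkedB e e').eval s ↔ V.network.Linked q q' := by
  have h1 := h.nat (by simp [netFacts] : D.refinesFact ∈ _) hq hq'
  have h2 := h.nat (by simp [netFacts] : D.refinesFact ∈ _) hq' hq
  have h3 := h.nat (by simp [netFacts] : V.coveredFact ∈ _) hq one_pos
  have h4 := h.nat (by simp [netFacts] : V.coveredFact ∈ _) hq' one_pos
  simp only [linkedB, eval_orB, BExp.eval, eval_posB, NExp.eval, he, he', h1, h2, h3, h4, bit_pos, not_not]
  rfl

theorem Valid.eval_infB {e e' : NExp} {u v : ℕ} (h : Knows s V.netFacts) (he : e.eval s = u)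
    (he' : e'.eval s = v) (hu : u < V.network.nodes) (hv : v < V.network.nodes) :
    (infB e e').eval s ↔ V.network.InfArc u v := by
  have hno : V.network.nodes = V.network.off + D.nP := rfl
  have h0 := h.sub pos_sub_net
  have ho := eval_offE (V := V) h0 input_sub_pos
  have hm := eval_mE h0 input_sub_pos
  have hk := eval_kE h0 input_sub_pos
  have ht : ∀ q < D.nP, ∀ a < D.k, s.nat 32 q a = bit (V.network.Touches q a) := fun q hq a ha =>
    h.nat (by simp [netFacts] : V.touchFact ∈ _) hq ha
  have hoff : V.network.off = 2 + D.k + D.k := rfl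
  simp only [infB, eval_orB, BExp.eval, eval_eqB, eval_leB, eval_posB, NExp.eval, he, he', ho, hm, hk]
  unfold Network.InfArc
  refine or_congr Iff.rfl (or_congr (and_congr_right fun _ => and_congr_right fun h1 => ?_)
    (or_congr (and_congr_right fun h1 => and_congr_right fun h2 => ?_)
      (or_congr (and_congr_right fun h1 => and_congr_right fun h2 => ?_)
        (and_congr_right fun h1 => and_congr_right fun h2 => ?_))))
  · exact eval_outerB h0 (by simp only [NExp.eval, he, ho]) (by omega)
  · rw [ht _ (by omega) _ (by omega), bit_pos]
  · rw [ht _ (by omega) _ (by omega), bit_pos]; rfl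
  · exact eval_linkedB h (by simp only [NExp.eval, he, ho]) (by simp only [NExp.eval, he', ho]) (by omega)
      (by omega)

theorem Valid.nodes_lt_size : V.network.nodes + 1 < D.size := by
  have h1 : V.network.nodes = 2 + D.k + D.k + D.nP := rfl
  unfold size; omega

/-- The program computes the capacities. -/
theorem Valid.runs_cap (hN : D.size ≤ N) (hs : Knows s V.netFacts) :
    Runs N capProg s fun s' => Knows s' V.capFacts := by
  have hn := V.nodes_lt_size
  have hno : V.network.nodes = 2 + D.k + D.k + D.nP := rfl
  have nP : ∀ {s}, Knows s V.netFacts → (vr 67).eval s = D.nP := fun h =>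
    eval_scalar (h.sub pos_sub_net) (by simp [posFacts] : D.nPFact ∈ _)
  have k : ∀ {s}, Knows s V.netFacts → kE.eval s = D.k := fun h =>
    eval_kE (h.sub pos_sub_net) input_sub_pos
  refine Runs.seq (P := fun s => Knows s ([scalar 68 V.network.nodes] ++ V.netFacts)) (runs_set
    (fresh_net (by simp) (by simp)) (fun s h => ?_) hs) fun s hs => ?_
  · simp only [NExp.eval, eval_offE (V := V) (h.sub pos_sub_net) input_sub_pos, nP h]; rfl
  refine Runs.seq (P := fun s => Knows s ([.nat 34 V.network.nodes V.network.nodes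
    (fun u v => bit (V.network.InfArc u v)), scalar 68 V.network.nodes] ++ V.netFacts)) (runs_tabBit
    (N₁ := V.network.nodes) (N₂ := V.network.nodes) _ (by norm_num)
    (Fresh.append (by simp [Fresh, Fact.Off, scalar]) (fresh_net (by simp) (by simp)))
    (fun s h => ⟨eval_scalar h (by simp [scalar]), eval_scalar h (by simp [scalar])⟩) (by omega)
    (fun s u v hc hu hv => eval_infB hc.knows.tail hc.ei hc.ej hu hv) hs) fun s hs => ?_
  refine runs_tab_count (N₁ := V.network.nodes) (N₂ := V.network.nodes) (N₃ := D.k + 1)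
    (fun u v l => V.network.InfArc u v ∨ (l = 0 ∧ V.network.UnitArc u v)) (by norm_num)
    (Fresh.append (by simp [Fresh, Fact.Off, scalar]) (fresh_net (by simp) (by simp)))
    (fun s h => ⟨eval_scalar h (by simp [scalar]), eval_scalar h (by simp [scalar]), ?_⟩) (by omega)
    (fun s u v l hc hu hv hl => ?_) hs
  · simp only [NExp.eval, k h.tail]
  · simp only [eval_orB, eval_posB, BExp.eval, eval_eqB, eval_leB, NExp.eval, hc.ei, hc.ej, hc.el,
      k hc.knows.tail]
    rw [hc.knows.nat (f := fun u v => bit (V.network.InfArc u v)) (by simp) hu hv, bit_pos]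
    rfl

/-- The program finds the optimal cut and writes the obstacles that belong to it into the output. -/
theorem Valid.runs_main {δ : ℚ} (hδ : D.δ = δ) (hs : Knows s D.inputFacts) :
    Runs D.size (mainProg δ) s fun s' =>
      ∃ R, Flow.AfterRounds V.network.nodes V.network.cap R D.k ∧
        (s'.nat 4 0 0 ≠ 0 ↔ ¬ Flow.Lay V.network.nodes R V.network.nodes 1) ∧
        ∀ i < D.k, (s'.nat 3 i 0 ≠ 0 ↔ D.Out (fun a => Flow.Lay V.network.nodes R V.network.nodes (2 + a) ∧
          ¬ Flow.Lay V.network.nodes R V.network.nodes (2 + D.k + a)) i) := by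
  have hn := V.nodes_lt_size
  have hno : V.network.nodes = 2 + D.k + D.k + D.nP := rfl
  set n := V.network.nodes
  refine (runs_pathProg hδ le_rfl hs).seq fun _ h => (runs_arrangement le_rfl h).seq fun _ h =>
    (V.runs_net le_rfl h).seq fun _ h => (V.runs_cap le_rfl h).seq fun s hs => ?_
  have sub : ∀ {s}, Knows s V.capFacts → Knows s D.posFacts := fun h => h.tail.sub pos_sub_net
  refine (Flow.runs_flow (n := n) (k := D.k) (kE := kE) (by omega) (by omega) (by unfold size; omega)
    (L := V.capFacts) (cap := V.network.cap)
    (Fresh.append (by simp [Fresh, Fact.Off, scalar]) (fresh_net (by simp) (by simp)))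
    (fun s h => ⟨eval_scalar h (by simp [capFacts, n] : scalar 68 n ∈ _), eval_kE (sub h) input_sub_pos, ?_⟩)
    hs).seq fun s hs => ?_
  · exact fun u hu v hv => h.nat (by simp [capFacts, n]) hu hv
  obtain ⟨R, hR, hs⟩ := hs
  set lay : Fact := .nat 41 (n + 1) n (fun r u => bit (Flow.Lay n R r u)) with hlay
  have hs1 : Knows s ([lay, scalar 68 n] ++ D.pathFacts) := by
    obtain ⟨h1, h2⟩ := knows_cons.1 hs
    exact knows_cons.2 ⟨h1, knows_cons.2 ⟨h2 _ (by simp [capFacts, n]),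
      (sub h2).sub fun _ h => sum_sub_pos (path_sub_sum h)⟩⟩
  have row : ∀ {s} {e : NExp} {u : ℕ}, Knows s ([lay, scalar 68 n] ++ D.pathFacts) → e.eval s = u → u < n →
      (NExp.read 41 Flow.nE e).eval s = bit (Flow.Lay n R n u) := fun h he hu => by
    have h1 : Flow.nE.eval _ = n := eval_scalar h (by simp : scalar 68 n ∈ _)
    simp only [NExp.eval, h1, he]
    exact h.nat (by simp : lay ∈ _) n.lt_succ_self hu
  refine (runs_tabEx (N₁ := D.k) (N₂ := 1) (N₃ := D.k * D.k) (fun i _ d => D.lo d ≠ 0 ∧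
    (Flow.Lay n R n (2 + d / D.k) ∧ ¬ Flow.Lay n R n (2 + D.k + d / D.k)) ∧
    (((D.lo d - 1) / D.k = i ∨ (D.lo d - 1) % D.k = i) ∨ ((D.hi d - 1) / D.k = i ∨ (D.hi d - 1) % D.k = i)))
    (by norm_num) (Fresh.append (by simp [Fresh, Fact.Off, scalar, lay]) (fresh_path (by simp) (by simp)))
    (fun s h => ⟨eval_kE h.tail input_sub_path, rfl, eval_kk h.tail pair_sub_path⟩)
    (by unfold size; omega) (fun s i j d hc hi hj hd => ?_) hs1).seq fun s hs => ?_
  · have h1 := hc.knows.tail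
    have hd' := div_lt_and_mod_lt hd
    have hf := eval_fstE h1 pair_sub_path hc.el hd
    have hk := eval_kE h1 input_sub_path
    obtain ⟨c1, c2, c3⟩ := eval_chosenE h1 (fun _ h => h) hc.el hd
    simp only [BExp.eval, eval_posB, c1, ← Nat.pos_iff_ne_zero, cutB, isOneB, eval_orB, eval_eqB]
    refine and_congr_right fun h0 => ?_
    have r1 := (rel_of_chosen h0.ne' (Or.inl rfl)).1
    have r2 := (rel_of_chosen h0.ne' (Or.inr rfl)).1
    rw [row hc.knows (u := 2 + d / D.k) (by simp only [NExp.eval, hf]) (by omega),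
      row hc.knows (u := 2 + D.k + d / D.k) (by simp only [NExp.eval, hf, hk]) (by omega), bit_pos, bit_pos,
      eval_fstE h1 pair_sub_path c2 r1, eval_sndE h1 pair_sub_path c2 r1, eval_fstE h1 pair_sub_path c3 r2,
      eval_sndE h1 pair_sub_path c3 r2, hc.ei]
  · refine (runs_set (v := 1 - bit (Flow.Lay n R n 1)) (Fresh.append (L := [_, lay, scalar 68 n])
      (by simp [Fresh, Fact.Off, scalar, lay]) (fresh_path (by simp) (by simp))) (fun s h => ?_) hs).mono
      fun s h => ⟨R, hR, ?_, fun i hi => ?_⟩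
    · have h1 := row (u := 1) (e := .const 1) (knows_cons.1 h).2 rfl (by omega)
      simp only [NExp.eval] at h1 ⊢
      rw [h1]
    · rw [(knows_cons.1 h).1 0 one_pos 0 one_pos]
      unfold bit; split_ifs with h1 <;> simp [h1]
    · rw [(knows_cons.1 (knows_cons.1 h).2).1 i hi 0 one_pos, ← Nat.pos_iff_ne_zero, bit_pos]
      rfl

end Inst

/-! ### The approximation algorithms -/

theorem eval_mono (p : ℕ[X]) {a b : ℕ} (h : a ≤ b) : p.eval a ≤ p.eval b := by
  rw [Polynomial.eval_eq_sum_range, Polynomial.eval_eq_sum_range]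
  exact Finset.sum_le_sum fun i _ => Nat.mul_le_mul_left _ (Nat.pow_le_pow_left h i)

/-- A polynomial in the number of points and obstacles that bounds the number of lines. -/
def linePoly : ℕ[X] := (3 * (Polynomial.X + Polynomial.X * Polynomial.X + 4)) ^ 2

/-- A polynomial in the number of points and obstacles that bounds the sizes of all tables. -/
def sizePoly : ℕ[X] := 40 + 10 * (Polynomial.X + Polynomial.X * Polynomial.X + linePoly + linePoly ^ 2 + linePoly ^ 4 + linePoly ^ 6)

/-- A polynomial in the number of points and obstacles that bounds the running time of a program whose loops are as
long as the tables. -/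
def timePoly (c : Prog) : ℕ[X] := (cost c).comp sizePoly

namespace Inst

variable {D : Inst} {obs : ℕ → Set Plane} {r R : ℝ} {s : Mem}

theorem size_le : D.size ≤ sizePoly.eval (D.m + D.k) := by
  have h1 : D.nB ≤ (D.m + D.k) + (D.m + D.k) * (D.m + D.k) := by
    unfold nB
    exact Nat.add_le_add_left (Nat.mul_le_mul (Nat.le_add_left _ _) (Nat.le_add_left _ _)) _
  have h2 : D.k * D.k ≤ (D.m + D.k) * (D.m + D.k) :=
    Nat.mul_le_mul (Nat.le_add_left _ _) (Nat.le_add_left _ _)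
  have h3 : D.nZ ≤ 3 * ((D.m + D.k) + (D.m + D.k) * (D.m + D.k) + 4) := by unfold nZ; omega
  have h4 : D.nL ≤ linePoly.eval (D.m + D.k) := by
    simp only [linePoly, Polynomial.eval_pow, Polynomial.eval_mul, Polynomial.eval_add, Polynomial.eval_X,
      Polynomial.eval_ofNat]
    rw [sq]
    exact Nat.mul_le_mul h3 h3
  set l := linePoly.eval (D.m + D.k) with hl
  have h5 : D.nV ≤ l ^ 2 := by rw [sq]; exact Nat.mul_le_mul h4 h4
  have h6 : D.nV * D.nV ≤ l ^ 4 := (Nat.mul_le_mul h5 h5).trans_eq (by ring)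
  have h7 : D.nV * D.nV * D.nV ≤ l ^ 6 := (Nat.mul_le_mul h6 h5).trans_eq (by ring)
  have h8 : D.nP = D.m + D.nV * D.nV * D.nV := rfl
  simp only [sizePoly, Polynomial.eval_pow, Polynomial.eval_mul, Polynomial.eval_add, Polynomial.eval_X,
    Polynomial.eval_ofNat, ← hl]
  unfold size
  generalize D.k * D.k = a1 at *
  generalize D.nV * D.nV * D.nV = a2 at *
  generalize D.nV * D.nV = a3 at *
  generalize (D.m + D.k) * (D.m + D.k) = a4 at *
  generalize l ^ 2 = a5 at *
  generalize l ^ 4 = a6 at *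
  generalize l ^ 6 = a7 at *
  omega

/-- The program computes an approximate solution of each instance whose data `pre` has brought into memory. -/
theorem Valid.approximates (V : D.Valid obs r R) (hR : 0 ≤ R) {B : ℕ}
    (hB : ∀ (c : Plane) {ι : Type} (f : ι → Plane) (S : Finset ι), (∀ i ∈ S, dist (f i) c ≤ 8 * R) →
      (∀ i ∈ S, ∀ j ∈ S, i ≠ j → D.δ < dist (f i) (f j)) → S.card ≤ B) {δ : ℚ} (hδ : D.δ = δ) {pre : Prog}
    (hpre : Runs D.size pre s fun s' => Knows s' D.inputFacts) :
    Approximates (4 * B * B) (timePoly (.seq pre (mainProg δ))) (.seq pre (mainProg δ))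
      (fun j : Fin D.m => D.pt j) (fun i : Fin D.k => obs i) s := by
  classical
  obtain ⟨s', t, he, ht, L, hL, hfeas, hout⟩ := hpre.seq fun s h => V.runs_main hδ h
  obtain ⟨r1, r2⟩ := V.network.result_of_flow hL
  have hT : ∀ i : Fin D.k, i ∈ output D.k s' ↔
      D.Out (fun a => Flow.Lay V.network.nodes L V.network.nodes (2 + a) ∧
        ¬ Flow.Lay V.network.nodes L V.network.nodes (2 + D.k + a)) i := fun i => by
    rw [output, Finset.mem_filter, hout i i.2, and_iff_right (Finset.mem_univ _)]
  have hc : ∀ T : Finset (Fin D.k), EnclosesAll (fun j : Fin D.m => D.pt j) (fun i : Fin D.k => obs i) T →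
      ¬ Flow.Lay V.network.nodes L V.network.nodes 1 := by
    intro T hT h1
    obtain ⟨I, O, ρ, hcut, -⟩ := V.exists_cut hB hT
    exact r1 h1 I O ρ hcut
  refine ⟨s', t, he, ?_, ?_, fun T hTe => ?_⟩
  · rw [timePoly, Polynomial.eval_comp]
    exact ht.trans (eval_mono _ size_le)
  · rw [saysFeasible, hfeas]
    exact ⟨fun h => ⟨_, V.out_encloses (r2 h).1 hT⟩, fun ⟨T, hTe⟩ => hc T hTe⟩
  · obtain ⟨h1, h2⟩ := r2 (hc T hTe)
    refine ⟨V.out_encloses h1 hT, ?_⟩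
    obtain ⟨I, O, ρ, hcut, hle⟩ := V.exists_cut hB hTe
    calc (output D.k s').card ≤ _ := V.card_out_le hR hB hT
      _ ≤ 4 * B * (B * T.card) :=
          -- The two filters differ in the instances that decide the condition.
          Nat.mul_le_mul_left _ (le_trans (Finset.card_le_card fun a ha => by
            simp only [Finset.mem_filter] at ha ⊢; exact ha) ((h2 I O ρ hcut).trans hle))
      _ = 4 * B * B * T.card := by ring

end Inst

/-- Extends a finite sequence by a default value. -/
def extend {α : Type} [Inhabited α] {n : ℕ} (f : Fin n → α) (i : ℕ) : α := if h : i < n then f ⟨i, h⟩ else default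

theorem extend_of_lt {α : Type} [Inhabited α] {n : ℕ} (f : Fin n → α) {i : ℕ} (h : i < n) :
    extend f i = f ⟨i, h⟩ := dif_pos h

theorem extend_val {α : Type} [Inhabited α] {n : ℕ} (f : Fin n → α) : (fun i : Fin n => extend f i) = f :=
  funext fun i => extend_of_lt f i.2

theorem table_of_lt {α : Type} [Zero α] {k l : ℕ} (f : Fin k → Fin l → α) {i j : ℕ} (hi : i < k) (hj : j < l) :
    table f i j = f ⟨i, hi⟩ ⟨j, hj⟩ := dif_pos ⟨hi, hj⟩

theorem table_plane {n : ℕ} (f : Fin n → Plane) {i j : ℕ} (hi : i < n) (hj : j < 2) :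
    table (fun i a => f i a) i j = co (extend f i) j := by
  rw [table_of_lt _ hi hj, extend_of_lt f hi]
  obtain rfl | rfl : j = 0 ∨ j = 1 := by omega
  · rfl
  · rfl

/-- This holds vacuously: no point of the interior lies outside the set. -/
theorem nonCrossing_self (A : Set Plane) : NonCrossing A A :=
  fun _ hp _ _ _ _ _ _ h => absurd (interior_subset hp) h

/-- The instance given by general obstacles. -/
def obstacleInst {m k : ℕ} (pt : Fin m → Plane) (obs : Fin k → Set Plane) (ctr : Fin k → Plane)
    (wit : Fin k → Fin k → Plane) (δ : ℝ) : Inst where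
  m := m
  k := k
  pt := extend pt
  ctr := extend ctr
  wit := table wit
  con i j := extend pt j ∈ extend obs i
  int i j := (extend obs i ∩ extend obs j).Nonempty
  δ := δ

/-- The algorithm for obstacles that can be accessed through the oracles.  The resolution `δ` of the net is a rational
number below `r`, and each obstacle of a solution gives rise to at most `B` net points, each of which costs at
most `4 * B` obstacles. -/
theorem exists_obstacle_algorithm {r R : ℝ} (hr : 0 < r) (hrR : r ≤ R) : ∃ (C : ℕ) (p : ℕ[X]) (prog : Prog),
    ∀ (m k : ℕ) (pt : Fin m → Plane) (obs : Fin k → Set Plane) (ctr : Fin k → Plane)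
      (wit : Fin k → Fin k → Plane), AreFatPseudoDisks r R obs → (∀ i, IsSandwiched r R (obs i) (ctr i)) →
      (∀ i j, (obs i ∩ obs j).Nonempty → wit i j ∈ obs i ∩ obs j) →
      Approximates C p prog pt obs (obstacleInput pt obs ctr wit) := by
  obtain ⟨δ, hδ, hδr⟩ := exists_rat_btwn hr
  obtain ⟨B, hB⟩ := exists_packing_bound (8 * R) (δ : ℝ) hδ
  refine ⟨4 * B * B, timePoly (.seq .skip (mainProg δ)), .seq .skip (mainProg δ), fun m k pt obs ctr wit hobs hctr hwit => ?_⟩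
  have V : (obstacleInst pt obs ctr wit δ).Valid (extend obs) r R :=
    { δ_pos := hδ
      δ_lt := hδr
      compact := fun i hi => by rw [extend_of_lt obs hi]; exact hobs.compact _
      convex := fun i hi => by rw [extend_of_lt obs hi]; exact hobs.convex _
      sandwiched := fun i hi => by
        change IsSandwiched r R _ (extend ctr i)
        rw [extend_of_lt obs hi, extend_of_lt ctr hi]; exact hctr _
      nonCrossing := fun i hi j hj => by
        rw [extend_of_lt obs hi, extend_of_lt obs hj]
        by_cases hij : i = j
        · subst hij; exact nonCrossing_self _
        · exact nonCrossing_of_boundaries (hobs.convex _) (hobs.convex _) (hobs.compact _) (hobs.compact _)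
            (hobs.boundaries _ _ fun h => hij (Fin.mk.inj_iff.1 h))
      con_iff := fun _ _ _ _ => Iff.rfl
      int_iff := fun _ _ _ _ => Iff.rfl
      wit_mem := fun i hi j hj h => by
        change (extend obs i ∩ extend obs j).Nonempty at h
        change table wit i j ∈ _
        rw [extend_of_lt obs hi, extend_of_lt obs hj] at h ⊢
        rw [table_of_lt wit hi hj]
        exact hwit _ _ h }
  have h := V.approximates (s := obstacleInput pt obs ctr wit) (hr.le.trans hrR) hB (δ := δ) rfl
    (pre := .skip) (Runs.skip ?_)
  · change Approximates _ _ _ (fun j : Fin m => extend pt j) (fun i : Fin k => extend obs i) _ at h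
    rwa [extend_val, extend_val] at h
  · simp only [knows_cons]
    refine ⟨fun i hi j hj => ?_, fun i hi j hj => ?_, fun i hi j hj => ?_, fun i hi j hj => table_plane pt hi hj,
      fun i hi j hj => table_plane ctr hi hj, fun i hi j hj => ?_, fun i hi j hj => ?_,
      fun _ h => absurd h List.not_mem_nil⟩
    · obtain rfl : i = 0 := by omega
      rfl
    · change i < k at hi; change j < m at hj
      change table (fun i j => bit (pt j ∈ obs i)) i j = bit (extend pt j ∈ extend obs i)
      rw [table_of_lt _ hi hj, extend_of_lt obs hi, extend_of_lt pt hj]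
    · change i < k at hi; change j < k at hj
      change table (fun i j => bit (obs i ∩ obs j).Nonempty) i j = bit (extend obs i ∩ extend obs j).Nonempty
      rw [table_of_lt _ hi hj, extend_of_lt obs hi, extend_of_lt obs hj]
    · change i < k at hi; change j < k at hj
      change table (fun i j => wit i j 0) i j = table wit i j 0
      rw [table_of_lt _ hi hj, table_of_lt _ hi hj]
    · change i < k at hi; change j < k at hj
      change table (fun i j => wit i j 1) i j = table wit i j 1
      rw [table_of_lt _ hi hj, table_of_lt _ hi hj]

/-- The instance given by translates of a shape; `sh c` is the translate with centre `c`. -/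
def shapeInst (sh : Plane → Set Plane) {m k : ℕ} (pt : Fin m → Plane) (ctr : Fin k → Plane) (δ : ℝ) : Inst where
  m := m
  k := k
  pt := extend pt
  ctr := extend ctr
  wit i j := (1 / 2 : ℝ) • (extend ctr i + extend ctr j)
  con i j := extend pt j ∈ sh (extend ctr i)
  int i j := (sh (extend ctr i) ∩ sh (extend ctr j)).Nonempty
  δ := δ

/-- Answers all queries, given tests for membership and for intersection. -/
def shapeProg (b b' : PExp → PExp → BExp) : Prog :=
  .seq (tabBit 1 kE mE (b (rowE 0 (vr 51)) (rowE 1 (vr 50))))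
  (.seq (tabBit 2 kE kE (b' (rowE 1 (vr 50)) (rowE 1 (vr 51))))
  (.seq (tabReal 2 kE kE [] (.mul (.const (1 / 2)) (.add (rowE 1 (vr 50)).1 (rowE 1 (vr 51)).1)))
    (tabReal 3 kE kE [] (.mul (.const (1 / 2)) (.add (rowE 1 (vr 50)).2 (rowE 1 (vr 51)).2)))))

section
variable {sh : Plane → Set Plane} {b b' : PExp → PExp → BExp} {m k : ℕ} {pt : Fin m → Plane}
  {ctr : Fin k → Plane}

theorem runs_shapeProg
    (hb : ∀ (s : Mem) (p c : PExp) (P Q : Plane), p.Is s P → c.Is s Q → ((b p c).eval s ↔ P ∈ sh Q))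
    (hb' : ∀ (s : Mem) (p c : PExp) (P Q : Plane), p.Is s P → c.Is s Q →
      ((b' p c).eval s ↔ (sh P ∩ sh Q).Nonempty)) {δ : ℝ} :
    Runs (shapeInst sh pt ctr δ).size (shapeProg b b') (coordinateInput pt ctr)
      fun s => Knows s (shapeInst sh pt ctr δ).inputFacts := by
  set D := shapeInst sh pt ctr δ with hD
  have hsize : D.m ≤ D.size ∧ D.k ≤ D.size ∧ 1 ≤ D.size := by unfold Inst.size; omega
  let L : List Fact := [.nat 0 1 2 (sizes D.m D.k), .real 0 D.m 2 (fun i j => co (D.pt i) j),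
    .real 1 D.k 2 (fun i j => co (D.ctr i) j)]
  have h0 : Knows (coordinateInput pt ctr) L := by
    simp only [L, knows_cons]
    refine ⟨fun i hi j hj => ?_, fun i hi j hj => table_plane pt hi hj,
      fun i hi j hj => table_plane ctr hi hj, fun _ h => absurd h List.not_mem_nil⟩
    obtain rfl : i = 0 := by omega
    rfl
  have em : ∀ {s L'}, Knows s L' → L ⊆ L' → mE.eval s = D.m := fun h hL =>
    (h.nat (hL (by simp [L] : Fact.nat 0 1 2 (sizes D.m D.k) ∈ L)) one_pos two_pos).trans rfl
  have ek : ∀ {s L'}, Knows s L' → L ⊆ L' → kE.eval s = D.k := fun h hL =>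
    (h.nat (hL (by simp [L] : Fact.nat 0 1 2 (sizes D.m D.k) ∈ L)) one_pos one_lt_two).trans rfl
  have ip : ∀ {s L'} {e : NExp} {i : ℕ}, Knows s L' → L ⊆ L' → e.eval s = i → i < D.m →
      (rowE 0 e).Is s (D.pt i) := fun h hL he hi => rowE_is h (hL (by simp [L])) he hi
  have ic : ∀ {s L'} {e : NExp} {i : ℕ}, Knows s L' → L ⊆ L' → e.eval s = i → i < D.k →
      (rowE 1 e).Is s (D.ctr i) := fun h hL he hi => rowE_is h (hL (by simp [L])) he hi
  refine (runs_tabBit (N₁ := D.k) (N₂ := D.m) D.con (by norm_num) (by simp [Fresh, Fact.Off, L])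
    (fun s h => ⟨ek h (by simp), em h (by simp)⟩) ⟨hsize.2.1, hsize.1, hsize.2.2⟩
    (fun s i j hc hi hj => ?_) h0).seq fun s hs => ?_
  · exact hb _ _ _ _ _ (ip hc.knows (by simp) hc.ej hj) (ic hc.knows (by simp) hc.ei hi)
  refine (runs_tabBit (N₁ := D.k) (N₂ := D.k) D.int (by norm_num) (by simp [Fresh, Fact.Off, L])
    (fun s h => ⟨ek h (by simp), ek h (by simp)⟩) ⟨hsize.2.1, hsize.2.1, hsize.2.2⟩
    (fun s i j hc hi hj => ?_) hs).seq fun s hs => ?_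
  · exact hb' _ _ _ _ _ (ic hc.knows (by simp) hc.ei hi) (ic hc.knows (by simp) hc.ej hj)
  refine (runs_tabReal (N₁ := D.k) (N₂ := D.k) (fun i j => D.wit i j 0) (by simp [Fresh, Fact.Off, L])
    (fun s h => ⟨ek h (by simp), ek h (by simp)⟩) ⟨hsize.2.1, hsize.2.1⟩
    (fun s i j h h1 h2 hi hj _ => ?_) hs).seq fun s hs => ?_
  · simp only [selectEval, List.foldr, RExp.eval, (ic h (by simp) (e := vr 50) h1 hi).1,
      (ic h (by simp) (e := vr 51) h2 hj).1]
    simp [D, shapeInst, mul_add]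
  have sub3 : ∀ {φ₁ φ₂ φ₃ : Fact}, L ⊆ φ₁ :: φ₂ :: φ₃ :: L := fun h =>
    List.mem_cons_of_mem _ (List.mem_cons_of_mem _ (List.mem_cons_of_mem _ h))
  refine (runs_tabReal (N₁ := D.k) (N₂ := D.k) (fun i j => D.wit i j 1) (by simp [Fresh, Fact.Off, L])
    (fun s h => ⟨ek h sub3, ek h sub3⟩) ⟨hsize.2.1, hsize.2.1⟩
    (fun s i j h h1 h2 hi hj _ => ?_) hs).mono fun s hs => ?_
  · simp only [selectEval, List.foldr, RExp.eval, (ic h sub3 (e := vr 50) h1 hi).2,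
      (ic h sub3 (e := vr 51) h2 hj).2]
    simp [D, shapeInst, mul_add]
  · simp only [L, knows_cons] at hs ⊢
    tauto

end

/-- The algorithm for translates of a shape for which containment and intersection can be tested by
arithmetic, and for which the midpoint of the centres is a common point. -/
theorem exists_shape_algorithm {sh : Plane → Set Plane} {b b' : PExp → PExp → BExp} {r R : ℝ} (hr : 0 < r)
    (hR : 0 ≤ R) (hcompact : ∀ c, IsCompact (sh c)) (hconvex : ∀ c, Convex ℝ (sh c))
    (hsand : ∀ c, IsSandwiched r R (sh c) c) (hcross : ∀ c d, NonCrossing (sh c) (sh d))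
    (hmid : ∀ c d, (sh c ∩ sh d).Nonempty → (1 / 2 : ℝ) • (c + d) ∈ sh c ∩ sh d)
    (hb : ∀ (s : Mem) (p c : PExp) (P Q : Plane), p.Is s P → c.Is s Q → ((b p c).eval s ↔ P ∈ sh Q))
    (hb' : ∀ (s : Mem) (p c : PExp) (P Q : Plane), p.Is s P → c.Is s Q →
      ((b' p c).eval s ↔ (sh P ∩ sh Q).Nonempty)) : ∃ (C : ℕ) (p : ℕ[X]) (prog : Prog),
    ∀ (m k : ℕ) (pt : Fin m → Plane) (ctr : Fin k → Plane),
      Approximates C p prog pt (fun i => sh (ctr i)) (coordinateInput pt ctr) := by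
  obtain ⟨δ, hδ, hδr⟩ := exists_rat_btwn hr
  obtain ⟨B, hB⟩ := exists_packing_bound (8 * R) (δ : ℝ) hδ
  refine ⟨4 * B * B, timePoly (.seq (shapeProg b b') (mainProg δ)), .seq (shapeProg b b') (mainProg δ),
    fun m k pt ctr => ?_⟩
  have V : (shapeInst sh pt ctr δ).Valid (fun i => sh (extend ctr i)) r R :=
    { δ_pos := hδ
      δ_lt := hδr
      compact := fun _ _ => hcompact _
      convex := fun _ _ => hconvex _
      sandwiched := fun _ _ => hsand _
      nonCrossing := fun _ _ _ _ => hcross _ _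
      con_iff := fun _ _ _ _ => Iff.rfl
      int_iff := fun _ _ _ _ => Iff.rfl
      wit_mem := fun _ _ _ _ h => hmid _ _ h }
  have h := V.approximates hR hB (δ := δ) rfl (runs_shapeProg hb hb')
  change Approximates _ _ _ (fun j : Fin m => extend pt j) (fun i : Fin k => sh (extend ctr i)) _ at h
  have e : (fun i : Fin k => sh (extend ctr i)) = fun i => sh (ctr i) :=
    funext fun i => by rw [extend_of_lt ctr i.2]
  rwa [extend_val, e] at h

theorem dist_midpoint_le {c d : Plane} {ρ : ℝ} (h : dist c d ≤ 2 * ρ) :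
    dist ((1 / 2 : ℝ) • (c + d)) c ≤ ρ ∧ dist ((1 / 2 : ℝ) • (c + d)) d ≤ ρ := by
  rw [dist_eq_norm] at h
  rw [dist_eq_norm, dist_eq_norm, show (1 / 2 : ℝ) • (c + d) - c = (-1 / 2 : ℝ) • (c - d) by module,
    show (1 / 2 : ℝ) • (c + d) - d = (1 / 2 : ℝ) • (c - d) by module, norm_smul, norm_smul]
  norm_num
  linarith

theorem dist_le_two_of_unitDisk {c d : Plane} (h : (unitDisk c ∩ unitDisk d).Nonempty) : dist c d ≤ 2 * 1 := by
  obtain ⟨z, hc, hd⟩ := h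
  have h1 := Metric.mem_closedBall.1 hc
  have h2 := Metric.mem_closedBall.1 hd
  linarith [dist_triangle_left c d z]

theorem unitDisk_midpoint {c d : Plane} (h : dist c d ≤ 2 * 1) :
    (1 / 2 : ℝ) • (c + d) ∈ unitDisk c ∩ unitDisk d := dist_midpoint_le h

theorem exists_unitDisk_algorithm : ∃ (C : ℕ) (p : ℕ[X]) (prog : Prog),
    ∀ (m k : ℕ) (pt : Fin m → Plane) (ctr : Fin k → Plane),
      Approximates C p prog pt (fun i => unitDisk (ctr i)) (coordinateInput pt ctr) := by
  refine exists_shape_algorithm (sh := unitDisk) (b := nearB 1) (b' := nearB 2) one_pos zero_le_one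
    (fun c => isCompact_closedBall c 1) (fun c => convex_closedBall c 1) (fun c => ⟨subset_rfl, subset_rfl⟩)
    nonCrossing_unitDisk (fun c d h => unitDisk_midpoint (dist_le_two_of_unitDisk h))
    (fun s p c P Q hp hc => ?_) (fun s p c P Q hp hc => ?_)
  · rw [eval_nearB hp hc, unitDisk, Metric.mem_closedBall, dist_le_iff zero_le_one, Rat.cast_one]
  · rw [eval_nearB hp hc, Rat.cast_ofNat, ← dist_le_iff zero_le_two]
    exact ⟨fun h => ⟨_, unitDisk_midpoint (by linarith)⟩, fun h => by linarith [dist_le_two_of_unitDisk h]⟩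

/-- The test whether two points differ by at most `q` in both coordinates. -/
def boxB (q : ℚ) (u v : PExp) : BExp :=
  .and (.and (.not (.realLt (.const q) (.sub u.1 v.1))) (.not (.realLt (.const q) (.sub v.1 u.1))))
    (.and (.not (.realLt (.const q) (.sub u.2 v.2))) (.not (.realLt (.const q) (.sub v.2 u.2))))

theorem eval_boxB {q : ℚ} {s : Mem} {u v : PExp} {P Q : Plane} (hu : u.Is s P) (hv : v.Is s Q) :
    (boxB q u v).eval s ↔ ∀ a, |P a - Q a| ≤ q := by
  simp only [boxB, BExp.eval, RExp.eval, hu.1, hu.2, hv.1, hv.2, not_lt, Fin.forall_fin_two, abs_le']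
  simp only [neg_sub]

theorem abs_sub_le_of_unitSquare {c d : Plane} (h : (unitSquare c ∩ unitSquare d).Nonempty) (a : Fin 2) :
    |c a - d a| ≤ 1 := by
  obtain ⟨z, hc, hd⟩ := h
  have h1 := abs_le.1 (hc a)
  have h2 := abs_le.1 (hd a)
  exact abs_le.2 ⟨by linarith, by linarith⟩

theorem unitSquare_midpoint {c d : Plane} (h : ∀ a, |c a - d a| ≤ 1) :
    (1 / 2 : ℝ) • (c + d) ∈ unitSquare c ∩ unitSquare d := by
  constructor <;> intro a <;> have h1 := abs_le.1 (h a) <;>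
    simp only [PiLp.smul_apply, PiLp.add_apply, smul_eq_mul] <;>
    exact abs_le.2 ⟨by linarith, by linarith⟩

theorem isSandwiched_unitSquare (c : Plane) : IsSandwiched (1 / 2) 1 (unitSquare c) c := by
  constructor
  · intro p hp a
    have h1 := (dist_le_iff (by norm_num)).1 (Metric.mem_closedBall.1 hp)
    refine abs_le_of_sq_le_sq ?_ (by norm_num)
    have h2 := sq_nonneg (p 0 - c 0)
    have h3 := sq_nonneg (p 1 - c 1)
    fin_cases a
    · exact le_trans (le_add_of_nonneg_right h3) h1
    · exact le_trans (le_add_of_nonneg_left h2) h1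
  · intro p hp
    rw [Metric.mem_closedBall, dist_le_iff zero_le_one]
    have h0 := sq_le_sq' (abs_le.1 (hp 0)).1 (abs_le.1 (hp 0)).2
    have h1 := sq_le_sq' (abs_le.1 (hp 1)).1 (abs_le.1 (hp 1)).2
    linarith

theorem isCompact_unitSquare (c : Plane) : IsCompact (unitSquare c) := by
  refine Metric.isCompact_of_isClosed_isBounded ?_
    (Metric.isBounded_closedBall.subset (isSandwiched_unitSquare c).2)
  rw [unitSquare, Set.ofPred_forall]
  exact isClosed_iInter fun a => isClosed_le (by fun_prop) continuous_const

theorem exists_unitSquare_algorithm : ∃ (C : ℕ) (p : ℕ[X]) (prog : Prog),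
    ∀ (m k : ℕ) (pt : Fin m → Plane) (ctr : Fin k → Plane),
      Approximates C p prog pt (fun i => unitSquare (ctr i)) (coordinateInput pt ctr) := by
  refine exists_shape_algorithm (sh := unitSquare) (b := boxB (1 / 2)) (b' := boxB 1) one_half_pos zero_le_one
    isCompact_unitSquare convex_unitSquare isSandwiched_unitSquare
    nonCrossing_unitSquare (fun c d h => unitSquare_midpoint (abs_sub_le_of_unitSquare h))
    (fun s p c P Q hp hc => ?_) (fun s p c P Q hp hc => ?_)
  · rw [eval_boxB hp hc]
    simp [unitSquare]
  · simp only [eval_boxB hp hc, Rat.cast_one]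
    exact ⟨fun h => ⟨_, unitSquare_midpoint h⟩, abs_sub_le_of_unitSquare⟩

end EnclosingAllPoints

end

theorem mainTheorem2 :
    (∀ r R : ℝ, 0 < r → r ≤ R →
      ∃ (C : ℕ) (p : Polynomial ℕ) (prog : EnclosingAllPoints.Prog),
        ∀ (m k : ℕ) (pt : Fin m → EnclosingAllPoints.Plane)
          (obs : Fin k → Set EnclosingAllPoints.Plane)
          (ctr : Fin k → EnclosingAllPoints.Plane)
          (wit : Fin k → Fin k → EnclosingAllPoints.Plane),
          EnclosingAllPoints.AreFatPseudoDisks r R obs →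
          (∀ i, EnclosingAllPoints.IsSandwiched r R (obs i) (ctr i)) →
          (∀ i j, (obs i ∩ obs j).Nonempty → wit i j ∈ obs i ∩ obs j) →
          EnclosingAllPoints.Approximates C p prog pt obs
            (EnclosingAllPoints.obstacleInput pt obs ctr wit)) ∧
    (∃ (C : ℕ) (p : Polynomial ℕ) (prog : EnclosingAllPoints.Prog),
      ∀ (m k : ℕ) (pt : Fin m → EnclosingAllPoints.Plane)
        (ctr : Fin k → EnclosingAllPoints.Plane),
        EnclosingAllPoints.Approximates C p prog pt
          (fun i => EnclosingAllPoints.unitDisk (ctr i))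
          (EnclosingAllPoints.coordinateInput pt ctr)) ∧
    (∃ (C : ℕ) (p : Polynomial ℕ) (prog : EnclosingAllPoints.Prog),
      ∀ (m k : ℕ) (pt : Fin m → EnclosingAllPoints.Plane)
        (ctr : Fin k → EnclosingAllPoints.Plane),
        EnclosingAllPoints.Approximates C p prog pt
          (fun i => EnclosingAllPoints.unitSquare (ctr i))
          (EnclosingAllPoints.coordinateInput pt ctr)) := ⟨fun _ _ hr hrR =>
    EnclosingAllPoints.exists_obstacle_algorithm hr hrR, EnclosingAllPoints.exists_unitDisk_algorithm,
    EnclosingAllPoints.exists_unitSquare_algorithm⟩
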